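/- **Setting.** Let $p\ge 1$. For each $T$ and each stream $j=1,\dots,p$, sessions start at the points $\Gamma^{(j)}_k$ ($k\in\mathbb Z$) of a homogeneous Poisson process on $\mathbb R$ with intensity $\lambda^{(j)}=\lambda^{(j)}(T)>0$; the $k$-th session has duration $D^{(j)}_k$ and transmits at rate $R^{(j)}_k$. The durations of stream $j$ are positive with distribution $F_D^{(j)}$ (not depending on $T$), where $\bar F_D^{(j)}=1-F_D^{(j)}\in RV_{-\alpha_D^{(j)}}$, $1<\alpha_D^{(j)}<2$; all rates are positive with common distribution $F_R$. The arrival processes of the $p$ streams, all durations and all rates are mutually independent. Here $f\in RV_\gamma$ means that $f$ is measurable, eventually positive, and $f(tx)/f(t)\to x^\gamma$ as $t\to\infty$ for every $x>0$. Write $R$ for a variable with law $F_R$, $\mu_R=E[R]$, $\mu_D^{(j)}=\int u\,F_D^{(j)}(du)$, and $$\lambda=\sum_j\lambda^{(j)},\quad F_D=\sum_j\tfrac{\lambda^{(j)}}{\lambda}F_D^{(j)},\quad \mu_D=\sum_j\tfrac{\lambda^{(j)}}{\lambda}\mu_D^{(j)},\quad \alpha_D=\min_j\alpha_D^{(j)},$$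 $b_D(t)=\inf\{x:F_D(x)\ge 1-1/t\}$, $b_R(t)=\inf\{x:F_R(x)\ge 1-1/t\}$. Let $L_t(s,u)$ be the length of $[0,t]\cap[s,s+u]$, let $N=\sum_j\sum_k\varepsilon_{(\Gamma_k^{(j)},D_k^{(j)},R_k^{(j)})}$, and $$A(t)=\int rL_t(s,u)\,N(ds,du,dr),\qquad A_{cs}(t)=\frac{A(Tt)-\lambda\mu_D\mu_RTt}{a(T)},\quad t\ge 0 .$$ For a measure $h$ on $(0,\infty)$, $N^\infty_{\gamma,h}$ is a Poisson random measure on $\mathbb R\times(0,\infty)^2$ with mean measure $ds\cdot\gamma u^{-(\gamma+1)}du\cdot h(dr)$, written $N^\infty_{\gamma,\delta}$ if $h(dr)=\delta r^{-(\delta+1)}dr$; a tilde denotes compensation by the mean measure. For $1<\gamma<2$ put $C_\gamma=\left(-\cos\frac{\pi\gamma}{2}\right)\frac{\Gamma(2-\gamma)}{\gamma-1}$. Let $M_{\gamma,m}$ be the $\gamma$-stable random measure totally skewed to the right with control measure $m$, so that $E\,e^{iz\int f\,dM_{\gamma,m}}=\exp\{-\int|zf|^\gamma(1-i\,\mathrm{sgn}(zf)\tan\frac{\pi\gamma}{2})\,dm\}$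 for $f\in L^\gamma(m)$, and let $\Lambda_\gamma$ be the $\gamma$-stable Lévy motion totally skewed to the right with $E\,e^{iz\Lambda_\gamma(t)}=\exp\{-tC_\gamma|z|^\gamma(1-i\,\mathrm{sgn}(z)\tan\frac{\pi\gamma}{2})\}$. All convergences are of finite-dimensional distributions (fidi) as $T\to\infty$. **Scenarios.** * $\mathcal F$: $\lambda^{(j)}T\bar F_D^{(j)}(T)\to\infty$ for at least one $j$. * $\mathcal M$: for some non-empty set $\mathcal M$ of streams, $\lambda^{(j)}T\bar F_D^{(j)}(T)\to c_j^{\alpha_D^{(j)}-1}$ with $0<c_j<\infty$ for $j\in\mathcal M$, and $\lambda^{(j)}T\bar F_D^{(j)}(T)\to0$ for $j\notin\mathcal M$; then put $c=\big(\sum_{j\in\mathcal M}c_j^{\alpha_D^{(j)}-1}\big)^{1/(\alpha_D-1)}$. * $\mathcal S$: $\lambda^{(j)}T\bar F_D^{(j)}(T)\to0$ for all $j$, and $\lambda T\to\infty$. **Statement.** Suppose that for all sufficiently large $T$ the proportions $\lambda^{(j)}/\lambda$, $j=1,\dots,p$, do not depend on $T$. Then for all large $T$ the mixture tail satisfies $\bar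 F_D\in RV_{-\alpha_D}$. Suppose moreover that either $E[R^2]<\infty$, or $\bar F_R\in RV_{-\alpha_R}$ with $1<\alpha_R<2$ and $\alpha_R>\alpha_D$. Then: (a)(i) In Scenario $\mathcal F$, if $E[R^2]<\infty$ and $a(T)=[\lambda T^3\bar F_D(T)]^{1/2}$, then $A_{cs}\to E[R^2]^{1/2}\,\sigma\,B_H$, where $\sigma^2=\frac{2}{(\alpha_D-1)(2-\alpha_D)(3-\alpha_D)}$ and $B_H$ is standard fractional Brownian motion with $H=(3-\alpha_D)/2\in(1/2,1)$. (a)(ii) In Scenario $\mathcal F$, if $\bar F_R\in RV_{-\alpha_R}$ with $\alpha_D<\alpha_R<2$ and $a(T)=T\,b_R(\lambda T\bar F_D(T))$, then $A_{cs}\to Z$, where $Z(t)=\int rL_t(s,u)\,\widetilde{N^\infty_{\alpha_D,\alpha_R}}(ds,du,dr)$. The process $Z$ is $\alpha_R$-stable and $H$-self-similar with $H=(\alpha_R+1-\alpha_D)/\alpha_R\in(1/\alpha_R,1)$, and has the finite-dimensional distributions of $C_{\alpha_R}^{1/\alpha_R}\int L_t(s,u)\,M_{\alpha_R,m}(ds,du)$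 with $m(ds,du)=ds\cdot\alpha_Du^{-(\alpha_D+1)}du$. (b) In Scenario $\mathcal M$, with $a(T)=T$, $A_{cs}\to cY(\cdot/c)$, where $Y(t)=\int rL_t(s,u)\,\widetilde{N^\infty_{\alpha_D,F_R}}(ds,du,dr)$. (c) In Scenario $\mathcal S$, with $a(T)=b_D(\lambda T)$, $A_{cs}\to E[R^{\alpha_D}]^{1/\alpha_D}\Lambda_{\alpha_D}$; this limit has the finite-dimensional distributions of $\int ur\,1_{\{0<s<t\}}\,\widetilde{N^\infty_{\alpha_D,F_R}}(ds,du,dr)$ and of $C_{\alpha_D}^{1/\alpha_D}\int r\,1_{\{0<s<t\}}\,M_{\alpha_D,m}(ds,dr)$ with $m(ds,dr)=ds\,F_R(dr)$. -/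

import Mathlib

open MeasureTheory ProbabilityTheory Filter Topology Set
open scoped NNReal ENNReal

noncomputable section

/-! ### Distribution tails, quantiles and regular variation -/

/-- The right tail `x ↦ F (x, ∞)` of a distribution `F` on the line. -/
def distTail (F : Measure ℝ) (x : ℝ) : ℝ := F.real (Ioi x)

/-- `b(t) = F^←(1 - 1/t)`, where `F^←(y) = inf {x | F(x) ≥ y}` is the left-continuous inverse of the
distribution function; equivalently `b = (1 / (1 - F))^←`. -/
def quantileFn (F : Measure ℝ) (t : ℝ) : ℝ := sInf {x : ℝ | 1 - 1 / t ≤ F.real (Iic x)}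

/-- `f ∈ RV_γ`: `f` is measurable, eventually positive, and `f (t x) / f t → x ^ γ` as `t → ∞`, for
every `x > 0`. -/
structure IsRegularlyVarying (f : ℝ → ℝ) (γ : ℝ) : Prop where
  measurable : Measurable f
  eventually_pos : ∀ᶠ t in atTop, 0 < f t
  tendsto_ratio : ∀ x : ℝ, 0 < x → Tendsto (fun t : ℝ => f (t * x) / f t) atTop (𝓝 (x ^ γ))

/-! ### Finite-dimensional convergence and classes of processes -/

/-- Convergence of the finite-dimensional distributions of processes on `[0, ∞)`, as `T → ∞`. -/
def FidiTendsto {Ω : ℝ → Type*} [∀ T, MeasurableSpace (Ω T)] (P : ∀ T, Measure (Ω T))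
    [∀ T, IsProbabilityMeasure (P T)] {Ω' : Type*} [MeasurableSpace Ω'] (P' : Measure Ω')
    [IsProbabilityMeasure P'] (X : ∀ T, ℝ≥0 → Ω T → ℝ) (Y : ℝ≥0 → Ω' → ℝ) : Prop :=
  ∀ (m : ℕ) (t : Fin m → ℝ≥0),
    TendstoInDistribution (fun T ω i => X T (t i) ω) atTop (fun ω i => Y (t i) ω) P P'

/-- Standard fractional Brownian motion on `[0, ∞)` with Hurst exponent `H`. -/
structure IsFractionalBrownianMotion {Ω : Type*} [MeasurableSpace Ω] (P : Measure Ω) (H : ℝ)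
    (B : ℝ≥0 → Ω → ℝ) : Prop where
  isGaussianProcess : IsGaussianProcess B P
  mean_zero : ∀ t, ∫ ω, B t ω ∂P = 0
  covariance : ∀ s t : ℝ≥0, ProbabilityTheory.covariance (B s) (B t) P =
    1 / 2 * ((s : ℝ) ^ (2 * H) + (t : ℝ) ^ (2 * H) - |(s : ℝ) - t| ^ (2 * H))

/-- A stable law of index `α` on `ℝ^m`: for independent copies `X₁, X₂` and `a, b > 0`, the vector
`a X₁ + b X₂` is distributed as `(a ^ α + b ^ α) ^ (1 / α) X₁ + d` for some vector `d`. -/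
def IsStableLaw {m : ℕ} (α : ℝ) (μ : Measure (Fin m → ℝ)) : Prop :=
  ∀ a b : ℝ, 0 < a → 0 < b → ∃ d : Fin m → ℝ,
    (μ.map (fun x => a • x)).conv (μ.map (fun x => b • x)) =
      μ.map (fun x => (a ^ α + b ^ α) ^ (1 / α) • x + d)

/-- All finite-dimensional distributions are stable of index `α`. -/
def IsStableProcess {Ω : Type*} [MeasurableSpace Ω] (P : Measure Ω) (α : ℝ)
    (Z : ℝ≥0 → Ω → ℝ) : Prop :=
  ∀ (m : ℕ) (t : Fin m → ℝ≥0), IsStableLaw α (P.map (fun ω i => Z (t i) ω))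

/-- `Z (c ·)` and `c ^ H Z (·)` have the same finite-dimensional distributions, for all `c > 0`. -/
def IsSelfSimilar {Ω : Type*} [MeasurableSpace Ω] (P : Measure Ω) (H : ℝ)
    (Z : ℝ≥0 → Ω → ℝ) : Prop :=
  ∀ c : ℝ≥0, 0 < c → ∀ (m : ℕ) (t : Fin m → ℝ≥0),
    P.map (fun ω i => Z (c * t i) ω) = P.map (fun ω i => (c : ℝ) ^ H * Z (t i) ω)

/-! ### Stable Lévy motion and stable integrals, totally skewed to the right -/

/-- `|x| ^ γ (1 - i sign(x) tan(π γ / 2))`: minus the logarithm of the characteristic function of the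
stable law `S_γ(1, 1, 0)`. -/
def skewedStableExponent (γ x : ℝ) : ℂ :=
  ((|x| ^ γ : ℝ) : ℂ) * (1 - Complex.I * ((SignType.sign x : ℝ) : ℂ) *
    ((Real.tan (Real.pi * γ / 2) : ℝ) : ℂ))

/-- The constant `(-cos (π γ / 2)) Γ(2 - γ) / (γ - 1)`, by which
`∫_0^∞ (exp (i x w) - 1 - i x w) γ w ^ (-(γ + 1)) dw` equals minus the constant times
`skewedStableExponent γ x`. -/
def stableConst (γ : ℝ) : ℝ :=
  (-Real.cos (Real.pi * γ / 2)) * Real.Gamma (2 - γ) / (γ - 1)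

/-- `Λ` is a `γ`-stable Lévy motion, totally skewed to the right, in which `Λ(1)` has the scale
parameter `σ` with `σ ^ γ = stableConst γ`. -/
structure IsSkewedStableLevyMotion {Ω : Type*} [MeasurableSpace Ω] (P : Measure Ω) (γ : ℝ)
    (Λ : ℝ≥0 → Ω → ℝ) : Prop where
  aemeasurable : ∀ t, AEMeasurable (Λ t) P
  start_zero : ∀ᵐ ω ∂P, Λ 0 ω = 0
  indep_increments : HasIndepIncrements Λ P
  charFun_increment : ∀ s t : ℝ≥0, s ≤ t → ∀ z : ℝ,
    charFun (P.map (fun ω => Λ t ω - Λ s ω)) z =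
      Complex.exp (-(((t : ℝ) - s : ℝ) : ℂ) * (stableConst γ : ℂ) * skewedStableExponent γ z)

/-- `I f = ∫ f dM` for `f ∈ L^γ(m)`, where `M` is the `γ`-stable random measure with control measure
`m`, totally skewed to the right (so `M A = I (1_A)`): the process `I` indexed by `L^γ(m)` with
the finite-dimensional characteristic functions of that integral. -/
def IsSkewedStableIntegral {Ω E : Type*} [MeasurableSpace Ω] [MeasurableSpace E] (P : Measure Ω)
    (γ : ℝ) (m : Measure E) (I : (E → ℝ) → Ω → ℝ) : Prop :=
  (∀ f, MemLp f (ENNReal.ofReal γ) m → AEMeasurable (I f) P) ∧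
  ∀ (n : ℕ) (f : Fin n → E → ℝ), (∀ i, MemLp (f i) (ENNReal.ofReal γ) m) → ∀ z : Fin n → ℝ,
    ∫ ω, Complex.exp (Complex.I * ((∑ i, z i * I (f i) ω : ℝ) : ℂ)) ∂P =
      Complex.exp (-∫ x, skewedStableExponent γ (∑ i, z i * f i x) ∂m)

/-! ### Poisson random measures and compensated integrals -/

/-- `N` is a Poisson random measure with mean measure `m`: `N B` is Poisson with mean `m B` when
`m B < ∞`, and the masses of finitely many disjoint sets are independent. -/
structure IsPoissonRandomMeasure {Ω E : Type*} [MeasurableSpace Ω] [MeasurableSpace E]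
    (P : Measure Ω) (N : Ω → Measure E) (m : Measure E) : Prop where
  measurable : Measurable N
  map_eq_poisson : ∀ B, MeasurableSet B → m B < ∞ →
    P.map (fun ω => N ω B) = (poissonMeasure (m B).toNNReal).map (fun n : ℕ => (n : ℝ≥0∞))
  indep : ∀ (n : ℕ) (B : Fin n → Set E), (∀ i, MeasurableSet (B i)) →
    Pairwise (fun i j => Disjoint (B i) (B j)) → iIndepFun (fun i ω => N ω (B i)) P

/-- `X = ∫ f d(N - m)`, the integral of `f` against the compensation of a Poisson random measure `N`
with mean measure `m`: it requires `∫ min (f², |f|) dm < ∞`, and is the limit in probability, as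
`ε ↓ 0`, of the integrals over `{|f| > ε}`, on which `f` is integrable for both measures. -/
structure IsCompensatedIntegral {Ω E : Type*} [MeasurableSpace Ω] [MeasurableSpace E]
    (P : Measure Ω) (N : Ω → Measure E) (m : Measure E) (f : E → ℝ) (X : Ω → ℝ) : Prop where
  integrable : Integrable (fun x => min (f x ^ 2) |f x|) m
  aemeasurable : AEMeasurable X P
  tendsto : TendstoInMeasure P
    (fun (ε : ℝ) ω => (∫ x in {x | ε < |f x|}, f x ∂(N ω)) - ∫ x in {x | ε < |f x|}, f x ∂m)
    (𝓝[>] 0) X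

/-- The measure `γ u ^ (-(γ + 1)) du` on `(0, ∞)`. -/
def powerMeasure (γ : ℝ) : Measure ℝ :=
  (volume.restrict (Ioi 0)).withDensity (fun u => ENNReal.ofReal (γ * u ^ (-(γ + 1))))

/-- The mean measure `ds · γ u ^ (-(γ + 1)) du · h(dr)` of `N^∞_{γ,h}`, on points `(s, u, r)`. -/
def limitMean (γ : ℝ) (h : Measure ℝ) : Measure (ℝ × ℝ × ℝ) :=
  (volume : Measure ℝ).prod ((powerMeasure γ).prod h)

/-! ### The superposition of M/G/∞ input streams -/

/-- `L_t(s, u)`, the length of `[0, t] ∩ [s, s + u]`. -/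
def sessionOverlap (t s u : ℝ) : ℝ := volume.real (Icc 0 t ∩ Icc s (s + u))

/-- Independent streams indexed by `ι`. The `k`-th session of stream `j` starts at `Γ j k`, lasts for
`D j k`, and transmits at rate `R j k`. The starting points of stream `j` are the points of a
homogeneous Poisson process on the line with intensity `lam j`, the durations of stream `j` have
distribution `FD j`, the rates have distribution `FR`, and the arrival streams, all the durations
and all the rates are mutually independent. -/
structure IsTrafficModel {ι Ω : Type*} [MeasurableSpace Ω] (P : Measure Ω) (lam : ι → ℝ)
    (FD : ι → Measure ℝ) (FR : Measure ℝ) (Γ D R : ι → ℤ → Ω → ℝ) : Prop where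
  measurable_start : ∀ j k, Measurable (Γ j k)
  measurable_duration : ∀ j k, Measurable (D j k)
  measurable_rate : ∀ j k, Measurable (R j k)
  poisson_start : ∀ j, IsPoissonRandomMeasure P
    (fun ω => Measure.sum (fun k => Measure.dirac (Γ j k ω)))
    (ENNReal.ofReal (lam j) • (volume : Measure ℝ))
  law_duration : ∀ j k, P.map (D j k) = FD j
  law_rate : ∀ j k, P.map (R j k) = FR
  indep_start : iIndepFun (fun j ω k => Γ j k ω) P
  indep_duration : iIndepFun (fun (i : ι × ℤ) ω => D i.1 i.2 ω) P
  indep_rate : iIndepFun (fun (i : ι × ℤ) ω => R i.1 i.2 ω) P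
  indep_blocks : iIndepFun (fun (i : Fin 3) ω (j : ι) (k : ℤ) => (![Γ, D, R] i) j k ω) P

/-- `N^(j)`, the counting measure of the session descriptors `(start, duration, rate)`. -/
def sessionCount {Ω : Type*} (Γ D R : ℤ → Ω → ℝ) (ω : Ω) : Measure (ℝ × ℝ × ℝ) :=
  Measure.sum (fun k => Measure.dirac (Γ k ω, D k ω, R k ω))

/-- `A(t) = ∫ r L_t(s, u) N(ds, du, dr)` with `N = ∑ j, N^(j)`: the cumulative input of the aggregated
stream in `[0, t]`. -/
def cumulativeInput {ι Ω : Type*} [Fintype ι] (Γ D R : ι → ℤ → Ω → ℝ) (t : ℝ) (ω : Ω) : ℝ :=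
  ∫ x, x.2.2 * sessionOverlap t x.1 x.2.1 ∂(∑ j, sessionCount (Γ j) (D j) (R j) ω)

/-- `λ = ∑ j, λ^(j)`. -/
def totalRate {ι : Type*} [Fintype ι] (lam : ι → ℝ) : ℝ := ∑ j, lam j

/-- `F_D = ∑ j, (λ^(j) / λ) F_D^(j)`. -/
def mixture {ι : Type*} [Fintype ι] (lam : ι → ℝ) (FD : ι → Measure ℝ) : Measure ℝ :=
  ∑ j, ENNReal.ofReal (lam j / totalRate lam) • FD j

/-- `μ_D = ∑ j, (λ^(j) / λ) μ_D^(j)`. -/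
def mixtureMean {ι : Type*} [Fintype ι] (lam : ι → ℝ) (FD : ι → Measure ℝ) : ℝ :=
  ∑ j, lam j / totalRate lam * ∫ u, u ∂(FD j)

/-- `A_cs(t) = (A(T t) - λ μ_D μ_R T t) / a`. -/
def scaledInput {ι Ω : Type*} [Fintype ι] (lam : ι → ℝ) (FD : ι → Measure ℝ) (FR : Measure ℝ)
    (Γ D R : ι → ℤ → Ω → ℝ) (T a : ℝ) (t : ℝ≥0) (ω : Ω) : ℝ :=
  (cumulativeInput Γ D R (T * t) ω -
    totalRate lam * mixtureMean lam FD * (∫ r, r ∂FR) * (T * t)) / a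

/-! ### Growth regimes of an arrival intensity `lam`, for the duration distribution `F` -/

/-- `λ T (1 - F(T)) → ∞`. -/
def FastGrowth (lam : ℝ → ℝ) (F : Measure ℝ) : Prop :=
  Tendsto (fun T => lam T * T * distTail F T) atTop atTop

/-- `λ T (1 - F(T)) → c ^ (α - 1)`, with `c > 0`. -/
def ModerateGrowth (lam : ℝ → ℝ) (F : Measure ℝ) (α c : ℝ) : Prop :=
  0 < c ∧ Tendsto (fun T => lam T * T * distTail F T) atTop (𝓝 (c ^ (α - 1)))

/-- `λ T (1 - F(T)) → 0`. -/
def SlowGrowth (lam : ℝ → ℝ) (F : Measure ℝ) : Prop :=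
  Tendsto (fun T => lam T * T * distTail F T) atTop (𝓝 0)

/-- `F` has a finite second moment. -/
def FiniteSecondMoment (F : Measure ℝ) : Prop := Integrable (fun r : ℝ => r ^ 2) F

/-- The tail of `F` is regularly varying with index `-α`, where `1 < α < 2`. -/
def HeavyTailed (F : Measure ℝ) (α : ℝ) : Prop :=
  1 < α ∧ α < 2 ∧ IsRegularlyVarying (distTail F) (-α)

end

/-! Everything goes through joint characteristic functions and Lévy's continuity theorem
(`fidiTendsto_of_jointCF`). Put S(s,u) = ∑ z_i L_{t_i}(s,u) and e(x) = exp(ix) - 1 - ix. The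
sessions form a marked Poisson process and the centring of A_cs is its exact mean, so after the
substitution s ↦ Ts the characteristic function of ∑ z_i A_cs(t_i) equals exp(λT ∫ e(r (T/a)
S(s,u/T)) ds F_D(du) F_R(dr)) without error term (`jointCF_scaledInput`). Exponents of independent
streams add, so the streams enter only through λ and the mixture F_D. Constant proportions make F_D
a fixed law F for large T; the heaviest component governs its tail (`isRegularlyVarying_sum`). Since
λT F̄(T) is the sum of the corresponding quantities of the streams, the scenarios say that it tends
to ∞, to c^(α-1), or to 0.

The analytic core is `tendsto_integral_scaled`: if n F̄(a) → 1, then n F(a du) converges to α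
u^(-(α+1)) du on suitably dominated integrands. It rests on a quantile coupling: n F is the image of
Lebesgue measure on (0,n) under y ↦ F̄^←(y/n). The scaled quantile tends to y^(-1/α) for each y,
Potter's bounds dominate it, and dominated convergence applies. The overlap bound L_t(s,u) ≤ (1+t)
min(1, u/(1+|s|)), raised to powers κ₁ ∈ (1,α) and κ₂ > α, gives integrability in s, for long
sessions and for short ones.

Each scenario is a choice of n and a in this theorem. Moderate: n = 1/F̄(T), a = T, with a fixed
integrand. Fast with E[R²] < ∞: the same n and a, while N = λT F̄(T) → ∞ and N e(x/√N) → -x²/2. Fast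
with heavy-tailed rates: in addition N F_R is coupled to Lebesgue measure, so that durations and
rates both acquire power laws. Slow: n = λT, a = b_D(λT), and K = T/a → ∞ turns K L_t(s,u/K) into u
1_{(0,t)}(s).

It remains to recognise the exponents. Compensated Poisson integrals have exponent ∫ e(f) dm
(`jointCF_of_isCompensatedIntegral`). Integrating a power-law variable out of e gives the skewed
stable exponent (`integral_centeredExp_powerMeasure`). The integral of L_s L_t is the fractional
Brownian covariance up to σ² (`integral_sessionOverlap_mul`). Self-similarity and the form c Y(·/c)
come from the homogeneity of the limit mean measure under dilations of time. -/

/-! ### Joint characteristic functions -/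

/-- The joint characteristic function `z ↦ E exp (i ∑ zᵢ Xᵢ)` of a finite family of variables. -/
noncomputable def jointCF {Ω : Type*} [MeasurableSpace Ω] (P : Measure Ω) {m : ℕ} (X : Fin m → Ω → ℝ)
    (z : Fin m → ℝ) : ℂ :=
  ∫ ω, Complex.exp (Complex.I * ((∑ i, z i * X i ω : ℝ) : ℂ)) ∂P

/-- Uniqueness and continuity theorems for characteristic functions live on an inner product space;
this translates them to coordinates. -/
lemma charFun_toLp_eq_jointCF {Ω : Type*} [MeasurableSpace Ω] {P : Measure Ω} {m : ℕ}
    {X : Fin m → Ω → ℝ} (hX : ∀ i, AEMeasurable (X i) P) (z : EuclideanSpace ℝ (Fin m)) :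
    charFun (P.map (fun ω => WithLp.toLp 2 (fun i => X i ω))) z = jointCF P X z := by
  have h : AEMeasurable (fun ω => (WithLp.toLp 2 (fun i => X i ω) : EuclideanSpace ℝ (Fin m))) P :=
    (by fun_prop : Measurable (WithLp.toLp 2 : (Fin m → ℝ) → EuclideanSpace ℝ (Fin m))).comp_aemeasurable
      (aemeasurable_pi_iff.2 hX)
  rw [charFun_apply, integral_map h (by fun_prop), jointCF]
  refine integral_congr_ae (ae_of_all _ fun ω => ?_)
  simp only [PiLp.inner_apply]
  rw [mul_comm]
  simp

lemma map_eq_of_jointCF_eq {Ω Ω' : Type*} [MeasurableSpace Ω] [MeasurableSpace Ω'] {P : Measure Ω}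
    {P' : Measure Ω'} [IsProbabilityMeasure P] [IsProbabilityMeasure P'] {m : ℕ}
    {X : Fin m → Ω → ℝ} {Y : Fin m → Ω' → ℝ} (hX : ∀ i, AEMeasurable (X i) P)
    (hY : ∀ i, AEMeasurable (Y i) P') (h : ∀ z, jointCF P X z = jointCF P' Y z) :
    P.map (fun ω i => X i ω) = P'.map (fun ω i => Y i ω) := by
  have hX' := aemeasurable_pi_iff.2 hX
  have hY' := aemeasurable_pi_iff.2 hY
  have hm : Measurable (WithLp.toLp 2 : (Fin m → ℝ) → EuclideanSpace ℝ (Fin m)) := by fun_prop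
  have hm' : Measurable (WithLp.ofLp : EuclideanSpace ℝ (Fin m) → (Fin m → ℝ)) := by fun_prop
  have key : P.map (fun ω => (WithLp.toLp 2 (fun i => X i ω) : EuclideanSpace ℝ (Fin m))) =
      P'.map (fun ω => WithLp.toLp 2 (fun i => Y i ω)) := by
    have := Measure.isProbabilityMeasure_map (hm.comp_aemeasurable hX')
    have := Measure.isProbabilityMeasure_map (hm.comp_aemeasurable hY')
    refine Measure.ext_of_charFun (funext fun z => ?_)
    rw [charFun_toLp_eq_jointCF hX, charFun_toLp_eq_jointCF hY, h]
  have := congrArg (fun μ => μ.map (WithLp.ofLp : EuclideanSpace ℝ (Fin m) → (Fin m → ℝ))) key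
  simp only at this
  erw [AEMeasurable.map_map_of_aemeasurable hm'.aemeasurable (hm.comp_aemeasurable hX'),
    AEMeasurable.map_map_of_aemeasurable hm'.aemeasurable (hm.comp_aemeasurable hY')] at this
  exact this

/-- Lévy's continuity theorem for finite-dimensional distributions. -/
lemma fidiTendsto_of_jointCF {Ω : ℝ → Type*} [∀ T, MeasurableSpace (Ω T)] {P : ∀ T, Measure (Ω T)}
    [∀ T, IsProbabilityMeasure (P T)] {Ω' : Type*} [MeasurableSpace Ω'] {P' : Measure Ω'}
    [IsProbabilityMeasure P'] {X : ∀ T, ℝ≥0 → Ω T → ℝ} {Y : ℝ≥0 → Ω' → ℝ}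
    (hX : ∀ T t, AEMeasurable (X T t) (P T)) (hY : ∀ t, AEMeasurable (Y t) P')
    (h : ∀ (m : ℕ) (t : Fin m → ℝ≥0) (z : Fin m → ℝ),
      Tendsto (fun T => jointCF (P T) (fun i => X T (t i)) z) atTop
        (𝓝 (jointCF P' (fun i => Y (t i)) z))) :
    FidiTendsto P P' X Y := by
  intro m t
  have hm : Measurable (WithLp.toLp 2 : (Fin m → ℝ) → EuclideanSpace ℝ (Fin m)) := by fun_prop
  have hX' : ∀ T, AEMeasurable
      (fun ω => (WithLp.toLp 2 (fun i => X T (t i) ω) : EuclideanSpace ℝ (Fin m))) (P T) :=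
    fun T => hm.comp_aemeasurable (aemeasurable_pi_iff.2 fun i => hX T (t i))
  have hY' : AEMeasurable
      (fun ω => (WithLp.toLp 2 (fun i => Y (t i) ω) : EuclideanSpace ℝ (Fin m))) P' :=
    hm.comp_aemeasurable (aemeasurable_pi_iff.2 fun i => hY (t i))
  have key : TendstoInDistribution
      (fun T ω => (WithLp.toLp 2 (fun i => X T (t i) ω) : EuclideanSpace ℝ (Fin m))) atTop
      (fun ω => WithLp.toLp 2 (fun i => Y (t i) ω)) P P' := by
    -- The filter `atTop` on ℝ is countably generated, so it suffices to apply Lévy's theorem along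
    -- every sequence.
    refine ⟨hX', hY', tendsto_of_seq_tendsto fun u hu => ?_⟩
    refine ProbabilityMeasure.tendsto_of_tendsto_charFun fun z => ?_
    have := (h m t z).comp hu
    simp only [ProbabilityMeasure.coe_mk]
    rw [charFun_toLp_eq_jointCF fun i => hY (t i)]
    refine this.congr fun n => ?_
    exact (charFun_toLp_eq_jointCF (fun i => hX _ (t i)) z).symm
  exact key.continuous_comp (g := (WithLp.ofLp : EuclideanSpace ℝ (Fin m) → (Fin m → ℝ))) (by fun_prop)

/-! ### Poisson random measures -/

lemma lintegral_natCast_poissonMeasure (r : ℝ≥0) :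
    ∫⁻ k : ℕ, (k : ℝ≥0∞) ∂(poissonMeasure r) = r := by
  have h : HasSum (fun k : ℕ => Real.exp (-r) * r ^ k / k.factorial * (k : ℝ)) (r : ℝ) := by
    have h1 := (hasSum_one_poissonMeasure r).mul_left (r : ℝ)
    rw [mul_one] at h1
    rw [← hasSum_nat_add_iff' 1]
    simp only [Finset.range_one, Finset.sum_singleton, Nat.cast_zero, mul_zero, sub_zero]
    refine h1.congr_fun fun k => ?_
    have : ((k : ℝ) + 1) ≠ 0 := by positivity
    have h2 : (k.factorial : ℝ) ≠ 0 := by positivity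
    rw [Nat.factorial_succ]
    push_cast
    field_simp
    ring
  rw [poissonMeasure, lintegral_sum_measure]
  simp_rw [lintegral_smul_measure, lintegral_dirac, smul_eq_mul]
  have h2 := ENNReal.ofReal_tsum_of_nonneg (fun k => by positivity) h.summable
  rw [h.tsum_eq, ENNReal.ofReal_coe_nnreal] at h2
  rw [h2]
  refine tsum_congr fun k => ?_
  rw [ENNReal.ofReal_mul (by positivity), ENNReal.ofReal_natCast]

lemma integral_pow_poissonMeasure (r : ℝ≥0) (c : ℂ) :
    ∫ k : ℕ, c ^ k ∂(poissonMeasure r) = Complex.exp (r * (c - 1)) := by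
  rw [integral_poissonMeasure]
  calc ∑' a : ℕ, (Real.exp (-r) * r ^ a / a.factorial : ℝ) • c ^ a
  _ = ∑' a : ℕ, ((Real.exp (-r) : ℝ) : ℂ) * ((r * c) ^ a / a.factorial) := by
      congr with a
      rw [Complex.real_smul]
      push_cast
      rw [mul_pow]
      ring
  _ = Real.exp (-r) * Complex.exp (r * c) := by
      rw [tsum_mul_left, (NormedSpace.expSeries_div_hasSum_exp ((r : ℂ) * c)).tsum_eq,
        Complex.exp_eq_exp_ℂ]
  _ = _ := by
      rw [Complex.ofReal_exp, ← Complex.exp_add]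
      push_cast
      ring_nf

namespace IsPoissonRandomMeasure

variable {Ω E : Type*} [MeasurableSpace Ω] [MeasurableSpace E] {P : Measure Ω}
  {N : Ω → Measure E} {m : Measure E}

lemma lintegral_apply (h : IsPoissonRandomMeasure P N m) {B : Set E} (hB : MeasurableSet B)
    (hm : m B < ∞) : ∫⁻ ω, N ω B ∂P = m B := by
  have h1 : Measurable fun ω => N ω B := (Measure.measurable_coe hB).comp h.measurable
  calc ∫⁻ ω, N ω B ∂P = ∫⁻ x, x ∂(P.map fun ω => N ω B) := (lintegral_map measurable_id h1).symm
  _ = m B := by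
    rw [h.map_eq_poisson B hB hm, lintegral_map (f := fun x => x) measurable_id .of_discrete]
    simp only [lintegral_natCast_poissonMeasure]
    exact ENNReal.coe_toNNReal hm.ne

/-- The mean measure of a Poisson random measure. -/
lemma bind_eq [SigmaFinite m] (h : IsPoissonRandomMeasure P N m) : P.bind N = m := by
  -- Counts are known to be Poisson only on sets of finite mean, hence the comparison on the
  -- spanning sets.
  refine Measure.ext_of_iUnion_eq_univ (iUnion_spanningSets m) fun n => ?_
  ext B hB
  rw [Measure.restrict_apply hB, Measure.restrict_apply hB]
  have hB' := hB.inter (measurableSet_spanningSets m n)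
  rw [Measure.bind_apply hB' h.measurable.aemeasurable]
  exact h.lintegral_apply hB'
    ((measure_mono inter_subset_right).trans_lt (measure_spanningSets_lt_top m n))

lemma lintegral_lintegral [SigmaFinite m] (h : IsPoissonRandomMeasure P N m) {f : E → ℝ≥0∞}
    (hf : Measurable f) : ∫⁻ ω, ∫⁻ x, f x ∂(N ω) ∂P = ∫⁻ x, f x ∂m := by
  rw [← Measure.lintegral_bind h.measurable.aemeasurable hf.aemeasurable, h.bind_eq]

lemma ae_integrable [SigmaFinite m] (h : IsPoissonRandomMeasure P N m) {F : Type*}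
    [NormedAddCommGroup F] [MeasurableSpace F] [BorelSpace F] [SecondCountableTopology F]
    {f : E → F} (hf : Measurable f) (hi : Integrable f m) : ∀ᵐ ω ∂P, Integrable f (N ω) := by
  have h1 : ∫⁻ ω, ∫⁻ x, ‖f x‖ₑ ∂(N ω) ∂P < ∞ := by
    rw [h.lintegral_lintegral hf.enorm]
    exact hi.2
  have h2 := ae_lt_top (α := Ω) (μ := P) (f := fun ω => ∫⁻ x, ‖f x‖ₑ ∂(N ω))
    ((Measure.measurable_lintegral hf.enorm).comp h.measurable) h1.ne
  filter_upwards [h2] with ω hω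
  exact ⟨hf.aestronglyMeasurable, hω⟩

lemma aemeasurable_integral [SigmaFinite m] (h : IsPoissonRandomMeasure P N m) {f : E → ℝ}
    (hf : Measurable f) (hi : Integrable f m) : AEMeasurable (fun ω => ∫ x, f x ∂(N ω)) P := by
  refine AEMeasurable.congr (f := fun ω => (∫⁻ x, ENNReal.ofReal (f x) ∂(N ω)).toReal -
    (∫⁻ x, ENNReal.ofReal (-f x) ∂(N ω)).toReal) ?_ ?_
  · refine (Measurable.sub ?_ ?_).aemeasurable
    · exact ((Measure.measurable_lintegral hf.ennreal_ofReal).comp h.measurable).ennreal_toReal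
    · exact ((Measure.measurable_lintegral hf.neg.ennreal_ofReal).comp h.measurable).ennreal_toReal
  · filter_upwards [h.ae_integrable hf hi] with ω hω
    rw [integral_eq_lintegral_pos_part_sub_lintegral_neg_part hω]

/-- Counts on disjoint sets are independent Poisson variables. The functions `G` are left general
because they are complex exponentials in one application and powers in another. -/
lemma integral_prod_apply (h : IsPoissonRandomMeasure P N m) {κ : Type*} (s : Finset κ)
    {B : κ → Set E} (hB : ∀ c ∈ s, MeasurableSet (B c)) (hm : ∀ c ∈ s, m (B c) < ∞)
    (hd : ∀ c ∈ s, ∀ d ∈ s, c ≠ d → Disjoint (B c) (B d)) {G : κ → ℝ≥0∞ → ℂ}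
    (hG : ∀ c, Measurable (G c)) :
    ∫ ω, ∏ c ∈ s, G c (N ω (B c)) ∂P =
      ∏ c ∈ s, ∫ k : ℕ, G c k ∂(poissonMeasure (m (B c)).toNNReal) := by
  have e := s.equivFin.symm
  have h1 := h.indep s.card (fun i => B (s.equivFin.symm i)) (fun i => hB _ (by simp))
    (fun i j hij => hd _ (by simp) _ (by simp) fun hc => hij (by
      simpa using s.equivFin.symm.injective (Subtype.ext hc)))
  have h2 : ∀ i, Measurable fun ω => N ω (B (s.equivFin.symm i)) := fun i =>
    (Measure.measurable_coe (hB _ (by simp))).comp h.measurable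
  have h3 := h1.integral_fun_prod_comp (f := fun i => G (s.equivFin.symm i))
    (fun i => (h2 i).aemeasurable) (fun i => (hG _).aestronglyMeasurable)
  have h4 : ∀ F : κ → ℂ, ∏ c ∈ s, F c = ∏ i, F (s.equivFin.symm i) := fun F => by
    rw [← Finset.prod_coe_sort, ← Equiv.prod_comp s.equivFin.symm]
  simp_rw [h4]
  rw [h3]
  refine Finset.prod_congr rfl fun i _ => ?_
  have hBi := hB (s.equivFin.symm i) (by simp)
  rw [← integral_map (φ := fun ω => N ω (B (s.equivFin.symm i))) (h2 i).aemeasurable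
    (hG _).aestronglyMeasurable, h.map_eq_poisson _ hBi (hm _ (by simp)),
    integral_map .of_discrete (hG _).aestronglyMeasurable]

/-- On a simple function the Poisson integral is ∑ c N(f = c) over the nonzero values c. These level
sets are disjoint and of finite mean, and each contributes a Poisson characteristic function. -/
lemma integral_exp_simpleFunc [SigmaFinite m] (h : IsPoissonRandomMeasure P N m)
    (f : SimpleFunc E ℝ) (hi : Integrable f m) :
    ∫ ω, Complex.exp (Complex.I * ((∫ x, f x ∂(N ω) : ℝ) : ℂ)) ∂P =
      Complex.exp (∫ x, (Complex.exp (Complex.I * ((f x : ℝ) : ℂ)) - 1) ∂m) := by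
  classical
  set s := f.range.filter (fun c => c ≠ 0) with hs
  have hfin : ∀ c ∈ s, m (f ⁻¹' {c}) < ∞ := fun c hc =>
    SimpleFunc.integrable_iff.1 hi c (Finset.mem_filter.1 hc).2
  set G : ℝ → ℝ≥0∞ → ℂ := fun c x => Complex.exp (Complex.I * ((x.toReal * c : ℝ) : ℂ)) with hGdef
  have hG : ∀ c, Measurable (G c) := fun c => by
    have : Measurable fun x : ℝ≥0∞ => x.toReal := ENNReal.measurable_toReal
    fun_prop
  have h1 : ∀ᵐ ω ∂P, Complex.exp (Complex.I * ((∫ x, f x ∂(N ω) : ℝ) : ℂ)) =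
      ∏ c ∈ s, G c (N ω (f ⁻¹' {c})) := by
    filter_upwards [h.ae_integrable f.measurable hi] with ω hω
    rw [← SimpleFunc.integral_eq_integral f hω, SimpleFunc.integral_eq_sum_filter]
    rw [hGdef, ← Complex.exp_sum, ← Finset.mul_sum]
    simp only [smul_eq_mul, Measure.real, Complex.ofReal_sum]
    rfl
  rw [integral_congr_ae h1, h.integral_prod_apply s (B := fun c => f ⁻¹' {c})
    (fun c _ => f.measurableSet_preimage _) hfin
    (fun c _ d _ hcd => Disjoint.preimage _ (by simpa using hcd)) hG]
  have h2 : ∀ c, ∫ k : ℕ, G c k ∂(poissonMeasure (m (f ⁻¹' {c})).toNNReal) =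
      Complex.exp (m.real (f ⁻¹' {c}) * (Complex.exp (Complex.I * c) - 1)) := fun c => by
    have h5 : (m.real (f ⁻¹' {c}) : ℂ) = (((m (f ⁻¹' {c})).toNNReal : ℝ) : ℂ) := rfl
    rw [h5, ← integral_pow_poissonMeasure]
    refine integral_congr_ae (ae_of_all _ fun k => ?_)
    simp only [hGdef, ENNReal.toReal_natCast]
    rw [← Complex.exp_nat_mul]
    push_cast
    ring_nf
  simp_rw [h2]
  rw [← Complex.exp_sum]
  congr 1
  set g : ℝ → ℂ := fun c => Complex.exp (Complex.I * c) - 1 with hg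
  have hg0 : g 0 = 0 := by simp [hg]
  have h3 : Integrable (f.map g) m := by
    rw [SimpleFunc.integrable_iff_finMeasSupp] at hi ⊢
    exact hi.map hg0
  have h4 := SimpleFunc.map_integral f g hi hg0
  rw [SimpleFunc.integral_eq_integral _ h3] at h4
  change _ = ∫ x, (f.map g) x ∂m
  rw [h4, hs, Finset.sum_filter]
  refine Finset.sum_congr rfl fun c _ => ?_
  split_ifs with hc
  · rw [Complex.real_smul]
  · rw [not_not.1 hc, hg0, smul_zero]

end IsPoissonRandomMeasure

lemma norm_exp_I_mul_ofReal (a : ℝ) : ‖Complex.exp (Complex.I * (a : ℂ))‖ = 1 := by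
  rw [mul_comm]
  exact Complex.norm_exp_ofReal_mul_I a

lemma norm_exp_I_sub_exp_I_le (a b : ℝ) :
    ‖Complex.exp (Complex.I * (a : ℂ)) - Complex.exp (Complex.I * (b : ℂ))‖ ≤ |a - b| := by
  have h : Complex.exp (Complex.I * (a : ℂ)) - Complex.exp (Complex.I * (b : ℂ)) =
      Complex.exp (Complex.I * (b : ℂ)) * (Complex.exp (Complex.I * ((a - b : ℝ) : ℂ)) - 1) := by
    rw [mul_sub, ← Complex.exp_add]
    push_cast
    ring_nf
  rw [h, norm_mul, norm_exp_I_mul_ofReal, one_mul]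
  exact Real.norm_exp_I_mul_ofReal_sub_one_le

/-- Telescoping: the factors are replaced one at a time, and the remaining ones have norm at most 1.
-/
lemma norm_prod_sub_prod_le {κ : Type*} (S : Finset κ) (a b : κ → ℂ) (ha : ∀ k, ‖a k‖ ≤ 1)
    (hb : ∀ k, ‖b k‖ ≤ 1) : ‖∏ k ∈ S, a k - ∏ k ∈ S, b k‖ ≤ ∑ k ∈ S, ‖a k - b k‖ := by
  classical
  induction S using Finset.induction_on with
  | empty => simp
  | insert k S hk ih =>
    rw [Finset.prod_insert hk, Finset.prod_insert hk, Finset.sum_insert hk]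
    have h1 : a k * ∏ k ∈ S, a k - b k * ∏ k ∈ S, b k =
        (a k - b k) * ∏ k ∈ S, a k + b k * (∏ k ∈ S, a k - ∏ k ∈ S, b k) := by ring
    rw [h1]
    refine (norm_add_le _ _).trans (add_le_add ?_ ?_)
    · rw [norm_mul, norm_prod]
      exact mul_le_of_le_one_right (norm_nonneg _)
        (Finset.prod_le_one (fun _ _ => norm_nonneg _) fun i _ => ha i)
    · rw [norm_mul]
      exact (mul_le_of_le_one_left (norm_nonneg _) (hb k)).trans ih

namespace IsPoissonRandomMeasure

variable {Ω E : Type*} [MeasurableSpace Ω] [MeasurableSpace E] {P : Measure Ω}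
  {N : Ω → Measure E} {m : Measure E}

lemma integrable_exp_sub_one {f : E → ℝ} (hf : Measurable f) (hi : Integrable f m) :
    Integrable (fun x => Complex.exp (Complex.I * ((f x : ℝ) : ℂ)) - 1) m := by
  refine hi.mono (by fun_prop) (ae_of_all _ fun x => ?_)
  exact Real.norm_exp_I_mul_ofReal_sub_one_le

/-- The characteristic functional of a Poisson random measure. -/
lemma integral_exp [SigmaFinite m] [IsProbabilityMeasure P] (h : IsPoissonRandomMeasure P N m)
    {f : E → ℝ} (hf : Measurable f) (hi : Integrable f m) :
    ∫ ω, Complex.exp (Complex.I * ((∫ x, f x ∂(N ω) : ℝ) : ℂ)) ∂P =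
      Complex.exp (∫ x, (Complex.exp (Complex.I * ((f x : ℝ) : ℂ)) - 1) ∂m) := by
  set F : ℕ → SimpleFunc E ℝ := fun n => SimpleFunc.approxOn f hf (range f ∪ {0}) 0 (by simp) n
  have hFi : ∀ n, Integrable (F n) m := fun n => SimpleFunc.integrable_approxOn_range hf hi n
  have hF : Tendsto (fun n => ∫⁻ x, ‖F n x - f x‖ₑ ∂m) atTop (𝓝 0) :=
    SimpleFunc.tendsto_approxOn_range_L1_enorm hf hi
  have hint : ∀ {g : E → ℝ}, Measurable g → Integrable g m →
      Integrable (fun ω => Complex.exp (Complex.I * ((∫ x, g x ∂(N ω) : ℝ) : ℂ))) P :=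
    fun hg hgi => by
      have := h.aemeasurable_integral hg hgi
      refine Integrable.of_bound (C := 1) (Complex.continuous_exp.measurable.comp_aemeasurable
        ((Complex.measurable_ofReal.comp_aemeasurable this).const_mul _)).aestronglyMeasurable
        (ae_of_all _ fun ω => ?_)
      rw [norm_exp_I_mul_ofReal]
  -- Both sides are continuous in f for the L¹(m) distance: x ↦ exp(ix) is 1-Lipschitz, and the
  -- expected Poisson integral of |f - g| is its m-integral. Simple functions therefore suffice.
  have hL := tendsto_integral_of_L1 (μ := P) (l := atTop) _ (hint hf hi).aestronglyMeasurable
    (F := fun n ω => Complex.exp (Complex.I * ((∫ x, F n x ∂(N ω) : ℝ) : ℂ)))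
    (Eventually.of_forall fun n => hint (F n).measurable (hFi n)) (by
      refine tendsto_of_tendsto_of_tendsto_of_le_of_le tendsto_const_nhds hF
        (fun _ => zero_le) fun n => ?_
      refine le_trans (lintegral_mono_ae ?_)
        (h.lintegral_lintegral ((F n).measurable.sub hf).enorm).le
      filter_upwards [h.ae_integrable hf hi, h.ae_integrable (F n).measurable (hFi n)] with ω h1 h2
      have h3 := norm_exp_I_sub_exp_I_le (∫ x, F n x ∂(N ω)) (∫ x, f x ∂(N ω))
      rw [← integral_sub h2 h1, ← Real.norm_eq_abs] at h3
      exact (enorm_le_iff_norm_le.2 h3).trans (enorm_integral_le_lintegral_enorm _))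
  have hR := tendsto_integral_of_L1 (μ := m) (l := atTop) _
    (integrable_exp_sub_one hf hi).aestronglyMeasurable
    (F := fun n x => Complex.exp (Complex.I * ((F n x : ℝ) : ℂ)) - 1)
    (Eventually.of_forall fun n => integrable_exp_sub_one (F n).measurable (hFi n)) (by
      refine tendsto_of_tendsto_of_tendsto_of_le_of_le tendsto_const_nhds hF
        (fun _ => zero_le) fun n => lintegral_mono fun x => ?_
      rw [sub_sub_sub_cancel_right]
      exact enorm_le_iff_norm_le.2 (norm_exp_I_sub_exp_I_le _ _))
  refine tendsto_nhds_unique hL ?_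
  refine ((Complex.continuous_exp.tendsto _).comp hR).congr fun n => ?_
  exact (h.integral_exp_simpleFunc (F n) (hFi n)).symm

section Points

variable {κ : Type*} [Countable κ] {X : κ → Ω → E}

/-- The individual points of a random enumeration have unknown laws; only the sum of these laws is
determined, and only that sum is needed later. -/
lemma sum_map_eq [SigmaFinite m] (hX : ∀ k, Measurable (X k))
    (h : IsPoissonRandomMeasure P (fun ω => Measure.sum fun k => Measure.dirac (X k ω)) m) :
    Measure.sum (fun k => P.map (X k)) = m := by
  rw [← h.bind_eq]
  ext B hB
  rw [Measure.bind_apply hB h.measurable.aemeasurable, Measure.sum_apply _ hB]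
  simp_rw [Measure.sum_apply _ hB, Measure.dirac_apply' _ hB]
  rw [lintegral_tsum (f := fun k ω => B.indicator 1 (X k ω))
    fun k => ((measurable_one.indicator hB).comp (hX k)).aemeasurable]
  refine tsum_congr fun k => ?_
  rw [Measure.map_apply (hX k) hB, ← lintegral_indicator_one ((hX k) hB)]
  rfl

/-- The bound does not depend on the finite set `S`, which is what permits approximating φ before
letting `S` exhaust the index set. -/
lemma integral_prod_le [SigmaFinite m] (hX : ∀ k, Measurable (X k))
    (h : IsPoissonRandomMeasure P (fun ω => Measure.sum fun k => Measure.dirac (X k ω)) m)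
    [IsProbabilityMeasure P] {φ φ' : E → ℂ} (hφ : Measurable φ) (hφ' : Measurable φ')
    (h1 : ∀ x, ‖φ x‖ ≤ 1) (h1' : ∀ x, ‖φ' x‖ ≤ 1) (S : Finset κ) :
    ‖(∫ ω, ∏ k ∈ S, φ (X k ω) ∂P) - ∫ ω, ∏ k ∈ S, φ' (X k ω) ∂P‖ₑ ≤ ∫⁻ x, ‖φ x - φ' x‖ₑ ∂m := by
  have hint : ∀ {φ : E → ℂ}, Measurable φ → (∀ x, ‖φ x‖ ≤ 1) →
      Integrable (fun ω => ∏ k ∈ S, φ (X k ω)) P := fun hφ h1 => by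
    refine Integrable.of_bound (C := 1) ?_ (ae_of_all _ fun ω => ?_)
    · exact (Finset.measurable_fun_prod S fun k _ => hφ.comp (hX k)).aestronglyMeasurable
    · rw [norm_prod]
      exact Finset.prod_le_one (fun _ _ => norm_nonneg _) fun i _ => h1 _
  rw [← integral_sub (hint hφ h1) (hint hφ' h1'), ← sum_map_eq hX h, lintegral_sum_measure]
  refine (enorm_integral_le_lintegral_enorm _).trans ?_
  calc _ ≤ ∫⁻ ω, ∑ k ∈ S, ‖φ (X k ω) - φ' (X k ω)‖ₑ ∂P := by
        refine lintegral_mono fun ω => ?_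
        have h3 := norm_prod_sub_prod_le S (fun k => φ (X k ω)) (fun k => φ' (X k ω))
          (fun k => h1 _) (fun k => h1' _)
        have h4 : ∑ k ∈ S, ‖φ (X k ω) - φ' (X k ω)‖ₑ =
            ENNReal.ofReal (∑ k ∈ S, ‖φ (X k ω) - φ' (X k ω)‖) := by
          rw [ENNReal.ofReal_sum_of_nonneg fun _ _ => norm_nonneg _]
          simp only [ofReal_norm]
        rw [h4, ← ofReal_norm]
        exact ENNReal.ofReal_le_ofReal h3
    _ = ∑ k ∈ S, ∫⁻ x, ‖φ x - φ' x‖ₑ ∂(P.map (X k)) := by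
        rw [lintegral_finsetSum]
        · refine Finset.sum_congr rfl fun k _ => ?_
          exact (lintegral_map (hφ.sub hφ').enorm (hX k)).symm
        · exact fun k _ => ((hφ.comp (hX k)).sub (hφ'.comp (hX k))).enorm
    _ ≤ _ := ENNReal.sum_le_tsum S

/-- Almost surely only finitely many points fall where φ ≠ 1, so the finite products are eventually
constant and equal to a product of powers c^N(φ = c) of independent Poisson counts. -/
lemma tendsto_integral_prod_simpleFunc [SigmaFinite m] (hX : ∀ k, Measurable (X k))
    (h : IsPoissonRandomMeasure P (fun ω => Measure.sum fun k => Measure.dirac (X k ω)) m)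
    [IsProbabilityMeasure P] (φ : SimpleFunc E ℂ) (h1 : ∀ x, ‖φ x‖ ≤ 1)
    (hi : Integrable (fun x => φ x - 1) m) :
    Tendsto (fun S : Finset κ => ∫ ω, ∏ k ∈ S, φ (X k ω) ∂P) atTop
      (𝓝 (Complex.exp (∫ x, (φ x - 1) ∂m))) := by
  classical
  set s := φ.range.filter (fun c => c ≠ 1) with hs
  have hfin : ∀ c ∈ s, m (φ ⁻¹' {c}) < ∞ := fun c hc => by
    have h2 : Integrable (φ.map fun c => c - 1) m := hi
    refine (measure_mono ?_).trans_lt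
      (SimpleFunc.integrable_iff.1 h2 (c - 1) (sub_ne_zero.2 (Finset.mem_filter.1 hc).2))
    intro x hx
    simp only [mem_preimage, mem_singleton_iff] at hx
    simp [hx]
  -- Counts take values in `ℝ≥0∞`; the floor recovers the natural exponent when the count is finite.
  set G : ℂ → ℝ≥0∞ → ℂ := fun c x => c ^ ⌊x.toReal⌋₊ with hGdef
  have hG : ∀ c, Measurable (G c) := fun c =>
    (measurable_from_nat (f := fun k => c ^ k)).comp
      (Nat.measurable_floor.comp ENNReal.measurable_toReal)
  have key : ∀ᵐ ω ∂P, Tendsto (fun S : Finset κ => ∏ k ∈ S, φ (X k ω)) atTop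
      (𝓝 (∏ c ∈ s, G c (Measure.sum (fun k => Measure.dirac (X k ω)) (φ ⁻¹' {c})))) := by
    have hfinite : ∀ᵐ ω ∂P, ∀ c ∈ s,
        Measure.sum (fun k => Measure.dirac (X k ω)) (φ ⁻¹' {c}) < ∞ := by
      refine (ae_ball_iff s.countable_toSet).2 fun c hc => ?_
      refine ae_lt_top ((Measure.measurable_coe (φ.measurableSet_preimage _)).comp h.measurable) ?_
      rw [h.lintegral_apply (φ.measurableSet_preimage _) (hfin c hc)]
      exact (hfin c hc).ne
    filter_upwards [hfinite] with ω hω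
    have hsum : ∀ c, Measure.sum (fun k => Measure.dirac (X k ω)) (φ ⁻¹' {c}) =
        ∑' k, ({k | φ (X k ω) = c} : Set κ).indicator (fun _ => (1 : ℝ≥0∞)) k := fun c => by
      rw [Measure.sum_apply _ (φ.measurableSet_preimage _)]
      refine tsum_congr fun k => ?_
      rw [Measure.dirac_apply' _ (φ.measurableSet_preimage _)]
      simp [indicator]
    have hKc : ∀ c ∈ s, ({k | φ (X k ω) = c} : Set κ).Finite := fun c hc => by
      have h5 := hω c hc
      rw [hsum] at h5
      by_contra hinf
      rw [← tsum_subtype] at h5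
      have := Set.infinite_coe_iff.2 hinf
      rw [ENNReal.tsum_const_eq_top_of_ne_zero one_ne_zero] at h5
      exact lt_irrefl _ h5
    have hK : ({k | φ (X k ω) ≠ 1} : Set κ).Finite := by
      refine (Set.Finite.biUnion s.finite_toSet hKc).subset fun k hk => ?_
      simp only [mem_iUnion]
      exact ⟨φ (X k ω), by simpa [hs] using hk, rfl⟩
    refine tendsto_const_nhds.congr' ?_
    filter_upwards [eventually_ge_atTop hK.toFinset] with S hS
    rw [← Finset.prod_subset hS fun k _ hk => by simpa using hk]
    rw [← Finset.prod_fiberwise_of_maps_to (s := hK.toFinset) (t := s) (g := fun k => φ (X k ω))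
      (fun k hk => by simpa [hs] using hk)]
    refine Finset.prod_congr rfl fun c hc => ?_
    rw [Finset.prod_congr rfl fun k hk => (Finset.mem_filter.1 hk).2, Finset.prod_const, hGdef]
    simp only
    rw [hsum, tsum_eq_sum (s := hK.toFinset) fun k hk => by
      have hk1 : φ (X k ω) = 1 := by simpa using hk
      have : φ (X k ω) ≠ c := by rw [hk1]; exact fun h => (Finset.mem_filter.1 hc).2 h.symm
      simp [this]]
    congr 1
    simp [indicator]
  have hlim := tendsto_integral_filter_of_dominated_convergence (μ := P) (l := atTop)
    (F := fun (S : Finset κ) ω => ∏ k ∈ S, φ (X k ω)) (fun _ => 1)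
    (Eventually.of_forall fun S =>
      (Finset.measurable_fun_prod S fun k _ => φ.measurable.comp (hX k)).aestronglyMeasurable)
    (Eventually.of_forall fun S => ae_of_all _ fun ω => by
      rw [norm_prod]
      exact Finset.prod_le_one (fun _ _ => norm_nonneg _) fun i _ => h1 _)
    (integrable_const _) key
  rw [h.integral_prod_apply s (B := fun c => φ ⁻¹' {c})
    (fun c _ => φ.measurableSet_preimage _) hfin
    (fun c _ d _ hcd => Disjoint.preimage _ (by simpa using hcd)) hG] at hlim
  convert hlim using 2
  simp only [hGdef, ENNReal.toReal_natCast, Nat.floor_natCast, integral_pow_poissonMeasure]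
  rw [← Complex.exp_sum]
  congr 1
  have h3 : Integrable (φ.map fun c => c - 1) m := hi
  change ∫ x, (φ.map fun c => c - 1) x ∂m = _
  rw [← SimpleFunc.integral_eq_integral _ h3, SimpleFunc.integral_eq_sum_filter]
  -- The nonzero values of φ - 1 correspond to the values of φ other than 1 by a shift.
  refine Finset.sum_bij' (fun c _ => c + 1) (fun c _ => c - 1) ?_ ?_ ?_ ?_ ?_
  · intro c hc
    simp only [SimpleFunc.range_map, Finset.mem_filter, Finset.mem_image] at hc
    obtain ⟨⟨a, ha, rfl⟩, hc⟩ := hc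
    simpa [hs, sub_ne_zero] using ⟨by simpa using ha, sub_ne_zero.1 hc⟩
  · intro c hc
    simp only [SimpleFunc.range_map, Finset.mem_filter, Finset.mem_image]
    exact ⟨⟨c, (Finset.mem_filter.1 hc).1, rfl⟩, sub_ne_zero.2 (Finset.mem_filter.1 hc).2⟩
  · intros; ring
  · intros; ring
  · intro c hc
    rw [Complex.real_smul]
    congr 1
    · have : (φ.map fun c => c - 1) ⁻¹' {c} = φ ⁻¹' {c + 1} := by
        ext x
        simp [sub_eq_iff_eq_add]
      rw [this]
      rfl
    · ring

/-- The probability generating functional of a Poisson process. -/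
lemma tendsto_integral_prod [SigmaFinite m] (hX : ∀ k, Measurable (X k))
    (h : IsPoissonRandomMeasure P (fun ω => Measure.sum fun k => Measure.dirac (X k ω)) m)
    [IsProbabilityMeasure P] {φ : E → ℂ} (hφ : Measurable φ) (h1 : ∀ x, ‖φ x‖ ≤ 1)
    (hi : Integrable (fun x => φ x - 1) m) :
    Tendsto (fun S : Finset κ => ∫ ω, ∏ k ∈ S, φ (X k ω) ∂P) atTop
      (𝓝 (Complex.exp (∫ x, (φ x - 1) ∂m))) := by
  have h01 : (1 : ℂ) ∈ Metric.closedBall (0 : ℂ) 1 := by simp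
  set F : ℕ → SimpleFunc E ℂ := fun n =>
    SimpleFunc.approxOn φ hφ (Metric.closedBall (0 : ℂ) 1) 1 h01 n
  have hF1 : ∀ n x, ‖F n x‖ ≤ 1 := fun n x => by
    simpa using SimpleFunc.approxOn_mem hφ h01 n x
  have hF : Tendsto (fun n => ∫⁻ x, ‖F n x - φ x‖ₑ ∂m) atTop (𝓝 0) :=
    SimpleFunc.tendsto_approxOn_L1_enorm hφ h01
      (ae_of_all _ fun x => subset_closure (by simpa using h1 x)) hi.2
  have hFi : ∀ n, Integrable (fun x => F n x - 1) m := fun n => by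
    refine (hi.norm.const_mul 2).mono (by fun_prop) (ae_of_all _ fun x => ?_)
    have := SimpleFunc.norm_approxOn_y₀_le hφ h01 x n
    rw [Real.norm_of_nonneg (by positivity)]
    linarith
  have hR : Tendsto (fun n => Complex.exp (∫ x, (F n x - 1) ∂m)) atTop
      (𝓝 (Complex.exp (∫ x, (φ x - 1) ∂m))) := by
    refine (Complex.continuous_exp.tendsto _).comp ?_
    refine tendsto_integral_of_L1 _ hi.aestronglyMeasurable (Eventually.of_forall hFi) ?_
    simpa using hF
  have hF' : Tendsto (fun n => (∫⁻ x, ‖F n x - φ x‖ₑ ∂m).toReal) atTop (𝓝 0) := by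
    exact (ENNReal.tendsto_toReal ENNReal.zero_ne_top).comp hF
  -- An ε/3 argument: the simple function is fixed first, with an error uniform in `S`; then `S`
  -- grows.
  refine Metric.tendsto_nhds.2 fun ε hε => ?_
  obtain ⟨n, hn1, hn2, hn3⟩ := ((hF.eventually_lt_const (by simp : (0 : ℝ≥0∞) < 1)).and
    (((Metric.tendsto_nhds.1 hF') (ε / 3) (by positivity)).and
    ((Metric.tendsto_nhds.1 hR) (ε / 3) (by positivity)))).exists
  filter_upwards [Metric.tendsto_nhds.1
    (h.tendsto_integral_prod_simpleFunc hX (F n) (hF1 n) (hFi n)) (ε / 3) (by positivity)] with S h5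
  have h2 := h.integral_prod_le hX (F n).measurable hφ (hF1 n) h1 S
  have h3 : dist (∫ ω, ∏ k ∈ S, φ (X k ω) ∂P) (∫ ω, ∏ k ∈ S, F n (X k ω) ∂P) < ε / 3 := by
    rw [dist_comm, dist_eq_norm, ← toReal_enorm]
    refine (ENNReal.toReal_mono (hn1.trans ENNReal.one_lt_top).ne h2).trans_lt ?_
    simpa using hn2
  have h4 := dist_triangle4 (∫ ω, ∏ k ∈ S, φ (X k ω) ∂P) (∫ ω, ∏ k ∈ S, F n (X k ω) ∂P)
    (Complex.exp (∫ x, (F n x - 1) ∂m)) (Complex.exp (∫ x, (φ x - 1) ∂m))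
  linarith

end Points

end IsPoissonRandomMeasure

/-! ### The compensated exponential and second moments of compensated integrals -/

/-- `exp (i x) - 1 - i x`. -/
noncomputable def centeredExp (x : ℝ) : ℂ :=
  Complex.exp (Complex.I * (x : ℂ)) - 1 - Complex.I * (x : ℂ)

@[fun_prop]
lemma continuous_centeredExp : Continuous centeredExp := by
  unfold centeredExp
  fun_prop

@[simp]
lemma centeredExp_zero : centeredExp 0 = 0 := by simp [centeredExp]

lemma norm_centeredExp_le_abs (x : ℝ) : ‖centeredExp x‖ ≤ 2 * |x| := by
  have h1 : ‖Complex.exp (Complex.I * (x : ℂ)) - 1‖ ≤ |x| := Real.norm_exp_I_mul_ofReal_sub_one_le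
  have h2 : ‖Complex.I * (x : ℂ)‖ = |x| := by simp
  have := norm_sub_le (Complex.exp (Complex.I * (x : ℂ)) - 1) (Complex.I * (x : ℂ))
  rw [centeredExp]
  linarith

lemma norm_centeredExp_le_sq (x : ℝ) : ‖centeredExp x‖ ≤ 2 * x ^ 2 := by
  have h2 : ‖Complex.I * (x : ℂ)‖ = |x| := by simp
  rcases le_total |x| 1 with h | h
  · have := Complex.norm_exp_sub_one_sub_id_le (x := Complex.I * (x : ℂ)) (by rwa [h2])
    rw [h2, sq_abs] at this
    rw [centeredExp]
    nlinarith [sq_nonneg x]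
  · refine (norm_centeredExp_le_abs x).trans ?_
    rw [← sq_abs]
    nlinarith

lemma norm_centeredExp_le_rpow {κ : ℝ} (h1 : 1 ≤ κ) (h2 : κ ≤ 2) (x : ℝ) :
    ‖centeredExp x‖ ≤ 2 * |x| ^ κ := by
  rcases le_total |x| 1 with h | h
  · refine (norm_centeredExp_le_sq x).trans ?_
    rw [← sq_abs]
    rcases (abs_nonneg x).eq_or_lt with h0 | h0
    · rw [← h0]; simp [Real.zero_rpow (by linarith : κ ≠ 0)]
    · have := Real.rpow_le_rpow_of_exponent_ge h0 h h2
      rw [Real.rpow_two] at this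
      linarith
  · refine (norm_centeredExp_le_abs x).trans ?_
    have := Real.rpow_le_rpow_of_exponent_le h h1
    rw [Real.rpow_one] at this
    linarith

lemma norm_centeredExp_le_min (x : ℝ) : ‖centeredExp x‖ ≤ 2 * min (x ^ 2) |x| := by
  rw [mul_min_of_nonneg _ _ (by norm_num)]
  exact le_min (norm_centeredExp_le_sq x) (norm_centeredExp_le_abs x)

/-- The compensated integral of an integrable function. -/
noncomputable def compensatedIntegral {Ω E : Type*} [MeasurableSpace E] (N : Ω → Measure E)
    (m : Measure E) (f : E → ℝ) (ω : Ω) : ℝ :=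
  (∫ x, f x ∂(N ω)) - ∫ x, f x ∂m

/-- A bound on the second moment from the characteristic function. -/
lemma lintegral_sq_le_of_charFun {Ω : Type*} [MeasurableSpace Ω] {P : Measure Ω}
    [IsProbabilityMeasure P] {X : Ω → ℝ} (hX : AEMeasurable X P) {K : ℝ}
    (h : ∀ᶠ n : ℕ in atTop,
      ‖(∫ ω, Complex.exp (Complex.I * (((1 / ((n : ℝ) + 1)) * X ω : ℝ) : ℂ)) ∂P) - 1‖ ≤
        K * (1 / ((n : ℝ) + 1)) ^ 2) :
    ∫⁻ ω, ENNReal.ofReal (X ω ^ 2) ∂P ≤ ENNReal.ofReal (Real.pi ^ 2 / 2 * K) := by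
  -- The inequality 1 - cos y ≥ (2/π²) y² for |y| ≤ π, taken at y = X/(n+1), bounds X² by `Y n` for
  -- all large n. Fatou's lemma then transfers the bound on the expectation of `Y n`.
  set Y : ℕ → Ω → ℝ≥0∞ := fun n ω => ENNReal.ofReal
    (Real.pi ^ 2 / 2 * ((n : ℝ) + 1) ^ 2 * (1 - Real.cos ((1 / ((n : ℝ) + 1)) * X ω))) with hY
  have hYm : ∀ n, AEMeasurable (Y n) P := fun n => by fun_prop
  have h1 : ∀ ω, ENNReal.ofReal (X ω ^ 2) ≤ liminf (fun n => Y n ω) atTop := fun ω => by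
    refine le_liminf_of_le (by isBoundedDefault) ?_
    obtain ⟨n₀, hn₀⟩ := exists_nat_gt |X ω|
    filter_upwards [eventually_ge_atTop n₀] with n hn
    refine ENNReal.ofReal_le_ofReal ?_
    have hn' : (n₀ : ℝ) ≤ n := by exact_mod_cast hn
    have hp : (0 : ℝ) < (n : ℝ) + 1 := by positivity
    have hy : |1 / ((n : ℝ) + 1) * X ω| ≤ Real.pi := by
      rw [abs_mul, abs_of_pos (by positivity), one_div, inv_mul_le_iff₀ hp]
      nlinarith [Real.pi_gt_three]
    have h3 := Real.cos_le_one_sub_mul_cos_sq hy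
    have h4 : 2 / Real.pi ^ 2 * (1 / ((n : ℝ) + 1) * X ω) ^ 2 ≤
        1 - Real.cos ((1 / ((n : ℝ) + 1)) * X ω) := by linarith
    calc X ω ^ 2 = Real.pi ^ 2 / 2 * ((n : ℝ) + 1) ^ 2 *
          (2 / Real.pi ^ 2 * (1 / ((n : ℝ) + 1) * X ω) ^ 2) := by
            field_simp
      _ ≤ _ := by gcongr
  calc ∫⁻ ω, ENNReal.ofReal (X ω ^ 2) ∂P ≤ ∫⁻ ω, liminf (fun n => Y n ω) atTop ∂P :=
        lintegral_mono h1
    _ ≤ liminf (fun n => ∫⁻ ω, Y n ω ∂P) atTop := lintegral_liminf_le' hYm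
    _ ≤ _ := by
      refine liminf_le_of_frequently_le' (Eventually.frequently ?_)
      filter_upwards [h] with n hn
      have hp : (0 : ℝ) < (n : ℝ) + 1 := by positivity
      have hc : Integrable (fun ω => Real.cos ((1 / ((n : ℝ) + 1)) * X ω)) P :=
        Integrable.of_bound (C := 1) (by fun_prop) (ae_of_all _ fun ω => Real.abs_cos_le_one _)
      simp only [hY]
      have hc' : Integrable (fun ω => Real.pi ^ 2 / 2 * ((n : ℝ) + 1) ^ 2 *
          (1 - Real.cos ((1 / ((n : ℝ) + 1)) * X ω))) P :=
        (Integrable.sub (integrable_const _) hc).const_mul _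
      rw [← ofReal_integral_eq_lintegral_ofReal hc' (ae_of_all _ fun ω => mul_nonneg (by positivity)
          (sub_nonneg.2 (Real.cos_le_one _))), integral_const_mul,
        integral_sub (integrable_const _) hc]
      refine ENNReal.ofReal_le_ofReal ?_
      have hE : Integrable
          (fun ω => Complex.exp (Complex.I * (((1 / ((n : ℝ) + 1)) * X ω : ℝ) : ℂ))) P :=
        Integrable.of_bound (C := 1) (by fun_prop) (ae_of_all _ fun ω =>
          (norm_exp_I_mul_ofReal _).le)
      have hre : ∫ ω, Real.cos ((1 / ((n : ℝ) + 1)) * X ω) ∂P =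
          (∫ ω, Complex.exp (Complex.I * (((1 / ((n : ℝ) + 1)) * X ω : ℝ) : ℂ)) ∂P).re := by
        have := integral_re hE
        simp only [RCLike.re_to_complex] at this
        rw [← this]
        refine integral_congr_ae (ae_of_all _ fun ω => ?_)
        simp only
        rw [mul_comm Complex.I, Complex.exp_ofReal_mul_I_re]
      have h5 := (Complex.abs_re_le_norm _).trans hn
      rw [Complex.sub_re, ← hre, Complex.one_re, abs_sub_comm] at h5
      have h6 := (le_abs_self _).trans h5
      simp only [integral_const, probReal_univ, smul_eq_mul, mul_one]
      calc _ ≤ Real.pi ^ 2 / 2 * ((n : ℝ) + 1) ^ 2 * (K * (1 / ((n : ℝ) + 1)) ^ 2) := by gcongr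
        _ = _ := by field_simp

namespace IsPoissonRandomMeasure

variable {Ω E : Type*} [MeasurableSpace Ω] [MeasurableSpace E] {P : Measure Ω}
  {N : Ω → Measure E} {m : Measure E}

lemma integral_exp_compensatedIntegral [SigmaFinite m] [IsProbabilityMeasure P]
    (h : IsPoissonRandomMeasure P N m) {f : E → ℝ} (hf : Measurable f) (hi : Integrable f m) :
    ∫ ω, Complex.exp (Complex.I * ((compensatedIntegral N m f ω : ℝ) : ℂ)) ∂P =
      Complex.exp (∫ x, centeredExp (f x) ∂m) := by
  have h1 : ∀ ω, Complex.exp (Complex.I * ((compensatedIntegral N m f ω : ℝ) : ℂ)) =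
      Complex.exp (-(Complex.I * ((∫ x, f x ∂m : ℝ) : ℂ))) *
        Complex.exp (Complex.I * ((∫ x, f x ∂(N ω) : ℝ) : ℂ)) := fun ω => by
    rw [compensatedIntegral, ← Complex.exp_add]
    push_cast
    ring_nf
  simp_rw [h1]
  rw [integral_const_mul, h.integral_exp hf hi, ← Complex.exp_add]
  congr 1
  unfold centeredExp
  have hi' : Integrable (fun x => Complex.I * ((f x : ℝ) : ℂ)) m := hi.ofReal.const_mul _
  rw [integral_sub (integrable_exp_sub_one hf hi) hi', integral_const_mul, integral_complex_ofReal]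
  ring

lemma aemeasurable_compensatedIntegral [SigmaFinite m] (h : IsPoissonRandomMeasure P N m)
    {f : E → ℝ} (hf : Measurable f) (hi : Integrable f m) :
    AEMeasurable (compensatedIntegral N m f) P :=
  (h.aemeasurable_integral hf hi).sub_const _

lemma compensatedIntegral_sub [SigmaFinite m] (h : IsPoissonRandomMeasure P N m)
    {f g : E → ℝ} (hf : Measurable f) (hi : Integrable f m) (hg : Measurable g)
    (hgi : Integrable g m) :
    compensatedIntegral N m f - compensatedIntegral N m g =ᵐ[P]
      compensatedIntegral N m (fun x => f x - g x) := by
  filter_upwards [h.ae_integrable hf hi, h.ae_integrable hg hgi] with ω h1 h2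
  simp only [Pi.sub_apply, compensatedIntegral]
  rw [integral_sub h1 h2, integral_sub hi hgi]
  ring

lemma compensatedIntegral_sum [SigmaFinite m] (h : IsPoissonRandomMeasure P N m)
    {n : ℕ} {f : Fin n → E → ℝ} (hf : ∀ i, Measurable (f i)) (hi : ∀ i, Integrable (f i) m)
    (z : Fin n → ℝ) :
    ∀ᵐ ω ∂P, ∑ i, z i * compensatedIntegral N m (f i) ω =
      compensatedIntegral N m (fun x => ∑ i, z i * f i x) ω := by
  filter_upwards [ae_all_iff.2 fun i => h.ae_integrable (hf i) (hi i)] with ω h1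
  simp only [compensatedIntegral]
  rw [integral_finsetSum _ fun i _ => (h1 i).const_mul _,
    integral_finsetSum _ fun i _ => (hi i).const_mul _, ← Finset.sum_sub_distrib]
  refine Finset.sum_congr rfl fun i _ => ?_
  rw [integral_const_mul, integral_const_mul]
  ring

/-- A weak form of the isometry of compensated Poisson integrals, read off from the characteristic
function near 0. The lost factor 2π² is harmless, since the bound only serves to prove a Cauchy
property. -/
lemma eLpNorm_compensatedIntegral_le [SigmaFinite m] [IsProbabilityMeasure P]
    (h : IsPoissonRandomMeasure P N m) {f : E → ℝ} (hf : Measurable f) (hi : Integrable f m)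
    (hi2 : Integrable (fun x => f x ^ 2) m) :
    eLpNorm (compensatedIntegral N m f) 2 P ≤
      (ENNReal.ofReal (2 * Real.pi ^ 2 * ∫ x, f x ^ 2 ∂m)) ^ (1 / 2 : ℝ) := by
  -- The exponent has norm at most 2 z² ∫ f², and |exp w - 1| ≤ 2|w| once |w| ≤ 1; the product of
  -- the two factors is 4.
  have key := lintegral_sq_le_of_charFun (K := 4 * ∫ x, f x ^ 2 ∂m)
    (h.aemeasurable_compensatedIntegral hf hi) (by
    have h0 : Tendsto (fun n : ℕ => 2 * (∫ x, f x ^ 2 ∂m) * (1 / ((n : ℝ) + 1)) ^ 2) atTop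
        (𝓝 0) := by
      simpa using ((tendsto_one_div_add_atTop_nhds_zero_nat (𝕜 := ℝ)).pow 2).const_mul
        (2 * (∫ x, f x ^ 2 ∂m))
    filter_upwards [h0.eventually_le_const one_pos] with n hn
    set z := 1 / ((n : ℝ) + 1)
    have h1 : ∀ ω, z * compensatedIntegral N m f ω =
        compensatedIntegral N m (fun x => z * f x) ω := fun ω => by
      simp only [compensatedIntegral, integral_const_mul]
      ring
    simp_rw [h1]
    rw [h.integral_exp_compensatedIntegral (hf.const_mul z) (hi.const_mul z)]
    have h2 : ‖∫ x, centeredExp (z * f x) ∂m‖ ≤ 2 * (∫ x, f x ^ 2 ∂m) * z ^ 2 := by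
      calc _ ≤ ∫ x, 2 * z ^ 2 * f x ^ 2 ∂m := by
            refine norm_integral_le_of_norm_le (hi2.const_mul _) (ae_of_all _ fun x => ?_)
            refine (norm_centeredExp_le_sq _).trans (le_of_eq ?_)
            ring
        _ = _ := by rw [integral_const_mul]; ring
    refine (Complex.norm_exp_sub_one_le (h2.trans hn)).trans ?_
    linarith)
  rw [eLpNorm_eq_lintegral_rpow_enorm_toReal two_ne_zero ENNReal.ofNat_ne_top]
  simp only [ENNReal.toReal_ofNat]
  refine ENNReal.rpow_le_rpow ?_ (by norm_num)
  refine le_trans (le_of_eq (lintegral_congr fun ω => ?_)) (key.trans (le_of_eq ?_))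
  · rw [← ofReal_norm, ENNReal.ofReal_rpow_of_nonneg (norm_nonneg _) (by norm_num)]
    simp
  · ring_nf

end IsPoissonRandomMeasure

/-! ### Compensated integrals of functions that need not be integrable -/

lemma abs_indicator_le_min {ε : ℝ} (hε : 0 < ε) (y : ℝ) :
    |if ε < |y| then y else 0| ≤ max 1 (1 / ε) * min (y ^ 2) |y| := by
  split_ifs with h
  · rcases le_total 1 |y| with h1 | h1
    · rw [min_eq_right (by rw [← sq_abs]; nlinarith)]
      exact le_mul_of_one_le_left (abs_nonneg _) (le_max_left _ _)
    · rw [min_eq_left (by rw [← sq_abs]; nlinarith [abs_nonneg y])]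
      refine le_trans ?_ (mul_le_mul_of_nonneg_right (le_max_right _ _) (sq_nonneg _))
      rw [one_div, inv_mul_eq_div, le_div_iff₀ hε, ← sq_abs]
      nlinarith [abs_nonneg y]
  · rw [abs_zero]
    positivity

lemma min_sq_abs_le_of_abs_le {x y : ℝ} (h : |x| ≤ |y|) : min (x ^ 2) |x| ≤ min (y ^ 2) |y| :=
  min_le_min (sq_le_sq.2 h) h

/-- Linear combinations keep the integrability of min(f², |f|). If all |y i| ≤ 1 the minima are
squares and Cauchy–Schwarz applies; otherwise the sum of the minima is at least 1 and dominates
every |y i|. -/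
lemma min_sq_abs_sum_le {n : ℕ} (z y : Fin n → ℝ) :
    min ((∑ i, z i * y i) ^ 2) |∑ i, z i * y i| ≤
      (1 + n * ∑ i, (|z i| + z i ^ 2)) * ∑ i, min (y i ^ 2) |y i| := by
  rcases n.eq_zero_or_pos with rfl | hn
  · simp
  have : Nonempty (Fin n) := ⟨⟨0, hn⟩⟩
  have hn1 : (1 : ℝ) ≤ n := by exact_mod_cast hn
  set M := ∑ i, min (y i ^ 2) |y i| with hM
  set Z := ∑ i, (|z i| + z i ^ 2) with hZ
  have hM0 : ∀ i, 0 ≤ min (y i ^ 2) |y i| := fun i => by positivity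
  have hZ0 : ∀ i, 0 ≤ |z i| + z i ^ 2 := fun i => by positivity
  have hMi : ∀ i, min (y i ^ 2) |y i| ≤ M := fun i =>
    Finset.single_le_sum (fun j _ => hM0 j) (Finset.mem_univ i)
  have hM0' : 0 ≤ M := Finset.sum_nonneg fun i _ => hM0 i
  have hZ0' : 0 ≤ Z := Finset.sum_nonneg fun i _ => hZ0 i
  have hZi : ∀ i, |z i| ≤ Z := fun i => (le_add_of_nonneg_right (sq_nonneg _)).trans
    (Finset.single_le_sum (f := fun i => |z i| + z i ^ 2) (fun j _ => hZ0 j) (Finset.mem_univ i))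
  have hsq : ∑ i, z i ^ 2 ≤ Z := Finset.sum_le_sum fun i _ => le_add_of_nonneg_left (abs_nonneg _)
  by_cases hb : ∀ i, |y i| ≤ 1
  · refine (min_le_left _ _).trans ?_
    have h1 := Finset.sum_mul_sq_le_sq_mul_sq Finset.univ z y
    have h2 : ∑ i, y i ^ 2 = M := Finset.sum_congr rfl fun i _ =>
      (min_eq_left (by rw [← sq_abs]; nlinarith [abs_nonneg (y i), hb i])).symm
    rw [h2] at h1
    refine h1.trans (mul_le_mul_of_nonneg_right ?_ hM0')
    nlinarith
  · push Not at hb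
    obtain ⟨j, hj⟩ := hb
    have hM1 : 1 ≤ M := by
      refine le_trans ?_ (hMi j)
      exact le_min (by rw [← sq_abs]; nlinarith) hj.le
    have hyM : ∀ i, |y i| ≤ M := fun i => by
      rcases le_total |y i| 1 with h | h
      · exact h.trans hM1
      · refine le_trans ?_ (hMi i)
        exact le_min (by rw [← sq_abs]; nlinarith) le_rfl
    refine (min_le_right _ _).trans ?_
    calc |∑ i, z i * y i| ≤ ∑ i, |z i * y i| := Finset.abs_sum_le_sum_abs _ _
      _ ≤ ∑ i : Fin n, |z i| * M := Finset.sum_le_sum fun i _ => by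
          rw [abs_mul]; exact mul_le_mul_of_nonneg_left (hyM i) (abs_nonneg _)
      _ = (∑ i, |z i|) * M := by rw [Finset.sum_mul]
      _ ≤ _ := by
        refine mul_le_mul_of_nonneg_right ?_ hM0'
        have : ∑ i, |z i| ≤ Z := Finset.sum_le_sum fun i _ => le_add_of_nonneg_right (sq_nonneg _)
        nlinarith

section Truncation

variable {E : Type*} [MeasurableSpace E] {m : Measure E} {f : E → ℝ}

lemma measurable_ite_lt_abs (hf : Measurable f) (ε : ℝ) :
    Measurable fun x => if ε < |f x| then f x else 0 :=
  Measurable.ite (measurableSet_lt measurable_const hf.abs) hf measurable_const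

lemma integrable_ite_lt_abs (hf : Measurable f)
    (hI : Integrable (fun x => min (f x ^ 2) |f x|) m) {ε : ℝ} (hε : 0 < ε) :
    Integrable (fun x => if ε < |f x| then f x else 0) m := by
  refine (hI.const_mul (max 1 (1 / ε))).mono (measurable_ite_lt_abs hf ε).aestronglyMeasurable
    (ae_of_all _ fun x => ?_)
  exact (abs_indicator_le_min hε _).trans (le_abs_self _)

lemma setIntegral_lt_abs_eq (hf : Measurable f) (ε : ℝ) (μ : Measure E) :
    ∫ x in {x | ε < |f x|}, f x ∂μ = ∫ x, (if ε < |f x| then f x else 0) ∂μ := by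
  rw [← integral_indicator (measurableSet_lt measurable_const hf.abs)]
  rfl

/-- Two truncations at levels below δ agree wherever |y| > δ, so their difference only sees small
values. -/
lemma sub_ite_sq_le {δ ε ε' : ℝ} (h : ε < δ) (h' : ε' < δ) (hδ : δ ≤ 1) (y : ℝ) :
    ((if ε < |y| then y else 0) - (if ε' < |y| then y else 0)) ^ 2 ≤
      if |y| ≤ δ then min (y ^ 2) |y| else 0 := by
  by_cases hy : |y| ≤ δ
  · rw [if_pos hy, min_eq_left (by rw [← sq_abs]; nlinarith [abs_nonneg y])]
    split_ifs <;> nlinarith [sq_nonneg y]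
  · push Not at hy
    rw [if_pos (h.trans hy), if_pos (h'.trans hy), if_neg (not_le.2 hy)]
    simp

lemma tendsto_integral_small_jumps (hf : Measurable f)
    (hI : Integrable (fun x => min (f x ^ 2) |f x|) m) :
    Tendsto (fun δ : ℝ => ∫ x, (if |f x| ≤ δ then min (f x ^ 2) |f x| else 0) ∂m) (𝓝[>] 0)
      (𝓝 0) := by
  have := tendsto_integral_filter_of_dominated_convergence (μ := m) (l := 𝓝[>] (0 : ℝ))
    (F := fun δ x => if |f x| ≤ δ then min (f x ^ 2) |f x| else 0) (f := fun _ => (0 : ℝ))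
    (fun x => min (f x ^ 2) |f x|)
    (Eventually.of_forall fun δ => (Measurable.ite (measurableSet_le hf.abs measurable_const)
      (by fun_prop) measurable_const).aestronglyMeasurable)
    (Eventually.of_forall fun δ => ae_of_all _ fun x => by
      have : 0 ≤ min (f x ^ 2) |f x| := by positivity
      split_ifs
      · rw [Real.norm_of_nonneg this]
      · simpa using this) hI (ae_of_all _ fun x => by
      rcases (abs_nonneg (f x)).eq_or_lt with h | h
      · refine tendsto_const_nhds.congr fun δ => ?_
        rw [abs_eq_zero.1 h.symm]; simp
      · refine tendsto_const_nhds.congr' ?_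
        filter_upwards [Ioo_mem_nhdsGT h] with δ hδ
        rw [if_neg (not_le.2 hδ.2)])
  simpa using this

end Truncation

namespace IsPoissonRandomMeasure

variable {Ω E : Type*} [MeasurableSpace Ω] [MeasurableSpace E] {P : Measure Ω}
  {N : Ω → Measure E} {m : Measure E}

/-- Truncations at levels below δ differ in L² by at most a multiple of the square root of ∫ f² over
{|f| ≤ δ}, which vanishes with δ. They are thus Cauchy in L² relative to one fixed truncation, and
completeness supplies the limit. -/
lemma exists_isCompensatedIntegral [SigmaFinite m] [IsProbabilityMeasure P]
    (h : IsPoissonRandomMeasure P N m) {f : E → ℝ} (hf : Measurable f)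
    (hI : Integrable (fun x => min (f x ^ 2) |f x|) m) :
    ∃ X, IsCompensatedIntegral P N m f X := by
  set g : ℝ → E → ℝ := fun ε x => if ε < |f x| then f x else 0 with hg
  have hgm : ∀ ε, Measurable (g ε) := measurable_ite_lt_abs hf
  have hgi : ∀ {ε}, 0 < ε → Integrable (g ε) m := fun hε => integrable_ite_lt_abs hf hI hε
  set V : ℝ → ℝ := fun δ => ∫ x, (if |f x| ≤ δ then min (f x ^ 2) |f x| else 0) ∂m with hV
  have hVi : ∀ δ, Integrable (fun x => if |f x| ≤ δ then min (f x ^ 2) |f x| else 0) m := fun δ =>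
    hI.mono (Measurable.ite (measurableSet_le hf.abs measurable_const)
      (by fun_prop) measurable_const).aestronglyMeasurable (ae_of_all _ fun x => by
        split_ifs <;> simp)
  have key : ∀ δ, δ ≤ 1 → ∀ ε ε', 0 < ε → ε < δ → 0 < ε' → ε' < δ →
      eLpNorm (compensatedIntegral N m (g ε) - compensatedIntegral N m (g ε')) 2 P ≤
        (ENNReal.ofReal (2 * Real.pi ^ 2 * V δ)) ^ (1 / 2 : ℝ) := by
    intro δ hδ ε ε' h1 h2 h3 h4
    rw [eLpNorm_congr_ae (h.compensatedIntegral_sub (hgm ε) (hgi h1) (hgm ε') (hgi h3))]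
    have hle : ∀ x, (g ε x - g ε' x) ^ 2 ≤ if |f x| ≤ δ then min (f x ^ 2) |f x| else 0 :=
      fun x => sub_ite_sq_le h2 h4 hδ (f x)
    have hi2 : Integrable (fun x => (g ε x - g ε' x) ^ 2) m :=
      (hVi δ).mono (((hgm ε).sub (hgm ε')).pow_const 2).aestronglyMeasurable
        (ae_of_all _ fun x => by
          rw [Real.norm_of_nonneg (sq_nonneg _)]
          exact (hle x).trans (le_abs_self _))
    refine (h.eLpNorm_compensatedIntegral_le ((hgm ε).sub (hgm ε')) ((hgi h1).sub (hgi h3))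
      hi2).trans ?_
    refine ENNReal.rpow_le_rpow (ENNReal.ofReal_le_ofReal ?_) (by norm_num)
    exact mul_le_mul_of_nonneg_left (integral_mono hi2 (hVi δ) hle) (by positivity)
  -- The integral over large values need not be square integrable; subtracting the truncation at 1/2
  -- removes these values, and it is added back in `Y`.
  have hmem : ∀ {ε}, 0 < ε → ε < 1 →
      MemLp (compensatedIntegral N m (g ε) - compensatedIntegral N m (g (1 / 2))) 2 P :=
    fun {ε} h1 h2 => by
      refine ⟨((h.aemeasurable_compensatedIntegral (hgm _) (hgi h1)).sub
        (h.aemeasurable_compensatedIntegral (hgm _) (hgi (by norm_num)))).aestronglyMeasurable, ?_⟩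
      refine (key 1 le_rfl ε (1 / 2) h1 h2 (by norm_num) (by norm_num)).trans_lt ?_
      exact ENNReal.rpow_lt_top_of_nonneg (by norm_num) ENNReal.ofReal_ne_top
  classical
  set F : ℝ → Lp ℝ 2 P := fun ε => if hε : 0 < ε ∧ ε < 1 then (hmem hε.1 hε.2).toLp _ else 0
    with hFdef
  have hcauchy : Cauchy (map F (𝓝[>] 0)) := by
    refine EMetric.cauchy_iff.2 ⟨NeBot.ne inferInstance, fun η hη => ?_⟩
    have hlim : Tendsto (fun δ => (ENNReal.ofReal (2 * Real.pi ^ 2 * V δ)) ^ (1 / 2 : ℝ))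
        (𝓝[>] 0) (𝓝 0) := by
      have h1 : Tendsto (fun δ => ENNReal.ofReal (2 * Real.pi ^ 2 * V δ)) (𝓝[>] 0) (𝓝 0) := by
        have := ENNReal.tendsto_ofReal
          ((tendsto_integral_small_jumps hf hI).const_mul (2 * Real.pi ^ 2))
        simpa using this
      have := h1.ennrpow_const (1 / 2 : ℝ)
      rwa [ENNReal.zero_rpow_of_pos (by norm_num)] at this
    obtain ⟨δ, hδ1, hδ2⟩ := ((hlim.eventually_lt_const hη).and
      (Ioo_mem_nhdsGT (one_pos (α := ℝ)))).exists
    refine ⟨F '' Ioo 0 δ, image_mem_map (Ioo_mem_nhdsGT hδ2.1), ?_⟩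
    rintro _ ⟨ε, hε, rfl⟩ _ ⟨ε', hε', rfl⟩
    have e1 : 0 < ε ∧ ε < 1 := ⟨hε.1, hε.2.trans hδ2.2⟩
    have e2 : 0 < ε' ∧ ε' < 1 := ⟨hε'.1, hε'.2.trans hδ2.2⟩
    rw [hFdef]
    simp only [dif_pos e1, dif_pos e2]
    rw [Lp.edist_toLp_toLp, sub_sub_sub_cancel_right]
    exact (key δ hδ2.2.le ε ε' hε.1 hε.2 hε'.1 hε'.2).trans_lt hδ1
  obtain ⟨X, hX⟩ := cauchy_map_iff_exists_tendsto.1 hcauchy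
  have hXm := tendstoInMeasure_of_tendsto_Lp hX
  set Y : Ω → ℝ := fun ω => X ω + compensatedIntegral N m (g (1 / 2)) ω with hY
  refine ⟨Y, hI, (Lp.aestronglyMeasurable X).aemeasurable.add
    (h.aemeasurable_compensatedIntegral (hgm _) (hgi (by norm_num))), ?_⟩
  have h1 : TendstoInMeasure P (fun ε => compensatedIntegral N m (g ε)) (𝓝[>] 0) Y := by
    intro η hη
    refine (hXm η hη).congr' ?_
    filter_upwards [Ioo_mem_nhdsGT (one_pos (α := ℝ))] with ε hε
    refine measure_congr ?_
    have e : F ε = (hmem hε.1 hε.2).toLp _ := dif_pos (⟨hε.1, hε.2⟩ : 0 < ε ∧ ε < 1)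
    rw [e]
    filter_upwards [(hmem hε.1 hε.2).coeFn_toLp] with ω hω
    refine propext ?_
    change η ≤ edist _ _ ↔ η ≤ edist _ _
    rw [hω, hY]
    simp only [Pi.sub_apply]
    rw [edist_eq_enorm_sub, edist_eq_enorm_sub]
    ring_nf
  refine h1.congr' ?_ (ae_eq_refl _)
  refine Eventually.of_forall fun ε => ae_of_all _ fun ω => ?_
  simp only [compensatedIntegral, setIntegral_lt_abs_eq hf, hg]

/-- The joint characteristic function of compensated integrals. -/
lemma jointCF_of_isCompensatedIntegral [SigmaFinite m] [IsProbabilityMeasure P]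
    (h : IsPoissonRandomMeasure P N m) {n : ℕ} {f : Fin n → E → ℝ} (hf : ∀ i, Measurable (f i))
    {X : Fin n → Ω → ℝ} (hX : ∀ i, IsCompensatedIntegral P N m (f i) (X i)) (z : Fin n → ℝ) :
    jointCF P X z = Complex.exp (∫ x, centeredExp (∑ i, z i * f i x) ∂m) := by
  set g : ℝ → Fin n → E → ℝ := fun ε i x => if ε < |f i x| then f i x else 0 with hg
  have hgm : ∀ ε i, Measurable (g ε i) := fun ε i => measurable_ite_lt_abs (hf i) ε
  have hgi : ∀ {ε}, 0 < ε → ∀ i, Integrable (g ε i) m := fun hε i =>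
    integrable_ite_lt_abs (hf i) (hX i).integrable hε
  set Xe : ℝ → Fin n → Ω → ℝ := fun ε i => compensatedIntegral N m (g ε i)
  have hlim : ∀ i, TendstoInMeasure P (fun ε => Xe ε i) (𝓝[>] 0) (X i) := fun i =>
    (hX i).tendsto.congr' (Eventually.of_forall fun ε => ae_of_all _ fun ω => by
      simp only [Xe, compensatedIntegral, setIntegral_lt_abs_eq (hf i), hg]) (ae_eq_refl _)
  have hvec : TendstoInMeasure P (fun ε ω i => Xe ε i ω) (𝓝[>] 0) (fun ω i => X i ω) := by
    intro η hη
    refine tendsto_of_tendsto_of_tendsto_of_le_of_le (h := fun ε =>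
      ∑ i, P {ω | η ≤ edist (Xe ε i ω) (X i ω)}) tendsto_const_nhds ?_ (fun _ => zero_le) ?_
    · simpa using tendsto_finsetSum (Finset.univ : Finset (Fin n)) fun i _ => hlim i η hη
    · intro ε
      refine le_trans (measure_mono ?_) (measure_iUnion_fintype_le P
        (fun i => {ω | η ≤ edist (Xe ε i ω) (X i ω)}))
      intro ω hω
      simp only [mem_ofPred_eq] at hω
      by_contra hc
      simp only [mem_iUnion, mem_ofPred_eq, not_exists, not_le] at hc
      refine absurd hω (not_le.2 ?_)
      rw [edist_pi_def]
      exact (Finset.sup_lt_iff (by simpa using hη)).2 fun i _ => hc i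
  -- Convergence in measure of the whole vector yields one sequence of levels along which all
  -- coordinates converge almost surely.
  obtain ⟨ns, hns, hae⟩ := hvec.exists_seq_tendsto_ae'
  have hpos : ∀ᶠ k in atTop, 0 < ns k := (hns.eventually self_mem_nhdsWithin)
  have hXem : ∀ {ε}, 0 < ε → ∀ i, AEMeasurable (Xe ε i) P := fun hε i =>
    h.aemeasurable_compensatedIntegral (hgm _ i) (hgi hε i)
  have hL : Tendsto (fun k => jointCF P (Xe (ns k)) z) atTop (𝓝 (jointCF P X z)) := by
    refine tendsto_integral_filter_of_dominated_convergence (fun _ => 1) ?_ ?_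
      (integrable_const _) ?_
    · filter_upwards [hpos] with k hk
      have h1 : AEMeasurable (fun ω => ∑ i, z i * Xe (ns k) i ω) P :=
        Finset.aemeasurable_fun_sum _ fun i _ => (hXem hk i).const_mul _
      exact (Complex.continuous_exp.measurable.comp_aemeasurable
        ((Complex.measurable_ofReal.comp_aemeasurable h1).const_mul _)).aestronglyMeasurable
    · exact Eventually.of_forall fun k => ae_of_all _ fun ω => (norm_exp_I_mul_ofReal _).le
    · filter_upwards [hae] with ω hω
      have h2 : Continuous fun y : Fin n → ℝ =>
        Complex.exp (Complex.I * ((∑ i, z i * y i : ℝ) : ℂ)) := by fun_prop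
      exact (h2.tendsto _).comp hω
  have hR : Tendsto (fun k => Complex.exp (∫ x, centeredExp (∑ i, z i * g (ns k) i x) ∂m)) atTop
      (𝓝 (Complex.exp (∫ x, centeredExp (∑ i, z i * f i x) ∂m))) := by
    refine (Complex.continuous_exp.tendsto _).comp ?_
    refine tendsto_integral_filter_of_dominated_convergence
      (fun x => 2 * ((1 + n * ∑ i, (|z i| + z i ^ 2)) * ∑ i, min (f i x ^ 2) |f i x|)) ?_ ?_ ?_ ?_
    · refine Eventually.of_forall fun k => ?_
      refine (continuous_centeredExp.measurable.comp ?_).aestronglyMeasurable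
      exact Finset.measurable_fun_sum _ fun i _ => (hgm _ i).const_mul _
    · refine Eventually.of_forall fun k => ae_of_all _ fun x => ?_
      refine (norm_centeredExp_le_min _).trans ?_
      gcongr 2 * ?_
      refine (min_sq_abs_sum_le _ _).trans ?_
      have : 0 ≤ ∑ i, (|z i| + z i ^ 2) := Finset.sum_nonneg fun i _ => by positivity
      refine mul_le_mul_of_nonneg_left (Finset.sum_le_sum fun i _ => ?_) (by positivity)
      refine min_sq_abs_le_of_abs_le ?_
      simp only [hg]
      split_ifs <;> simp
    · exact ((integrable_finsetSum _ fun i _ => (hX i).integrable).const_mul _).const_mul _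
    · refine ae_of_all _ fun x => ?_
      refine (continuous_centeredExp.tendsto _).comp (tendsto_finsetSum _ fun i _ => ?_)
      refine Tendsto.const_mul _ ?_
      rcases (abs_nonneg (f i x)).eq_or_lt with h0 | h0
      · have h00 : f i x = 0 := abs_eq_zero.1 h0.symm
        refine tendsto_const_nhds.congr fun k => ?_
        simp [hg, h00]
      · refine tendsto_const_nhds.congr' ?_
        filter_upwards [hns.eventually (Ioo_mem_nhdsGT h0)] with k hk
        simp only [hg]
        rw [if_pos hk.2]
  refine tendsto_nhds_unique hL (hR.congr' ?_)
  filter_upwards [hpos] with k hk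
  rw [jointCF, ← h.integral_exp_compensatedIntegral
    (Finset.measurable_fun_sum _ fun i _ => (hgm _ i).const_mul _)
    (integrable_finsetSum _ fun i _ => (hgi hk i).const_mul _)]
  refine integral_congr_ae ?_
  filter_upwards [h.compensatedIntegral_sum (hgm (ns k)) (hgi hk) z] with ω hω
  rw [hω]

end IsPoissonRandomMeasure

/-! ### The characteristic function of the traffic model -/

/-- Fubini for the joint law of `X` and the independent family `Y`: marks are averaged out with `X`
frozen. It is applied to the rates given starts and durations, then to the durations given the
starts. -/
lemma integral_prod_comp_of_indepFun {Ω A κ : Type*} [MeasurableSpace Ω] [MeasurableSpace A]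
    {P : Measure Ω} [IsProbabilityMeasure P] {X : Ω → A} {Y : κ → Ω → ℝ} (hX : Measurable X)
    (hY : ∀ p, Measurable (Y p)) (hXY : IndepFun X (fun ω p => Y p ω) P) (hYi : iIndepFun Y P)
    {G : κ → A → ℝ → ℂ} (hG : ∀ p, Measurable (Function.uncurry (G p)))
    (hG1 : ∀ p x y, ‖G p x y‖ ≤ 1) (S : Finset κ) :
    ∫ ω, ∏ p ∈ S, G p (X ω) (Y p ω) ∂P =
      ∫ ω, ∏ p ∈ S, ∫ y, G p (X ω) y ∂(P.map (Y p)) ∂P := by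
  have hY' : Measurable fun ω (p : S) => Y p ω := measurable_pi_lambda _ fun p => hY p
  have hi : IndepFun X (fun ω (p : S) => Y p ω) P := by
    have h := hXY.comp (φ := id) (ψ := fun (y : κ → ℝ) (p : S) => y p) measurable_id
      (measurable_pi_lambda _ fun p => measurable_pi_apply _)
    exact h
  have hpi : P.map (fun ω (p : S) => Y p ω) = Measure.pi fun p : S => P.map (Y p) :=
    (hYi.precomp (g := ((↑) : S → κ)) Subtype.val_injective).map_fun_eq_pi_map
      fun p => (hY p).aemeasurable
  have hlaw := (indepFun_iff_map_prod_eq_prod_map_map hX.aemeasurable hY'.aemeasurable).1 hi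
  rw [hpi] at hlaw
  have := fun p : κ => Measure.isProbabilityMeasure_map (μ := P) (hY p).aemeasurable
  have := Measure.isProbabilityMeasure_map (μ := P) hX.aemeasurable
  set F : A × (S → ℝ) → ℂ := fun q => ∏ p : S, G p q.1 (q.2 p) with hF
  have hFm : Measurable F := by
    refine Finset.measurable_fun_prod _ fun p _ => ?_
    exact (hG p).comp (measurable_fst.prodMk ((measurable_pi_apply p).comp measurable_snd))
  have hFi : Integrable F ((P.map X).prod (Measure.pi fun p : S => P.map (Y p))) :=
    Integrable.of_bound (C := 1) hFm.aestronglyMeasurable (ae_of_all _ fun q => by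
      rw [hF, norm_prod]
      exact Finset.prod_le_one (fun _ _ => norm_nonneg _) fun p _ => hG1 _ _ _)
  calc ∫ ω, ∏ p ∈ S, G p (X ω) (Y p ω) ∂P = ∫ ω, F (X ω, fun p : S => Y p ω) ∂P := by
        refine integral_congr_ae (ae_of_all _ fun ω => ?_)
        simp only [hF]
        exact (Finset.prod_coe_sort S fun p => G p (X ω) (Y p ω)).symm
    _ = ∫ q, F q ∂((P.map X).prod (Measure.pi fun p : S => P.map (Y p))) := by
        rw [← hlaw, integral_map (hX.prodMk hY').aemeasurable hFm.aestronglyMeasurable]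
    _ = ∫ x, ∏ p : S, ∫ y, G p x y ∂(P.map (Y p)) ∂(P.map X) := by
        rw [integral_prod _ hFi]
        refine integral_congr_ae (ae_of_all _ fun x => ?_)
        exact integral_fintype_prod_eq_prod (μ := fun p : S => P.map (Y p))
          (fun (p : S) y => G p x y)
    _ = ∫ ω, ∏ p : S, ∫ y, G p (X ω) y ∂(P.map (Y p)) ∂P := by
        rw [integral_map hX.aemeasurable]
        refine (Finset.stronglyMeasurable_fun_prod _ fun p _ => ?_).aestronglyMeasurable
        exact (hG p).stronglyMeasurable.integral_prod_right
    _ = _ := by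
        refine integral_congr_ae (ae_of_all _ fun ω => ?_)
        exact Finset.prod_coe_sort S fun p => ∫ y, G p (X ω) y ∂(P.map (Y p))

/-- The scalar `ENNReal.ofReal c` is the coercion of `c.toNNReal`, for which the scaled measure is
known to be σ-finite. -/
instance sigmaFinite_ofReal_smul_volume (c : ℝ) :
    SigmaFinite (ENNReal.ofReal c • (volume : Measure ℝ)) :=
  inferInstanceAs (SigmaFinite (c.toNNReal • (volume : Measure ℝ)))

namespace IsTrafficModel

variable {ι Ω : Type*} [MeasurableSpace Ω] {P : Measure Ω}
  {lam : ι → ℝ} {FD : ι → Measure ℝ} {FR : Measure ℝ} {Γ D R : ι → ℤ → Ω → ℝ}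

lemma measurable_block (hM : IsTrafficModel P lam FD FR Γ D R) (i : Fin 3) :
    Measurable fun ω (j : ι) (k : ℤ) => (![Γ, D, R] i) j k ω := by
  refine measurable_pi_lambda _ fun j => measurable_pi_lambda _ fun k => ?_
  fin_cases i
  exacts [hM.measurable_start j k, hM.measurable_duration j k, hM.measurable_rate j k]

lemma indepFun_start_duration (hM : IsTrafficModel P lam FD FR Γ D R) :
    IndepFun (fun ω j k => Γ j k ω) (fun ω j k => D j k ω) P :=
  hM.indep_blocks.indepFun (i := 0) (j := 1) (by decide)

lemma indepFun_start_duration_rate (hM : IsTrafficModel P lam FD FR Γ D R) :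
    IndepFun (fun ω => ((fun j k => Γ j k ω), (fun j k => D j k ω))) (fun ω j k => R j k ω) P :=
  hM.indep_blocks.indepFun_prodMk hM.measurable_block 0 1 2 (by decide) (by decide)

variable [IsProbabilityMeasure P]

lemma map_session (hM : IsTrafficModel P lam FD FR Γ D R) (j : ι) (k : ℤ) :
    P.map (fun ω => (Γ j k ω, D j k ω, R j k ω)) =
      (P.map (Γ j k)).prod ((FD j).prod FR) := by
  have hΓ := hM.measurable_start j k
  have hD := hM.measurable_duration j k
  have hR := hM.measurable_rate j k
  have m2 : Measurable fun y : ι → ℤ → ℝ => y j k :=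
    (measurable_pi_apply k).comp (measurable_pi_apply j)
  have h1 : IndepFun (fun ω => (Γ j k ω, D j k ω)) (R j k) P :=
    hM.indepFun_start_duration_rate.comp (φ := fun q => (q.1 j k, q.2 j k)) (ψ := fun y => y j k)
      ((m2.comp measurable_fst).prodMk (m2.comp measurable_snd)) m2
  have h2 : IndepFun (Γ j k) (D j k) P := by
    have h := hM.indepFun_start_duration.comp (φ := fun y => y j k) (ψ := fun y => y j k) m2 m2
    exact h
  have h3 := (indepFun_iff_map_prod_eq_prod_map_map (hΓ.prodMk hD).aemeasurable
    hR.aemeasurable).1 h1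
  rw [(indepFun_iff_map_prod_eq_prod_map_map hΓ.aemeasurable hD.aemeasurable).1 h2,
    hM.law_duration, hM.law_rate] at h3
  have : IsProbabilityMeasure (FD j) := hM.law_duration j k ▸
    Measure.isProbabilityMeasure_map hD.aemeasurable
  have : IsProbabilityMeasure FR := hM.law_rate j k ▸
    Measure.isProbabilityMeasure_map hR.aemeasurable
  have : IsProbabilityMeasure (P.map (Γ j k)) := Measure.isProbabilityMeasure_map hΓ.aemeasurable
  have h4 := congrArg (Measure.map MeasurableEquiv.prodAssoc) h3
  rw [Measure.prodAssoc_prod, Measure.map_map (MeasurableEquiv.measurable _)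
    ((hΓ.prodMk hD).prodMk hR)] at h4
  exact h4

/-- Campbell's formula for the marked process: each session has a product law, and the laws of the
starts sum to λ times Lebesgue measure. -/
lemma lintegral_sessionCount [IsProbabilityMeasure FR] [∀ j, IsProbabilityMeasure (FD j)]
    (hM : IsTrafficModel P lam FD FR Γ D R) (j : ι)
    {g : ℝ × ℝ × ℝ → ℝ≥0∞} (hg : Measurable g) :
    ∫⁻ ω, ∫⁻ x, g x ∂(sessionCount (Γ j) (D j) (R j) ω) ∂P =
      ENNReal.ofReal (lam j) * ∫⁻ x, g x ∂((volume : Measure ℝ).prod ((FD j).prod FR)) := by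
  have hm : ∀ k, Measurable fun ω => (Γ j k ω, D j k ω, R j k ω) := fun k =>
    (hM.measurable_start j k).prodMk ((hM.measurable_duration j k).prodMk (hM.measurable_rate j k))
  simp only [sessionCount, lintegral_sum_measure, lintegral_dirac' _ hg]
  rw [lintegral_tsum (f := fun k ω => g (Γ j k ω, D j k ω, R j k ω))
    fun k => (hg.comp (hm k)).aemeasurable]
  have h1 : ∀ k, ∫⁻ ω, g (Γ j k ω, D j k ω, R j k ω) ∂P =
      ∫⁻ x, g x ∂((P.map (Γ j k)).prod ((FD j).prod FR)) := fun k => by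
    rw [← hM.map_session j k, lintegral_map hg (hm k)]
  have : ∀ k, SFinite (P.map (Γ j k)) := fun k => inferInstance
  simp_rw [h1]
  rw [← lintegral_sum_measure, ← Measure.prod_sum_left,
    (hM.poisson_start j).sum_map_eq (hM.measurable_start j), Measure.prod_smul_left,
    lintegral_smul_measure, smul_eq_mul]

lemma ae_integrable_sessionCount [IsProbabilityMeasure FR] [∀ j, IsProbabilityMeasure (FD j)]
    (hM : IsTrafficModel P lam FD FR Γ D R) (j : ι) {g : ℝ × ℝ × ℝ → ℝ} (hg : Measurable g)
    (hi : Integrable g ((volume : Measure ℝ).prod ((FD j).prod FR))) :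
    ∀ᵐ ω ∂P, Integrable g (sessionCount (Γ j) (D j) (R j) ω) := by
  have h1 := hM.lintegral_sessionCount j hg.enorm
  have h2 : ∫⁻ ω, ∫⁻ x, ‖g x‖ₑ ∂(sessionCount (Γ j) (D j) (R j) ω) ∂P ≠ ∞ := by
    rw [h1]
    exact ENNReal.mul_ne_top ENNReal.ofReal_ne_top hi.2.ne
  have hm : Measurable fun ω => ∫⁻ x, ‖g x‖ₑ ∂(sessionCount (Γ j) (D j) (R j) ω) := by
    simp only [sessionCount, lintegral_sum_measure, lintegral_dirac' _ hg.enorm]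
    refine Measurable.tsum fun k => hg.enorm.comp ?_
    exact (hM.measurable_start j k).prodMk
      ((hM.measurable_duration j k).prodMk (hM.measurable_rate j k))
  filter_upwards [ae_lt_top hm h2] with ω hω
  exact ⟨hg.aestronglyMeasurable, hω⟩

variable [Fintype ι]

/-- Absolute integrability turns the integral into an unconditional sum over sessions, so a single
finite index set can exhaust all streams at once. -/
lemma ae_tendsto_sum [IsProbabilityMeasure FR] [∀ j, IsProbabilityMeasure (FD j)]
    (hM : IsTrafficModel P lam FD FR Γ D R) {g : ℝ × ℝ × ℝ → ℝ} (hg : Measurable g)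
    (hi : ∀ j, Integrable g ((volume : Measure ℝ).prod ((FD j).prod FR))) :
    ∀ᵐ ω ∂P, Integrable g (∑ j, sessionCount (Γ j) (D j) (R j) ω) ∧
      Tendsto (fun S : Finset ℤ => ∑ j, ∑ k ∈ S, g (Γ j k ω, D j k ω, R j k ω)) atTop
      (𝓝 (∫ x, g x ∂(∑ j, sessionCount (Γ j) (D j) (R j) ω))) := by
  filter_upwards [ae_all_iff.2 fun j => hM.ae_integrable_sessionCount j hg (hi j)] with ω hω
  refine ⟨integrable_finsetSum_measure.2 fun j _ => hω j, ?_⟩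
  rw [integral_finsetSum_measure fun j _ => hω j]
  refine tendsto_finsetSum _ fun j _ => ?_
  have h1 := hasSum_integral_measure (hω j)
  simp only [integral_dirac] at h1
  exact h1

lemma aemeasurable_integral [IsProbabilityMeasure FR] [∀ j, IsProbabilityMeasure (FD j)]
    (hM : IsTrafficModel P lam FD FR Γ D R) {g : ℝ × ℝ × ℝ → ℝ} (hg : Measurable g)
    (hi : ∀ j, Integrable g ((volume : Measure ℝ).prod ((FD j).prod FR))) :
    AEMeasurable (fun ω => ∫ x, g x ∂(∑ j, sessionCount (Γ j) (D j) (R j) ω)) P := by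
  refine aemeasurable_of_tendsto_metrizable_ae (atTop : Filter (Finset ℤ))
    (f := fun S ω => ∑ j, ∑ k ∈ S, g (Γ j k ω, D j k ω, R j k ω)) (fun S => ?_)
    ((hM.ae_tendsto_sum hg hi).mono fun ω h => h.2)
  refine (Finset.measurable_fun_sum _ fun j _ => Finset.measurable_fun_sum _ fun k _ =>
    hg.comp ?_).aemeasurable
  exact (hM.measurable_start j k).prodMk
    ((hM.measurable_duration j k).prodMk (hM.measurable_rate j k))

/-- Rates are integrated out first, durations next, and then the independence of the arrival streams
factors the expectation. What remains is a product functional of each Poisson process of starts. -/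
lemma integral_prod_sessions [IsProbabilityMeasure FR] [∀ j, IsProbabilityMeasure (FD j)]
    (hM : IsTrafficModel P lam FD FR Γ D R) {G : ℝ × ℝ × ℝ → ℂ} (hG : Measurable G)
    (hG1 : ∀ x, ‖G x‖ ≤ 1) (S : Finset ℤ) :
    ∫ ω, ∏ j, ∏ k ∈ S, G (Γ j k ω, D j k ω, R j k ω) ∂P =
      ∏ j, ∫ ω, ∏ k ∈ S, (∫ y, G (Γ j k ω, y) ∂((FD j).prod FR)) ∂P := by
  set S' : Finset (ι × ℤ) := Finset.univ ×ˢ S with hS'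
  have m2 : ∀ p : ι × ℤ, Measurable fun y : ι → ℤ → ℝ => y p.1 p.2 := fun p =>
    (measurable_pi_apply p.2).comp (measurable_pi_apply p.1)
  have mΓ : Measurable fun ω (j : ι) (k : ℤ) => Γ j k ω := hM.measurable_block 0
  have mD : Measurable fun ω (j : ι) (k : ℤ) => D j k ω := hM.measurable_block 1
  have hcurry : Measurable fun (y : ι → ℤ → ℝ) (p : ι × ℤ) => y p.1 p.2 :=
    measurable_pi_lambda _ fun p => m2 p
  have i1 := hM.indepFun_start_duration_rate.comp (φ := id)
    (ψ := fun (y : ι → ℤ → ℝ) (p : ι × ℤ) => y p.1 p.2) measurable_id hcurry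
  have i2 := hM.indepFun_start_duration.comp (φ := id)
    (ψ := fun (y : ι → ℤ → ℝ) (p : ι × ℤ) => y p.1 p.2) measurable_id hcurry
  have e1 := integral_prod_comp_of_indepFun (P := P)
    (X := fun ω => ((fun j k => Γ j k ω), (fun j k => D j k ω)))
    (Y := fun (p : ι × ℤ) => R p.1 p.2) (mΓ.prodMk mD) (fun p => hM.measurable_rate p.1 p.2)
    i1 hM.indep_rate
    (G := fun p x r => G (x.1 p.1 p.2, x.2 p.1 p.2, r))
    (fun p => hG.comp (((m2 p).comp (measurable_fst.comp measurable_fst)).prodMk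
      (((m2 p).comp (measurable_snd.comp measurable_fst)).prodMk measurable_snd)))
    (fun p x y => hG1 _) S'
  set H : ℝ × ℝ → ℂ := fun q => ∫ r, G (q.1, q.2, r) ∂FR with hH
  have hHm : Measurable H := by
    refine StronglyMeasurable.measurable ?_
    refine StronglyMeasurable.integral_prod_right (f := fun (q : ℝ × ℝ) r => G (q.1, q.2, r)) ?_
    exact (hG.comp ((measurable_fst.comp measurable_fst).prodMk
      ((measurable_snd.comp measurable_fst).prodMk measurable_snd))).stronglyMeasurable
  have hH1 : ∀ q, ‖H q‖ ≤ 1 := fun q => by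
    refine (norm_integral_le_of_norm_le_const (C := 1) (ae_of_all _ fun r => hG1 _)).trans ?_
    simp
  have e2 := integral_prod_comp_of_indepFun (P := P)
    (X := fun ω j k => Γ j k ω)
    (Y := fun (p : ι × ℤ) => D p.1 p.2) mΓ (fun p => hM.measurable_duration p.1 p.2)
    i2 hM.indep_duration
    (G := fun p x u => H (x p.1 p.2, u))
    (fun p => hHm.comp (((m2 p).comp measurable_fst).prodMk measurable_snd))
    (fun p x y => hH1 _) S'
  simp only [hM.law_rate, hM.law_duration, hS', Finset.prod_product] at e1 e2
  rw [e1]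
  refine e2.trans ?_
  have e3 : ∀ j s, ∫ u, H (s, u) ∂(FD j) = ∫ y, G (s, y) ∂((FD j).prod FR) := fun j s => by
    rw [integral_prod]
    exact Integrable.of_bound (C := 1) (hG.comp measurable_prodMk_left).aestronglyMeasurable
      (ae_of_all _ fun y => hG1 _)
  simp_rw [e3]
  refine hM.indep_start.integral_fun_prod_comp
    (f := fun j x => ∏ k ∈ S, ∫ y, G (x k, y) ∂((FD j).prod FR)) (fun j => ?_) (fun j => ?_)
  · exact (measurable_pi_lambda _ fun k => hM.measurable_start j k).aemeasurable
  · refine (Finset.stronglyMeasurable_fun_prod _ fun k _ => ?_).aestronglyMeasurable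
    refine StronglyMeasurable.integral_prod_right
      (f := fun (x : ℤ → ℝ) y => G (x k, y)) ?_
    exact (hG.comp (((measurable_pi_apply k).comp measurable_fst).prodMk
      measurable_snd)).stronglyMeasurable

/-- The characteristic functional of the superposed marked Poisson processes. -/
lemma integral_exp [IsProbabilityMeasure FR] [∀ j, IsProbabilityMeasure (FD j)]
    (hM : IsTrafficModel P lam FD FR Γ D R) (hlam : ∀ j, 0 ≤ lam j) {g : ℝ × ℝ × ℝ → ℝ}
    (hg : Measurable g)
    (hi : ∀ j, Integrable g ((volume : Measure ℝ).prod ((FD j).prod FR))) :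
    ∫ ω, Complex.exp (Complex.I *
        ((∫ x, g x ∂(∑ j, sessionCount (Γ j) (D j) (R j) ω) : ℝ) : ℂ)) ∂P =
      Complex.exp (∑ j, lam j * ∫ x, (Complex.exp (Complex.I * ((g x : ℝ) : ℂ)) - 1)
        ∂((volume : Measure ℝ).prod ((FD j).prod FR))) := by
  set G : ℝ × ℝ × ℝ → ℂ := fun x => Complex.exp (Complex.I * ((g x : ℝ) : ℂ)) with hGdef
  have hG : Measurable G := by fun_prop
  have hG1 : ∀ x, ‖G x‖ ≤ 1 := fun x => (norm_exp_I_mul_ofReal _).le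
  have hms : ∀ j k, Measurable fun ω => (Γ j k ω, D j k ω, R j k ω) := fun j k =>
    (hM.measurable_start j k).prodMk ((hM.measurable_duration j k).prodMk (hM.measurable_rate j k))
  have hL : Tendsto (fun S : Finset ℤ => ∫ ω, ∏ j, ∏ k ∈ S, G (Γ j k ω, D j k ω, R j k ω) ∂P) atTop
      (𝓝 (∫ ω, Complex.exp (Complex.I *
        ((∫ x, g x ∂(∑ j, sessionCount (Γ j) (D j) (R j) ω) : ℝ) : ℂ)) ∂P)) := by
    refine tendsto_integral_filter_of_dominated_convergence (fun _ => 1) ?_ ?_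
      (integrable_const _) ?_
    · exact Eventually.of_forall fun S => (Finset.measurable_fun_prod _ fun j _ =>
        Finset.measurable_fun_prod _ fun k _ => hG.comp (hms j k)).aestronglyMeasurable
    · refine Eventually.of_forall fun S => ae_of_all _ fun ω => ?_
      simp only [norm_prod]
      exact Finset.prod_le_one (fun _ _ => Finset.prod_nonneg fun _ _ => norm_nonneg _)
        fun j _ => Finset.prod_le_one (fun _ _ => norm_nonneg _) fun k _ => hG1 _
    · filter_upwards [hM.ae_tendsto_sum hg hi] with ω hω
      have h2 : Continuous fun y : ℝ => Complex.exp (Complex.I * (y : ℂ)) := by fun_prop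
      refine ((h2.tendsto _).comp hω.2).congr fun S => ?_
      simp only [Function.comp, hGdef, ← Complex.exp_sum, ← Finset.mul_sum]
      push_cast
      rfl
  -- The factor of a session starting at s after averaging over its marks; the generating functional
  -- of the starts is applied to it.
  set φ : ι → ℝ → ℂ := fun j s => ∫ y, G (s, y) ∂((FD j).prod FR) with hφ
  have hφm : ∀ j, Measurable (φ j) := fun j =>
    (StronglyMeasurable.integral_prod_right (f := fun s y => G (s, y))
      hG.stronglyMeasurable).measurable
  have hφ1 : ∀ j s, ‖φ j s‖ ≤ 1 := fun j s => by
    refine (norm_integral_le_of_norm_le_const (C := 1) (ae_of_all _ fun r => hG1 _)).trans ?_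
    simp
  have hGi : ∀ j, Integrable (fun x => G x - 1) ((volume : Measure ℝ).prod ((FD j).prod FR)) :=
    fun j => IsPoissonRandomMeasure.integrable_exp_sub_one hg (hi j)
  have hφG : ∀ j s, φ j s - 1 = ∫ y, (G (s, y) - 1) ∂((FD j).prod FR) := fun j s => by
    rw [integral_sub _ (integrable_const _)]
    · simp [hφ]
    · exact Integrable.of_bound (C := 1) (hG.comp measurable_prodMk_left).aestronglyMeasurable
        (ae_of_all _ fun y => hG1 _)
  have hφi : ∀ j, Integrable (fun s => φ j s - 1) (ENNReal.ofReal (lam j) • (volume : Measure ℝ)) :=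
    fun j => by
      simp_rw [hφG]
      exact (hGi j).integral_prod_left.smul_measure ENNReal.ofReal_ne_top
  have hR : Tendsto (fun S : Finset ℤ => ∏ j, ∫ ω, ∏ k ∈ S, φ j (Γ j k ω) ∂P) atTop
      (𝓝 (∏ j, Complex.exp (∫ s, (φ j s - 1) ∂(ENNReal.ofReal (lam j) • (volume : Measure ℝ))))) :=
    tendsto_finsetProd _ fun j _ =>
      (hM.poisson_start j).tendsto_integral_prod (hM.measurable_start j) (hφm j) (hφ1 j) (hφi j)
  rw [tendsto_nhds_unique hL (hR.congr fun S => (hM.integral_prod_sessions hG hG1 S).symm),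
    ← Complex.exp_sum]
  congr 1
  refine Finset.sum_congr rfl fun j _ => ?_
  rw [integral_smul_measure, ENNReal.toReal_ofReal (hlam j), Complex.real_smul,
    integral_prod _ (hGi j)]
  simp_rw [hφG]

end IsTrafficModel

/-! ### Regularly varying tails -/

lemma distTail_nonneg (F : Measure ℝ) (x : ℝ) : 0 ≤ distTail F x := measureReal_nonneg

lemma distTail_antitone (F : Measure ℝ) [IsFiniteMeasure F] : Antitone (distTail F) :=
  fun _ _ h => measureReal_mono (Ioi_subset_Ioi h)

lemma distTail_le_one (F : Measure ℝ) [IsProbabilityMeasure F] (x : ℝ) : distTail F x ≤ 1 :=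
  measureReal_le_one

lemma distTail_eq_one_sub (F : Measure ℝ) [IsProbabilityMeasure F] (x : ℝ) :
    distTail F x = 1 - F.real (Iic x) := by
  rw [distTail, ← compl_Iic, probReal_compl_eq_one_sub measurableSet_Iic]

lemma distTail_eq_one_of_nonpos {F : Measure ℝ} [IsProbabilityMeasure F] (h0 : F (Iic 0) = 0)
    {x : ℝ} (hx : x ≤ 0) : distTail F x = 1 := by
  rw [distTail_eq_one_sub, measureReal_def, measure_mono_null (Iic_subset_Iic.2 hx) h0]
  simp

lemma tendsto_distTail_atTop (F : Measure ℝ) [IsProbabilityMeasure F] :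
    Tendsto (distTail F) atTop (𝓝 0) := by
  have h := (tendsto_cdf_atTop F).const_sub 1
  simp only [sub_self] at h
  refine h.congr fun x => ?_
  rw [distTail_eq_one_sub, cdf_eq_real]

lemma IsRegularlyVarying.eventually_mul_le {f : ℝ → ℝ} {γ : ℝ} (h : IsRegularlyVarying f γ)
    {x : ℝ} (hx : 0 < x) {c : ℝ} (hc : x ^ γ < c) : ∀ᶠ t in atTop, f (t * x) ≤ c * f t := by
  filter_upwards [h.eventually_pos, (h.tendsto_ratio x hx).eventually_lt_const hc] with t h1 h2
  exact ((div_lt_iff₀ h1).1 h2).le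

lemma IsRegularlyVarying.eventually_le_mul {f : ℝ → ℝ} {γ : ℝ} (h : IsRegularlyVarying f γ)
    {x : ℝ} (hx : 0 < x) {c : ℝ} (hc : c < x ^ γ) : ∀ᶠ t in atTop, c * f t ≤ f (t * x) := by
  filter_upwards [h.eventually_pos, (h.tendsto_ratio x hx).eventually_const_lt hc] with t h1 h2
  exact ((lt_div_iff₀ h1).1 h2).le

/-- Potter's bounds for monotone regularly varying functions. -/
lemma IsRegularlyVarying.exists_potter {f : ℝ → ℝ} {α β₁ β₂ : ℝ} (h : IsRegularlyVarying f (-α))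
    (hf : Antitone f) (hβ₁ : 0 ≤ β₁) (h1 : β₁ < α) (h2 : α < β₂) :
    ∃ t₀ : ℝ, 1 ≤ t₀ ∧ (∀ t, t₀ ≤ t → 0 < f t) ∧ ∀ t, t₀ ≤ t → ∀ x, 1 ≤ x →
      f (t * x) ≤ 2 ^ β₁ * x ^ (-β₁) * f t ∧ (2 ^ β₂)⁻¹ * x ^ (-β₂) * f t ≤ f (t * x) := by
  have e1 := h.eventually_mul_le (x := 2) two_pos (c := 2 ^ (-β₁))
    (Real.rpow_lt_rpow_of_exponent_lt one_lt_two (by linarith))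
  have e2 := h.eventually_le_mul (x := 2) two_pos (c := 2 ^ (-β₂))
    (Real.rpow_lt_rpow_of_exponent_lt one_lt_two (by linarith))
  obtain ⟨t₀, ht₀⟩ := eventually_atTop.1 ((eventually_ge_atTop (1 : ℝ)).and
    (h.eventually_pos.and (e1.and e2)))
  refine ⟨t₀, (ht₀ t₀ le_rfl).1, fun t ht => (ht₀ t ht).2.1, fun t ht x hx => ?_⟩
  have ht1 : 1 ≤ t := (ht₀ t ht).1
  have ft := (ht₀ t ht).2.1
  -- The one-step comparison of f(2t) with f(t) holds at every level beyond t₀, so it can be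
  -- iterated along powers of 2; monotonicity fills in between.
  have hk : ∀ k : ℕ, f (t * 2 ^ k) ≤ ((2 : ℝ) ^ k) ^ (-β₁) * f t ∧
      ((2 : ℝ) ^ k) ^ (-β₂) * f t ≤ f (t * 2 ^ k) := by
    intro k
    induction k with
    | zero => simp
    | succ k ih =>
      have h3 : t₀ ≤ t * 2 ^ k := ht.trans (le_mul_of_one_le_right (by linarith)
        (one_le_pow₀ one_le_two))
      obtain ⟨-, -, h4, h5⟩ := ht₀ _ h3
      rw [pow_succ, ← mul_assoc, Real.mul_rpow (by positivity) (by positivity),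
        Real.mul_rpow (by positivity) (by positivity)]
      constructor
      · refine h4.trans ?_
        have := mul_le_mul_of_nonneg_left ih.1 (by positivity : (0 : ℝ) ≤ 2 ^ (-β₁))
        linarith
      · refine le_trans ?_ h5
        have := mul_le_mul_of_nonneg_left ih.2 (by positivity : (0 : ℝ) ≤ 2 ^ (-β₂))
        linarith
  obtain ⟨k, hk1, hk2⟩ := exists_nat_pow_near hx one_lt_two
  have hx0 : 0 < x := by linarith
  constructor
  · calc f (t * x) ≤ f (t * 2 ^ k) := hf (by gcongr)
      _ ≤ ((2 : ℝ) ^ k) ^ (-β₁) * f t := (hk k).1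
      _ ≤ (x / 2) ^ (-β₁) * f t := by
        refine mul_le_mul_of_nonneg_right ?_ ft.le
        refine Real.rpow_le_rpow_of_nonpos (by positivity) ?_ (by linarith)
        rw [pow_succ] at hk2
        linarith
      _ = _ := by
        rw [Real.div_rpow hx0.le two_pos.le, Real.rpow_neg two_pos.le, div_inv_eq_mul]
        ring
  · calc (2 ^ β₂)⁻¹ * x ^ (-β₂) * f t = (2 * x) ^ (-β₂) * f t := by
          rw [Real.mul_rpow two_pos.le hx0.le, Real.rpow_neg two_pos.le]
      _ ≤ ((2 : ℝ) ^ (k + 1)) ^ (-β₂) * f t := by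
        refine mul_le_mul_of_nonneg_right ?_ ft.le
        refine Real.rpow_le_rpow_of_nonpos (by positivity) ?_ (by linarith)
        rw [pow_succ]
        linarith
      _ ≤ f (t * 2 ^ (k + 1)) := (hk _).2
      _ ≤ f (t * x) := hf (by gcongr)

/-- A Potter bound for distribution tails that is valid for all scale factors. -/
lemma exists_potter_distTail {F : Measure ℝ} [IsProbabilityMeasure F] {α β₁ β₂ : ℝ}
    (h : IsRegularlyVarying (distTail F) (-α)) (hβ₁ : 0 ≤ β₁) (h1 : β₁ < α) (h2 : α < β₂) :
    ∃ C t₀ : ℝ, 1 ≤ C ∧ 1 ≤ t₀ ∧ ∀ t, t₀ ≤ t → ∀ x, 0 < x →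
      distTail F (t * x) ≤ C * max (x ^ (-β₁)) (x ^ (-β₂)) * distTail F t := by
  obtain ⟨t₀, ht₀, hpos, hp⟩ := h.exists_potter (distTail_antitone F) hβ₁ h1 h2
  set f := distTail F
  have f0 := hpos t₀ le_rfl
  have f1 : f t₀ ≤ 1 := distTail_le_one F t₀
  have c1 : (1 : ℝ) ≤ 2 ^ β₁ := Real.one_le_rpow one_le_two hβ₁
  have c2 : (1 : ℝ) ≤ 2 ^ β₂ := Real.one_le_rpow one_le_two (by linarith)
  have c12 : (2 : ℝ) ^ β₁ ≤ 2 ^ β₂ := Real.rpow_le_rpow_of_exponent_le one_le_two (by linarith)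
  have c3 : (2 : ℝ) ^ β₂ ≤ 2 ^ β₂ / f t₀ := le_div_self (by positivity) f0 f1
  -- The division by `f t₀` pays for arguments t x below t₀, where only f ≤ 1 is available. For x <
  -- 1 with t x ≥ t₀ the lower Potter bound is used backwards, from t x up to t.
  refine ⟨2 ^ β₂ / f t₀, t₀, c2.trans c3, ht₀, fun t ht x hx => ?_⟩
  have ft := hpos t ht
  have tpos : 0 < t := by linarith
  rcases le_total 1 x with hx1 | hx1
  · refine ((hp t ht x hx1).1).trans ?_
    refine mul_le_mul_of_nonneg_right ?_ ft.le
    exact mul_le_mul (c12.trans c3) (le_max_left _ _) (by positivity) (by positivity)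
  · have key : f (t * x) ≤ 2 ^ β₂ / f t₀ * x ^ (-β₂) * f t := by
      rcases le_total t₀ (t * x) with h3 | h3
      · have h4 := (hp (t * x) h3 x⁻¹ (one_le_inv_iff₀.2 ⟨hx, hx1⟩)).2
        rw [mul_assoc t x, mul_inv_cancel₀ hx.ne', mul_one, Real.inv_rpow hx.le,
          Real.rpow_neg hx.le, inv_inv] at h4
        have h5 : f (t * x) ≤ 2 ^ β₂ * x ^ (-β₂) * f t := by
          have hxp : 0 < x ^ β₂ := by positivity
          rw [Real.rpow_neg hx.le]
          calc f (t * x) = 2 ^ β₂ * (x ^ β₂)⁻¹ * ((2 ^ β₂)⁻¹ * x ^ β₂ * f (t * x)) := by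
                field_simp
            _ ≤ _ := by gcongr
        refine h5.trans ?_
        gcongr
      · have h4 := (hp t₀ le_rfl (t / t₀) ((one_le_div (by linarith)).2 ht)).2
        rw [mul_div_cancel₀ _ (by linarith)] at h4
        have h5 : x ^ β₂ ≤ (t / t₀) ^ (-β₂) := by
          rw [Real.rpow_neg (by positivity), ← Real.inv_rpow (by positivity)]
          refine Real.rpow_le_rpow hx.le ?_ (by linarith)
          rw [inv_div, le_div_iff₀ tpos]
          linarith
        have h6 : (2 ^ β₂)⁻¹ * x ^ β₂ * f t₀ ≤ f t := by
          refine le_trans ?_ h4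
          gcongr
        have hxp : 0 < x ^ β₂ := by positivity
        calc f (t * x) ≤ 1 := distTail_le_one F _
          _ = 2 ^ β₂ / f t₀ * (x ^ β₂)⁻¹ * ((2 ^ β₂)⁻¹ * x ^ β₂ * f t₀) := by field_simp
          _ ≤ _ := by rw [Real.rpow_neg hx.le]; gcongr
    refine key.trans ?_
    gcongr
    exact le_max_right _ _

/-- With exponents α < γ < δ < β, Potter's bounds give a ratio of order t^(-(δ-γ)). -/
lemma tendsto_div_of_lt {f g : ℝ → ℝ} {α β : ℝ} (hf : IsRegularlyVarying f (-β)) (hfa : Antitone f)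
    (hg : IsRegularlyVarying g (-α)) (hga : Antitone g) (hα : 0 < α) (hαβ : α < β) :
    Tendsto (fun t => f t / g t) atTop (𝓝 0) := by
  obtain ⟨γ, h1, h2⟩ := exists_between hαβ
  obtain ⟨δ, h3, h4⟩ := exists_between h2
  obtain ⟨t₁, ht₁, p₁, q₁⟩ := hf.exists_potter hfa (β₁ := δ) (by linarith) h4
    (lt_add_one β)
  obtain ⟨t₂, ht₂, p₂, q₂⟩ := hg.exists_potter hga (β₁ := α / 2) (β₂ := γ) (by linarith)
    (by linarith) h1
  set s := max t₁ t₂ with hs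
  have hs1 : 0 < s := by linarith [le_max_left t₁ t₂]
  have fs := p₁ s (le_max_left _ _)
  have gs := p₂ s (le_max_right _ _)
  have hlim : Tendsto (fun t => (2 ^ δ * f s * (2 ^ γ / g s)) * (t / s) ^ (-(δ - γ))) atTop
      (𝓝 0) := by
    have : Tendsto (fun t => (t / s) ^ (-(δ - γ))) atTop (𝓝 0) :=
      (tendsto_rpow_neg_atTop (by linarith)).comp (tendsto_id.atTop_div_const hs1)
    simpa using this.const_mul (2 ^ δ * f s * (2 ^ γ / g s))
  refine tendsto_of_tendsto_of_tendsto_of_le_of_le' tendsto_const_nhds hlim ?_ ?_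
  · filter_upwards [eventually_ge_atTop s] with t ht
    exact div_nonneg (p₁ t ((le_max_left _ _).trans ht)).le (p₂ t ((le_max_right _ _).trans ht)).le
  · filter_upwards [eventually_ge_atTop s] with t ht
    have hx : 1 ≤ t / s := (one_le_div hs1).2 ht
    have a1 := (q₁ s (le_max_left _ _) (t / s) hx).1
    have a2 := (q₂ s (le_max_right _ _) (t / s) hx).2
    rw [mul_div_cancel₀ _ hs1.ne'] at a1 a2
    have hx0 : 0 < t / s := by linarith
    have gpos : 0 < (2 ^ γ)⁻¹ * (t / s) ^ (-γ) * g s := by positivity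
    calc f t / g t ≤ (2 ^ δ * (t / s) ^ (-δ) * f s) / ((2 ^ γ)⁻¹ * (t / s) ^ (-γ) * g s) :=
          div_le_div₀ (by positivity) a1 gpos a2
      _ = _ := by
        have : (t / s) ^ (-(δ - γ)) = (t / s) ^ (-δ) / (t / s) ^ (-γ) := by
          rw [← Real.rpow_sub hx0]; ring_nf
        rw [this]
        have : 0 < (t / s) ^ (-γ) := by positivity
        field_simp

/-- Sums of monotone regularly varying functions. -/
lemma isRegularlyVarying_sum {ι : Type*} [Fintype ι] {f : ι → ℝ → ℝ} {αs : ι → ℝ} {α : ℝ}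
    (hf : ∀ j, IsRegularlyVarying (f j) (-αs j)) (hfa : ∀ j, Antitone (f j)) (hα : 0 < α)
    (hle : ∀ j, α ≤ αs j) {j₀ : ι} (hj₀ : αs j₀ = α) {w : ι → ℝ} (hw : ∀ j, 0 < w j) :
    IsRegularlyVarying (fun t => ∑ j, w j * f j t) (-α) := by
  have hpos : ∀ᶠ t in atTop, ∀ j, 0 < f j t := eventually_all.2 fun j => (hf j).eventually_pos
  refine ⟨Finset.measurable_fun_sum _ fun j _ => (hf j).measurable.const_mul _, ?_, fun x hx => ?_⟩
  · filter_upwards [hpos] with t ht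
    exact Finset.sum_pos (fun j _ => mul_pos (hw j) (ht j)) ⟨j₀, Finset.mem_univ _⟩
  -- The error of the ratio of sums is a weighted average of the individual errors. For terms of
  -- index α the error vanishes; for lighter terms the error stays bounded and the weight vanishes.
  · have key : Tendsto (fun t => ∑ j, (f j (t * x) / f j t - x ^ (-α)) *
        (w j * f j t / ∑ i, w i * f i t)) atTop (𝓝 (∑ _j : ι, 0)) := by
      refine tendsto_finsetSum _ fun j _ => ?_
      have hle1 : ∀ i, ∀ᶠ t in atTop, w i * f i t ≤ ∑ i, w i * f i t := fun i => by
        filter_upwards [hpos] with t ht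
        exact Finset.single_le_sum (f := fun i => w i * f i t)
          (fun i _ => (mul_pos (hw i) (ht i)).le) (Finset.mem_univ i)
      rcases (hle j).eq_or_lt with h | h
      · have h1 : Tendsto (fun t => f j (t * x) / f j t - x ^ (-α)) atTop (𝓝 0) := by
          have := ((hf j).tendsto_ratio x hx).sub_const (x ^ (-α))
          rwa [← h, sub_self] at this
        refine squeeze_zero_norm' ?_ (tendsto_norm_zero.comp h1)
        filter_upwards [hpos, hle1 j] with t ht h2
        simp only [Function.comp]
        rw [norm_mul]
        refine mul_le_of_le_one_right (norm_nonneg _) ?_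
        have h3 := mul_pos (hw j) (ht j)
        rw [Real.norm_of_nonneg (div_nonneg h3.le (h3.le.trans h2))]
        exact div_le_one_of_le₀ h2 (h3.le.trans h2)
      · have h1 := ((hf j).tendsto_ratio x hx).sub_const (x ^ (-α))
        have h2 : Tendsto (fun t => w j * f j t / ∑ i, w i * f i t) atTop (𝓝 0) := by
          have h3 := (tendsto_div_of_lt (hf j) (hfa j) (hj₀ ▸ hf j₀) (hfa j₀) hα h).const_mul
            (w j / w j₀)
          rw [mul_zero] at h3
          refine tendsto_of_tendsto_of_tendsto_of_le_of_le' tendsto_const_nhds h3 ?_ ?_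
          · filter_upwards [hpos] with t ht
            exact div_nonneg (mul_pos (hw j) (ht j)).le
              (Finset.sum_nonneg fun i _ => (mul_pos (hw i) (ht i)).le)
          · filter_upwards [hpos, hle1 j₀] with t ht h4
            have h5 := mul_pos (hw j₀) (ht j₀)
            rw [div_mul_div_comm]
            exact div_le_div_of_nonneg_left (mul_pos (hw j) (ht j)).le h5 h4
        simpa using h1.mul h2
    rw [Finset.sum_const_zero] at key
    have h1 := key.add_const (x ^ (-α))
    rw [zero_add] at h1
    refine h1.congr' ?_
    filter_upwards [hpos] with t ht
    have hS : 0 < ∑ i, w i * f i t :=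
      Finset.sum_pos (fun j _ => mul_pos (hw j) (ht j)) ⟨j₀, Finset.mem_univ _⟩
    have h2 : ∀ j, (f j (t * x) / f j t - x ^ (-α)) * (w j * f j t / ∑ i, w i * f i t) =
        (w j * f j (t * x) - x ^ (-α) * (w j * f j t)) / ∑ i, w i * f i t := fun j => by
      have := (ht j).ne'
      field_simp
    simp_rw [h2]
    rw [← Finset.sum_div, Finset.sum_sub_distrib, ← Finset.mul_sum]
    field_simp
    ring

/-! ### Quantiles -/

/-- The generalized inverse of the tail of `F`, on `(0, 1)`. -/
noncomputable def tailQuantile (F : Measure ℝ) (y : ℝ) : ℝ :=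
  if y ∈ Ioo 0 1 then sInf {x | distTail F x ≤ y} else 0

/-- Right continuity makes the infimum attained, which gives an exact Galois connection. Atoms and
flat pieces of the distribution then need no separate treatment. -/
lemma tailQuantile_le_iff {F : Measure ℝ} [IsProbabilityMeasure F] (h0 : F (Iic 0) = 0) {y : ℝ}
    (hy : y ∈ Ioo (0 : ℝ) 1) (x : ℝ) : tailQuantile F y ≤ x ↔ distTail F x ≤ y := by
  rw [tailQuantile, if_pos hy]
  set S := {x | distTail F x ≤ y}
  have hne : S.Nonempty := ((tendsto_distTail_atTop F).eventually_le_const hy.1).exists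
  have hbdd : BddBelow S := ⟨0, fun z hz => by
    by_contra hc
    have h1 := distTail_eq_one_of_nonpos h0 (not_le.1 hc).le
    have h2 : distTail F z ≤ y := hz
    linarith [hy.2]⟩
  refine ⟨fun h => ?_, fun h => csInf_le hbdd h⟩
  refine (distTail_antitone F h).trans ?_
  by_contra hc
  rw [not_le] at hc
  have hcont : ContinuousWithinAt (distTail F) (Ici (sInf S)) (sInf S) := by
    have h1 := (cdf F).right_continuous (sInf S)
    refine (continuousWithinAt_const (b := (1 : ℝ)).sub h1).congr (fun z _ => ?_) ?_ <;>
    simp only [Pi.sub_apply, distTail_eq_one_sub, cdf_eq_real]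
  have h2 := hcont.eventually (lt_mem_nhds hc)
  rw [eventually_nhdsWithin_iff, Metric.eventually_nhds_iff] at h2
  obtain ⟨ε, hε, h3⟩ := h2
  obtain ⟨z, hz, hz2⟩ := exists_lt_of_csInf_lt hne (lt_add_of_pos_right (sInf S) hε)
  have hz1 := csInf_le hbdd hz
  refine absurd hz (not_le.2 (h3 ?_ hz1))
  rw [Real.dist_eq, abs_of_nonneg (by linarith)]
  linarith

lemma tailQuantile_nonneg {F : Measure ℝ} [IsProbabilityMeasure F] (h0 : F (Iic 0) = 0) (y : ℝ) :
    0 ≤ tailQuantile F y := by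
  by_cases hy : y ∈ Ioo (0 : ℝ) 1
  · by_contra hc
    have := (tailQuantile_le_iff h0 hy _).1 le_rfl
    rw [distTail_eq_one_of_nonpos h0 (not_le.1 hc).le] at this
    linarith [hy.2]
  · rw [tailQuantile, if_neg hy]

lemma measurable_tailQuantile {F : Measure ℝ} [IsProbabilityMeasure F] (h0 : F (Iic 0) = 0) :
    Measurable (tailQuantile F) := by
  refine measurable_of_Iic fun x => ?_
  have : tailQuantile F ⁻¹' Iic x =
      (Ioo 0 1 ∩ Ici (distTail F x)) ∪ ((Ioo 0 1)ᶜ ∩ {_y | 0 ≤ x}) := by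
    ext y
    by_cases hy : y ∈ Ioo (0 : ℝ) 1
    · simp only [mem_preimage, mem_Iic, tailQuantile_le_iff h0 hy]
      simp [hy]
    · rw [mem_preimage, mem_Iic, tailQuantile, if_neg hy]
      simp [hy]
  rw [this]
  exact (measurableSet_Ioo.inter measurableSet_Ici).union
    (measurableSet_Ioo.compl.inter (MeasurableSet.const _))

lemma quantileFn_eq_tailQuantile (F : Measure ℝ) [IsProbabilityMeasure F] {t : ℝ} (ht : 1 < t) :
    quantileFn F t = tailQuantile F (1 / t) := by
  have h1 : 1 / t ∈ Ioo (0 : ℝ) 1 := ⟨by positivity, (div_lt_one (by linarith)).2 ht⟩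
  rw [quantileFn, tailQuantile, if_pos h1]
  congr 1
  ext x
  simp only [mem_ofPred_eq, distTail_eq_one_sub]
  constructor <;> intro h <;> linarith

/-- The quantile coupling. -/
lemma map_tailQuantile {F : Measure ℝ} [IsProbabilityMeasure F] (h0 : F (Iic 0) = 0) {n : ℝ}
    (hn : 0 < n) :
    (volume.restrict (Ioo 0 n)).map (fun y => tailQuantile F (y / n)) = ENNReal.ofReal n • F := by
  have hm : Measurable fun y => tailQuantile F (y / n) :=
    (measurable_tailQuantile h0).comp (measurable_id.div_const n)
  have : IsFiniteMeasure (ENNReal.ofReal n • F) := by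
    have : IsFiniteMeasure (n.toNNReal • F) := inferInstance
    exact this
  refine (Measure.ext_of_Iic _ _ fun x => ?_).symm
  rw [Measure.map_apply hm measurableSet_Iic, Measure.restrict_apply (hm measurableSet_Iic),
    Measure.smul_apply, smul_eq_mul]
  set c := n * distTail F x with hc
  have hc0 : 0 ≤ c := mul_nonneg hn.le (distTail_nonneg F x)
  have hcn : c ≤ n := mul_le_of_le_one_right hn.le (distTail_le_one F x)
  -- By the Galois connection, the quantile at y/n is at most x exactly when y ≥ n F̄(x).
  have h1 : (fun y => tailQuantile F (y / n)) ⁻¹' Iic x ∩ Ioo 0 n = Ioo 0 n ∩ Ici c := by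
    ext y
    simp only [mem_inter_iff, mem_preimage, mem_Iic, mem_Ici]
    rw [and_comm]
    refine and_congr_right fun hy => ?_
    have hyn : y / n ∈ Ioo (0 : ℝ) 1 := ⟨div_pos hy.1 hn, (div_lt_one hn).2 hy.2⟩
    rw [tailQuantile_le_iff h0 hyn, le_div_iff₀ hn, mul_comm]
  have h2 : volume (Ioo 0 n ∩ Ici c) = ENNReal.ofReal (n - c) := by
    refine le_antisymm ?_ ?_
    · rw [← Real.volume_Ico]
      exact measure_mono fun y hy => ⟨hy.2, hy.1.2⟩
    · rw [← Real.volume_Ioo]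
      exact measure_mono fun y hy => ⟨⟨hc0.trans_lt hy.1, hy.2⟩, hy.1.le⟩
  have h3 : n - c = n * F.real (Iic x) := by rw [hc, distTail_eq_one_sub]; ring
  rw [h1, h2, h3, ENNReal.ofReal_mul hn.le, measureReal_def,
    ENNReal.ofReal_toReal (measure_ne_top _ _)]

lemma tendsto_scaled_distTail {F : Measure ℝ} {α : ℝ} {n a : ℝ → ℝ} (h : IsRegularlyVarying (distTail F) (-α)) (ha : Tendsto a atTop atTop)
    (hna : Tendsto (fun T => n T * distTail F (a T)) atTop (𝓝 1)) {x : ℝ} (hx : 0 < x) :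
    Tendsto (fun T => n T * distTail F (a T * x)) atTop (𝓝 (x ^ (-α))) := by
  have h1 := hna.mul ((h.tendsto_ratio x hx).comp ha)
  rw [one_mul] at h1
  refine h1.congr' ?_
  filter_upwards [ha.eventually h.eventually_pos] with T hT
  simp only [Function.comp]
  field_simp

section Scaling

variable {F : Measure ℝ} [IsProbabilityMeasure F] {α : ℝ} {n a : ℝ → ℝ}

/-- Inversion of n F̄(a x) → x^(-α): the limit is strictly decreasing, so each strict inequality for
the quantile becomes one for the tail at a nearby point. -/
lemma tendsto_scaled_tailQuantile (h0 : F (Iic 0) = 0) (h : IsRegularlyVarying (distTail F) (-α))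
    (hα : 0 < α) (hn : Tendsto n atTop atTop) (ha : Tendsto a atTop atTop)
    (hna : Tendsto (fun T => n T * distTail F (a T)) atTop (𝓝 1)) {y : ℝ} (hy : 0 < y) :
    Tendsto (fun T => tailQuantile F (y / n T) / a T) atTop (𝓝 (y ^ (-α⁻¹))) := by
  have hY : 0 < y ^ (-α⁻¹) := Real.rpow_pos_of_pos hy _
  have hYα : (y ^ (-α⁻¹)) ^ (-α) = y := by
    rw [← Real.rpow_mul hy.le, neg_mul_neg, inv_mul_cancel₀ hα.ne', Real.rpow_one]
  have hev : ∀ᶠ T in atTop, 0 < a T ∧ 0 < n T ∧ y / n T ∈ Ioo (0 : ℝ) 1 := by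
    filter_upwards [ha.eventually_gt_atTop 0, hn.eventually_gt_atTop y] with T h1 h2
    have : 0 < n T := hy.trans h2
    exact ⟨h1, this, div_pos hy this, (div_lt_one this).2 h2⟩
  refine tendsto_order.2 ⟨fun x hx => ?_, fun x hx => ?_⟩
  · rcases le_or_gt x 0 with hx0 | hx0
    · obtain ⟨x', hx'1, hx'2⟩ := exists_between hY
      have h1 := tendsto_scaled_distTail h ha hna hx'1
      have h2 : y < x' ^ (-α) := by
        conv_lhs => rw [← hYα]
        exact Real.rpow_lt_rpow_of_neg hx'1 hx'2 (by linarith)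
      filter_upwards [hev, h1.eventually_const_lt h2] with T ⟨ha0, hn0, hT⟩ h3
      rw [lt_div_iff₀ ha0]
      by_contra hc
      rw [not_lt, tailQuantile_le_iff h0 hT, le_div_iff₀ hn0] at hc
      have := distTail_antitone F (show x * a T ≤ a T * x' by nlinarith)
      nlinarith
    · have h1 := tendsto_scaled_distTail h ha hna hx0
      have h2 : y < x ^ (-α) := by
        conv_lhs => rw [← hYα]
        exact Real.rpow_lt_rpow_of_neg hx0 hx (by linarith)
      filter_upwards [hev, h1.eventually_const_lt h2] with T ⟨ha0, hn0, hT⟩ h3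
      rw [lt_div_iff₀ ha0]
      by_contra hc
      rw [not_lt, tailQuantile_le_iff h0 hT, le_div_iff₀ hn0, mul_comm x] at hc
      linarith
  · obtain ⟨x', hx'1, hx'2⟩ := exists_between hx
    have hx'0 : 0 < x' := hY.trans hx'1
    have h1 := tendsto_scaled_distTail h ha hna hx'0
    have h2 : x' ^ (-α) < y := by
      conv_rhs => rw [← hYα]
      exact Real.rpow_lt_rpow_of_neg hY hx'1 (by linarith)
    filter_upwards [hev, h1.eventually_lt_const h2] with T ⟨ha0, hn0, hT⟩ h3
    refine lt_of_le_of_lt ?_ hx'2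
    rw [div_le_iff₀ ha0, tailQuantile_le_iff h0 hT, le_div_iff₀ hn0, mul_comm x']
    linarith

/-- Potter's bound read through the inverse. Small y are large values of the variable and use the
exponent β₁ < α; large y are small values and use β₂ > α. The two powers give integrability at 0 and
at infinity. -/
lemma exists_scaled_tailQuantile_le (h0 : F (Iic 0) = 0)
    (h : IsRegularlyVarying (distTail F) (-α)) (hn : Tendsto n atTop atTop)
    (ha : Tendsto a atTop atTop) (hna : Tendsto (fun T => n T * distTail F (a T)) atTop (𝓝 1))
    {β₁ β₂ : ℝ} (hβ₁ : 1 ≤ β₁) (h1 : β₁ < α) (h2 : α < β₂) :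
    ∃ C : ℝ, 1 ≤ C ∧ ∀ᶠ T in atTop, ∀ y ∈ Ioo 0 (n T),
      tailQuantile F (y / n T) / a T ≤ C * if y ≤ 1 then y ^ (-β₁⁻¹) else y ^ (-β₂⁻¹) := by
  obtain ⟨C, t₀, hC, ht₀, hp⟩ := exists_potter_distTail h (by linarith) h1 h2
  -- `C` is the Potter constant and 2 bounds n F̄(a). As the exponents are at least 1, (2C)^(-β) ≤
  -- 1/(2C), which cancels both.
  refine ⟨2 * C, by linarith, ?_⟩
  filter_upwards [ha.eventually_ge_atTop t₀, hn.eventually_gt_atTop 0,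
    hna.eventually_le_const one_lt_two] with T haT hnT h3 y hy
  have ha0 : 0 < a T := by linarith
  have hyn : y / n T ∈ Ioo (0 : ℝ) 1 := ⟨div_pos hy.1 hnT, (div_lt_one hnT).2 hy.2⟩
  have hy0 : 0 < y := hy.1
  rw [div_le_iff₀ ha0, tailQuantile_le_iff h0 hyn, le_div_iff₀ hnT, mul_comm _ (a T)]
  set p := if y ≤ 1 then y ^ (-β₁⁻¹) else y ^ (-β₂⁻¹) with hpdef
  have hp0 : 0 < p := by rw [hpdef]; split_ifs <;> positivity
  have hb1 : 0 < β₁ := by linarith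
  have hb2 : 0 < β₂ := by linarith
  have e1 : ∀ β : ℝ, 1 ≤ β → p ^ (-β) ≤ y → (2 * C * p) ^ (-β) ≤ y / (2 * C) := fun β hβ hle => by
    rw [Real.mul_rpow (by positivity) hp0.le, div_eq_inv_mul]
    refine mul_le_mul ?_ hle (by positivity) (by positivity)
    rw [← Real.rpow_neg_one]
    exact Real.rpow_le_rpow_of_exponent_le (by linarith) (by linarith)
  have e2 : p ^ (-β₁) ≤ y := by
    rw [hpdef]
    split_ifs with hy1
    · rw [← Real.rpow_mul hy0.le, neg_mul_neg, inv_mul_cancel₀ hb1.ne', Real.rpow_one]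
    · rw [← Real.rpow_mul hy0.le, neg_mul_neg]
      conv_rhs => rw [← Real.rpow_one y]
      refine Real.rpow_le_rpow_of_exponent_le (not_le.1 hy1).le ?_
      rw [inv_mul_le_iff₀ hb2]
      linarith
  have e3 : p ^ (-β₂) ≤ y := by
    rw [hpdef]
    split_ifs with hy1
    · rw [← Real.rpow_mul hy0.le, neg_mul_neg]
      conv_rhs => rw [← Real.rpow_one y]
      refine Real.rpow_le_rpow_of_exponent_ge hy0 hy1 ?_
      rw [le_inv_mul_iff₀ hb1]
      linarith
    · rw [← Real.rpow_mul hy0.le, neg_mul_neg, inv_mul_cancel₀ hb2.ne', Real.rpow_one]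
  have h4 := hp (a T) haT (2 * C * p) (by positivity)
  have h5 : max ((2 * C * p) ^ (-β₁)) ((2 * C * p) ^ (-β₂)) ≤ y / (2 * C) :=
    max_le (e1 β₁ hβ₁ e2) (e1 β₂ (by linarith) e3)
  calc distTail F (a T * (2 * C * p)) * n T
      ≤ (C * (y / (2 * C)) * distTail F (a T)) * n T := by
        refine mul_le_mul_of_nonneg_right (h4.trans ?_) hnT.le
        have := distTail_nonneg F (a T)
        gcongr
    _ = y / 2 * (n T * distTail F (a T)) := by field_simp
    _ ≤ y / 2 * 2 := by gcongr
    _ = y := by ring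

end Scaling

lemma distTail_pos_of_isRegularlyVarying {F : Measure ℝ} [IsProbabilityMeasure F] {γ : ℝ}
    (h : IsRegularlyVarying (distTail F) γ) (x : ℝ) : 0 < distTail F x := by
  obtain ⟨t, h1, h2⟩ := (h.eventually_pos.and (eventually_ge_atTop x)).exists
  exact h1.trans_le (distTail_antitone F h2)

lemma tendsto_quantileFn_atTop {F : Measure ℝ} [IsProbabilityMeasure F] (h0 : F (Iic 0) = 0) {γ : ℝ}
    (h : IsRegularlyVarying (distTail F) γ) : Tendsto (quantileFn F) atTop atTop := by
  refine tendsto_atTop.2 fun x => ?_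
  have hx := distTail_pos_of_isRegularlyVarying h x
  filter_upwards [eventually_gt_atTop 1, eventually_gt_atTop (1 / distTail F x)] with t ht1 ht2
  have h1 : 1 / t ∈ Ioo (0 : ℝ) 1 := ⟨by positivity, (div_lt_one (by linarith)).2 ht1⟩
  rw [quantileFn_eq_tailQuantile F ht1]
  by_contra hc
  have := (tailQuantile_le_iff h0 h1 x).1 (not_le.1 hc).le
  rw [le_div_iff₀ (by linarith)] at this
  rw [div_lt_iff₀ hx] at ht2
  linarith

/-- Atoms may keep t F̄(b(t)) below 1, while it never exceeds 1. For x < 1 the tail at x b(t)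
exceeds 1/t, and regular variation compares it with the tail at b(t); then x ↑ 1. -/
lemma tendsto_mul_distTail_quantileFn {F : Measure ℝ} [IsProbabilityMeasure F]
    (h0 : F (Iic 0) = 0) {α : ℝ} (h : IsRegularlyVarying (distTail F) (-α)) :
    Tendsto (fun t => t * distTail F (quantileFn F t)) atTop (𝓝 1) := by
  have hb := tendsto_quantileFn_atTop h0 h
  have hcont : Tendsto (fun x : ℝ => x ^ α) (𝓝[<] 1) (𝓝 1) := by
    have : ContinuousAt (fun x : ℝ => x ^ α) 1 :=
      Real.continuousAt_rpow_const 1 α (Or.inl one_ne_zero)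
    have h1 := this.tendsto.mono_left (nhdsWithin_le_nhds (s := Iio 1))
    simpa using h1
  refine tendsto_order.2 ⟨fun c hc => ?_, fun c hc => ?_⟩
  · obtain ⟨x, hx1, hx2⟩ := ((hcont.eventually_const_lt hc).and
      (Ioo_mem_nhdsLT (zero_lt_one (α := ℝ)))).exists
    have h1 := (h.tendsto_ratio x hx2.1).comp hb
    have h2 : Tendsto (fun t => distTail F (quantileFn F t) / distTail F (quantileFn F t * x)) atTop
        (𝓝 (x ^ α)) := by
      have := h1.inv₀ (by have := hx2.1; positivity)
      rw [Real.rpow_neg hx2.1.le, inv_inv] at this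
      refine this.congr fun t => ?_
      simp only [Function.comp, inv_div]
    filter_upwards [h2.eventually_const_lt hx1, eventually_gt_atTop 1, hb.eventually_gt_atTop 0]
      with t h3 ht1 hbt
    have hT : 1 / t ∈ Ioo (0 : ℝ) 1 := ⟨by positivity, (div_lt_one (by linarith)).2 ht1⟩
    have h4 : 1 / t < distTail F (quantileFn F t * x) := by
      by_contra hc
      have := (tailQuantile_le_iff h0 hT _).2 (not_lt.1 hc)
      rw [← quantileFn_eq_tailQuantile F ht1] at this
      nlinarith [hx2.2]
    have h5 : 0 < distTail F (quantileFn F t * x) := distTail_pos_of_isRegularlyVarying h _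
    rw [lt_div_iff₀ h5] at h3
    rcases le_or_gt c 0 with hc0 | hc0
    · exact hc0.trans_lt (mul_pos (by linarith) (distTail_pos_of_isRegularlyVarying h _))
    · rw [div_lt_iff₀ (by linarith)] at h4
      nlinarith
  · filter_upwards [eventually_gt_atTop 1] with t ht1
    have hT : 1 / t ∈ Ioo (0 : ℝ) 1 := ⟨by positivity, (div_lt_one (by linarith)).2 ht1⟩
    have := (tailQuantile_le_iff h0 hT _).1 le_rfl
    rw [← quantileFn_eq_tailQuantile F ht1, le_div_iff₀ (by linarith)] at this
    linarith

/-! ### The overlap of a session with the observation window -/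

lemma sessionOverlap_eq (t s u : ℝ) :
    sessionOverlap t s u = max (min t (s + u) - max 0 s) 0 := by
  rw [sessionOverlap, Icc_inter_Icc, Real.volume_real_Icc]

lemma sessionOverlap_nonneg (t s u : ℝ) : 0 ≤ sessionOverlap t s u := measureReal_nonneg

lemma continuous_sessionOverlap (t : ℝ) :
    Continuous fun p : ℝ × ℝ => sessionOverlap t p.1 p.2 := by
  simp only [sessionOverlap_eq]
  fun_prop

lemma measurable_sessionOverlap (t : ℝ) :
    Measurable fun p : ℝ × ℝ × ℝ => sessionOverlap t p.1 p.2.1 :=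
  (continuous_sessionOverlap t).measurable.comp (by fun_prop : Measurable fun p : ℝ × ℝ × ℝ => (p.1, p.2.1))

lemma sessionOverlap_le_left {t : ℝ} (ht : 0 ≤ t) (s u : ℝ) : sessionOverlap t s u ≤ t := by
  rw [sessionOverlap_eq]
  refine max_le ?_ ht
  linarith [min_le_left t (s + u), le_max_left 0 s]

/-- A session that starts at s < 0 and reaches the window has length at least |s|; one that starts
at s ≥ 0 must have s ≤ t. Combined with L ≤ t and L ≤ u this gives decay in s. -/
lemma sessionOverlap_mul_le {t u : ℝ} (ht : 0 ≤ t) (hu : 0 ≤ u) (s : ℝ) :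
    sessionOverlap t s u * (1 + |s|) ≤ (1 + t) * u := by
  by_cases h : min t (s + u) - max 0 s ≤ 0
  · rw [sessionOverlap_eq, max_eq_right h, zero_mul]
    positivity
  · have h1 := sessionOverlap_le_left ht s u
    have h0 := sessionOverlap_nonneg t s u
    have e : sessionOverlap t s u = min t (s + u) - max 0 s := by
      rw [sessionOverlap_eq, max_eq_left (not_le.1 h).le]
    have m1 := min_le_left t (s + u)
    have m2 := min_le_right t (s + u)
    have m3 := le_max_left 0 s
    have m4 := le_max_right 0 s
    have h2 : sessionOverlap t s u ≤ u := by linarith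
    rcases le_total 0 s with hs | hs
    · rw [abs_of_nonneg hs]
      have : s ≤ t := by linarith
      calc sessionOverlap t s u * (1 + s) ≤ u * (1 + t) := by gcongr
        _ = (1 + t) * u := by ring
    · rw [abs_of_nonpos hs]
      have : -s ≤ u := by linarith
      have := mul_le_mul h1 this (by linarith) ht
      linarith

/-- This bound feeds the domination arguments: a power larger than 1 of the second entry is
integrable over the starting times, and the cap at 1 lets exponents be lowered freely. -/
lemma sessionOverlap_le {t u : ℝ} (ht : 0 ≤ t) (hu : 0 ≤ u) (s : ℝ) :
    sessionOverlap t s u ≤ (1 + t) * min 1 (u / (1 + |s|)) := by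
  have : 0 < 1 + |s| := by positivity
  rw [mul_min_of_nonneg _ _ (by linarith)]
  refine le_min (by linarith [sessionOverlap_le_left ht s u]) ?_
  rw [← mul_div_assoc, le_div_iff₀ this]
  exact sessionOverlap_mul_le ht hu s

lemma sessionOverlap_scale {c : ℝ} (hc : 0 ≤ c) (t s u : ℝ) :
    sessionOverlap (c * t) (c * s) (c * u) = c * sessionOverlap t s u := by
  simp only [sessionOverlap_eq]
  rw [← mul_add, ← mul_min_of_nonneg _ _ hc, mul_max_of_nonneg _ _ hc, mul_zero,
    mul_sub, mul_max_of_nonneg _ _ hc, mul_zero]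

/-- Short sessions that start strictly inside the window are contained in it. -/
lemma tendsto_mul_sessionOverlap_div {t s u : ℝ} (hs0 : s ≠ 0) (hu : 0 < u)
    {K w : ℝ → ℝ} (hK : Tendsto K atTop atTop) (hw : Tendsto w atTop (𝓝 u)) :
    Tendsto (fun T => K T * sessionOverlap t s (w T / K T)) atTop
      (𝓝 (u * (Ioo (0 : ℝ) t).indicator 1 s)) := by
  have hwK : Tendsto (fun T => w T / K T) atTop (𝓝 0) := hw.div_atTop hK
  by_cases h : s ∈ Ioo 0 t
  · rw [indicator_of_mem h, Pi.one_apply, mul_one]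
    refine hw.congr' ?_
    filter_upwards [hwK.eventually_lt_const (sub_pos.2 h.2), hK.eventually_gt_atTop 0,
      hw.eventually_const_lt hu] with T h1 h2 h3
    have : 0 < w T / K T := by positivity
    rw [sessionOverlap_eq, min_eq_right (by linarith), max_eq_right h.1.le, add_sub_cancel_left,
      max_eq_left this.le]
    field_simp
  · rw [indicator_of_notMem h, mul_zero]
    refine tendsto_const_nhds.congr' ?_
    rcases lt_or_gt_of_ne hs0 with h0 | h0
    · filter_upwards [hwK.eventually_lt_const (neg_pos.2 h0)] with T h1
      rw [sessionOverlap_eq, max_eq_right, mul_zero]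
      linarith [min_le_right t (s + w T / K T), le_max_left 0 s]
    · have : t ≤ s := not_lt.1 fun hh => h ⟨h0, hh⟩
      filter_upwards with T
      rw [sessionOverlap_eq, max_eq_right, mul_zero]
      linarith [min_le_left t (s + w T / K T), le_max_right 0 s]

/-- Fubini on a strip: an instant x in [0,t] is covered exactly by the sessions that start in [x-u,
x]. -/
lemma lintegral_sessionOverlap (t u : ℝ) :
    ∫⁻ s, ENNReal.ofReal (sessionOverlap t s u) = ENNReal.ofReal t * ENNReal.ofReal u := by
  set S : Set (ℝ × ℝ) := {p | p.2 ∈ Icc 0 t ∧ p.2 ∈ Icc p.1 (p.1 + u)} with hS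
  have hSm : MeasurableSet S :=
    (measurable_snd measurableSet_Icc).inter ((measurableSet_le measurable_fst measurable_snd).inter
      (measurableSet_le measurable_snd (measurable_fst.add_const u)))
  have h1 := Measure.prod_apply (μ := (volume : Measure ℝ)) (ν := (volume : Measure ℝ)) hSm
  have h2 := Measure.prod_apply_symm (μ := (volume : Measure ℝ)) (ν := (volume : Measure ℝ)) hSm
  have e1 : ∀ s, ENNReal.ofReal (sessionOverlap t s u) = volume (Prod.mk s ⁻¹' S) := by
    intro s
    rw [sessionOverlap, ofReal_measureReal ((measure_mono inter_subset_left).trans_lt (by simp)).ne]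
    rfl
  have e2 : ∀ x, volume ((fun s => (s, x)) ⁻¹' S) =
      (Icc 0 t).indicator (fun _ => ENNReal.ofReal u) x := by
    intro x
    by_cases hx : x ∈ Icc 0 t
    · rw [indicator_of_mem hx]
      have : (fun s => (s, x)) ⁻¹' S = Icc (x - u) x := by
        ext s
        constructor
        · rintro ⟨_, h3, h4⟩
          exact ⟨by linarith, h3⟩
        · rintro ⟨h3, h4⟩
          exact ⟨hx, h4, by simp only; linarith⟩
      rw [this, Real.volume_Icc]
      congr 1; ring
    · rw [indicator_of_notMem hx]
      have : (fun s => (s, x)) ⁻¹' S = ∅ := by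
        ext s
        simp only [mem_preimage, mem_empty_iff_false, iff_false]
        exact fun h => hx h.1
      rw [this, measure_empty]
  simp_rw [e1]
  rw [← h1, h2]
  simp_rw [e2]
  rw [lintegral_indicator measurableSet_Icc, setLIntegral_const, Real.volume_Icc, sub_zero, mul_comm]

/-! ### Power measures and moments of heavy-tailed laws -/

instance (γ : ℝ) : SigmaFinite (powerMeasure γ) := by
  unfold powerMeasure
  infer_instance

lemma powerMeasure_Iic (γ : ℝ) : powerMeasure γ (Iic 0) = 0 := by
  rw [powerMeasure]
  refine withDensity_absolutelyContinuous _ _ ?_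
  rw [Measure.restrict_apply measurableSet_Iic, Iic_inter_Ioi]
  simp

lemma ae_powerMeasure_pos (γ : ℝ) : ∀ᵐ u ∂(powerMeasure γ), 0 < u := by
  rw [ae_iff]
  convert powerMeasure_Iic γ using 2
  ext; simp

/-- The limiting counterpart of the quantile coupling: the power measure has tail x^(-γ), whose
inverse is y^(-1/γ). -/
lemma map_rpow_eq_powerMeasure {γ : ℝ} (hγ : 0 < γ) :
    (volume.restrict (Ioi 0)).map (fun y : ℝ => y ^ (-γ⁻¹)) = powerMeasure γ := by
  ext B hB
  have hm : Measurable fun y : ℝ => y ^ (-γ⁻¹) := by fun_prop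
  rw [Measure.map_apply hm hB, powerMeasure, withDensity_apply _ hB, Measure.restrict_restrict hB,
    Measure.restrict_apply (hm hB)]
  have him : (fun y : ℝ => y ^ (-γ⁻¹)) ⁻¹' B ∩ Ioi 0 = (fun u : ℝ => u ^ (-γ)) '' (B ∩ Ioi 0) := by
    ext y
    constructor
    · rintro ⟨h1, h2⟩
      have h2' : 0 < y := h2
      refine ⟨y ^ (-γ⁻¹), ⟨h1, Real.rpow_pos_of_pos h2' _⟩, ?_⟩
      simp only
      rw [← Real.rpow_mul h2'.le, neg_mul_neg, inv_mul_cancel₀ hγ.ne', Real.rpow_one]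
    · rintro ⟨u, ⟨h1, h2⟩, rfl⟩
      have h2' : 0 < u := h2
      refine ⟨?_, Real.rpow_pos_of_pos h2' _⟩
      simp only [mem_preimage]
      rwa [← Real.rpow_mul h2'.le, neg_mul_neg, mul_inv_cancel₀ hγ.ne', Real.rpow_one]
  rw [him, ← lintegral_abs_det_fderiv_eq_addHaar_image volume (hB.inter measurableSet_Ioi)
    (f' := fun u => ContinuousLinearMap.toSpanSingleton ℝ (-γ * u ^ (-γ - 1)))]
  · refine setLIntegral_congr_fun (hB.inter measurableSet_Ioi) fun u hu => ?_
    have h2' : 0 < u := hu.2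
    simp only [ContinuousLinearMap.det_toSpanSingleton]
    rw [abs_mul, abs_neg, abs_of_pos hγ, abs_of_pos (Real.rpow_pos_of_pos h2' _)]
    congr 3; ring
  · intro u hu
    have h2' : 0 < u := hu.2
    exact ((Real.hasDerivAt_rpow_const (Or.inl h2'.ne')).hasFDerivAt).hasFDerivWithinAt
  · intro u hu v hv huv
    have hu' : 0 < u := hu.2
    have hv' : 0 < v := hv.2
    exact (Real.rpow_left_inj hu'.le hv'.le (neg_ne_zero.2 hγ.ne')).1 huv

/-- In the coordinate y, multiplication of u by c is multiplication of y by c^(-γ), and Lebesgue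
measure scales. -/
lemma map_mul_powerMeasure {γ c : ℝ} (hγ : 0 < γ) (hc : 0 < c) :
    (powerMeasure γ).map (fun u => c * u) = ENNReal.ofReal (c ^ γ) • powerMeasure γ := by
  have e : (fun y : ℝ => c * y ^ (-γ⁻¹)) =ᵐ[volume.restrict (Ioi 0)]
      (fun y => y ^ (-γ⁻¹)) ∘ fun y => c ^ (-γ) * y := by
    filter_upwards [ae_restrict_mem measurableSet_Ioi] with y hy
    have hy' : 0 < y := hy
    simp only [Function.comp]
    rw [Real.mul_rpow (by positivity) hy'.le, ← Real.rpow_mul hc.le, neg_mul_neg,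
      mul_inv_cancel₀ hγ.ne', Real.rpow_one]
  have e2 : (volume.restrict (Ioi 0)).map (fun y : ℝ => c ^ (-γ) * y) =
      ENNReal.ofReal (c ^ γ) • volume.restrict (Ioi (0 : ℝ)) := by
    have hp : 0 < c ^ (-γ) := by positivity
    have h1 := Real.map_volume_mul_left hp.ne'
    have hm : Measurable fun y : ℝ => c ^ (-γ) * y := by fun_prop
    have : Ioi (0 : ℝ) = (fun y : ℝ => c ^ (-γ) * y) ⁻¹' Ioi 0 := by
      ext y
      simp [hp]
    rw [this, ← Measure.restrict_map hm measurableSet_Ioi, h1, ← this, Measure.restrict_smul,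
      abs_of_pos (by positivity), Real.rpow_neg hc.le, inv_inv]
  rw [← map_rpow_eq_powerMeasure hγ, Measure.map_map (by fun_prop) (by fun_prop)]
  change Measure.map (fun y : ℝ => c * y ^ (-γ⁻¹)) _ = _
  rw [Measure.map_congr e, ← Measure.map_map (by fun_prop) (by fun_prop), e2, Measure.map_smul]

lemma integrableOn_ite_rpow {p q : ℝ} (hp : p < 1) (hq : 1 < q) :
    IntegrableOn (fun y : ℝ => if y ≤ 1 then y ^ (-p) else y ^ (-q)) (Ioi 0) := by
  rw [← Ioc_union_Ioi_eq_Ioi zero_le_one]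
  refine IntegrableOn.union ?_ ?_
  · have h : IntegrableOn (fun y : ℝ => y ^ (-p)) (Ioc 0 1) :=
      (intervalIntegral.intervalIntegrable_rpow' (a := 0) (b := 1) (by linarith : -1 < -p)).1
    exact h.congr_fun (fun y hy => by simp [hy.2]) measurableSet_Ioc
  · have h := integrableOn_Ioi_rpow_of_lt (a := -q) (by linarith) zero_lt_one
    exact h.congr_fun (fun y hy => by simp [not_le.2 (mem_Ioi.1 hy)]) measurableSet_Ioi

/-- The quantile coupling at one fixed scale turns the moment into an integral over a bounded
interval, where y^(-κ/β₁) is integrable at 0 because κ < β₁. -/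
lemma integrable_rpow_of_heavyTailed {F : Measure ℝ} [IsProbabilityMeasure F] (h0 : F (Iic 0) = 0)
    {α κ : ℝ} (h : IsRegularlyVarying (distTail F) (-α)) (hκ : 1 ≤ κ) (hκα : κ < α) :
    Integrable (fun r : ℝ => r ^ κ) F := by
  obtain ⟨β₁, hb1, hb2⟩ := exists_between hκα
  have hpos := distTail_pos_of_isRegularlyVarying h
  have hna : Tendsto (fun T => (distTail F T)⁻¹ * distTail F T) atTop (𝓝 1) :=
    tendsto_const_nhds.congr fun T => (inv_mul_cancel₀ (hpos T).ne').symm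
  have hn : Tendsto (fun T => (distTail F T)⁻¹) atTop atTop :=
    (tendsto_nhdsWithin_iff.2 ⟨tendsto_distTail_atTop F,
      Eventually.of_forall fun T => hpos T⟩).inv_tendsto_nhdsGT_zero
  obtain ⟨C, hC, hev⟩ := exists_scaled_tailQuantile_le h0 h hn tendsto_id hna
    (by linarith : (1 : ℝ) ≤ β₁) hb2 (lt_add_one α)
  obtain ⟨T, hT, hT0⟩ := (hev.and (eventually_gt_atTop 0)).exists
  set n := (distTail F T)⁻¹ with hn'
  have hn0 : 0 < n := inv_pos.2 (hpos T)
  have hm : Measurable fun y => tailQuantile F (y / n) :=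
    (measurable_tailQuantile h0).comp (measurable_id.div_const n)
  have hsm : Integrable (fun r : ℝ => r ^ κ) (ENNReal.ofReal n • F) := by
    rw [← map_tailQuantile h0 hn0, integrable_map_measure (by fun_prop) hm.aemeasurable]
    have hb : IntegrableOn (fun y : ℝ => (T * C) ^ κ * (y ^ (-(κ / β₁)) + 1)) (Ioo 0 n) := by
      refine Integrable.const_mul (Integrable.add ?_ (integrable_const _)) _
      have := (intervalIntegral.intervalIntegrable_rpow' (a := 0) (b := n) (r := -(κ / β₁))
        (by rw [neg_lt_neg_iff, div_lt_one (by linarith)]; exact hb1)).1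
      exact this.mono_set Ioo_subset_Ioc_self
    refine Integrable.mono' hb ((measurable_id.pow_const κ).comp hm).aestronglyMeasurable ?_
    filter_upwards [ae_restrict_mem measurableSet_Ioo] with y hy
    have hq := tailQuantile_nonneg h0 (y / n)
    have h1 := hT y hy
    rw [id, div_le_iff₀ hT0] at h1
    have hTC : 0 ≤ T * C := by positivity
    simp only [Function.comp]
    rw [Real.norm_of_nonneg (by positivity)]
    have hy0 : 0 < y := hy.1
    have h2 : (if y ≤ 1 then y ^ (-β₁⁻¹) else y ^ (-(α + 1)⁻¹)) ^ κ ≤ y ^ (-(κ / β₁)) + 1 := by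
      split_ifs with hy1
      · rw [← Real.rpow_mul hy0.le]
        have : -β₁⁻¹ * κ = -(κ / β₁) := by ring
        rw [this]; linarith
      · rw [← Real.rpow_mul hy0.le]
        have : y ^ (-(α + 1)⁻¹ * κ) ≤ 1 := by
          refine Real.rpow_le_one_of_one_le_of_nonpos (not_le.1 hy1).le ?_
          have : 0 ≤ (α + 1)⁻¹ * κ := mul_nonneg (inv_nonneg.2 (by linarith)) (by linarith)
          linarith
        linarith [Real.rpow_nonneg hy0.le (-(κ / β₁))]
    have h3 : 0 ≤ (if y ≤ 1 then y ^ (-β₁⁻¹) else y ^ (-(α + 1)⁻¹)) := by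
      split_ifs <;> positivity
    calc tailQuantile F (y / n) ^ κ
        ≤ ((T * C) * (if y ≤ 1 then y ^ (-β₁⁻¹) else y ^ (-(α + 1)⁻¹))) ^ κ :=
          Real.rpow_le_rpow hq (by linarith) (by linarith)
      _ = (T * C) ^ κ * (if y ≤ 1 then y ^ (-β₁⁻¹) else y ^ (-(α + 1)⁻¹)) ^ κ :=
          Real.mul_rpow hTC h3
      _ ≤ _ := by gcongr
  rwa [integrable_smul_measure (by simpa using hn0) ENNReal.ofReal_ne_top] at hsm

lemma integrable_rpow_of_finiteSecondMoment {F : Measure ℝ} [IsProbabilityMeasure F]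
    (h0 : F (Iic 0) = 0) (h : FiniteSecondMoment F) {κ : ℝ} (hκ : 1 ≤ κ) (hκ2 : κ ≤ 2) :
    Integrable (fun r : ℝ => r ^ κ) F := by
  have hb : Integrable (fun r : ℝ => 1 + r ^ 2) F := (integrable_const _).add h
  refine hb.mono' (by fun_prop) ?_
  have : ∀ᵐ r ∂F, 0 < r := by
    rw [ae_iff]; convert h0 using 2; ext; simp
  filter_upwards [this] with r hr
  rw [Real.norm_of_nonneg (by positivity)]
  rcases le_total r 1 with h1 | h1
  · linarith [Real.rpow_le_one hr.le h1 (by linarith : 0 ≤ κ), sq_nonneg r]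
  · have := Real.rpow_le_rpow_of_exponent_le h1 hκ2
    rw [Real.rpow_two] at this
    linarith

lemma div_one_add_abs_rpow_le {u s κ κ' : ℝ} (hu : 0 ≤ u) (hκ : κ ≤ κ') :
    (u / (1 + |s|)) ^ κ' ≤ u ^ κ' * (1 + ‖s‖) ^ (-κ) := by
  rw [Real.norm_eq_abs, Real.div_rpow hu (by positivity), div_eq_mul_inv,
    ← Real.rpow_neg (by positivity)]
  gcongr
  linarith [abs_nonneg s]

/-- The exponent κ₁ < α controls infinity and κ₂ > α controls 0. -/
lemma integrable_min_rpow_powerMeasure {α κ₁ κ₂ : ℝ} (h0 : 0 < α) (h1 : κ₁ < α) (h2 : α < κ₂) :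
    Integrable (fun u : ℝ => min (u ^ κ₁) (u ^ κ₂)) (powerMeasure α) := by
  rw [← map_rpow_eq_powerMeasure h0, integrable_map_measure (by fun_prop) (by fun_prop)]
  refine Integrable.mono' (integrableOn_ite_rpow (p := κ₁ / α) (q := κ₂ / α)
    ((div_lt_one h0).2 h1) ((one_lt_div h0).2 h2)) (by fun_prop) ?_
  filter_upwards [ae_restrict_mem measurableSet_Ioi] with y hy
  have hy0 : 0 < y := hy
  simp only [Function.comp]
  rw [Real.norm_of_nonneg (by positivity), ← Real.rpow_mul hy0.le, ← Real.rpow_mul hy0.le]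
  have e1 : -α⁻¹ * κ₁ = -(κ₁ / α) := by ring
  have e2 : -α⁻¹ * κ₂ = -(κ₂ / α) := by ring
  rw [e1, e2]
  split_ifs
  · exact min_le_left _ _
  · exact min_le_right _ _

/-- The hypothesis is the pair of bounds used in `tendsto_integral_scaled`, now for the limit
measure itself. -/
lemma integrable_of_norm_le_powerMeasure {E : Type*} [NormedAddCommGroup E] {ρ : Measure ℝ}
    [SFinite ρ] {α κ₁ κ₂ : ℝ} (h0 : 1 < κ₁) (h1 : κ₁ < α) (h2 : α < κ₂) {v : ℝ → ℝ}
    (hv : Integrable v ρ) {g : ℝ × ℝ × ℝ → E}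
    (hg : AEStronglyMeasurable g ((volume : Measure ℝ).prod ((powerMeasure α).prod ρ)))
    (hb : ∀ s u x, 0 < u → ‖g (s, u, x)‖ ≤ v x * (u / (1 + |s|)) ^ κ₁ ∧
      ‖g (s, u, x)‖ ≤ v x * (u / (1 + |s|)) ^ κ₂) :
    Integrable g ((volume : Measure ℝ).prod ((powerMeasure α).prod ρ)) := by
  have hv0 : ∀ x, 0 ≤ v x := fun x => by
    have := (norm_nonneg _).trans (hb 0 1 x one_pos).1
    simpa using this
  have hs : Integrable (fun s : ℝ => (1 + ‖s‖) ^ (-κ₁)) := integrable_one_add_norm (by simpa)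
  have hd := hs.mul_prod ((integrable_min_rpow_powerMeasure (by linarith) h1 h2).mul_prod hv)
  refine hd.mono' hg ?_
  have hpos : ∀ᵐ p ∂((volume : Measure ℝ).prod ((powerMeasure α).prod ρ)), 0 < p.2.1 :=
    Measure.quasiMeasurePreserving_snd.ae
      (Measure.quasiMeasurePreserving_fst.ae (ae_powerMeasure_pos α))
  filter_upwards [hpos] with ⟨s, u, x⟩ hu
  simp only at hu ⊢
  obtain ⟨b1, b2⟩ := hb s u x hu
  have c1 := div_one_add_abs_rpow_le (s := s) hu.le (le_refl κ₁)
  have c2 := div_one_add_abs_rpow_le (s := s) hu.le (h1.trans h2).le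
  have : (1 + ‖s‖) ^ (-κ₁) * (min (u ^ κ₁) (u ^ κ₂) * v x) =
      min (v x * (u ^ κ₁ * (1 + ‖s‖) ^ (-κ₁))) (v x * (u ^ κ₂ * (1 + ‖s‖) ^ (-κ₁))) := by
    rw [← mul_min_of_nonneg _ _ (hv0 x), ← min_mul_of_nonneg _ _ (by positivity)]
    ring
  rw [this]
  exact le_min (b1.trans (mul_le_mul_of_nonneg_left c1 (hv0 x)))
    (b2.trans (mul_le_mul_of_nonneg_left c2 (hv0 x)))

/-! ### The limit theorem for scaled duration laws -/

/-- Vague convergence of `n F(a du)` to the power measure, with dominated integrands. -/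
theorem tendsto_integral_scaled {F ρ : Measure ℝ} [IsProbabilityMeasure F] [SFinite ρ]
    (h0 : F (Iic 0) = 0) {α : ℝ} (h : IsRegularlyVarying (distTail F) (-α)) {n a : ℝ → ℝ}
    (hn : Tendsto n atTop atTop) (ha : Tendsto a atTop atTop)
    (hna : Tendsto (fun T => n T * distTail F (a T)) atTop (𝓝 1))
    {κ₁ κ₂ : ℝ} (hκ₁ : 1 < κ₁) (h1 : κ₁ < α) (h2 : α < κ₂) {v : ℝ → ℝ} (hv : Integrable v ρ)
    {Φ : ℝ → ℝ × ℝ × ℝ → ℂ} (hΦ : ∀ T, Measurable (Φ T))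
    (hb : ∀ᶠ T in atTop, ∀ s u x, 0 ≤ u → ‖Φ T (s, u, x)‖ ≤ v x * (u / (1 + |s|)) ^ κ₁ ∧
      ‖Φ T (s, u, x)‖ ≤ v x * (u / (1 + |s|)) ^ κ₂)
    {Ψ : ℝ × ℝ × ℝ → ℂ} (hΨ : Measurable Ψ) {p q : ℝ → Prop} (hp : ∀ᵐ s, p s)
    (hq : ∀ᵐ x ∂ρ, q x)
    (hlim : ∀ s u x, p s → 0 < u → q x → ∀ w : ℝ → ℝ, Tendsto w atTop (𝓝 u) → (∀ T, 0 ≤ w T) →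
      Tendsto (fun T => Φ T (s, w T, x)) atTop (𝓝 (Ψ (s, u, x)))) :
    Tendsto (fun T => (n T : ℂ) * ∫ y, Φ T (y.1, y.2.1 / a T, y.2.2)
      ∂((volume : Measure ℝ).prod (F.prod ρ))) atTop
      (𝓝 (∫ y, Ψ y ∂((volume : Measure ℝ).prod ((powerMeasure α).prod ρ)))) := by
  have hα : 0 < α := by linarith
  -- With κ₁ < β₁ < α < β₂ < κ₂, the majorant has exponent κ₁/β₁ < 1 near y = 0 and κ₂/β₂ > 1 at
  -- infinity.
  obtain ⟨β₁, hb1, hb2⟩ := exists_between h1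
  obtain ⟨β₂, hb3, hb4⟩ := exists_between h2
  obtain ⟨C, hC, hev⟩ := exists_scaled_tailQuantile_le h0 h hn ha hna
    (by linarith : (1 : ℝ) ≤ β₁) hb2 hb3
  have hv0 : ∀ x, 0 ≤ v x := fun x => by
    obtain ⟨T, hT⟩ := hb.exists
    have := (norm_nonneg _).trans (hT 0 1 x zero_le_one).1
    simpa using this
  set Q : ℝ → ℝ → ℝ := fun T y => tailQuantile F (y / n T) / a T with hQ
  have hQm : ∀ T, Measurable (Q T) := fun T =>
    ((measurable_tailQuantile h0).comp (measurable_id.div_const (n T))).div_const _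
  -- the coupled form of the integral
  have key : ∀ᶠ T in atTop, (n T : ℂ) * ∫ y, Φ T (y.1, y.2.1 / a T, y.2.2)
      ∂((volume : Measure ℝ).prod (F.prod ρ)) =
      ∫ y, {y : ℝ × ℝ × ℝ | y.2.1 < n T}.indicator (fun y => Φ T (y.1, Q T y.2.1, y.2.2)) y
        ∂((volume : Measure ℝ).prod ((volume.restrict (Ioi 0)).prod ρ)) := by
    filter_upwards [hn.eventually_gt_atTop 0] with T hT
    have hm : Measurable fun y => tailQuantile F (y / n T) :=
      (measurable_tailQuantile h0).comp (measurable_id.div_const (n T))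
    have hS : MeasurableSet {y : ℝ × ℝ × ℝ | y.2.1 < n T} :=
      measurableSet_lt (by fun_prop) measurable_const
    have hS' : MeasurableSet {y : ℝ | y < n T} := measurableSet_lt measurable_id measurable_const
    have e1 : {y : ℝ × ℝ × ℝ | y.2.1 < n T} = univ ×ˢ ({y : ℝ | y < n T} ×ˢ univ) := by
      ext; simp
    have e5 : {y : ℝ | y < n T} ∩ Ioi 0 = Ioo 0 (n T) := by
      ext y; simp [and_comm]
    have e2 : ((volume : Measure ℝ).prod ((volume.restrict (Ioi 0)).prod ρ)).restrict
        {y : ℝ × ℝ × ℝ | y.2.1 < n T} =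
        (volume : Measure ℝ).prod ((volume.restrict (Ioo 0 (n T))).prod ρ) := by
      rw [e1, ← Measure.prod_restrict, Measure.restrict_univ, ← Measure.prod_restrict,
        Measure.restrict_univ, Measure.restrict_restrict hS', e5]
    have e3 : ((volume : Measure ℝ).prod ((volume.restrict (Ioo 0 (n T))).prod ρ)).map
        (Prod.map id (Prod.map (fun y => tailQuantile F (y / n T)) id)) =
        ENNReal.ofReal (n T) • ((volume : Measure ℝ).prod (F.prod ρ)) := by
      have : SFinite (Measure.map (fun y => tailQuantile F (y / n T))
        (volume.restrict (Ioo 0 (n T)))) := inferInstance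
      rw [← Measure.map_prod_map _ _ measurable_id (hm.prodMap measurable_id),
        ← Measure.map_prod_map _ _ hm measurable_id, map_tailQuantile h0 hT,
        Measure.map_id, Measure.map_id, Measure.prod_smul_left, Measure.prod_smul_right]
    rw [integral_indicator hS, e2]
    have e4 : ∫ y, Φ T (y.1, y.2.1 / a T, y.2.2)
        ∂(ENNReal.ofReal (n T) • ((volume : Measure ℝ).prod (F.prod ρ))) =
        ∫ y, Φ T (y.1, Q T y.2.1, y.2.2)
          ∂((volume : Measure ℝ).prod ((volume.restrict (Ioo 0 (n T))).prod ρ)) := by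
      rw [← e3, integral_map]
      · rfl
      · exact (measurable_id.prodMap (hm.prodMap measurable_id)).aemeasurable
      · exact ((hΦ T).comp (by fun_prop)).aestronglyMeasurable
    rw [← e4, integral_smul_measure, ENNReal.toReal_ofReal hT.le, Complex.real_smul]
  -- the limit integral
  have hlimit : ∫ y, Ψ y ∂((volume : Measure ℝ).prod ((powerMeasure α).prod ρ)) =
      ∫ y, Ψ (y.1, y.2.1 ^ (-α⁻¹), y.2.2)
        ∂((volume : Measure ℝ).prod ((volume.restrict (Ioi 0)).prod ρ)) := by
    have hm : Measurable fun y : ℝ => y ^ (-α⁻¹) := by fun_prop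
    have e3 : ((volume : Measure ℝ).prod ((volume.restrict (Ioi 0)).prod ρ)).map
        (Prod.map id (Prod.map (fun y : ℝ => y ^ (-α⁻¹)) id)) =
        (volume : Measure ℝ).prod ((powerMeasure α).prod ρ) := by
      rw [← Measure.map_prod_map _ _ measurable_id (hm.prodMap measurable_id),
        ← Measure.map_prod_map _ _ hm measurable_id, map_rpow_eq_powerMeasure hα,
        Measure.map_id, Measure.map_id]
    rw [← e3, integral_map]
    · rfl
    · exact (measurable_id.prodMap (hm.prodMap measurable_id)).aemeasurable
    · exact hΨ.aestronglyMeasurable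
  rw [hlimit]
  refine Tendsto.congr' (key.mono fun T hT => hT.symm) ?_
  have hposy : ∀ᵐ y : ℝ × ℝ × ℝ ∂((volume : Measure ℝ).prod ((volume.restrict (Ioi (0 : ℝ))).prod ρ)),
      0 < y.2.1 := by
    have : ∀ᵐ y ∂((volume : Measure ℝ).restrict (Ioi 0)), 0 < y := ae_restrict_mem measurableSet_Ioi
    exact Measure.quasiMeasurePreserving_snd.ae (Measure.quasiMeasurePreserving_fst.ae this)
  -- Integrability in the starting time uses κ₁ > 1, hence α > 1. The bound with κ₂ decays faster in
  -- s and is weakened to the same factor.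
  have hs : Integrable (fun s : ℝ => (1 + ‖s‖) ^ (-κ₁)) := integrable_one_add_norm (by simpa)
  have hw := integrableOn_ite_rpow (p := κ₁ / β₁) (q := κ₂ / β₂)
    ((div_lt_one (by linarith)).2 hb1) ((one_lt_div (by linarith)).2 hb4)
  have hd := (hs.mul_prod (Integrable.mul_prod hw hv)).const_mul (C ^ κ₂)
  refine tendsto_integral_filter_of_dominated_convergence _ (Eventually.of_forall fun T => ?_)
    ?_ hd ?_
  · refine (Measurable.indicator ?_ (measurableSet_lt (by fun_prop)
      measurable_const)).aestronglyMeasurable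
    have := hQm T
    exact (hΦ T).comp (by fun_prop)
  · filter_upwards [hb, hev, ha.eventually_gt_atTop 0] with T hbT hevT haT
    filter_upwards [hposy] with ⟨s, y, x⟩ hy
    simp only at hy ⊢
    have hC0 : 0 ≤ C ^ κ₂ := by positivity
    have hsp : 0 ≤ (1 + ‖s‖) ^ (-κ₁) := by positivity
    have hR : 0 ≤ C ^ κ₂ * ((1 + ‖s‖) ^ (-κ₁) *
        ((if y ≤ 1 then y ^ (-(κ₁ / β₁)) else y ^ (-(κ₂ / β₂))) * v x)) := by
      have := hv0 x
      split_ifs <;> positivity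
    by_cases hyn : y < n T
    · rw [indicator_of_mem (by exact hyn)]
      have hq0 : 0 ≤ Q T y := div_nonneg (tailQuantile_nonneg h0 _) haT.le
      obtain ⟨b1, b2⟩ := hbT s (Q T y) x hq0
      have hQb := hevT y ⟨hy, hyn⟩
      by_cases hy1 : y ≤ 1
      · rw [if_pos hy1] at hQb ⊢
        have c1 := div_one_add_abs_rpow_le (s := s) hq0 (le_refl κ₁)
        have c2 : Q T y ^ κ₁ ≤ C ^ κ₂ * y ^ (-(κ₁ / β₁)) := by
          calc Q T y ^ κ₁ ≤ (C * y ^ (-β₁⁻¹)) ^ κ₁ := Real.rpow_le_rpow hq0 hQb (by linarith)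
            _ = C ^ κ₁ * y ^ (-(κ₁ / β₁)) := by
              rw [Real.mul_rpow (by linarith) (by positivity), ← Real.rpow_mul hy.le]
              congr 2; ring
            _ ≤ _ := by gcongr; linarith
        calc _ ≤ v x * (Q T y / (1 + |s|)) ^ κ₁ := b1
          _ ≤ v x * (C ^ κ₂ * y ^ (-(κ₁ / β₁)) * (1 + ‖s‖) ^ (-κ₁)) :=
            mul_le_mul_of_nonneg_left (c1.trans (mul_le_mul_of_nonneg_right c2 hsp)) (hv0 x)
          _ = _ := by ring
      · rw [if_neg hy1] at hQb ⊢
        have c1 := div_one_add_abs_rpow_le (s := s) hq0 (h1.trans h2).le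
        have c2 : Q T y ^ κ₂ ≤ C ^ κ₂ * y ^ (-(κ₂ / β₂)) := by
          calc Q T y ^ κ₂ ≤ (C * y ^ (-β₂⁻¹)) ^ κ₂ := Real.rpow_le_rpow hq0 hQb (by linarith)
            _ = C ^ κ₂ * y ^ (-(κ₂ / β₂)) := by
              rw [Real.mul_rpow (by linarith) (by positivity), ← Real.rpow_mul hy.le]
              congr 2; ring
        calc _ ≤ v x * (Q T y / (1 + |s|)) ^ κ₂ := b2
          _ ≤ v x * (C ^ κ₂ * y ^ (-(κ₂ / β₂)) * (1 + ‖s‖) ^ (-κ₁)) :=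
            mul_le_mul_of_nonneg_left (c1.trans (mul_le_mul_of_nonneg_right c2 hsp)) (hv0 x)
          _ = _ := by ring
    · rw [indicator_of_notMem (by exact hyn), norm_zero]
      exact hR
  · have hpa : ∀ᵐ y : ℝ × ℝ × ℝ ∂((volume : Measure ℝ).prod ((volume.restrict (Ioi (0 : ℝ))).prod ρ)), p y.1 :=
      Measure.quasiMeasurePreserving_fst.ae hp
    have hqa : ∀ᵐ y : ℝ × ℝ × ℝ ∂((volume : Measure ℝ).prod ((volume.restrict (Ioi (0 : ℝ))).prod ρ)), q y.2.2 :=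
      Measure.quasiMeasurePreserving_snd.ae (Measure.quasiMeasurePreserving_snd.ae hq)
    filter_upwards [hposy, hpa, hqa] with ⟨s, y, x⟩ hy hs hx
    simp only at hy hs hx ⊢
    have hQl := tendsto_scaled_tailQuantile h0 h hα hn ha hna hy
    -- The hypothesis `hlim` asks for a nonnegative path at every T, while `a T` may be negative for
    -- small T; the absolute value changes nothing eventually.
    have hQl' : Tendsto (fun T => |Q T y|) atTop (𝓝 (y ^ (-α⁻¹))) := by
      have := hQl.abs
      rwa [abs_of_pos (Real.rpow_pos_of_pos hy _)] at this
    refine (hlim s _ x hs (Real.rpow_pos_of_pos hy _) hx _ hQl' fun T => abs_nonneg _).congr' ?_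
    filter_upwards [hn.eventually_gt_atTop y, ha.eventually_gt_atTop 0] with T h3 h4
    rw [indicator_of_mem (by exact h3), abs_of_nonneg (div_nonneg (tailQuantile_nonneg h0 _) h4.le)]

/-! ### Overlap functionals and the limits of the exponents in the three scenarios -/

/-- The overlap functional `∑ i, z i * L_{t i}(s, u)`. -/
noncomputable def overlapSum {m : ℕ} (t : Fin m → ℝ≥0) (z : Fin m → ℝ) (s u : ℝ) : ℝ :=
  ∑ i, z i * sessionOverlap (t i) s u

section overlapSum

variable {m : ℕ} (t : Fin m → ℝ≥0) (z : Fin m → ℝ)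

lemma continuous_overlapSum : Continuous fun p : ℝ × ℝ => overlapSum t z p.1 p.2 :=
  continuous_finsetSum _ fun i _ => (continuous_sessionOverlap (t i)).const_mul (z i)

lemma tendsto_overlapSum {w : ℝ → ℝ} {s u : ℝ} (hw : Tendsto w atTop (𝓝 u)) :
    Tendsto (fun T => overlapSum t z s (w T)) atTop (𝓝 (overlapSum t z s u)) := by
  have h1 := (continuous_overlapSum t z).tendsto (s, u)
  have h2 : Tendsto (fun T => (s, w T)) atTop (𝓝 (s, u)) := tendsto_const_nhds.prodMk_nhds hw
  have h3 := h1.comp h2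
  exact h3

lemma exists_abs_overlapSum_le : ∃ C : ℝ, 1 ≤ C ∧ ∀ s u, 0 ≤ u →
    |overlapSum t z s u| ≤ C * min 1 (u / (1 + |s|)) := by
  refine ⟨1 + ∑ i, |z i| * (1 + t i), ?_, fun s u hu => ?_⟩
  · have : 0 ≤ ∑ i, |z i| * (1 + (t i : ℝ)) := Finset.sum_nonneg fun i _ => by positivity
    linarith
  · have hm : 0 ≤ min 1 (u / (1 + |s|)) := le_min zero_le_one (by positivity)
    calc |overlapSum t z s u| ≤ ∑ i, |z i * sessionOverlap (t i) s u| :=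
          Finset.abs_sum_le_sum_abs _ _
      _ ≤ ∑ i, |z i| * (1 + t i) * min 1 (u / (1 + |s|)) := by
          refine Finset.sum_le_sum fun i _ => ?_
          rw [abs_mul, abs_of_nonneg (sessionOverlap_nonneg _ _ _), mul_assoc]
          exact mul_le_mul_of_nonneg_left (sessionOverlap_le (t i).2 hu s) (abs_nonneg _)
      _ ≤ _ := by
          rw [← Finset.sum_mul]
          exact mul_le_mul_of_nonneg_right (by linarith) hm

end overlapSum

lemma measurable_centeredExp_comp {E : Type*} [MeasurableSpace E] {f : E → ℝ} (hf : Measurable f) :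
    Measurable fun x => centeredExp (f x) :=
  continuous_centeredExp.measurable.comp hf

lemma norm_centeredExp_mul_le {C x y m κ : ℝ} (h1 : 1 ≤ κ) (h2 : κ ≤ 2) (hC : 0 ≤ C) (hm : 0 ≤ m)
    (hy : |y| ≤ C * m) : ‖centeredExp (x * y)‖ ≤ 2 * C ^ κ * |x| ^ κ * m ^ κ := by
  refine (norm_centeredExp_le_rpow h1 h2 _).trans ?_
  rw [abs_mul]
  have : (|x| * |y|) ^ κ ≤ (|x| * (C * m)) ^ κ :=
    Real.rpow_le_rpow (by positivity) (mul_le_mul_of_nonneg_left hy (abs_nonneg _)) (by linarith)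
  rw [Real.mul_rpow (abs_nonneg x) (mul_nonneg hC hm), Real.mul_rpow hC hm] at this
  linarith

section Scenarios

variable {F FR : Measure ℝ} [IsProbabilityMeasure F] {α : ℝ} {m : ℕ} (t : Fin m → ℝ≥0)
  (z : Fin m → ℝ)

/-- The scaling n = 1/F̄(T), a = T, for which n F̄(a) is identically 1. -/
lemma tendsto_inv_distTail (h : IsRegularlyVarying (distTail F) (-α)) :
    Tendsto (fun T => (distTail F T)⁻¹) atTop atTop ∧
    Tendsto (fun T => (distTail F T)⁻¹ * distTail F (id T)) atTop (𝓝 1) := by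
  have hpos := distTail_pos_of_isRegularlyVarying h
  exact ⟨(tendsto_nhdsWithin_iff.2 ⟨tendsto_distTail_atTop F,
    Eventually.of_forall fun T => hpos T⟩).inv_tendsto_nhdsGT_zero,
    tendsto_const_nhds.congr fun T => (inv_mul_cancel₀ (hpos T).ne').symm⟩

lemma measurable_overlapSum_comp (a : ℝ) : Measurable fun y : ℝ × ℝ × ℝ =>
    overlapSum t z y.1 (y.2.1 / a) := by
  have h1 : Measurable fun y : ℝ × ℝ × ℝ => (y.1, y.2.1 / a) := by fun_prop
  have h2 := (continuous_overlapSum t z).measurable.comp h1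
  exact h2

lemma measurable_overlapSum : Measurable fun y : ℝ × ℝ × ℝ => overlapSum t z y.1 y.2.1 := by
  have h1 : Measurable fun y : ℝ × ℝ × ℝ => (y.1, y.2.1) := by fun_prop
  have h2 := (continuous_overlapSum t z).measurable.comp h1
  exact h2

/-- Write λT = (λT F̄(T)) · (1/F̄(T)): the first factor tends to θ, and the second normalises the
durations in units of T. The integrand does not depend on T. -/
lemma tendsto_exponent_moderate [SFinite FR] (h0 : F (Iic 0) = 0)
    (h : IsRegularlyVarying (distTail F) (-α)) (h1 : 1 < α) {κ₂ : ℝ} (hκ : α < κ₂) (hκ2 : κ₂ ≤ 2)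
    (hmom : ∀ κ, 1 ≤ κ → κ ≤ κ₂ → Integrable (fun r : ℝ => |r| ^ κ) FR) {l : ℝ → ℝ} {θ : ℝ}
    (hl : Tendsto (fun T => l T * T * distTail F T) atTop (𝓝 θ)) :
    Tendsto (fun T => ((l T * T : ℝ) : ℂ) *
      -- The quotient `T / T` is the general factor T / a with a = T, kept so that the form agrees
      -- with the exact exponent.
      ∫ y, centeredExp (y.2.2 * (T / T * overlapSum t z y.1 (y.2.1 / T)))
        ∂((volume : Measure ℝ).prod (F.prod FR))) atTop
      (𝓝 (θ * ∫ y, centeredExp (y.2.2 * overlapSum t z y.1 y.2.1) ∂(limitMean α FR))) := by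
  obtain ⟨C, hC, hS⟩ := exists_abs_overlapSum_le t z
  obtain ⟨κ₁, hk1, hk2⟩ := exists_between h1
  obtain ⟨hn, hna⟩ := tendsto_inv_distTail h
  have hpos := distTail_pos_of_isRegularlyVarying h
  have hm : Measurable fun y : ℝ × ℝ × ℝ => centeredExp (y.2.2 * overlapSum t z y.1 y.2.1) :=
    measurable_centeredExp_comp ((by fun_prop : Measurable fun y : ℝ × ℝ × ℝ => y.2.2).mul
      (measurable_overlapSum t z))
  have key := tendsto_integral_scaled h0 h hn tendsto_id hna hk1 hk2 hκ
    (v := fun x => 2 * C ^ κ₁ * |x| ^ κ₁ + 2 * C ^ κ₂ * |x| ^ κ₂)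
    (((hmom κ₁ hk1.le (hk2.trans hκ).le).const_mul _).add ((hmom κ₂ (by linarith) le_rfl).const_mul _))
    (Φ := fun _ y => centeredExp (y.2.2 * overlapSum t z y.1 y.2.1))
    (fun _ => hm) (Eventually.of_forall fun T s u x hu => ?_)
    (Ψ := fun y => centeredExp (y.2.2 * overlapSum t z y.1 y.2.1)) hm (p := fun _ => True)
    (q := fun _ => True) (by simp) (by simp) ?_
  · refine ((Complex.continuous_ofReal.tendsto _).comp hl).mul key |>.congr' ?_
    filter_upwards [eventually_gt_atTop 0] with T hT
    have : (distTail F T : ℂ) ≠ 0 := Complex.ofReal_ne_zero.2 (hpos T).ne'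
    simp only [Function.comp, div_self hT.ne', one_mul, id]
    push_cast
    field_simp
  · have hb : |overlapSum t z s u| ≤ C * (u / (1 + |s|)) :=
      (hS s u hu).trans (mul_le_mul_of_nonneg_left (min_le_right _ _) (by linarith))
    have hm0 : 0 ≤ u / (1 + |s|) := by positivity
    have b1 := norm_centeredExp_mul_le (x := x) hk1.le (by linarith) (by linarith) hm0 hb
    have b2 := norm_centeredExp_mul_le (x := x) (by linarith : 1 ≤ κ₂) hκ2 (by linarith) hm0 hb
    refine ⟨b1.trans (mul_le_mul_of_nonneg_right ?_ (by positivity)),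
      b2.trans (mul_le_mul_of_nonneg_right ?_ (by positivity))⟩
    · have : 0 ≤ 2 * C ^ κ₂ * |x| ^ κ₂ := by positivity
      linarith
    · have : 0 ≤ 2 * C ^ κ₁ * |x| ^ κ₁ := by positivity
      linarith
  · intro s u x _ _ _ w hw _
    exact (continuous_centeredExp.tendsto _).comp ((tendsto_overlapSum t z hw).const_mul x)

lemma norm_centeredExp_add_sq_le {y : ℝ} (hy : |y| ≤ 1) :
    ‖centeredExp y + (y ^ 2 / 2 : ℝ)‖ ≤ |y| ^ 3 := by
  have hn : ‖Complex.I * (y : ℂ)‖ = |y| := by simp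
  have := Complex.exp_bound (x := Complex.I * y) (by rw [hn]; exact hy) (n := 3) (by norm_num)
  rw [hn] at this
  have e : Complex.exp (Complex.I * y) - ∑ m ∈ Finset.range 3, (Complex.I * (y : ℂ)) ^ m / (m.factorial : ℂ) =
      centeredExp y + (y ^ 2 / 2 : ℝ) := by
    simp only [Finset.sum_range_succ, Finset.sum_range_zero, centeredExp]
    simp only [Nat.factorial]
    push_cast
    have : (Complex.I * (y : ℂ)) ^ 2 = - (y : ℂ) ^ 2 := by rw [mul_pow, Complex.I_sq]; ring
    rw [this]
    ring
  rw [e] at this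
  refine this.trans ?_
  have h3 : 0 ≤ |y| ^ 3 := by positivity
  norm_num [Nat.factorial]
  nlinarith

lemma tendsto_mul_centeredExp_div_sqrt {N x : ℝ → ℝ} {x₀ : ℝ} (hN : Tendsto N atTop atTop)
    (hx : Tendsto x atTop (𝓝 x₀)) :
    Tendsto (fun T => (N T : ℂ) * centeredExp (x T / √(N T))) atTop (𝓝 ((-(x₀ ^ 2 / 2) : ℝ) : ℂ)) := by
  have hsq : Tendsto (fun T => √(N T)) atTop atTop := Real.tendsto_sqrt_atTop.comp hN
  have hy : Tendsto (fun T => x T / √(N T)) atTop (𝓝 0) := hx.div_atTop hsq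
  have h1 : Tendsto (fun T => (N T : ℂ) * (centeredExp (x T / √(N T)) + ((x T / √(N T)) ^ 2 / 2 : ℝ)))
      atTop (𝓝 0) := by
    refine squeeze_zero_norm' (a := fun T => |x T| ^ 2 * |x T / √(N T)|) ?_ ?_
    · filter_upwards [hy.abs.eventually_le_const (by simp : |(0:ℝ)| < 1), hN.eventually_gt_atTop 0]
        with T h1 h2
      rw [norm_mul, Complex.norm_real, Real.norm_of_nonneg h2.le]
      refine (mul_le_mul_of_nonneg_left (norm_centeredExp_add_sq_le h1) h2.le).trans (le_of_eq ?_)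
      rw [pow_succ, ← mul_assoc]
      congr 1
      rw [abs_div, div_pow, sq_abs √(N T), Real.sq_sqrt h2.le]
      field_simp
    · simpa using (hx.abs.pow 2).mul hy.abs
  have h2 : Tendsto (fun T => ((-(x T ^ 2 / 2) : ℝ) : ℂ)) atTop (𝓝 ((-(x₀ ^ 2 / 2) : ℝ) : ℂ)) :=
    (Complex.continuous_ofReal.tendsto _).comp ((hx.pow 2).div_const 2).neg
  have := h1.add h2
  rw [zero_add] at this
  refine this.congr' ?_
  filter_upwards [hN.eventually_gt_atTop 0] with T h3
  rw [div_pow, Real.sq_sqrt h3.le]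
  have : (N T : ℂ) ≠ 0 := Complex.ofReal_ne_zero.2 h3.ne'
  push_cast
  field_simp
  ring

/-- With N = λT F̄(T) the normalisation is a = T √N, so each session contributes x/√N. There are of
order N relevant sessions, and only the quadratic Taylor term survives. -/
lemma tendsto_exponent_fast_gaussian [SFinite FR] (h0 : F (Iic 0) = 0)
    (h : IsRegularlyVarying (distTail F) (-α)) (h1 : 1 < α) (h2 : α < 2)
    (hmom : Integrable (fun r : ℝ => r ^ 2) FR) {l : ℝ → ℝ}
    (hl : Tendsto (fun T => l T * T * distTail F T) atTop atTop) :
    Tendsto (fun T => ((l T * T : ℝ) : ℂ) *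
      ∫ y, centeredExp (y.2.2 * (T / (l T * T ^ 3 * distTail F T) ^ (1 / 2 : ℝ) *
        overlapSum t z y.1 (y.2.1 / T))) ∂((volume : Measure ℝ).prod (F.prod FR))) atTop
      (𝓝 (∫ y, ((-((y.2.2 * overlapSum t z y.1 y.2.1) ^ 2 / 2) : ℝ) : ℂ) ∂(limitMean α FR))) := by
  obtain ⟨C, hC, hS⟩ := exists_abs_overlapSum_le t z
  obtain ⟨κ₁, hk1, hk2⟩ := exists_between h1
  obtain ⟨hn, hna⟩ := tendsto_inv_distTail h
  have hpos := distTail_pos_of_isRegularlyVarying h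
  have hm : Measurable fun y : ℝ × ℝ × ℝ => y.2.2 * overlapSum t z y.1 y.2.1 :=
    (by fun_prop : Measurable fun y : ℝ × ℝ × ℝ => y.2.2).mul (measurable_overlapSum t z)
  set N : ℝ → ℝ := fun T => l T * T * distTail F T with hN
  have key := tendsto_integral_scaled h0 h hn tendsto_id hna hk1 hk2 h2
    (v := fun x => 2 * C ^ 2 * x ^ 2) (hmom.const_mul _)
    (Φ := fun T y => (N T : ℂ) * centeredExp (y.2.2 * overlapSum t z y.1 y.2.1 / √(N T)))
    (fun T => (measurable_centeredExp_comp (hm.div_const _)).const_mul _) ?_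
    (Ψ := fun y => ((-((y.2.2 * overlapSum t z y.1 y.2.1) ^ 2 / 2) : ℝ) : ℂ))
    (Complex.measurable_ofReal.comp ((hm.pow_const 2).div_const 2).neg) (p := fun _ => True)
    (q := fun _ => True) (by simp) (by simp) ?_
  · refine key.congr' ?_
    filter_upwards [eventually_gt_atTop 0, hl.eventually_gt_atTop 0] with T hT hNT
    rw [integral_const_mul, ← mul_assoc]
    congr 1
    · have : (distTail F T : ℂ) ≠ 0 := Complex.ofReal_ne_zero.2 (hpos T).ne'
      simp only [hN]
      push_cast
      field_simp
    · congr 1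
      ext y
      have e : l T * T ^ 3 * distTail F T = T ^ 2 * N T := by simp only [hN]; ring
      rw [e, ← Real.sqrt_eq_rpow, Real.sqrt_mul (sq_nonneg T), Real.sqrt_sq hT.le, id]
      congr 1
      field_simp
  · filter_upwards [hl.eventually_gt_atTop 0] with T hNT s u x hu
    have hm0 : 0 ≤ u / (1 + |s|) := by positivity
    set μ := min 1 (u / (1 + |s|)) with hμ
    have hμ0 : 0 ≤ μ := le_min zero_le_one hm0
    have hμ1 : μ ≤ 1 := min_le_left _ _
    have b : ‖(N T : ℂ) * centeredExp (x * overlapSum t z s u / √(N T))‖ ≤ 2 * C ^ 2 * x ^ 2 * μ ^ 2 := by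
      rw [norm_mul, Complex.norm_real, Real.norm_of_nonneg hNT.le]
      refine (mul_le_mul_of_nonneg_left (norm_centeredExp_le_sq _) hNT.le).trans ?_
      rw [div_pow, Real.sq_sqrt hNT.le]
      have e : l T * T * distTail F T * (2 * ((x * overlapSum t z s u) ^ 2 / N T)) =
          2 * x ^ 2 * overlapSum t z s u ^ 2 := by
        change N T * _ = _
        have : N T ≠ 0 := hNT.ne'
        field_simp
      rw [e]
      have : overlapSum t z s u ^ 2 ≤ (C * μ) ^ 2 := by
        rw [← sq_abs]
        exact pow_le_pow_left₀ (abs_nonneg _) (hS s u hu) 2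
      calc 2 * x ^ 2 * overlapSum t z s u ^ 2 ≤ 2 * x ^ 2 * (C * μ) ^ 2 := by gcongr
        _ = _ := by ring
    -- As μ ≤ 1, its square lies below every power of exponent at most 2; this supplies the bounds
    -- with κ₁ and with 2 from one quadratic estimate.
    have c : ∀ η : ℝ, 1 ≤ η → η ≤ 2 → μ ^ 2 ≤ (u / (1 + |s|)) ^ η := by
      intro η hη1 hη2
      rcases hμ0.eq_or_lt with h | h
      · rw [← h]; simp; positivity
      calc μ ^ 2 = μ ^ (2 : ℝ) := (Real.rpow_two _).symm
        _ ≤ μ ^ η := Real.rpow_le_rpow_of_exponent_ge h hμ1 hη2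
        _ ≤ _ := Real.rpow_le_rpow hμ0 (min_le_right _ _) (by linarith)
    exact ⟨b.trans (mul_le_mul_of_nonneg_left (c κ₁ hk1.le (by linarith)) (by positivity)),
      b.trans (mul_le_mul_of_nonneg_left (c 2 (by linarith) le_rfl) (by positivity))⟩
  · intro s u x _ _ _ w hw _
    exact tendsto_mul_centeredExp_div_sqrt hl ((tendsto_overlapSum t z hw).const_mul x)

/-- Slow growth forces b_D(λT) = o(T): for every K > 0 the quantity λT F̄(T/K) tends to 0, so T/K
eventually exceeds the quantile. -/
lemma tendsto_div_quantileFn (h0 : F (Iic 0) = 0) (h : IsRegularlyVarying (distTail F) (-α))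
    {l : ℝ → ℝ} (hl : Tendsto (fun T => l T * T * distTail F T) atTop (𝓝 0))
    (hl' : Tendsto (fun T => l T * T) atTop atTop) :
    Tendsto (fun T => T / quantileFn F (l T * T)) atTop atTop := by
  have hpos := distTail_pos_of_isRegularlyVarying h
  have hb := (tendsto_quantileFn_atTop h0 h).comp hl'
  rw [tendsto_atTop]
  intro M
  set K := max M 1 with hK
  have hK0 : 0 < K := lt_max_of_lt_right one_pos
  have h1 : Tendsto (fun T => l T * T * distTail F (T * K⁻¹)) atTop (𝓝 0) := by
    have := hl.mul (h.tendsto_ratio K⁻¹ (inv_pos.2 hK0))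
    rw [zero_mul] at this
    refine this.congr fun T => ?_
    have := (hpos T).ne'
    field_simp
  filter_upwards [h1.eventually_lt_const zero_lt_one, hl'.eventually_gt_atTop 1,
    hb.eventually_gt_atTop 0] with T h2 h3 h4
  have h4' : 0 < quantileFn F (l T * T) := h4
  have h5 : quantileFn F (l T * T) ≤ T * K⁻¹ := by
    rw [quantileFn_eq_tailQuantile F h3, tailQuantile_le_iff h0
      ⟨by positivity, (div_lt_one (by linarith)).2 h3⟩, le_div_iff₀ (by linarith)]
    linarith
  refine (le_max_left M 1).trans ?_
  rw [le_div_iff₀ h4', ← hK]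
  calc K * quantileFn F (l T * T) ≤ K * (T * K⁻¹) := by gcongr
    _ = T := by field_simp

/-- Durations are measured in units of b_D(λT), which is negligible against T. A session therefore
counts at its starting time with its full length, and duration times rate is the size of a jump. -/
lemma tendsto_exponent_slow [SFinite FR] (h0 : F (Iic 0) = 0)
    (h : IsRegularlyVarying (distTail F) (-α)) (h1 : 1 < α) {κ₂ : ℝ} (hκ : α < κ₂) (hκ2 : κ₂ ≤ 2)
    (hmom : ∀ κ, 1 ≤ κ → κ ≤ κ₂ → Integrable (fun r : ℝ => |r| ^ κ) FR) {l : ℝ → ℝ}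
    (hl : Tendsto (fun T => l T * T * distTail F T) atTop (𝓝 0))
    (hl' : Tendsto (fun T => l T * T) atTop atTop) :
    Tendsto (fun T => ((l T * T : ℝ) : ℂ) *
      ∫ y, centeredExp (y.2.2 * (T / quantileFn F (l T * T) * overlapSum t z y.1 (y.2.1 / T)))
        ∂((volume : Measure ℝ).prod (F.prod FR))) atTop
      (𝓝 (∫ y, centeredExp (y.2.2 * (y.2.1 * ∑ i, z i * (Ioo (0 : ℝ) (t i)).indicator 1 y.1))
        ∂(limitMean α FR))) := by
  obtain ⟨C, hC, hS⟩ := exists_abs_overlapSum_le t z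
  obtain ⟨κ₁, hk1, hk2⟩ := exists_between h1
  have hb := (tendsto_quantileFn_atTop h0 h).comp hl'
  have hna := (tendsto_mul_distTail_quantileFn h0 h).comp hl'
  have hK := tendsto_div_quantileFn h0 h hl hl'
  set K : ℝ → ℝ := fun T => T / quantileFn F (l T * T) with hKdef
  have hm : ∀ T, Measurable fun y : ℝ × ℝ × ℝ =>
      centeredExp (y.2.2 * (K T * overlapSum t z y.1 (y.2.1 / K T))) := fun T =>
    measurable_centeredExp_comp ((by fun_prop : Measurable fun y : ℝ × ℝ × ℝ => y.2.2).mul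
      ((measurable_overlapSum_comp t z (K T)).const_mul _))
  have hind : ∀ i, Measurable fun y : ℝ × ℝ × ℝ => z i * (Ioo (0 : ℝ) (t i)).indicator 1 y.1 :=
    fun i => ((measurable_one.indicator measurableSet_Ioo).comp measurable_fst).const_mul _
  have hm' : Measurable fun y : ℝ × ℝ × ℝ =>
      centeredExp (y.2.2 * (y.2.1 * ∑ i, z i * (Ioo (0 : ℝ) (t i)).indicator 1 y.1)) :=
    measurable_centeredExp_comp ((by fun_prop : Measurable fun y : ℝ × ℝ × ℝ => y.2.2).mul
      ((by fun_prop : Measurable fun y : ℝ × ℝ × ℝ => y.2.1).mul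
        (Finset.measurable_fun_sum _ fun i _ => hind i)))
  have key := tendsto_integral_scaled h0 h hl' hb hna hk1 hk2 hκ
    (v := fun x => 2 * C ^ κ₁ * |x| ^ κ₁ + 2 * C ^ κ₂ * |x| ^ κ₂)
    (((hmom κ₁ hk1.le (hk2.trans hκ).le).const_mul _).add ((hmom κ₂ (by linarith) le_rfl).const_mul _))
    (Φ := fun T y => centeredExp (y.2.2 * (K T * overlapSum t z y.1 (y.2.1 / K T))))
    -- A session that starts exactly at 0 may lie inside the window although the open indicator
    -- vanishes there; that single point is discarded as a null set.
    hm ?_ hm' (p := fun s => s ≠ 0) (q := fun _ => True)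
    (by simp [ae_iff]) (by simp) ?_
  · refine key.congr' ?_
    filter_upwards [eventually_gt_atTop 0, hb.eventually_gt_atTop 0] with T hT hbT
    congr 1
    congr 1
    ext y
    have hbT' : 0 < quantileFn F (l T * T) := hbT
    simp only [hKdef, Function.comp]
    congr 4
    field_simp
  · filter_upwards [hK.eventually_gt_atTop 0] with T hKT s u x hu
    have hb : |K T * overlapSum t z s (u / K T)| ≤ C * (u / (1 + |s|)) := by
      rw [abs_mul, abs_of_pos hKT]
      have := (hS s (u / K T) (by positivity)).trans
        (mul_le_mul_of_nonneg_left (min_le_right _ _) (by linarith))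
      calc K T * |overlapSum t z s (u / K T)| ≤ K T * (C * (u / K T / (1 + |s|))) := by gcongr
        _ = _ := by field_simp
    have hm0 : 0 ≤ u / (1 + |s|) := by positivity
    have b1 := norm_centeredExp_mul_le (x := x) hk1.le (by linarith) (by linarith) hm0 hb
    have b2 := norm_centeredExp_mul_le (x := x) (by linarith : 1 ≤ κ₂) hκ2 (by linarith) hm0 hb
    refine ⟨b1.trans (mul_le_mul_of_nonneg_right ?_ (by positivity)),
      b2.trans (mul_le_mul_of_nonneg_right ?_ (by positivity))⟩
    · have : 0 ≤ 2 * C ^ κ₂ * |x| ^ κ₂ := by positivity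
      linarith
    · have : 0 ≤ 2 * C ^ κ₁ * |x| ^ κ₁ := by positivity
      linarith
  · intro s u x hs hu _ w hw _
    refine (continuous_centeredExp.tendsto _).comp (Tendsto.const_mul x ?_)
    simp only [overlapSum, Finset.mul_sum]
    refine tendsto_finsetSum _ fun i _ => ?_
    have := (tendsto_mul_sessionOverlap_div (t := t i) hs hu hK hw).const_mul (z i)
    refine (this.congr fun T => by ring).trans (le_of_eq (by congr 1; ring))

end Scenarios

/-- Split λT = N/F̄(T) with N = λT F̄(T). The factor 1/F̄(T) scales the durations and N scales the
rates by b_R(N). The rates are replaced by their quantile coupling, so the theorem for durations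
applies with Lebesgue measure on (0,∞) as mark measure. -/
lemma tendsto_exponent_fast_stable {F FR : Measure ℝ} [IsProbabilityMeasure F]
    [IsProbabilityMeasure FR] {α αR : ℝ} {m : ℕ} (t : Fin m → ℝ≥0) (z : Fin m → ℝ)
    (h0 : F (Iic 0) = 0) (h : IsRegularlyVarying (distTail F) (-α)) (h1 : 1 < α)
    (hR0 : FR (Iic 0) = 0) (hR : IsRegularlyVarying (distTail FR) (-αR)) (hα : α < αR)
    (hR2 : αR < 2) {l : ℝ → ℝ} (hl : Tendsto (fun T => l T * T * distTail F T) atTop atTop) :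
    Tendsto (fun T => ((l T * T : ℝ) : ℂ) *
      ∫ y, centeredExp (y.2.2 * (T / (T * quantileFn FR (l T * T * distTail F T)) *
        overlapSum t z y.1 (y.2.1 / T))) ∂((volume : Measure ℝ).prod (F.prod FR))) atTop
      (𝓝 (∫ y, centeredExp (y.2.2 * overlapSum t z y.1 y.2.1)
        ∂(limitMean α (powerMeasure αR)))) := by
  obtain ⟨C, hC, hS⟩ := exists_abs_overlapSum_le t z
  obtain ⟨κ₁, hk1, hk2⟩ := exists_between h1
  -- The condition α < α_R leaves room for a power κ₂ that exceeds α, as short sessions require, and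
  -- is still a finite moment of the rates.
  obtain ⟨κ₂, hk3, hk4⟩ := exists_between hα
  obtain ⟨β₁, hb1, hb2⟩ := exists_between hk4
  obtain ⟨β₂, hb3, hb4⟩ := exists_between hR2
  obtain ⟨hn, hna⟩ := tendsto_inv_distTail h
  have hαR : 0 < αR := by linarith
  have hpos := distTail_pos_of_isRegularlyVarying h
  set N : ℝ → ℝ := fun T => l T * T * distTail F T with hN
  set b : ℝ → ℝ := fun T => quantileFn FR (N T) with hb
  have hbt : Tendsto b atTop atTop := (tendsto_quantileFn_atTop hR0 hR).comp hl
  have hNb : Tendsto (fun T => N T * distTail FR (b T)) atTop (𝓝 1) :=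
    (tendsto_mul_distTail_quantileFn hR0 hR).comp hl
  obtain ⟨B, hB, hev⟩ := exists_scaled_tailQuantile_le hR0 hR hl hbt hNb
    (by linarith : (1 : ℝ) ≤ β₁) hb2 hb3
  set Q : ℝ → ℝ → ℝ := fun T y => tailQuantile FR (y / N T) / b T with hQ
  have hQ0 : ∀ n : ℝ, Measurable fun y => tailQuantile FR (y / n) := fun n =>
    (measurable_tailQuantile hR0).comp (measurable_id.div_const n)
  have hQm : ∀ T, Measurable (Q T) := fun T => (hQ0 (N T)).div_const _
  -- Large rates (y ≤ 1) are estimated with the power κ₂ < β₁, small rates (y > 1) with the power 2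
  -- > β₂, so `v` is integrable at both ends.
  set v : ℝ → ℝ := (Ioi 0).indicator fun y =>
    2 * (C * B) ^ 2 * (if y ≤ 1 then y ^ (-(κ₂ / β₁)) else y ^ (-(2 / β₂))) with hv
  have hvi : Integrable v (volume.restrict (Ioi 0)) := by
    have := (integrableOn_ite_rpow (p := κ₂ / β₁) (q := 2 / β₂)
      ((div_lt_one (by linarith)).2 hb1) ((one_lt_div (by linarith)).2 hb4)).const_mul
        (2 * (C * B) ^ 2)
    exact (Integrable.indicator this measurableSet_Ioi)
  have hv0 : ∀ y, 0 ≤ v y := fun y => by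
    refine indicator_nonneg (fun y hy => ?_) y
    have : 0 < y := hy
    split_ifs <;> positivity
  set Φ : ℝ → ℝ × ℝ × ℝ → ℂ := fun T => {y : ℝ × ℝ × ℝ | y.2.2 ∈ Ioo 0 (N T)}.indicator
    fun y => centeredExp (Q T y.2.2 * overlapSum t z y.1 y.2.1) with hΦ
  have hΦm : ∀ T, Measurable (Φ T) := fun T => by
    refine Measurable.indicator (measurable_centeredExp_comp (Measurable.mul ?_
      (measurable_overlapSum t z))) ?_
    · exact (hQm T).comp (by fun_prop : Measurable fun y : ℝ × ℝ × ℝ => y.2.2)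
    · exact (by fun_prop : Measurable fun y : ℝ × ℝ × ℝ => y.2.2) measurableSet_Ioo
  have hΨm : Measurable fun y : ℝ × ℝ × ℝ =>
      centeredExp (y.2.2 ^ (-αR⁻¹) * overlapSum t z y.1 y.2.1) := by
    refine measurable_centeredExp_comp (Measurable.mul ?_ (measurable_overlapSum t z))
    fun_prop
  have key := tendsto_integral_scaled h0 h hn tendsto_id hna hk1 hk2 hk3 hvi hΦm ?_ hΨm
    (p := fun _ => True) (q := fun y => 0 < y) (by simp) (ae_restrict_mem measurableSet_Ioi) ?_
  · have hlimit : ∫ y, centeredExp (y.2.2 * overlapSum t z y.1 y.2.1)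
        ∂(limitMean α (powerMeasure αR)) =
        ∫ y, centeredExp (y.2.2 ^ (-αR⁻¹) * overlapSum t z y.1 y.2.1)
        ∂((volume : Measure ℝ).prod ((powerMeasure α).prod (volume.restrict (Ioi 0)))) := by
      have hm : Measurable fun y : ℝ => y ^ (-αR⁻¹) := by fun_prop
      have e3 : ((volume : Measure ℝ).prod ((powerMeasure α).prod (volume.restrict (Ioi 0)))).map
          (Prod.map id (Prod.map id (fun y : ℝ => y ^ (-αR⁻¹)))) =
          limitMean α (powerMeasure αR) := by
        rw [← Measure.map_prod_map _ _ measurable_id (measurable_id.prodMap hm),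
          ← Measure.map_prod_map _ _ measurable_id hm, map_rpow_eq_powerMeasure hαR,
          Measure.map_id, Measure.map_id, limitMean]
      rw [← e3, integral_map]
      · rfl
      · exact (measurable_id.prodMap (measurable_id.prodMap hm)).aemeasurable
      · exact (measurable_centeredExp_comp ((by fun_prop :
          Measurable fun y : ℝ × ℝ × ℝ => y.2.2).mul
          (measurable_overlapSum t z))).aestronglyMeasurable
    rw [hlimit]
    refine key.congr' ?_
    filter_upwards [eventually_gt_atTop 0, hl.eventually_gt_atTop 0] with T hT hNT
    have hNT' : 0 < N T := hNT
    have hm := hQ0 (N T)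
    have e3 : ((volume : Measure ℝ).prod (F.prod (volume.restrict (Ioo 0 (N T))))).map
        (Prod.map id (Prod.map id (fun y => tailQuantile FR (y / N T)))) =
        ENNReal.ofReal (N T) • ((volume : Measure ℝ).prod (F.prod FR)) := by
      have : SFinite (Measure.map (fun y => tailQuantile FR (y / N T))
        (volume.restrict (Ioo 0 (N T)))) := inferInstance
      rw [← Measure.map_prod_map _ _ measurable_id (measurable_id.prodMap hm),
        ← Measure.map_prod_map _ _ measurable_id hm, map_tailQuantile hR0 hNT',
        Measure.map_id, Measure.map_id, Measure.prod_smul_right, Measure.prod_smul_right]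
    have hS : MeasurableSet {y : ℝ × ℝ × ℝ | y.2.2 ∈ Ioo 0 (N T)} :=
      (by fun_prop : Measurable fun y : ℝ × ℝ × ℝ => y.2.2) measurableSet_Ioo
    have e5 : Ioo 0 (N T) ∩ Ioi 0 = Ioo 0 (N T) := inter_eq_left.2 fun y hy => hy.1
    have e1 : {y : ℝ × ℝ × ℝ | y.2.2 ∈ Ioo 0 (N T)} = univ ×ˢ (univ ×ˢ Ioo 0 (N T)) := by
      ext; simp
    have e2 : ((volume : Measure ℝ).prod (F.prod (volume.restrict (Ioi 0)))).restrict
        {y : ℝ × ℝ × ℝ | y.2.2 ∈ Ioo 0 (N T)} =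
        (volume : Measure ℝ).prod (F.prod (volume.restrict (Ioo 0 (N T)))) := by
      rw [e1, ← Measure.prod_restrict, Measure.restrict_univ, ← Measure.prod_restrict,
        Measure.restrict_univ, Measure.restrict_restrict measurableSet_Ioo, e5]
    have hmeas : Measurable fun y : ℝ × ℝ × ℝ =>
        centeredExp (y.2.2 * (T / (T * b T) * overlapSum t z y.1 (y.2.1 / T))) :=
      measurable_centeredExp_comp ((by fun_prop : Measurable fun y : ℝ × ℝ × ℝ => y.2.2).mul
        ((measurable_overlapSum_comp t z T).const_mul _))
    have e4 : (N T : ℂ) * ∫ y, centeredExp (y.2.2 * (T / (T * b T) *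
        overlapSum t z y.1 (y.2.1 / T))) ∂((volume : Measure ℝ).prod (F.prod FR)) =
        ∫ y, Φ T (y.1, y.2.1 / id T, y.2.2)
          ∂((volume : Measure ℝ).prod (F.prod (volume.restrict (Ioi 0)))) := by
      have e6 : (fun y : ℝ × ℝ × ℝ => Φ T (y.1, y.2.1 / id T, y.2.2)) =
          {y : ℝ × ℝ × ℝ | y.2.2 ∈ Ioo 0 (N T)}.indicator
            fun y => centeredExp (Q T y.2.2 * overlapSum t z y.1 (y.2.1 / T)) := rfl
      rw [e6, integral_indicator hS, e2]
      have e7 := integral_smul_measure (μ := (volume : Measure ℝ).prod (F.prod FR)) (fun y : ℝ × ℝ × ℝ =>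
        centeredExp (y.2.2 * (T / (T * b T) * overlapSum t z y.1 (y.2.1 / T))))
        (ENNReal.ofReal (N T))
      rw [ENNReal.toReal_ofReal hNT'.le, Complex.real_smul] at e7
      rw [← e7, ← e3, integral_map]
      · congr 1
        ext y
        simp only [Prod.map, id, hQ]
        congr 1
        field_simp
      · exact (measurable_id.prodMap (measurable_id.prodMap hm)).aemeasurable
      · exact hmeas.aestronglyMeasurable
    rw [← e4, ← mul_assoc]
    congr 1
    have : (distTail F T : ℂ) ≠ 0 := Complex.ofReal_ne_zero.2 (hpos T).ne'
    simp only [hN]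
    push_cast
    field_simp
  · filter_upwards [hev, hbt.eventually_gt_atTop 0] with T hevT hbT s u y hu
    have hm0 : 0 ≤ u / (1 + |s|) := by positivity
    by_cases hy : y ∈ Ioo 0 (N T)
    swap
    · have : Φ T (s, u, y) = 0 := indicator_of_notMem (by exact hy) _
      rw [this, norm_zero]
      have := hv0 y
      exact ⟨by positivity, by positivity⟩
    have hΦe : Φ T (s, u, y) = centeredExp (Q T y * overlapSum t z s u) :=
      indicator_of_mem (by exact hy) _
    rw [hΦe]
    set μ := min 1 (u / (1 + |s|)) with hμ
    have hμ0 : 0 ≤ μ := le_min zero_le_one hm0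
    have hμ1 : μ ≤ 1 := min_le_left _ _
    have hy0 : 0 < y := hy.1
    have hq0 : 0 ≤ Q T y := div_nonneg (tailQuantile_nonneg hR0 _) hbT.le
    have hQb := hevT y hy
    have hCB : 1 ≤ C * B := one_le_mul_of_one_le_of_one_le hC hB
    have c : ∀ η κ : ℝ, 1 ≤ η → η ≤ κ → μ ^ κ ≤ (u / (1 + |s|)) ^ η := by
      intro η κ hη1 hη2
      rcases hμ0.eq_or_lt with h | h
      · rw [← h, Real.zero_rpow (by linarith)]; positivity
      calc μ ^ κ ≤ μ ^ η := Real.rpow_le_rpow_of_exponent_ge h hμ1 hη2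
        _ ≤ _ := Real.rpow_le_rpow hμ0 (min_le_right _ _) (by linarith)
    have hve : v y = 2 * (C * B) ^ 2 *
        (if y ≤ 1 then y ^ (-(κ₂ / β₁)) else y ^ (-(2 / β₂))) := indicator_of_mem hy0 _
    -- The power used depends on the size of the rate, but it is never below κ₂; since μ ≤ 1 it can
    -- then be lowered to κ₁ or κ₂.
    have main : ∃ κ : ℝ, κ₂ ≤ κ ∧ ‖centeredExp (Q T y * overlapSum t z s u)‖ ≤ v y * μ ^ κ := by
      have gen : ∀ κ β : ℝ, κ₂ ≤ κ → κ ≤ 2 → Q T y ≤ B * y ^ (-β⁻¹) →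
          ‖centeredExp (Q T y * overlapSum t z s u)‖ ≤
            2 * (C * B) ^ 2 * y ^ (-(κ / β)) * μ ^ κ := by
        intro κ β hκ hκ' hq
        refine (norm_centeredExp_mul_le (by linarith) hκ' (by linarith) hμ0 (hS s u hu)).trans ?_
        refine mul_le_mul_of_nonneg_right ?_ (by positivity)
        rw [abs_of_nonneg hq0]
        calc 2 * C ^ κ * Q T y ^ κ ≤ 2 * C ^ κ * (B * y ^ (-β⁻¹)) ^ κ := by gcongr; linarith
          _ = 2 * (C * B) ^ κ * y ^ (-(κ / β)) := by
            rw [Real.mul_rpow (by linarith) (by positivity), ← Real.rpow_mul hy0.le,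
              Real.mul_rpow (by linarith) (by linarith)]
            have : -β⁻¹ * κ = -(κ / β) := by ring
            rw [this]
            ring
          _ ≤ 2 * (C * B) ^ 2 * y ^ (-(κ / β)) := by
            rw [← Real.rpow_two]
            gcongr
      rw [hve]
      by_cases hy1 : y ≤ 1
      · rw [if_pos hy1] at hQb ⊢
        exact ⟨κ₂, le_rfl, gen κ₂ β₁ le_rfl (by linarith) hQb⟩
      · rw [if_neg hy1] at hQb ⊢
        exact ⟨2, by linarith, gen 2 β₂ (by linarith) le_rfl hQb⟩
    obtain ⟨κ, hκ, hm⟩ := main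
    exact ⟨hm.trans (mul_le_mul_of_nonneg_left (c κ₁ κ hk1.le (by linarith)) (hv0 y)),
      hm.trans (mul_le_mul_of_nonneg_left (c κ₂ κ (by linarith) hκ) (hv0 y))⟩
  · intro s u y _ _ hy w hw _
    have hQl := tendsto_scaled_tailQuantile hR0 hR hαR hl hbt hNb hy
    refine ((continuous_centeredExp.tendsto _).comp
      (hQl.mul (tendsto_overlapSum t z hw))).congr' ?_
    filter_upwards [hl.eventually_gt_atTop y] with T hT
    simp only [hΦ]
    rw [indicator_of_mem (by exact ⟨hy, hT⟩)]
    rfl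

/-! ### The exact characteristic function of the scaled input -/

lemma ae_pos_of_measure_Iic_eq_zero {F : Measure ℝ} (h0 : F (Iic 0) = 0) : ∀ᵐ r ∂F, 0 < r := by
  rw [ae_iff]; convert h0 using 2; ext; simp

lemma integral_sessionOverlap {t u : ℝ} (ht : 0 ≤ t) (hu : 0 ≤ u) :
    ∫ s, sessionOverlap t s u = t * u := by
  rw [integral_eq_lintegral_of_nonneg_ae (Eventually.of_forall fun s => sessionOverlap_nonneg t s u),
    lintegral_sessionOverlap, ← ENNReal.ofReal_mul ht, ENNReal.toReal_ofReal (by positivity)]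
  exact ((continuous_sessionOverlap t).comp (by fun_prop : Continuous fun s : ℝ =>
    (s, u))).aestronglyMeasurable

section

variable {F FR : Measure ℝ} [IsProbabilityMeasure F] [IsProbabilityMeasure FR]

lemma measurable_mul_sessionOverlap (t : ℝ) :
    Measurable fun y : ℝ × ℝ × ℝ => y.2.2 * sessionOverlap t y.1 y.2.1 :=
  (by fun_prop : Measurable fun y : ℝ × ℝ × ℝ => y.2.2).mul (measurable_sessionOverlap t)

/-- Integrating over the start first gives t u, so finite means of the duration and of the rate
suffice. -/
lemma integrable_mul_sessionOverlap (hF : Integrable (fun u : ℝ => u) F)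
    (hR : Integrable (fun r : ℝ => r) FR) (t : ℝ) :
    Integrable (fun y : ℝ × ℝ × ℝ => y.2.2 * sessionOverlap t y.1 y.2.1)
      ((volume : Measure ℝ).prod (F.prod FR)) := by
  have hm := measurable_mul_sessionOverlap t
  refine ⟨hm.aestronglyMeasurable, ?_⟩
  rw [hasFiniteIntegral_iff_enorm, lintegral_prod_symm _ hm.enorm.aemeasurable]
  have h1 : ∀ y : ℝ × ℝ, ∫⁻ s, ‖y.2 * sessionOverlap t s y.1‖ₑ =
      ENNReal.ofReal t * (ENNReal.ofReal y.1 * ‖y.2‖ₑ) := fun y => by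
    simp_rw [enorm_mul, Real.enorm_of_nonneg (sessionOverlap_nonneg _ _ _)]
    rw [lintegral_const_mul' _ _ enorm_ne_top, lintegral_sessionOverlap]
    ring
  simp only [h1]
  rw [lintegral_const_mul _ (by fun_prop), lintegral_prod_mul (by fun_prop) (by fun_prop)]
  refine ENNReal.mul_lt_top ENNReal.ofReal_lt_top (ENNReal.mul_lt_top ?_ ?_)
  · refine (lintegral_mono fun u => ?_).trans_lt (hasFiniteIntegral_iff_enorm.1 hF.2)
    exact Real.ofReal_le_enorm u
  · exact hasFiniteIntegral_iff_enorm.1 hR.2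

lemma integral_mul_sessionOverlap (h0 : F (Iic 0) = 0) (hF : Integrable (fun u : ℝ => u) F)
    (hR : Integrable (fun r : ℝ => r) FR) {t : ℝ} (ht : 0 ≤ t) :
    ∫ y : ℝ × ℝ × ℝ, y.2.2 * sessionOverlap t y.1 y.2.1 ∂((volume : Measure ℝ).prod (F.prod FR)) =
      t * (∫ u, u ∂F) * ∫ r, r ∂FR := by
  rw [integral_prod_symm _ (integrable_mul_sessionOverlap hF hR t)]
  have hpos : ∀ᵐ y ∂(F.prod FR), 0 < y.1 :=
    Measure.quasiMeasurePreserving_fst.ae (ae_pos_of_measure_Iic_eq_zero h0)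
  have : ∀ᵐ y ∂(F.prod FR), ∫ s, y.2 * sessionOverlap t s y.1 = t * (y.1 * y.2) := by
    filter_upwards [hpos] with y hy
    rw [integral_const_mul, integral_sessionOverlap ht hy.le]
    ring
  rw [integral_congr_ae this, integral_const_mul, integral_prod_mul (fun u : ℝ => u) (fun r : ℝ => r),
    mul_assoc]

end

/-- A dilation is a measurable embedding, so the substitution is valid for an arbitrary integrand.
-/
lemma integral_comp_mul_start {E : Type*} [NormedAddCommGroup E] [NormedSpace ℝ E] {ν : Measure (ℝ × ℝ)} [SFinite ν]
    {T : ℝ} (hT : 0 < T) (h : ℝ × ℝ × ℝ → E) :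
    ∫ y, h y ∂((volume : Measure ℝ).prod ν) =
      T • ∫ y, h (T * y.1, y.2) ∂((volume : Measure ℝ).prod ν) := by
  have hm : Measurable fun s : ℝ => T * s := by fun_prop
  have e : ((volume : Measure ℝ).prod ν).map (Prod.map (fun s => T * s) id) =
      ENNReal.ofReal T⁻¹ • ((volume : Measure ℝ).prod ν) := by
    rw [← Measure.map_prod_map _ _ hm measurable_id, Measure.map_id,
      Real.map_volume_mul_left hT.ne', Measure.prod_smul_left, abs_of_pos (inv_pos.2 hT)]
  have hemb : MeasurableEmbedding (Prod.map (fun s : ℝ => T * s) (id : ℝ × ℝ → ℝ × ℝ)) := by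
    have h2 : MeasurableEmbedding (fun s : ℝ => T * s) :=
      (Homeomorph.mulLeft₀ T hT.ne').measurableEmbedding
    exact h2.prodMap MeasurableEmbedding.id
  have h1 := hemb.integral_map (μ := (volume : Measure ℝ).prod ν) h
  rw [e, integral_smul_measure, ENNReal.toReal_ofReal (inv_pos.2 hT).le] at h1
  have h2 : ∫ y, h (T * y.1, y.2) ∂((volume : Measure ℝ).prod ν) =
      T⁻¹ • ∫ y, h y ∂((volume : Measure ℝ).prod ν) := h1.symm
  rw [h2, smul_smul, mul_inv_cancel₀ hT.ne', one_smul]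

section

variable {ι Ω : Type*} [Fintype ι] [MeasurableSpace Ω] {P : Measure Ω}
  {lam : ι → ℝ} {FD : ι → Measure ℝ} {FR : Measure ℝ} {Γ D R : ι → ℤ → Ω → ℝ}
  [IsProbabilityMeasure FR] [∀ j, IsProbabilityMeasure (FD j)]

lemma totalRate_pos [Nonempty ι] (hlam : ∀ j, 0 < lam j) : 0 < totalRate lam :=
  Finset.sum_pos (fun j _ => hlam j) Finset.univ_nonempty

lemma isProbabilityMeasure_mixture [Nonempty ι] (hlam : ∀ j, 0 < lam j) :
    IsProbabilityMeasure (mixture lam FD) := by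
  have h := totalRate_pos hlam
  refine ⟨?_⟩
  simp only [mixture, Measure.finsetSum_apply, Measure.smul_apply, measure_univ, smul_eq_mul, mul_one]
  rw [← ENNReal.ofReal_sum_of_nonneg fun j _ => (div_pos (hlam j) h).le, ← Finset.sum_div]
  change ENNReal.ofReal (totalRate lam / totalRate lam) = 1
  rw [div_self h.ne', ENNReal.ofReal_one]

/-- Superposition in one line: the exponents of independent streams add up to the exponent of a
single stream with intensity λ and duration law F_D. -/
lemma integral_mixture_prod [Nonempty ι] (hlam : ∀ j, 0 < lam j) {h : ℝ × ℝ × ℝ → ℂ}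
    (hi : ∀ j, Integrable h ((volume : Measure ℝ).prod ((FD j).prod FR))) :
    (totalRate lam : ℂ) * ∫ y, h y ∂((volume : Measure ℝ).prod ((mixture lam FD).prod FR)) =
      ∑ j, lam j * ∫ y, h y ∂((volume : Measure ℝ).prod ((FD j).prod FR)) := by
  have hL := totalRate_pos hlam
  have e : (volume : Measure ℝ).prod ((mixture lam FD).prod FR) =
      ∑ j, ENNReal.ofReal (lam j / totalRate lam) • (volume : Measure ℝ).prod ((FD j).prod FR) := by
    rw [mixture, ← Measure.sum_fintype, Measure.prod_sum_left, Measure.prod_sum_right,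
      Measure.sum_fintype]
    refine Finset.sum_congr rfl fun j _ => ?_
    rw [Measure.prod_smul_left, Measure.prod_smul_right]
  rw [e, integral_finsetSum_measure fun j _ => (hi j).smul_measure ENNReal.ofReal_ne_top,
    Finset.mul_sum]
  refine Finset.sum_congr rfl fun j _ => ?_
  rw [integral_smul_measure, ENNReal.toReal_ofReal (div_pos (hlam j) hL).le, Complex.real_smul,
    ← mul_assoc]
  congr 1
  rw [← Complex.ofReal_mul, mul_div_cancel₀ _ hL.ne']

lemma integrable_centeredExp_comp {E : Type*} [MeasurableSpace E] {μ : Measure E} {f : E → ℝ}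
    (hm : Measurable f) (hf : Integrable f μ) : Integrable (fun x => centeredExp (f x)) μ :=
  (hf.norm.const_mul 2).mono' (measurable_centeredExp_comp hm).aestronglyMeasurable
    (Eventually.of_forall fun _ => norm_centeredExp_le_abs _)

lemma aemeasurable_scaledInput [IsProbabilityMeasure P] (hM : IsTrafficModel P lam FD FR Γ D R)
    (hFD : ∀ j, Integrable (fun u : ℝ => u) (FD j)) (hR : Integrable (fun r : ℝ => r) FR)
    (T a : ℝ) (t : ℝ≥0) : AEMeasurable (scaledInput lam FD FR Γ D R T a t) P := by
  refine AEMeasurable.div_const (AEMeasurable.sub_const ?_ _) _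
  exact hM.aemeasurable_integral (measurable_mul_sessionOverlap _)
    fun j => integrable_mul_sessionOverlap (hFD j) hR _

/-- The centring removes exactly the linear term of the Poisson exponent. Rescaling the starts by T
produces the factor T in front, and L_{Tt}(Ts,u) = T L_t(s,u/T) produces the factor T/a inside. -/
lemma jointCF_scaledInput [IsProbabilityMeasure P] [Nonempty ι]
    (hM : IsTrafficModel P lam FD FR Γ D R) (hlam : ∀ j, 0 < lam j)
    (h0 : ∀ j, FD j (Iic 0) = 0)
    (hFD : ∀ j, Integrable (fun u : ℝ => u) (FD j)) (hR : Integrable (fun r : ℝ => r) FR)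
    {T : ℝ} (hT : 0 < T) (a : ℝ) {m : ℕ} (t : Fin m → ℝ≥0) (z : Fin m → ℝ) :
    jointCF P (fun i => scaledInput lam FD FR Γ D R T a (t i)) z =
      Complex.exp (((totalRate lam * T : ℝ) : ℂ) *
        ∫ y, centeredExp (y.2.2 * (T / a * overlapSum t z y.1 (y.2.1 / T)))
          ∂((volume : Measure ℝ).prod ((mixture lam FD).prod FR))) := by
  have := isProbabilityMeasure_mixture (FD := FD) hlam
  have hL := totalRate_pos hlam
  set g : ℝ × ℝ × ℝ → ℝ := fun y =>
    ∑ i, z i / a * (y.2.2 * sessionOverlap (T * t i) y.1 y.2.1) with hg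
  have hgm : Measurable g := Finset.measurable_fun_sum _ fun i _ =>
    (measurable_mul_sessionOverlap _).const_mul _
  have hgi : ∀ j, Integrable g ((volume : Measure ℝ).prod ((FD j).prod FR)) := fun j =>
    integrable_finsetSum _ fun i _ => (integrable_mul_sessionOverlap (hFD j) hR _).const_mul _
  have hgint : ∀ j, ∫ y, g y ∂((volume : Measure ℝ).prod ((FD j).prod FR)) =
      (∫ u, u ∂(FD j)) * ∑ i, z i / a * ((∫ r, r ∂FR) * (T * t i)) := fun j => by
    rw [integral_finsetSum _ fun i _ => (integrable_mul_sessionOverlap (hFD j) hR _).const_mul _,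
      Finset.mul_sum]
    refine Finset.sum_congr rfl fun i _ => ?_
    rw [integral_const_mul, integral_mul_sessionOverlap (h0 j) (hFD j) hR
      (mul_nonneg hT.le (t i).coe_nonneg)]
    ring
  set c : ℝ := ∑ j, lam j * ∫ y, g y ∂((volume : Measure ℝ).prod ((FD j).prod FR)) with hc
  -- The mean of the Poisson integral coincides with the subtracted constant, because the integral
  -- of the overlap over all starts is t u.
  have hcm : c = ∑ i, z i / a * (totalRate lam * mixtureMean lam FD * (∫ r, r ∂FR) * (T * t i)) := by
    have : totalRate lam * mixtureMean lam FD = ∑ j, lam j * ∫ u, u ∂(FD j) := by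
      rw [mixtureMean, Finset.mul_sum]
      refine Finset.sum_congr rfl fun j _ => ?_
      rw [← mul_assoc, mul_div_cancel₀ _ hL.ne']
    rw [hc]
    simp_rw [hgint, this, ← mul_assoc]
    rw [← Finset.sum_mul, Finset.mul_sum]
    refine Finset.sum_congr rfl fun i _ => ?_
    ring
  have hae : ∀ᵐ ω ∂P, ∑ i, z i * scaledInput lam FD FR Γ D R T a (t i) ω =
      (∫ y, g y ∂(∑ j, sessionCount (Γ j) (D j) (R j) ω)) - c := by
    have h1 : ∀ i, ∀ᵐ ω ∂P, Integrable (fun y : ℝ × ℝ × ℝ =>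
        y.2.2 * sessionOverlap (T * t i) y.1 y.2.1) (∑ j, sessionCount (Γ j) (D j) (R j) ω) :=
      fun i => (hM.ae_tendsto_sum (measurable_mul_sessionOverlap _)
        fun j => integrable_mul_sessionOverlap (hFD j) hR _).mono fun ω h => h.1
    filter_upwards [ae_all_iff.2 h1] with ω hω
    rw [integral_finsetSum _ fun i _ => (hω i).const_mul _, hcm, ← Finset.sum_sub_distrib]
    refine Finset.sum_congr rfl fun i _ => ?_
    rw [integral_const_mul, scaledInput, cumulativeInput]
    ring
  have h2 := hM.integral_exp (fun j => (hlam j).le) hgm hgi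
  have h3 : jointCF P (fun i => scaledInput lam FD FR Γ D R T a (t i)) z =
      Complex.exp (∑ j, lam j * ∫ y, centeredExp (g y)
        ∂((volume : Measure ℝ).prod ((FD j).prod FR))) := by
    rw [jointCF]
    have h4 : ∀ᵐ ω ∂P, Complex.exp (Complex.I *
        ((∑ i, z i * scaledInput lam FD FR Γ D R T a (t i) ω : ℝ) : ℂ)) =
        Complex.exp (-(Complex.I * (c : ℂ))) * Complex.exp (Complex.I *
          ((∫ y, g y ∂(∑ j, sessionCount (Γ j) (D j) (R j) ω) : ℝ) : ℂ)) := by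
      filter_upwards [hae] with ω hω
      rw [hω, ← Complex.exp_add]
      congr 1
      push_cast
      ring
    rw [integral_congr_ae h4, integral_const_mul, h2, ← Complex.exp_add]
    congr 1
    rw [hc]
    push_cast
    rw [Finset.mul_sum, ← Finset.sum_neg_distrib, ← Finset.sum_add_distrib]
    refine Finset.sum_congr rfl fun j _ => ?_
    have hge : Integrable (fun y => Complex.exp (Complex.I * ((g y : ℝ) : ℂ)) - 1)
        ((volume : Measure ℝ).prod ((FD j).prod FR)) :=
      IsPoissonRandomMeasure.integrable_exp_sub_one hgm (hgi j)
    have hgI : Integrable (fun y => Complex.I * ((g y : ℝ) : ℂ))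
        ((volume : Measure ℝ).prod ((FD j).prod FR)) := (hgi j).ofReal.const_mul _
    have h5 : ∫ y, centeredExp (g y) ∂((volume : Measure ℝ).prod ((FD j).prod FR)) =
        (∫ y, (Complex.exp (Complex.I * ((g y : ℝ) : ℂ)) - 1)
          ∂((volume : Measure ℝ).prod ((FD j).prod FR))) -
        Complex.I * ((∫ y, g y ∂((volume : Measure ℝ).prod ((FD j).prod FR)) : ℝ) : ℂ) := by
      have h6 : ∫ y, ((g y : ℝ) : ℂ) ∂((volume : Measure ℝ).prod ((FD j).prod FR)) =
          ((∫ y, g y ∂((volume : Measure ℝ).prod ((FD j).prod FR)) : ℝ) : ℂ) := integral_ofReal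
      rw [← h6, ← integral_const_mul, ← integral_sub hge hgI]
      rfl
    rw [h5]
    ring
  rw [h3, ← integral_mixture_prod hlam fun j => integrable_centeredExp_comp hgm (hgi j),
    integral_comp_mul_start hT]
  congr 1
  push_cast
  rw [Complex.real_smul, ← mul_assoc]
  congr 2
  ext y
  simp only [hg, overlapSum, Finset.mul_sum]
  congr 1
  refine Finset.sum_congr rfl fun i _ => ?_
  have : y.2.1 = T * (y.2.1 / T) := by field_simp
  conv_lhs => rw [this, sessionOverlap_scale hT.le]
  ring

end

/-! ### The characteristic exponent of the totally skewed stable law -/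

lemma integral_powerMeasure {E : Type*} [NormedAddCommGroup E] [NormedSpace ℝ E] {γ : ℝ}
    (hγ : 0 < γ) (f : ℝ → E) :
    ∫ w, f w ∂(powerMeasure γ) = ∫ w in Ioi 0, (γ * w ^ (-(γ + 1))) • f w := by
  rw [powerMeasure]
  have hm : Measurable fun u : ℝ => γ * u ^ (-(γ + 1)) := by fun_prop
  have h1 : ∀ᵐ u ∂(volume.restrict (Ioi (0 : ℝ))), ENNReal.ofReal (γ * u ^ (-(γ + 1))) < ∞ :=
    Eventually.of_forall fun u => ENNReal.ofReal_lt_top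
  rw [integral_withDensity_eq_integral_toReal_smul hm.ennreal_ofReal h1]
  refine setIntegral_congr_fun measurableSet_Ioi fun u hu => ?_
  have hu' : 0 < u := hu
  rw [ENNReal.toReal_ofReal (by positivity)]

/-- The tail of the power measure integrated once more: it is the weight that appears when the
Taylor remainder below is integrated against the measure. -/
lemma integral_Ioi_sub_mul_rpow {γ v : ℝ} (hγ : 1 < γ) (hv : 0 < v) :
    IntegrableOn (fun w : ℝ => (w - v) * (γ * w ^ (-(γ + 1)))) (Ioi v) ∧
    ∫ w in Ioi v, (w - v) * (γ * w ^ (-(γ + 1))) = v ^ (1 - γ) / (γ - 1) := by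
  have i1 := (integrableOn_Ioi_rpow_of_lt (a := -γ) (by linarith) hv).const_mul γ
  have i2 := (integrableOn_Ioi_rpow_of_lt (a := -(γ + 1)) (by linarith) hv).const_mul (v * γ)
  have e : EqOn (fun w : ℝ => γ * w ^ (-γ) - v * γ * w ^ (-(γ + 1)))
      (fun w : ℝ => (w - v) * (γ * w ^ (-(γ + 1)))) (Ioi v) := fun w hw => by
    have hw0 : 0 < w := hv.trans hw
    have : w ^ (-γ) = w * w ^ (-(γ + 1)) := by
      rw [← Real.rpow_one_add' hw0.le (by linarith)]; congr 1; ring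
    simp only [this]
    ring
  refine ⟨IntegrableOn.congr_fun (Integrable.sub i1 i2) e measurableSet_Ioi, ?_⟩
  rw [← setIntegral_congr_fun measurableSet_Ioi e, integral_sub i1 i2, integral_const_mul,
    integral_const_mul, integral_Ioi_rpow_of_lt (by linarith) hv,
    integral_Ioi_rpow_of_lt (by linarith) hv]
  have h1 : -γ + 1 = 1 - γ := by ring
  have h2 : -(γ + 1) + 1 = -γ := by ring
  have h3 : v ^ (1 - γ) = v * v ^ (-γ) := by
    rw [← Real.rpow_one_add' hv.le (by linarith)]; congr 1
  rw [h1, h2, h3]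
  have h4 : γ - 1 ≠ 0 := by linarith
  have h5 : 1 - γ ≠ 0 := by linarith
  have h6 : γ ≠ 0 := by linarith
  field_simp
  ring

/-- Taylor's formula with integral remainder for exp(-rw). A Fubini swap then leaves a Gamma
integral. -/
lemma integral_sub_mul_exp (r : ℂ) (w : ℝ) :
    ∫ v in (0 : ℝ)..w, ((w - v : ℝ) : ℂ) * (r ^ 2 * Complex.exp (-(r * v))) =
      Complex.exp (-(r * w)) - 1 + r * w := by
  have hd : ∀ v : ℝ, HasDerivAt (fun v : ℝ => -((w - v : ℝ) : ℂ) * (r * Complex.exp (-(r * v))) +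
      Complex.exp (-(r * v))) (((w - v : ℝ) : ℂ) * (r ^ 2 * Complex.exp (-(r * v)))) v := by
    intro v
    have h1 : HasDerivAt (fun v : ℝ => Complex.exp (-(r * v))) (Complex.exp (-(r * v)) * (-(r * 1))) v :=
      (((Complex.ofRealCLM.hasDerivAt (x := v)).const_mul r).neg).cexp
    have h2 : HasDerivAt (fun v : ℝ => -((w - v : ℝ) : ℂ)) 1 v := by
      have := ((hasDerivAt_id v).const_sub w).neg.ofReal_comp
      convert this using 1
      · ext; simp
      · simp
    refine HasDerivAt.congr_deriv ((h2.mul (h1.const_mul r)).add h1) ?_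
    push_cast
    ring
  rw [intervalIntegral.integral_eq_sub_of_hasDerivAt (fun v _ => hd v)
    (Continuous.intervalIntegrable (by fun_prop) _ _)]
  simp
  ring

/-- Both sides are analytic in r on the right half-plane, the left one as a complex moment
generating function of the measure v^(s-1) dv. They agree at real r > 1, which accumulate at 1, so
the identity theorem applies. -/
lemma integral_rpow_mul_exp_neg_mul_complex {s : ℝ} (hs : 0 < s) {r : ℂ} (hr : 0 < r.re) :
    ∫ v in Ioi (0 : ℝ), ((v ^ (s - 1) : ℝ) : ℂ) * Complex.exp (-(r * v)) =
      (1 / r) ^ (s : ℂ) * (Real.Gamma s : ℂ) := by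
  set μ : Measure ℝ := (volume.restrict (Ioi 0)).withDensity (fun v => ENNReal.ofReal (v ^ (s - 1)))
    with hμ
  have hm : Measurable fun v : ℝ => v ^ (s - 1) := by fun_prop
  have hfin : ∀ᵐ u ∂(volume.restrict (Ioi (0 : ℝ))), ENNReal.ofReal (u ^ (s - 1)) < ∞ :=
    Eventually.of_forall fun u => ENNReal.ofReal_lt_top
  have hint : ∀ x : ℝ, 0 < x → Integrable (fun v => Real.exp (-x * v)) μ := fun x hx => by
    rw [hμ, integrable_withDensity_iff_integrable_smul' hm.ennreal_ofReal hfin]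
    have h3 := integrableOn_rpow_mul_exp_neg_mul_rpow (p := 1) (s := s - 1) (b := x) (by linarith)
      zero_lt_one hx
    refine IntegrableOn.congr_fun h3 (fun v hv => ?_) measurableSet_Ioi
    have hv0 : 0 < v := hv
    simp only [Real.rpow_one, smul_eq_mul]
    rw [ENNReal.toReal_ofReal (by positivity)]
  have hform : ∀ z : ℂ, complexMGF id μ (-z) =
      ∫ v in Ioi (0 : ℝ), ((v ^ (s - 1) : ℝ) : ℂ) * Complex.exp (-(z * v)) := fun z => by
    rw [complexMGF, hμ, integral_withDensity_eq_integral_toReal_smul hm.ennreal_ofReal hfin]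
    refine setIntegral_congr_fun measurableSet_Ioi fun v hv => ?_
    have hv0 : 0 < v := hv
    simp only [id]
    rw [ENNReal.toReal_ofReal (by positivity), Complex.real_smul, neg_mul]
  set U : Set ℂ := {z | 0 < z.re} with hU
  have hUo : IsOpen U := isOpen_lt continuous_const Complex.continuous_re
  have hsub : ∀ z ∈ U, (-z) ∈ {z : ℂ | z.re ∈ interior (integrableExpSet id μ)} := fun z hz => by
    have : Iio (0 : ℝ) ⊆ integrableExpSet id μ := fun x hx => by
      have := hint (-x) (neg_pos.2 hx)
      simpa [integrableExpSet] using this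
    have h2 := interior_maximal this isOpen_Iio
    refine h2 ?_
    have hz' : 0 < z.re := hz
    simpa using hz'
  have hA : AnalyticOnNhd ℂ (fun z => complexMGF id μ (-z)) U := by
    refine DifferentiableOn.analyticOnNhd (fun z hz => ?_) hUo
    exact ((analyticAt_complexMGF (hsub z hz)).differentiableAt.comp z
      (differentiableAt_id.neg)).differentiableWithinAt
  have hB : AnalyticOnNhd ℂ (fun z : ℂ => (1 / z) ^ (s : ℂ) * (Real.Gamma s : ℂ)) U := by
    refine DifferentiableOn.analyticOnNhd (fun z hz => ?_) hUo
    have hz' : 0 < z.re := hz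
    have hz0 : z ≠ 0 := fun h => by simp [h] at hz'
    have hsl : 1 / z ∈ Complex.slitPlane := by
      rw [one_div]
      refine Complex.mem_slitPlane_iff.2 (Or.inl ?_)
      rw [Complex.inv_re]
      exact div_pos hz' (Complex.normSq_pos.2 hz0)
    have h1 : DifferentiableAt ℂ (fun z : ℂ => 1 / z) z :=
      (differentiableAt_const _).div differentiableAt_id hz0
    exact ((h1.cpow_const hsl).mul_const _).differentiableWithinAt
  have hUc : IsPreconnected U := (convex_halfSpace_re_gt 0).isPreconnected
  have hfreq : ∃ᶠ z in 𝓝[≠] (1 : ℂ), (fun z => complexMGF id μ (-z)) z =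
      (fun z : ℂ => (1 / z) ^ (s : ℂ) * (Real.Gamma s : ℂ)) z := by
    have ht : Tendsto (fun x : ℝ => (x : ℂ)) (𝓝[>] 1) (𝓝[≠] (1 : ℂ)) := by
      refine tendsto_nhdsWithin_iff.2 ⟨?_, ?_⟩
      · exact (Complex.continuous_ofReal.tendsto' 1 1 (by simp)).mono_left nhdsWithin_le_nhds
      · filter_upwards [self_mem_nhdsWithin] with x hx
        have : x ≠ 1 := (mem_Ioi.1 hx).ne'
        rw [mem_compl_singleton_iff]
        exact_mod_cast this
    refine ht.frequently (Eventually.frequently ?_)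
    filter_upwards [self_mem_nhdsWithin] with x hx
    have hx0 : 0 < x := zero_lt_one.trans (mem_Ioi.1 hx)
    rw [hform, ← Complex.Gamma_ofReal, ← Complex.integral_cpow_mul_exp_neg_mul_Ioi
      (by simpa using hs) hx0]
    refine setIntegral_congr_fun measurableSet_Ioi fun v hv => ?_
    have hv0 : 0 < v := hv
    rw [Complex.ofReal_cpow hv0.le]
    push_cast
    rfl
  have := hA.eqOn_of_preconnected_of_frequently_eq hB hUc (by simp [hU] : (1 : ℂ) ∈ U) hfreq hr
  rw [← hform]
  exact this

/-- The Laplace exponent of the totally skewed stable law, in the open right half-plane. -/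
lemma integral_exp_sub_powerMeasure {γ : ℝ} (h1 : 1 < γ) (h2 : γ < 2) {r : ℂ} (hr : 0 < r.re) :
    ∫ w, (Complex.exp (-(r * w)) - 1 + r * w) ∂(powerMeasure γ) =
      r ^ 2 * ((1 / r) ^ ((2 - γ : ℝ) : ℂ) * (Real.Gamma (2 - γ) : ℂ)) / ((γ - 1 : ℝ) : ℂ) := by
  rw [integral_powerMeasure (by linarith)]
  -- The kernel on {v < w}: integrated over v it is the Taylor remainder times the density,
  -- integrated over w it is v^(1-γ)/(γ-1) times r² exp(-rv).
  set H : ℝ → ℝ → ℂ := fun w v => (Ioi v).indicator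
    (fun w : ℝ => (((w - v) * (γ * w ^ (-(γ + 1))) : ℝ) : ℂ)) w * (r ^ 2 * Complex.exp (-(r * v)))
    with hH
  have hHm : Measurable (Function.uncurry H) := by
    have e : Function.uncurry H = ({p : ℝ × ℝ | p.2 < p.1}.indicator
        (fun p : ℝ × ℝ => (((p.1 - p.2) * (γ * p.1 ^ (-(γ + 1))) : ℝ) : ℂ))) *
        fun p => (r ^ 2 * Complex.exp (-(r * p.2))) := by
      ext ⟨w, v⟩
      simp only [hH, Function.uncurry, Pi.mul_apply]
      congr 1
    rw [e]
    refine (Measurable.indicator (by fun_prop) (measurableSet_lt (by fun_prop) (by fun_prop))).mul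
      (by fun_prop)
  have hIoi : ∀ v : ℝ, 0 < v → Ioi v ∩ Ioi 0 = Ioi v := fun v hv =>
    inter_eq_left.2 (Ioi_subset_Ioi hv.le)
  have hin : ∀ v : ℝ, 0 < v → ∫ w in Ioi 0, H w v =
      ((v ^ (1 - γ) / (γ - 1) : ℝ) : ℂ) * (r ^ 2 * Complex.exp (-(r * v))) := fun v hv => by
    simp only [hH]
    rw [integral_mul_const, integral_indicator measurableSet_Ioi,
      Measure.restrict_restrict measurableSet_Ioi, hIoi v hv, integral_complex_ofReal,
      (integral_Ioi_sub_mul_rpow h1 hv).2]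
  have hnorm : ∀ w v : ℝ, 0 < v → ‖H w v‖ = (Ioi v).indicator
      (fun w : ℝ => (w - v) * (γ * w ^ (-(γ + 1)))) w * (‖r‖ ^ 2 * Real.exp (-(r.re * v))) := by
    intro w v hv
    simp only [hH]
    rw [norm_mul, norm_mul, norm_pow, Complex.norm_exp]
    congr 1
    · by_cases hw : w ∈ Ioi v
      · have h3 : 0 < w := hv.trans hw
        have h4 : 0 ≤ w - v := sub_nonneg.2 (mem_Ioi.1 hw).le
        rw [indicator_of_mem hw, indicator_of_mem hw, Complex.norm_real, Real.norm_of_nonneg]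
        positivity
      · rw [indicator_of_notMem hw, indicator_of_notMem hw, norm_zero]
    · simp
  have hexp : IntegrableOn (fun v : ℝ => v ^ (1 - γ) / (γ - 1) * (‖r‖ ^ 2 * Real.exp (-(r.re * v))))
      (Ioi 0) := by
    have h3 : IntegrableOn (fun v : ℝ => v ^ (1 - γ) * Real.exp (-(r.re * v))) (Ioi 0) := by
      have := integrableOn_rpow_mul_exp_neg_mul_rpow (p := 1) (s := 1 - γ) (b := r.re) (by linarith)
        zero_lt_one hr
      refine this.congr_fun (fun v _ => ?_) measurableSet_Ioi
      simp
    refine (h3.const_mul (‖r‖ ^ 2 / (γ - 1))).congr (Eventually.of_forall fun v => ?_)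
    simp only
    ring
  have hint : Integrable (Function.uncurry H)
      ((volume.restrict (Ioi 0)).prod (volume.restrict (Ioi 0))) := by
    rw [integrable_prod_iff' hHm.aestronglyMeasurable]
    constructor
    · filter_upwards [ae_restrict_mem measurableSet_Ioi] with v hv
      have hv0 : 0 < v := hv
      have h3 : Integrable ((Ioi v).indicator
          (fun w : ℝ => (((w - v) * (γ * w ^ (-(γ + 1))) : ℝ) : ℂ))) (volume.restrict (Ioi 0)) := by
        rw [integrable_indicator_iff measurableSet_Ioi, IntegrableOn,
          Measure.restrict_restrict measurableSet_Ioi, hIoi v hv0]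
        exact (integral_Ioi_sub_mul_rpow h1 hv0).1.ofReal
      exact h3.mul_const (r ^ 2 * Complex.exp (-(r * v)))
    · refine hexp.congr ?_
      filter_upwards [ae_restrict_mem measurableSet_Ioi] with v hv
      have hv0 : 0 < v := hv
      simp only [Function.uncurry]
      simp_rw [hnorm _ v hv0]
      rw [integral_mul_const, integral_indicator measurableSet_Ioi,
        Measure.restrict_restrict measurableSet_Ioi, hIoi v hv0, (integral_Ioi_sub_mul_rpow h1 hv0).2]
  have hout : ∀ w : ℝ, 0 < w → ∫ v in Ioi 0, H w v =
      (γ * w ^ (-(γ + 1))) • (Complex.exp (-(r * w)) - 1 + r * w) := fun w hw => by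
    rw [← integral_sub_mul_exp, intervalIntegral.integral_of_le hw.le, ← integral_smul]
    have e : ∀ v, H w v = (Iio w).indicator (fun v : ℝ => (γ * w ^ (-(γ + 1))) •
        (((w - v : ℝ) : ℂ) * (r ^ 2 * Complex.exp (-(r * v))))) v := fun v => by
      by_cases hvw : v < w
      · rw [indicator_of_mem (by exact hvw)]
        simp only [hH]
        rw [indicator_of_mem (by exact hvw), Complex.real_smul]
        push_cast
        ring
      · rw [indicator_of_notMem (by exact hvw)]
        simp only [hH]
        rw [indicator_of_notMem (by exact hvw), zero_mul]
    simp_rw [e]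
    rw [integral_indicator measurableSet_Iio, Measure.restrict_restrict measurableSet_Iio,
      inter_comm, Ioi_inter_Iio, integral_Ioc_eq_integral_Ioo]
  rw [← setIntegral_congr_fun measurableSet_Ioi hout, integral_integral_swap hint,
    setIntegral_congr_fun measurableSet_Ioi hin]
  have hG := integral_rpow_mul_exp_neg_mul_complex (s := 2 - γ) (by linarith) hr
  rw [← hG, ← integral_const_mul, ← integral_div]
  refine setIntegral_congr_fun measurableSet_Ioi fun v hv => ?_
  have h3 : 2 - γ - 1 = 1 - γ := by ring
  simp only [h3]
  push_cast
  ring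

lemma norm_exp_neg_sub_le {z : ℂ} (hz : 0 ≤ z.re) :
    ‖Complex.exp (-z) - 1 + z‖ ≤ 2 + ‖z‖ ∧ ‖Complex.exp (-z) - 1 + z‖ ≤ 3 * ‖z‖ ^ 2 := by
  have h1 : ‖Complex.exp (-z) - 1 + z‖ ≤ 2 + ‖z‖ := by
    refine (norm_add_le _ _).trans (add_le_add_left ((norm_sub_le _ _).trans ?_) _)
    have : ‖Complex.exp (-z)‖ ≤ 1 := by
      rw [Complex.norm_exp]; exact Real.exp_le_one_iff.2 (by simpa using hz)
    rw [norm_one]; linarith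
  refine ⟨h1, ?_⟩
  rcases le_total ‖z‖ 1 with h | h
  · have := Complex.norm_exp_sub_one_sub_id_le (x := -z) (by simpa using h)
    rw [sub_neg_eq_add, norm_neg] at this
    nlinarith [norm_nonneg z]
  · nlinarith

/-- The Laplace exponent is evaluated at r = 1/(n+1) - i, and n → ∞ gives the boundary value at -i.
There 1/r = i lies off the branch cut, which fixes the argument π/2. -/
lemma integral_centeredExp_powerMeasure_one {γ : ℝ} (h1 : 1 < γ) (h2 : γ < 2) :
    ∫ w, centeredExp w ∂(powerMeasure γ) =
      Complex.exp (-(Complex.I * (Real.pi * γ / 2 : ℝ))) * (Real.Gamma (2 - γ) / (γ - 1) : ℝ) := by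
  have hγ : (γ : ℂ) - 1 ≠ 0 := by
    rw [← Complex.ofReal_one, ← Complex.ofReal_sub]
    exact Complex.ofReal_ne_zero.2 (by linarith)
  set R : ℕ → ℂ := fun n => ((1 / ((n : ℝ) + 1) : ℝ) : ℂ) - Complex.I with hR
  have hRt : Tendsto R atTop (𝓝 (-Complex.I)) := by
    have := ((Complex.continuous_ofReal.tendsto 0).comp
      (tendsto_one_div_add_atTop_nhds_zero_nat (𝕜 := ℝ))).sub_const Complex.I
    simpa [hR, Function.comp_def] using this
  have hRre : ∀ n, 0 < (R n).re := fun n => by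
    simp only [hR, Complex.sub_re, Complex.ofReal_re, Complex.I_re, sub_zero]
    positivity
  have hRn : ∀ n, ‖R n‖ ≤ 2 := fun n => by
    refine (norm_sub_le _ _).trans ?_
    rw [Complex.norm_real, Complex.norm_I, Real.norm_of_nonneg (by positivity)]
    have : 1 / ((n : ℝ) + 1) ≤ 1 := by
      rw [div_le_one (by positivity)]; linarith [n.cast_nonneg (α := ℝ)]
    linarith
  have hL : Tendsto (fun n => ∫ w, (Complex.exp (-(R n * w)) - 1 + R n * w) ∂(powerMeasure γ)) atTop
      (𝓝 (∫ w, centeredExp w ∂(powerMeasure γ))) := by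
    refine tendsto_integral_of_dominated_convergence
      -- From |r| ≤ 2: the quadratic bound is 3 (2w)² = 12 w² for w ≤ 1, and 2 + 2w ≤ 12 w for w ≥
      -- 1.
      (fun w => 12 * min (w ^ (1 : ℝ)) (w ^ (2 : ℝ))) (fun n => by fun_prop)
      ((integrable_min_rpow_powerMeasure (by linarith) h1 h2).const_mul _) (fun n => ?_)
      (Eventually.of_forall fun w => ?_)
    · filter_upwards [ae_powerMeasure_pos γ] with w hw
      have hz : 0 ≤ (R n * (w : ℂ)).re := by
        rw [Complex.re_mul_ofReal]; exact mul_nonneg (hRre n).le hw.le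
      obtain ⟨b1, b2⟩ := norm_exp_neg_sub_le hz
      have hzn : ‖R n * (w : ℂ)‖ ≤ 2 * w := by
        rw [norm_mul, Complex.norm_real, Real.norm_of_nonneg hw.le]
        exact mul_le_mul_of_nonneg_right (hRn n) hw.le
      have hz0 := norm_nonneg (R n * (w : ℂ))
      rw [Real.rpow_one, Real.rpow_two]
      rcases le_total w 1 with h | h
      · rw [min_eq_right (by nlinarith)]
        nlinarith
      · rw [min_eq_left (by nlinarith)]
        linarith
    · have hc : Continuous fun r : ℂ => Complex.exp (-(r * w)) - 1 + r * w := by fun_prop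
      have := (hc.tendsto (-Complex.I)).comp hRt
      refine this.trans (le_of_eq ?_)
      congr 1
      simp only [centeredExp]
      ring_nf
  have hR2 : Tendsto (fun n => R n ^ 2 * ((1 / R n) ^ ((2 - γ : ℝ) : ℂ) * (Real.Gamma (2 - γ) : ℂ)) /
      ((γ - 1 : ℝ) : ℂ)) atTop (𝓝 ((-Complex.I) ^ 2 * ((1 / (-Complex.I)) ^ ((2 - γ : ℝ) : ℂ) *
        (Real.Gamma (2 - γ) : ℂ)) / ((γ - 1 : ℝ) : ℂ))) := by
    have h3 : Tendsto (fun n => 1 / R n) atTop (𝓝 (1 / (-Complex.I))) :=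
      tendsto_const_nhds.div hRt (neg_ne_zero.2 Complex.I_ne_zero)
    have h4 : (1 / (-Complex.I)) ∈ Complex.slitPlane := by
      rw [one_div, inv_neg, Complex.inv_I, neg_neg]
      exact Complex.mem_slitPlane_iff.2 (Or.inr (by simp))
    have h5 := (continuousAt_id.cpow continuousAt_const h4 :
      ContinuousAt (fun x : ℂ => id x ^ ((2 - γ : ℝ) : ℂ)) (1 / (-Complex.I))).tendsto.comp h3
    exact ((hRt.pow 2).mul (h5.mul_const _)).div_const _
  have hlim := tendsto_nhds_unique hL (hR2.congr fun n =>
    (integral_exp_sub_powerMeasure h1 h2 (hRre n)).symm)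
  rw [hlim, one_div, inv_neg, Complex.inv_I, neg_neg, neg_sq, Complex.I_sq,
    Complex.cpow_def_of_ne_zero Complex.I_ne_zero, Complex.log_I]
  have : Complex.exp (Real.pi / 2 * Complex.I * ((2 - γ : ℝ) : ℂ)) =
      -Complex.exp (-(Complex.I * (Real.pi * γ / 2 : ℝ))) := by
    have e : (Real.pi : ℂ) / 2 * Complex.I * ((2 - γ : ℝ) : ℂ) =
        Real.pi * Complex.I + -(Complex.I * (Real.pi * γ / 2 : ℝ)) := by
      push_cast; ring
    rw [e, Complex.exp_add, Complex.exp_pi_mul_I]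
    ring
  rw [this]
  push_cast
  ring

lemma cos_neg_of_mem {γ : ℝ} (h1 : 1 < γ) (h2 : γ < 2) : Real.cos (Real.pi * γ / 2) < 0 := by
  have := Real.pi_pos
  exact Real.cos_neg_of_pi_div_two_lt_of_lt (by nlinarith) (by nlinarith)

lemma stableConst_pos {γ : ℝ} (h1 : 1 < γ) (h2 : γ < 2) : 0 < stableConst γ := by
  have := cos_neg_of_mem h1 h2
  have h3 := Real.Gamma_pos_of_pos (by linarith : 0 < 2 - γ)
  rw [stableConst]
  exact div_pos (mul_pos (by linarith) h3) (by linarith)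

lemma centeredExp_neg (x : ℝ) : centeredExp (-x) = (starRingEnd ℂ) (centeredExp x) := by
  simp only [centeredExp, map_sub, map_mul, map_one, ← Complex.exp_conj, Complex.conj_I,
    Complex.conj_ofReal]
  push_cast
  ring_nf

lemma skewedStableExponent_mul {γ c : ℝ} (hc : 0 < c) (x : ℝ) :
    skewedStableExponent γ (c * x) = ((c ^ γ : ℝ) : ℂ) * skewedStableExponent γ x := by
  rw [skewedStableExponent, skewedStableExponent, abs_mul, Real.mul_rpow (abs_nonneg _) (abs_nonneg _),
    abs_of_pos hc, sign_mul, sign_pos hc, one_mul]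
  push_cast
  ring

/-- The characteristic exponent of the totally skewed stable law. -/
theorem integral_centeredExp_powerMeasure {γ : ℝ} (h1 : 1 < γ) (h2 : γ < 2) (x : ℝ) :
    ∫ w, centeredExp (x * w) ∂(powerMeasure γ) =
      -((stableConst γ : ℂ) * skewedStableExponent γ x) := by
  have hγ : 0 < γ := by linarith
  have hcos := cos_neg_of_mem h1 h2
  have hone : ∫ w, centeredExp w ∂(powerMeasure γ) =
      -((stableConst γ : ℂ) * skewedStableExponent γ 1) := by
    rw [integral_centeredExp_powerMeasure_one h1 h2, skewedStableExponent, stableConst]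
    have e : -(Complex.I * ((Real.pi * γ / 2 : ℝ) : ℂ)) = ((-(Real.pi * γ / 2) : ℝ) : ℂ) * Complex.I := by
      push_cast; ring
    rw [e, Complex.exp_mul_I, ← Complex.ofReal_cos, ← Complex.ofReal_sin, Real.cos_neg, Real.sin_neg,
      Real.tan_eq_sin_div_cos]
    have hc : (Real.cos (Real.pi * γ / 2) : ℂ) ≠ 0 := Complex.ofReal_ne_zero.2 hcos.ne
    simp only [abs_one, Real.one_rpow, sign_one, SignType.coe_one]
    push_cast at hc ⊢
    field_simp
    ring
  -- Homogeneity of the power measure reduces x to ±1; the value at -1 is the complex conjugate of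
  -- the value at 1.
  have hpos : ∀ c : ℝ, 0 < c → ∀ f : ℝ → ℂ, Continuous f →
      ∫ w, f (c * w) ∂(powerMeasure γ) = ((c ^ γ : ℝ) : ℂ) * ∫ w, f w ∂(powerMeasure γ) := by
    intro c hc f hf
    have h3 := map_mul_powerMeasure hγ hc
    have h4 : ∫ w, f w ∂((powerMeasure γ).map (fun u => c * u)) = ∫ w, f (c * w) ∂(powerMeasure γ) :=
      integral_map (by fun_prop) hf.aestronglyMeasurable
    rw [← h4, h3, integral_smul_measure, ENNReal.toReal_ofReal (by positivity), Complex.real_smul]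
  rcases lt_trichotomy x 0 with hx | hx | hx
  · have h3 := hpos (-x) (by linarith) (fun w => centeredExp (-w))
      (continuous_centeredExp.comp continuous_neg)
    have h4 : ∀ w : ℝ, centeredExp (-(-x * w)) = centeredExp (x * w) := fun w => by
      congr 1; ring
    simp only [h4] at h3
    rw [h3]
    simp_rw [centeredExp_neg]
    rw [integral_conj, hone]
    have h5 : skewedStableExponent γ x = (((-x) ^ γ : ℝ) : ℂ) * skewedStableExponent γ (-1) := by
      rw [← skewedStableExponent_mul (by linarith)]
      congr 1; ring
    rw [h5]
    have h6 : (starRingEnd ℂ) (skewedStableExponent γ 1) = skewedStableExponent γ (-1) := by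
      simp only [skewedStableExponent, map_mul, map_sub, map_one, Complex.conj_ofReal,
        Complex.conj_I, abs_neg]
      simp
    rw [map_neg, map_mul, h6, Complex.conj_ofReal]
    ring
  · subst hx
    simp [centeredExp_zero, skewedStableExponent, Real.zero_rpow hγ.ne']
  · rw [hpos x hx centeredExp continuous_centeredExp, hone]
    have h5 : skewedStableExponent γ x = ((x ^ γ : ℝ) : ℂ) * skewedStableExponent γ 1 := by
      rw [← skewedStableExponent_mul hx, mul_one]
    rw [h5]
    ring

/-! ### Integrability under the limit mean measures and integration over stable marks -/

lemma min_sq_abs_le_rpow {κ : ℝ} (h1 : 1 ≤ κ) (h2 : κ ≤ 2) (x : ℝ) :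
    min (x ^ 2) |x| ≤ |x| ^ κ := by
  rcases le_total |x| 1 with h | h
  · refine (min_le_left _ _).trans ?_
    rw [← sq_abs]
    rcases (abs_nonneg x).eq_or_lt with h0 | h0
    · rw [← h0]; simp [Real.zero_rpow (by linarith : κ ≠ 0)]
    · have := Real.rpow_le_rpow_of_exponent_ge h0 h h2
      rwa [Real.rpow_two] at this
  · refine (min_le_right _ _).trans ?_
    have := Real.rpow_le_rpow_of_exponent_le h h1
    rwa [Real.rpow_one] at this

lemma measurable_min_sq_abs {E : Type*} [MeasurableSpace E] {f : E → ℝ} (hf : Measurable f) :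
    Measurable fun x => min (f x ^ 2) |f x| :=
  (hf.pow_const 2).min (continuous_abs.measurable.comp hf)

lemma abs_mul_rpow_le {C x y m κ : ℝ} (h0 : 0 ≤ κ) (hC : 0 ≤ C) (hm : 0 ≤ m)
    (hy : |y| ≤ C * |x| * m) : |y| ^ κ ≤ C ^ κ * |x| ^ κ * m ^ κ := by
  rw [← Real.mul_rpow hC (abs_nonneg x), ← Real.mul_rpow (by positivity) hm]
  exact Real.rpow_le_rpow (abs_nonneg _) hy h0

/-- Rates with moments up to some κ₂ > α: min(f², |f|) lies below |f|^κ for all κ in [1,2], so κ₁ <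
α and κ₂ can both be used. -/
lemma integrable_min_limitMean {FR : Measure ℝ} [SFinite FR] {α κ₂ C : ℝ} (h1 : 1 < α)
    (hκ : α < κ₂) (hκ2 : κ₂ ≤ 2)
    (hmom : ∀ κ, 1 ≤ κ → κ ≤ κ₂ → Integrable (fun r : ℝ => |r| ^ κ) FR) (hC : 0 ≤ C)
    {f : ℝ × ℝ × ℝ → ℝ} (hf : Measurable f)
    (hb : ∀ s u x, 0 < u → |f (s, u, x)| ≤ C * |x| * (u / (1 + |s|))) :
    Integrable (fun y => min (f y ^ 2) |f y|) (limitMean α FR) := by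
  obtain ⟨κ₁, hk1, hk2⟩ := exists_between h1
  refine integrable_of_norm_le_powerMeasure hk1 hk2 hκ
    (v := fun x => C ^ κ₁ * |x| ^ κ₁ + C ^ κ₂ * |x| ^ κ₂)
    (((hmom κ₁ hk1.le (hk2.trans hκ).le).const_mul _).add ((hmom κ₂ (by linarith) le_rfl).const_mul _))
    (measurable_min_sq_abs hf).aestronglyMeasurable fun s u x hu => ?_
  have hm0 : 0 ≤ u / (1 + |s|) := by positivity
  rw [Real.norm_of_nonneg (le_min (sq_nonneg _) (abs_nonneg _))]
  have b1 := (min_sq_abs_le_rpow hk1.le (by linarith) _).trans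
    (abs_mul_rpow_le (by linarith) hC hm0 (hb s u x hu))
  have b2 := (min_sq_abs_le_rpow (by linarith) hκ2 _).trans
    (abs_mul_rpow_le (by linarith) hC hm0 (hb s u x hu))
  refine ⟨b1.trans (mul_le_mul_of_nonneg_right ?_ (by positivity)),
    b2.trans (mul_le_mul_of_nonneg_right ?_ (by positivity))⟩
  · have : 0 ≤ C ^ κ₂ * |x| ^ κ₂ := by positivity
    linarith
  · have : 0 ≤ C ^ κ₁ * |x| ^ κ₁ := by positivity
    linarith

lemma min_one_rpow_le {a η κ : ℝ} (ha : 0 ≤ a) (hη : 0 < η) (h : η ≤ κ) :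
    (min 1 a) ^ κ ≤ a ^ η := by
  rcases ha.eq_or_lt with h0 | h0
  · rw [← h0, min_eq_right zero_le_one, Real.zero_rpow (by linarith), Real.zero_rpow (by linarith)]
  · calc (min 1 a) ^ κ ≤ (min 1 a) ^ η :=
        Real.rpow_le_rpow_of_exponent_ge (lt_min one_pos h0) (min_le_left _ _) h
      _ ≤ _ := Real.rpow_le_rpow (le_min zero_le_one ha) (min_le_right _ _) hη.le

/-- Power-law rates have no finite moment of any order, so κ₂ < α_R is used for large rates and 2
for small ones. The cap at 1 in the overlap bound makes both choices compatible with the durations.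
-/
lemma integrable_min_limitMean_powerMeasure {α αR C : ℝ} (h1 : 1 < α) (hα : α < αR)
    (hR2 : αR < 2) (hC : 1 ≤ C) {f : ℝ × ℝ × ℝ → ℝ} (hf : Measurable f)
    (hb : ∀ s u x, 0 < u → |f (s, u, x)| ≤ C * |x| * min 1 (u / (1 + |s|))) :
    Integrable (fun y => min (f y ^ 2) |f y|) (limitMean α (powerMeasure αR)) := by
  obtain ⟨κ₁, hk1, hk2⟩ := exists_between h1
  obtain ⟨κ₂, hk3, hk4⟩ := exists_between hα
  have hv : Integrable (fun x => C ^ (2 : ℝ) * min (|x| ^ κ₂) (|x| ^ (2 : ℝ))) (powerMeasure αR) := by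
    refine ((integrable_min_rpow_powerMeasure (by linarith) hk4 hR2).const_mul
      (C ^ (2 : ℝ))).congr ?_
    filter_upwards [ae_powerMeasure_pos αR] with x hx
    rw [abs_of_pos hx]
  refine integrable_of_norm_le_powerMeasure hk1 hk2 hk3 hv
    (measurable_min_sq_abs hf).aestronglyMeasurable fun s u x hu => ?_
  have hm0 : 0 ≤ u / (1 + |s|) := by positivity
  have hμ0 : 0 ≤ min 1 (u / (1 + |s|)) := le_min zero_le_one hm0
  rw [Real.norm_of_nonneg (le_min (sq_nonneg _) (abs_nonneg _))]
  have hv0 : 0 ≤ C ^ (2 : ℝ) * min (|x| ^ κ₂) (|x| ^ (2 : ℝ)) :=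
    mul_nonneg (by positivity) (le_min (by positivity) (by positivity))
  have b : min (f (s, u, x) ^ 2) |f (s, u, x)| ≤
      C ^ (2 : ℝ) * min (|x| ^ κ₂) (|x| ^ (2 : ℝ)) * (min 1 (u / (1 + |s|))) ^ κ₂ := by
    rw [mul_min_of_nonneg _ _ (by positivity), min_mul_of_nonneg _ _ (by positivity)]
    refine le_min ?_ ?_
    · refine (min_sq_abs_le_rpow (κ := κ₂) (by linarith) (by linarith) _).trans
        ((abs_mul_rpow_le (by linarith) (by linarith) hμ0 (hb s u x hu)).trans ?_)
      gcongr
      linarith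
    · refine (min_sq_abs_le_rpow one_le_two le_rfl _).trans
        ((abs_mul_rpow_le zero_le_two (by linarith) hμ0 (hb s u x hu)).trans ?_)
      refine mul_le_mul_of_nonneg_left ?_ (by positivity)
      rcases hμ0.eq_or_lt with h0 | h0
      · rw [← h0, Real.zero_rpow two_ne_zero]
        positivity
      · exact Real.rpow_le_rpow_of_exponent_ge h0 (min_le_left _ _) (by linarith)
  exact ⟨b.trans (mul_le_mul_of_nonneg_left (min_one_rpow_le hm0 (by linarith) (by linarith)) hv0),
    b.trans (mul_le_mul_of_nonneg_left (min_one_rpow_le hm0 (by linarith) le_rfl) hv0)⟩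

lemma integrable_centeredExp_of_min {E : Type*} [MeasurableSpace E] {μ : Measure E} {f : E → ℝ}
    (hf : Measurable f) (hi : Integrable (fun x => min (f x ^ 2) |f x|) μ) :
    Integrable (fun x => centeredExp (f x)) μ :=
  (hi.const_mul 2).mono' (measurable_centeredExp_comp hf).aestronglyMeasurable
    (Eventually.of_forall fun _ => norm_centeredExp_le_min _)

/-- Integrability of powers of the overlap functionals. -/
lemma integrable_abs_overlapSum_rpow {m : ℕ} (t : Fin m → ℝ≥0) (z : Fin m → ℝ) {α κ : ℝ}
    (h1 : 1 < α) (hκ : α < κ) :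
    Integrable (fun p : ℝ × ℝ => |overlapSum t z p.1 p.2| ^ κ)
      ((volume : Measure ℝ).prod (powerMeasure α)) := by
  obtain ⟨C, hC, hS⟩ := exists_abs_overlapSum_le t z
  obtain ⟨κ₁, hk1, hk2⟩ := exists_between h1
  have hs : Integrable (fun s : ℝ => (1 + ‖s‖) ^ (-κ₁)) := integrable_one_add_norm (by simpa)
  have hd := (hs.mul_prod (integrable_min_rpow_powerMeasure (by linarith) hk2 hκ)).const_mul (C ^ κ)
  refine hd.mono' ?_ ?_
  · exact (((continuous_overlapSum t z).abs.rpow_const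
      fun p => Or.inr (by linarith)).measurable).aestronglyMeasurable
  have hpos : ∀ᵐ p : ℝ × ℝ ∂((volume : Measure ℝ).prod (powerMeasure α)), 0 < p.2 :=
    Measure.quasiMeasurePreserving_snd.ae (ae_powerMeasure_pos α)
  filter_upwards [hpos] with ⟨s, u⟩ hu
  simp only at hu ⊢
  have hm0 : 0 ≤ u / (1 + |s|) := by positivity
  rw [Real.norm_of_nonneg (by positivity)]
  have b : |overlapSum t z s u| ^ κ ≤ C ^ κ * (min 1 (u / (1 + |s|))) ^ κ := by
    rw [← Real.mul_rpow (by linarith) (le_min zero_le_one hm0)]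
    exact Real.rpow_le_rpow (abs_nonneg _) (hS s u hu.le) (by linarith)
  have c1 := (min_one_rpow_le hm0 (by linarith : 0 < κ₁) (by linarith : κ₁ ≤ κ)).trans
    (div_one_add_abs_rpow_le (s := s) hu.le (le_refl κ₁))
  have c2 := (min_one_rpow_le hm0 (by linarith : 0 < κ) (le_refl κ)).trans
    (div_one_add_abs_rpow_le (s := s) hu.le (hk2.trans hκ).le)
  refine b.trans (mul_le_mul_of_nonneg_left ?_ (by positivity))
  rw [mul_min_of_nonneg _ _ (by positivity), mul_comm _ (u ^ κ₁), mul_comm _ (u ^ κ)]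
  exact le_min c1 c2

lemma sessionOverlap_eq_overlapSum (t : ℝ≥0) (s u : ℝ) :
    sessionOverlap t s u = overlapSum (fun _ : Fin 1 => t) (fun _ => 1) s u := by
  simp [overlapSum]

lemma memLp_sessionOverlap (t : ℝ≥0) {α κ : ℝ} (h1 : 1 < α) (hκ : α < κ) :
    MemLp (fun p : ℝ × ℝ => sessionOverlap t p.1 p.2) (ENNReal.ofReal κ)
      ((volume : Measure ℝ).prod (powerMeasure α)) := by
  refine (integrable_norm_rpow_iff (continuous_sessionOverlap t).measurable.aestronglyMeasurable
    (by simp; linarith) ENNReal.ofReal_ne_top).1 ?_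
  rw [ENNReal.toReal_ofReal (by linarith)]
  have := integrable_abs_overlapSum_rpow (fun _ : Fin 1 => t) (fun _ => 1) h1 hκ
  simp only [← sessionOverlap_eq_overlapSum] at this
  exact this

lemma measurable_skewedStableExponent (γ : ℝ) : Measurable (skewedStableExponent γ) := by
  unfold skewedStableExponent
  have hs : Measurable fun x : ℝ => ((SignType.sign x : ℝ)) := by
    have e : (fun x : ℝ => ((SignType.sign x : ℝ))) =
        fun x => if 0 < x then 1 else if x < 0 then -1 else 0 := by
      ext x
      rw [sign_apply]
      split_ifs <;> simp
    rw [e]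
    exact Measurable.ite measurableSet_Ioi measurable_const
      (Measurable.ite measurableSet_Iio measurable_const measurable_const)
  fun_prop

lemma norm_skewedStableExponent_le (γ x : ℝ) :
    ‖skewedStableExponent γ x‖ ≤ (1 + |Real.tan (Real.pi * γ / 2)|) * |x| ^ γ := by
  have hs : ‖((SignType.sign x : ℝ) : ℂ)‖ ≤ 1 := by
    rw [Complex.norm_real]
    rcases SignType.sign x with _ | _ | _ <;> simp
  rw [skewedStableExponent, norm_mul, Complex.norm_real, Real.norm_of_nonneg (by positivity), mul_comm]
  refine mul_le_mul_of_nonneg_right ((norm_sub_le _ _).trans ?_) (by positivity)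
  have ht : ‖((Real.tan (Real.pi * γ / 2) : ℝ) : ℂ)‖ = |Real.tan (Real.pi * γ / 2)| := by
    rw [Complex.norm_real, Real.norm_eq_abs]
  rw [norm_one, norm_mul, norm_mul, Complex.norm_I, one_mul, ht]
  have := mul_le_mul_of_nonneg_right hs (abs_nonneg (Real.tan (Real.pi * γ / 2)))
  linarith

/-- Stable marks integrated out. -/
lemma integral_centeredExp_limitMean_powerMeasure {m : ℕ} (t : Fin m → ℝ≥0) (z : Fin m → ℝ)
    {α αR : ℝ} (h1 : 1 < α) (hα : α < αR) (hR2 : αR < 2) :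
    ∫ y, centeredExp (y.2.2 * overlapSum t z y.1 y.2.1) ∂(limitMean α (powerMeasure αR)) =
      -((stableConst αR : ℂ) * ∫ p, skewedStableExponent αR (overlapSum t z p.1 p.2)
        ∂((volume : Measure ℝ).prod (powerMeasure α))) := by
  obtain ⟨C, hC, hS⟩ := exists_abs_overlapSum_le t z
  have hm : Measurable fun y : ℝ × ℝ × ℝ => y.2.2 * overlapSum t z y.1 y.2.1 :=
    (by fun_prop : Measurable fun y : ℝ × ℝ × ℝ => y.2.2).mul (measurable_overlapSum t z)
  have hi := integrable_centeredExp_of_min hm (integrable_min_limitMean_powerMeasure h1 hα hR2 hC hm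
    fun s u x hu => by
      rw [abs_mul]
      calc |x| * |overlapSum t z s u| ≤ |x| * (C * min 1 (u / (1 + |s|))) :=
            mul_le_mul_of_nonneg_left (hS s u hu.le) (abs_nonneg _)
        _ = _ := by ring)
  rw [limitMean, ← Measure.prodAssoc_prod] at hi ⊢
  have hi2 := (integrable_map_equiv _ _).1 hi
  simp only [Function.comp_def] at hi2
  rw [integral_map_equiv, integral_prod _ hi2]
  rw [← integral_const_mul, ← integral_neg]
  congr 1
  ext p
  rw [← integral_centeredExp_powerMeasure (h1.trans hα) hR2]
  congr 1
  ext w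
  simp only [MeasurableEquiv.prodAssoc, MeasurableEquiv.coe_mk, Equiv.prodAssoc_apply]
  rw [mul_comm]

/-! ### Step functionals of the slow scenario -/

/-- The functional `∑ i, z i * 1_{(0, t i)}(s)`. -/
noncomputable def stepSum {m : ℕ} (t : Fin m → ℝ≥0) (z : Fin m → ℝ) (s : ℝ) : ℝ :=
  ∑ i, z i * (Ioo (0 : ℝ) (t i)).indicator 1 s

section stepSum

variable {m : ℕ} (t : Fin m → ℝ≥0) (z : Fin m → ℝ)

lemma measurable_stepSum : Measurable (stepSum t z) :=
  Finset.measurable_fun_sum _ fun _ _ =>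
    (measurable_one.indicator measurableSet_Ioo).const_mul _

/-- The step functional obeys the decay in s that the overlap has, so the same integrability lemmas
serve. -/
lemma abs_indicator_Ioo_mul_le (t : ℝ≥0) (s u : ℝ) (hu : 0 ≤ u) :
    u * (Ioo (0 : ℝ) t).indicator 1 s ≤ (1 + t) * (u / (1 + |s|)) := by
  by_cases hs : s ∈ Ioo (0 : ℝ) t
  · rw [indicator_of_mem hs, Pi.one_apply, mul_one, ← mul_div_assoc, le_div_iff₀ (by positivity),
      abs_of_pos hs.1, mul_comm]
    exact mul_le_mul_of_nonneg_right (by linarith [hs.2]) hu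
  · rw [indicator_of_notMem hs, mul_zero]
    positivity

lemma exists_abs_mul_stepSum_le : ∃ C : ℝ, 0 ≤ C ∧ ∀ s u, 0 ≤ u →
    |u * stepSum t z s| ≤ C * (u / (1 + |s|)) := by
  refine ⟨∑ i, |z i| * (1 + (t i : ℝ)), Finset.sum_nonneg fun i _ => by positivity,
    fun s u hu => ?_⟩
  rw [stepSum, Finset.mul_sum, Finset.sum_mul]
  refine (Finset.abs_sum_le_sum_abs _ _).trans (Finset.sum_le_sum fun i _ => ?_)
  have h0 : 0 ≤ u * (Ioo (0 : ℝ) (t i)).indicator 1 s :=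
    mul_nonneg hu (indicator_nonneg (fun _ _ => zero_le_one) s)
  calc |u * (z i * (Ioo (0 : ℝ) (t i)).indicator 1 s)|
      = |z i| * (u * (Ioo (0 : ℝ) (t i)).indicator 1 s) := by
        rw [mul_left_comm, abs_mul, abs_of_nonneg h0]
    _ ≤ |z i| * ((1 + t i) * (u / (1 + |s|))) :=
        mul_le_mul_of_nonneg_left (abs_indicator_Ioo_mul_le (t i) s u hu) (abs_nonneg _)
    _ = _ := by ring

lemma integrable_abs_stepSum_rpow {κ : ℝ} (hκ : 0 < κ) :
    Integrable (fun s => |stepSum t z s| ^ κ) := by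
  set b : ℝ := ∑ i, (t i : ℝ) with hb
  have hti : ∀ i, (t i : ℝ) ≤ b := fun i =>
    Finset.single_le_sum (f := fun i => (t i : ℝ)) (fun i _ => (t i).coe_nonneg) (Finset.mem_univ i)
  have h1 : IntegrableOn (fun _ : ℝ => (∑ i, |z i|) ^ κ) (Ioo 0 b) := integrableOn_const (by simp)
  have h2 : Integrable ((Ioo 0 b).indicator fun _ : ℝ => (∑ i, |z i|) ^ κ) :=
    h1.integrable_indicator measurableSet_Ioo
  refine h2.mono' ?_ (Eventually.of_forall fun s => ?_)
  · have := measurable_stepSum t z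
    exact (by fun_prop : Measurable fun s => |stepSum t z s| ^ κ).aestronglyMeasurable
  · rw [Real.norm_of_nonneg (by positivity)]
    by_cases hs : s ∈ Ioo 0 b
    · rw [indicator_of_mem hs]
      refine Real.rpow_le_rpow (abs_nonneg _) ?_ hκ.le
      refine (Finset.abs_sum_le_sum_abs _ _).trans (Finset.sum_le_sum fun i _ => ?_)
      rw [abs_mul]
      refine mul_le_of_le_one_right (abs_nonneg _) ?_
      have h3 : 0 ≤ (Ioo (0 : ℝ) (t i)).indicator (1 : ℝ → ℝ) s :=
        indicator_nonneg (fun _ _ => zero_le_one) s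
      rw [abs_of_nonneg h3]
      exact indicator_le_self' (f := (1 : ℝ → ℝ)) (fun _ _ => zero_le_one) s
    · have : stepSum t z s = 0 := by
        refine Finset.sum_eq_zero fun i _ => ?_
        rw [indicator_of_notMem (fun h => hs ⟨h.1, h.2.trans_le (hti i)⟩), mul_zero]
      rw [indicator_of_notMem hs, this, abs_zero, Real.zero_rpow hκ.ne']

variable {FR : Measure ℝ}

lemma integrable_abs_mul_stepSum_rpow {κ : ℝ} (hκ : 0 < κ)
    (hmom : Integrable (fun r : ℝ => |r| ^ κ) FR) :
    Integrable (fun p : ℝ × ℝ => |p.2 * stepSum t z p.1| ^ κ) ((volume : Measure ℝ).prod FR) := by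
  refine ((integrable_abs_stepSum_rpow t z hκ).mul_prod hmom).congr (Eventually.of_forall fun p => ?_)
  simp only
  rw [abs_mul, Real.mul_rpow (abs_nonneg _) (abs_nonneg _), mul_comm]

lemma memLp_mul_indicator (t : ℝ≥0) {κ : ℝ} (hκ : 0 < κ)
    (hmom : Integrable (fun r : ℝ => |r| ^ κ) FR) :
    MemLp (fun p : ℝ × ℝ => p.2 * (Ioo (0 : ℝ) t).indicator 1 p.1) (ENNReal.ofReal κ)
      ((volume : Measure ℝ).prod FR) := by
  have hm : Measurable fun p : ℝ × ℝ => p.2 * (Ioo (0 : ℝ) t).indicator (1 : ℝ → ℝ) p.1 :=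
    measurable_snd.mul ((measurable_one.indicator measurableSet_Ioo).comp measurable_fst)
  refine (integrable_norm_rpow_iff hm.aestronglyMeasurable (by simpa) ENNReal.ofReal_ne_top).1 ?_
  rw [ENNReal.toReal_ofReal hκ.le]
  have := integrable_abs_mul_stepSum_rpow (fun _ : Fin 1 => t) (fun _ => 1) hκ hmom
  simpa [stepSum] using this

lemma integrable_skewedStableExponent_mul_stepSum {κ : ℝ} (hκ : 0 < κ)
    (hmom : Integrable (fun r : ℝ => |r| ^ κ) FR) :
    Integrable (fun p : ℝ × ℝ => skewedStableExponent κ (p.2 * stepSum t z p.1))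
      ((volume : Measure ℝ).prod FR) := by
  refine ((integrable_abs_mul_stepSum_rpow t z hκ hmom).const_mul _).mono' ?_
    (Eventually.of_forall fun p => norm_skewedStableExponent_le _ _)
  exact ((measurable_skewedStableExponent κ).comp
    (measurable_snd.mul ((measurable_stepSum t z).comp measurable_fst))).aestronglyMeasurable

lemma measurable_mul_stepSum : Measurable fun y : ℝ × ℝ × ℝ => y.2.2 * (y.2.1 * stepSum t z y.1) :=
  (by fun_prop : Measurable fun y : ℝ × ℝ × ℝ => y.2.2).mul
    ((by fun_prop : Measurable fun y : ℝ × ℝ × ℝ => y.2.1).mul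
      ((measurable_stepSum t z).comp measurable_fst))

/-- Stable durations integrated out. -/
lemma integral_centeredExp_limitMean_stepSum [SFinite FR] {α κ₂ : ℝ} (h1 : 1 < α) (hκ : α < κ₂) (hκ2 : κ₂ ≤ 2)
    (hmom : ∀ κ, 1 ≤ κ → κ ≤ κ₂ → Integrable (fun r : ℝ => |r| ^ κ) FR) :
    ∫ y, centeredExp (y.2.2 * (y.2.1 * stepSum t z y.1)) ∂(limitMean α FR) =
      -((stableConst α : ℂ) * ∫ p, skewedStableExponent α (p.2 * stepSum t z p.1)
        ∂((volume : Measure ℝ).prod FR)) := by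
  obtain ⟨C, hC, hS⟩ := exists_abs_mul_stepSum_le t z
  have hm := measurable_mul_stepSum t z
  have hi := integrable_centeredExp_of_min hm (integrable_min_limitMean h1 hκ hκ2 hmom hC hm
    fun s u x hu => by
      rw [abs_mul]
      calc |x| * |u * stepSum t z s| ≤ |x| * (C * (u / (1 + |s|))) :=
            mul_le_mul_of_nonneg_left (hS s u hu.le) (abs_nonneg _)
        _ = _ := by ring)
  rw [limitMean] at hi ⊢
  rw [integral_prod _ hi, integral_prod _ (integrable_skewedStableExponent_mul_stepSum t z
    (by linarith) (hmom α h1.le hκ.le)), ← integral_const_mul, ← integral_neg]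
  refine integral_congr_ae ?_
  filter_upwards [hi.prod_right_ae] with s hs
  rw [integral_prod_symm _ hs, ← integral_const_mul, ← integral_neg]
  congr 1
  ext r
  rw [← integral_centeredExp_powerMeasure h1 (hκ.trans_le hκ2)]
  congr 1
  ext u
  congr 1
  ring

/-- Positive marks factor out of the stable exponent. -/
lemma integral_skewedStableExponent_mul_stepSum [SFinite FR] {α : ℝ} (hα : 0 < α) (h0 : FR (Iic 0) = 0)
    (hmom : Integrable (fun r : ℝ => |r| ^ α) FR) :
    ∫ p, skewedStableExponent α (p.2 * stepSum t z p.1) ∂((volume : Measure ℝ).prod FR) =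
      ((∫ r, r ^ α ∂FR : ℝ) : ℂ) * ∫ s, skewedStableExponent α (stepSum t z s) := by
  rw [integral_prod _ (integrable_skewedStableExponent_mul_stepSum t z hα hmom),
    ← integral_const_mul]
  congr 1
  ext s
  have : ∀ᵐ r ∂FR, skewedStableExponent α (r * stepSum t z s) =
      ((r ^ α : ℝ) : ℂ) * skewedStableExponent α (stepSum t z s) := by
    filter_upwards [ae_pos_of_measure_Iic_eq_zero h0] with r hr
    exact skewedStableExponent_mul hr _
  rw [integral_congr_ae this, integral_mul_const, integral_complex_ofReal]

end stepSum

/-! ### Scaling of the limit measures, and stable laws -/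

/-- Dilating time by c contributes 1/c from the starts and c^α from the durations. -/
lemma map_scale_limitMean {α c : ℝ} (hα : 0 < α) (hc : 0 < c) (h : Measure ℝ) [SFinite h] :
    (limitMean α h).map (Prod.map (fun s => c * s) (Prod.map (fun u => c * u) id)) =
      ENNReal.ofReal (c ^ (α - 1)) • limitMean α h := by
  have hm : Measurable fun s : ℝ => c * s := by fun_prop
  have : SFinite (Measure.map (fun u => c * u) (powerMeasure α)) := inferInstance
  rw [limitMean, ← Measure.map_prod_map _ _ hm (hm.prodMap measurable_id),
    ← Measure.map_prod_map _ _ hm measurable_id, map_mul_powerMeasure hα hc, Measure.map_id,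
    Real.map_volume_mul_left hc.ne', Measure.prod_smul_left, Measure.prod_smul_left,
    Measure.prod_smul_right, smul_smul, abs_of_pos (inv_pos.2 hc), ← ENNReal.ofReal_mul (by positivity)]
  congr 2
  rw [Real.rpow_sub_one hc.ne']
  field_simp

lemma integral_scale_limitMean {α c : ℝ} (hα : 0 < α) (hc : 0 < c) (h : Measure ℝ) [SFinite h]
    {G : ℝ × ℝ × ℝ → ℂ} (hG : Measurable G) :
    ∫ y, G (c * y.1, c * y.2.1, y.2.2) ∂(limitMean α h) =
      ((c ^ (α - 1) : ℝ) : ℂ) * ∫ y, G y ∂(limitMean α h) := by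
  have hm : Measurable (Prod.map (fun s : ℝ => c * s) (Prod.map (fun u : ℝ => c * u) (id : ℝ → ℝ))) := by
    fun_prop
  have e := integral_map (μ := limitMean α h) hm.aemeasurable hG.aestronglyMeasurable
  rw [map_scale_limitMean hα hc, integral_smul_measure, ENNReal.toReal_ofReal (by positivity),
    Complex.real_smul] at e
  rw [e]
  rfl

lemma overlapSum_scale {m : ℕ} (t : Fin m → ℝ≥0) (z : Fin m → ℝ) (c : ℝ≥0) (s u : ℝ) :
    overlapSum (fun i => c * t i) z (c * s) (c * u) = c * overlapSum t z s u := by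
  simp only [overlapSum, Finset.mul_sum]
  refine Finset.sum_congr rfl fun i _ => ?_
  rw [NNReal.coe_mul, sessionOverlap_scale c.coe_nonneg]
  ring

lemma overlapSum_smul {m : ℕ} (t : Fin m → ℝ≥0) (z : Fin m → ℝ) (c s u : ℝ) :
    overlapSum t (fun i => c * z i) s u = c * overlapSum t z s u := by
  simp only [overlapSum, Finset.mul_sum, mul_assoc]

lemma integral_centeredExp_overlapSum_smul {m : ℕ} (t : Fin m → ℝ≥0) (z : Fin m → ℝ)
    {α αR c : ℝ} (h1 : 1 < α) (hα : α < αR) (hR2 : αR < 2) (hc : 0 < c) :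
    ∫ y, centeredExp (y.2.2 * overlapSum t (fun i => c * z i) y.1 y.2.1)
        ∂(limitMean α (powerMeasure αR)) =
      ((c ^ αR : ℝ) : ℂ) * ∫ y, centeredExp (y.2.2 * overlapSum t z y.1 y.2.1)
        ∂(limitMean α (powerMeasure αR)) := by
  rw [integral_centeredExp_limitMean_powerMeasure t _ h1 hα hR2,
    integral_centeredExp_limitMean_powerMeasure t _ h1 hα hR2]
  simp_rw [overlapSum_smul, skewedStableExponent_mul hc]
  rw [integral_const_mul]
  ring

/-- Multiplying the amplitudes by c amounts to dilating time by c, at the price of the factor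
c^(α-1). This yields c Y(·/c) in the moderate scenario and, with stable rates, self-similarity. -/
lemma integral_centeredExp_overlapSum_scale {m : ℕ} (t : Fin m → ℝ≥0) (z : Fin m → ℝ)
    {α : ℝ} (hα : 0 < α) {c : ℝ≥0} (hc : 0 < c) (h : Measure ℝ) [SFinite h] :
    ∫ y, centeredExp (y.2.2 * overlapSum t (fun i => c * z i) y.1 y.2.1) ∂(limitMean α h) =
      (((c : ℝ) ^ (α - 1) : ℝ) : ℂ) *
        ∫ y, centeredExp (y.2.2 * overlapSum (fun i => c * t i) z y.1 y.2.1) ∂(limitMean α h) := by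
  have hm : Measurable fun y : ℝ × ℝ × ℝ =>
      centeredExp (y.2.2 * overlapSum (fun i => c * t i) z y.1 y.2.1) :=
    measurable_centeredExp_comp ((by fun_prop : Measurable fun y : ℝ × ℝ × ℝ => y.2.2).mul
      (measurable_overlapSum _ z))
  rw [← integral_scale_limitMean hα (NNReal.coe_pos.2 hc) h hm]
  simp_rw [overlapSum_scale, overlapSum_smul]

section Stable

variable {Ω : Type*} [MeasurableSpace Ω] {P : Measure Ω} [IsProbabilityMeasure P] {m : ℕ}
  {X : Fin m → Ω → ℝ}

/-- An exponent homogeneous of degree α makes the law strictly stable: exponents of independent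
copies add, and the shift is 0. -/
lemma isStableLaw_of_jointCF (hX : ∀ i, AEMeasurable (X i) P) {E : (Fin m → ℝ) → ℂ}
    (hE : ∀ z, jointCF P X z = Complex.exp (E z)) {α : ℝ} (hα : 0 < α)
    (hhom : ∀ (c : ℝ) z, 0 < c → E (fun i => c * z i) = ((c ^ α : ℝ) : ℂ) * E z) :
    IsStableLaw α (P.map (fun ω i => X i ω)) := by
  intro a b ha hb
  have hXm : AEMeasurable (fun ω i => X i ω) P := aemeasurable_pi_lambda _ hX
  set μ := P.map (fun ω i => X i ω) with hμ
  have : IsProbabilityMeasure μ := Measure.isProbabilityMeasure_map hXm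
  have hμE : ∀ z, jointCF μ (fun i x => x i) z = Complex.exp (E z) := fun z => by
    rw [← hE z, jointCF, jointCF, hμ, integral_map hXm
      (Continuous.aestronglyMeasurable (by fun_prop))]
  refine ⟨0, ?_⟩
  have e1 : (μ.map (fun x => a • x)).conv (μ.map (fun x => b • x)) =
      (μ.prod μ).map (fun p i => a * p.1 i + b * p.2 i) := by
    rw [Measure.conv, Measure.map_prod_map _ _ (by fun_prop) (by fun_prop),
      Measure.map_map (by fun_prop) (by fun_prop)]
    rfl
  have e2 : μ.map (fun x => (a ^ α + b ^ α) ^ (1 / α) • x + 0) =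
      μ.map (fun x i => (a ^ α + b ^ α) ^ (1 / α) * x i) := by
    congr 1
    ext x i
    simp
  rw [e1, e2]
  have hs : 0 < a ^ α + b ^ α := by positivity
  refine map_eq_of_jointCF_eq (X := fun i (p : (Fin m → ℝ) × (Fin m → ℝ)) => a * p.1 i + b * p.2 i)
    (Y := fun i (x : Fin m → ℝ) => (a ^ α + b ^ α) ^ (1 / α) * x i) (fun i => by fun_prop)
    (fun i => ((measurable_pi_apply i).const_mul _).aemeasurable) fun z => ?_
  have f1 : jointCF μ (fun i x => (a ^ α + b ^ α) ^ (1 / α) * x i) z =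
      Complex.exp ((a ^ α + b ^ α : ℝ) * E z) := by
    have h1 := hμE (fun i => (a ^ α + b ^ α) ^ (1 / α) * z i)
    rw [hhom _ _ (by positivity), ← Real.rpow_mul hs.le, one_div, inv_mul_cancel₀ hα.ne',
      Real.rpow_one] at h1
    rw [← h1, jointCF, jointCF]
    simp_rw [one_div]
    congr 1
    ext x
    congr 5
    ext i
    ring
  have f2 : jointCF (μ.prod μ) (fun i p => a * p.1 i + b * p.2 i) z =
      jointCF μ (fun i x => x i) (fun i => a * z i) * jointCF μ (fun i x => x i) (fun i => b * z i) := by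
    simp only [jointCF]
    rw [← integral_prod_mul]
    congr 1
    ext p
    rw [← Complex.exp_add, ← mul_add, ← Complex.ofReal_add, ← Finset.sum_add_distrib]
    congr 5
    ext i
    ring
  rw [f1, f2, hμE, hμE, hhom a z ha, hhom b z hb, ← Complex.exp_add]
  congr 1
  push_cast
  ring

end Stable

/-! ### Finite-dimensional laws of the stable Lévy motion -/

lemma skewedStableExponent_zero {γ : ℝ} (hγ : γ ≠ 0) : skewedStableExponent γ 0 = 0 := by
  simp [skewedStableExponent, Real.zero_rpow hγ]

/-- The running maxima of the times, as a sequence started at `0`. -/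
noncomputable def timeGrid {m : ℕ} (t : Fin m → ℝ≥0) (k : ℕ) : ℝ≥0 :=
  (Finset.univ.filter fun i : Fin m => i.val < k).sup t

section timeGrid

variable {m : ℕ} {t : Fin m → ℝ≥0}

lemma timeGrid_zero : timeGrid t 0 = 0 := by simp [timeGrid]

lemma monotone_timeGrid : Monotone (timeGrid t) := fun _ _ h =>
  Finset.sup_mono fun _ hi => by
    simp only [Finset.mem_filter, Finset.mem_univ, true_and] at hi ⊢
    omega

lemma timeGrid_succ (ht : Monotone t) (i : Fin m) : timeGrid t (i + 1) = t i := by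
  refine le_antisymm (Finset.sup_le fun j hj => ht ?_) (Finset.le_sup (by simp))
  simp only [Finset.mem_filter, Finset.mem_univ, true_and] at hj
  exact Fin.le_def.2 (by omega)

/-- Abel summation: a combination of values becomes a combination of increments over the grid, with
the coefficients of the later times summed. -/
lemma sum_mul_eq_sum_range (ht : Monotone t) (z : Fin m → ℝ) (f : ℝ≥0 → ℝ) (h0 : f 0 = 0) :
    ∑ i, z i * f (t i) = ∑ k ∈ Finset.range m, (∑ i : Fin m, if k ≤ i then z i else 0) *
      (f (timeGrid t (k + 1)) - f (timeGrid t k)) := by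
  have h1 : ∀ i : Fin m, f (t i) = ∑ k ∈ Finset.range m, if k ≤ i then
      (f (timeGrid t (k + 1)) - f (timeGrid t k)) else 0 := fun i => by
    rw [← Finset.sum_filter]
    have : (Finset.range m).filter (fun k => k ≤ (i : ℕ)) = Finset.range (i + 1) := by
      ext k
      simp only [Finset.mem_filter, Finset.mem_range]
      have := i.2
      omega
    rw [this, Finset.sum_range_sub (fun k => f (timeGrid t k)), timeGrid_zero, h0, sub_zero,
      timeGrid_succ ht]
  simp_rw [h1, Finset.mul_sum, Finset.sum_mul]
  rw [Finset.sum_comm]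
  refine Finset.sum_congr rfl fun k _ => Finset.sum_congr rfl fun i _ => ?_
  split_ifs <;> ring

lemma stepSum_eq_of_mem (ht : Monotone t) (z : Fin m → ℝ) {k : ℕ} {s : ℝ}
    (hs : s ∈ Ioo (timeGrid t k : ℝ) (timeGrid t (k + 1))) :
    stepSum t z s = ∑ i : Fin m, if k ≤ i then z i else 0 := by
  refine Finset.sum_congr rfl fun i _ => ?_
  have h0 : (0 : ℝ) ≤ timeGrid t k := NNReal.coe_nonneg _
  split_ifs with h
  · have : (timeGrid t (k + 1) : ℝ) ≤ t i := by
      rw [← timeGrid_succ ht i]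
      exact_mod_cast monotone_timeGrid (by omega)
    rw [indicator_of_mem (show s ∈ Ioo (0 : ℝ) (t i) from
      ⟨h0.trans_lt hs.1, hs.2.trans_le this⟩), Pi.one_apply, mul_one]
  · have : (t i : ℝ) ≤ timeGrid t k := by
      rw [← timeGrid_succ ht i]
      exact_mod_cast monotone_timeGrid (by omega)
    rw [indicator_of_notMem (fun hh => absurd hh.2 (by linarith [hs.1])), mul_zero]

lemma stepSum_eq_zero (ht : Monotone t) (z : Fin m → ℝ) {s : ℝ}
    (hs : s ∉ Ioc (0 : ℝ) (timeGrid t m)) : stepSum t z s = 0 := by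
  refine Finset.sum_eq_zero fun i _ => ?_
  have : (t i : ℝ) ≤ timeGrid t m := by
    rw [← timeGrid_succ ht i]
    exact_mod_cast monotone_timeGrid i.2
  rw [indicator_of_notMem (fun hh => hs ⟨hh.1, (hh.2.trans_le this).le⟩), mul_zero]

/-- The step functional is constant on each open grid cell, equal to the Abel coefficient of that
cell; endpoints are null and g(0) = 0 disposes of the complement. -/
lemma integral_comp_stepSum (ht : Monotone t) (z : Fin m → ℝ) {g : ℝ → ℂ} (hg : g 0 = 0) :
    ∫ s, g (stepSum t z s) = ∑ k ∈ Finset.range m,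
      (((timeGrid t (k + 1) : ℝ) - timeGrid t k : ℝ) : ℂ) *
        g (∑ i : Fin m, if k ≤ i then z i else 0) := by
  have h1 : ∫ s, g (stepSum t z s) = ∫ s in (timeGrid t 0 : ℝ)..(timeGrid t m), g (stepSum t z s) := by
    rw [timeGrid_zero, intervalIntegral.integral_of_le (by simp)]
    refine (setIntegral_eq_integral_of_forall_compl_eq_zero fun s hs => ?_).symm
    rw [stepSum_eq_zero ht z (by simpa using hs), hg]
  have hle : ∀ k : ℕ, (timeGrid t k : ℝ) ≤ timeGrid t (k + 1) := fun k =>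
    by exact_mod_cast monotone_timeGrid (Nat.le_succ k)
  have hae : ∀ k : ℕ, ∀ᵐ s, s ∈ uIoc (timeGrid t k : ℝ) (timeGrid t (k + 1)) →
      g (∑ i : Fin m, if k ≤ i then z i else 0) = g (stepSum t z s) := fun k => by
    filter_upwards [Measure.ae_ne volume (timeGrid t (k + 1) : ℝ)] with s hs hsm
    rw [uIoc_of_le (hle k)] at hsm
    rw [stepSum_eq_of_mem ht z ⟨hsm.1, lt_of_le_of_ne hsm.2 hs⟩]
  rw [h1, ← intervalIntegral.sum_integral_adjacent_intervals (a := fun k => (timeGrid t k : ℝ))]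
  · refine Finset.sum_congr rfl fun k _ => ?_
    rw [← intervalIntegral.integral_congr_ae (hae k), intervalIntegral.integral_const,
      Complex.real_smul]
  · intro k _
    refine (intervalIntegrable_const (c := g (∑ i : Fin m, if k ≤ i then z i else 0))).congr_ae ?_
    exact (ae_restrict_iff' measurableSet_uIoc).2 (hae k)

end timeGrid

/-- Abel summation exposes the independent increments, whose exponents recombine into the integral
of the exponent of a step function. -/
lemma IsSkewedStableLevyMotion.jointCF_of_monotone {Ω : Type*} [MeasurableSpace Ω] {P : Measure Ω}
    [IsProbabilityMeasure P] {γ : ℝ} (hγ : γ ≠ 0) {Λ : ℝ≥0 → Ω → ℝ}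
    (h : IsSkewedStableLevyMotion P γ Λ) {m : ℕ} {t : Fin m → ℝ≥0} (ht : Monotone t)
    (z : Fin m → ℝ) :
    jointCF P (fun i => Λ (t i)) z =
      Complex.exp (-((stableConst γ : ℂ) * ∫ s, skewedStableExponent γ (stepSum t z s))) := by
  set Z : ℕ → ℝ := fun k => ∑ i : Fin m, if k ≤ i then z i else 0 with hZ
  set Δ : ℕ → Ω → ℝ := fun k ω => Λ (timeGrid t (k + 1)) ω - Λ (timeGrid t k) ω with hΔ
  have hΔm : ∀ k, AEMeasurable (Δ k) P := fun k => (h.aemeasurable _).sub (h.aemeasurable _)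
  have hind : iIndepFun (fun (k : Fin m) ω => Δ k ω) P :=
    (h.indep_increments.nat (monotone_timeGrid (t := t))).precomp Fin.val_injective
  have e1 : jointCF P (fun i => Λ (t i)) z =
      ∫ ω, ∏ k : Fin m, Complex.exp (Complex.I * ((Z k * Δ k ω : ℝ) : ℂ)) ∂P := by
    refine integral_congr_ae ?_
    filter_upwards [h.start_zero] with ω hω
    rw [sum_mul_eq_sum_range ht z (fun s => Λ s ω) hω, Finset.sum_range, ← Complex.exp_sum,
      ← Finset.mul_sum, ← Complex.ofReal_sum]
  have e2 := hind.integral_fun_prod_comp (f := fun (k : Fin m) x =>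
    Complex.exp (Complex.I * ((Z k * x : ℝ) : ℂ))) (fun k => hΔm k)
    (fun k => Continuous.aestronglyMeasurable (by fun_prop))
  have e3 : ∀ k : ℕ, ∫ ω, Complex.exp (Complex.I * ((Z k * Δ k ω : ℝ) : ℂ)) ∂P =
      Complex.exp (-(((timeGrid t (k + 1) : ℝ) - timeGrid t k : ℝ) : ℂ) * (stableConst γ : ℂ) *
        skewedStableExponent γ (Z k)) := fun k => by
    rw [← h.charFun_increment _ _ (monotone_timeGrid (Nat.le_succ k)), charFun_apply_real,
      integral_map (hΔm k) (Continuous.aestronglyMeasurable (by fun_prop))]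
    congr 1
    ext ω
    congr 1
    push_cast
    ring
  rw [e1, e2]
  simp_rw [e3]
  rw [← Complex.exp_sum, integral_comp_stepSum ht z (skewedStableExponent_zero hγ), Finset.sum_range,
    Finset.mul_sum, ← Finset.sum_neg_distrib]
  congr 1
  refine Finset.sum_congr rfl fun k _ => ?_
  ring

/-- The finite-dimensional characteristic functions of a totally skewed stable Lévy motion. -/
theorem IsSkewedStableLevyMotion.jointCF_eq {Ω : Type*} [MeasurableSpace Ω] {P : Measure Ω}
    [IsProbabilityMeasure P] {γ : ℝ} (hγ : γ ≠ 0) {Λ : ℝ≥0 → Ω → ℝ}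
    (h : IsSkewedStableLevyMotion P γ Λ) {m : ℕ} (t : Fin m → ℝ≥0) (z : Fin m → ℝ) :
    jointCF P (fun i => Λ (t i)) z =
      Complex.exp (-((stableConst γ : ℂ) * ∫ s, skewedStableExponent γ (stepSum t z s))) := by
  -- Both sides are symmetric under simultaneous permutation of times and coefficients, so the times
  -- may be sorted.
  set σ := Tuple.sort t
  have e1 : jointCF P (fun i => Λ (t i)) z = jointCF P (fun i => Λ ((t ∘ σ) i)) (z ∘ σ) := by
    simp only [jointCF, Function.comp]
    congr 1
    ext ω
    rw [← Equiv.sum_comp σ]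
  have e2 : ∀ s, stepSum t z s = stepSum (t ∘ σ) (z ∘ σ) s := fun s => by
    simp only [stepSum, Function.comp]
    rw [← Equiv.sum_comp σ]
  rw [e1, h.jointCF_of_monotone hγ (Tuple.monotone_sort t)]
  simp_rw [e2]
  rfl

/-! ### The covariance of the overlap functionals -/

/-- As a function of the start, the overlap is a trapezoid on [-u,t] with unit slopes and height
min(u,t). -/
lemma sessionOverlap_eq_max_min (t x u : ℝ) :
    sessionOverlap t x u = max (min (min u t) (min (x + u) (t - x))) 0 := by
  rw [sessionOverlap_eq]
  congr 1
  simp only [min_def, max_def]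
  split_ifs <;> linarith

/-- With a = min(u,t) and b = max(u,t), the two ramps contribute a³/3 each and the plateau a²(b-a).
-/
lemma integral_sq_sessionOverlap {t u : ℝ} (ht : 0 ≤ t) (hu : 0 ≤ u) :
    ∫ x, sessionOverlap t x u ^ 2 = min u t ^ 2 * max u t - min u t ^ 3 / 3 := by
  have hL := fun x => sessionOverlap_eq_max_min t x u
  set a := min u t with ha
  set b := max u t with hb
  have hab : a + b = u + t := min_add_max u t
  have hab' : a ≤ b := min_le_max
  have ha0 : 0 ≤ a := le_min hu ht
  have hau : a ≤ u := min_le_left _ _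
  have hat : a ≤ t := min_le_right _ _
  have hcont : Continuous fun x => sessionOverlap t x u ^ 2 := by
    simp only [hL]
    fun_prop
  have h0 : ∫ x, sessionOverlap t x u ^ 2 = ∫ x in (-u)..t, sessionOverlap t x u ^ 2 := by
    rw [intervalIntegral.integral_of_le (by linarith)]
    refine (setIntegral_eq_integral_of_forall_compl_eq_zero fun x hx => ?_).symm
    rw [hL, max_eq_right, zero_pow two_ne_zero]
    by_cases h : -u < x
    · have : t < x := by
        by_contra h'
        exact hx ⟨h, not_lt.1 h'⟩
      exact (min_le_right _ _).trans ((min_le_right _ _).trans (by linarith))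
    · exact (min_le_right _ _).trans ((min_le_left _ _).trans (by linarith))
  have hi : ∀ c d, IntervalIntegrable (fun x => sessionOverlap t x u ^ 2) volume c d :=
    fun c d => hcont.intervalIntegrable c d
  have e1 : ∫ x in (-u)..(-u + a), sessionOverlap t x u ^ 2 = a ^ 3 / 3 := by
    have : EqOn (fun x => sessionOverlap t x u ^ 2) (fun x => (x + u) ^ 2) (uIcc (-u) (-u + a)) := by
      intro x hx
      rw [uIcc_of_le (by linarith)] at hx
      simp only [hL]
      rw [min_eq_left (by linarith [hx.2] : x + u ≤ t - x), min_eq_right (by linarith [hx.2]),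
        max_eq_left (by linarith [hx.1])]
    rw [intervalIntegral.integral_congr this,
      intervalIntegral.integral_comp_add_right (fun x => x ^ 2), integral_pow]
    norm_num
  have e2 : ∫ x in (-u + a)..(t - a), sessionOverlap t x u ^ 2 = a ^ 2 * (b - a) := by
    have : EqOn (fun x => sessionOverlap t x u ^ 2) (fun _ => a ^ 2) (uIcc (-u + a) (t - a)) := by
      intro x hx
      rw [uIcc_of_le (by linarith)] at hx
      simp only [hL]
      rw [min_eq_left (le_min (by linarith [hx.1]) (by linarith [hx.2])), max_eq_left ha0]
    rw [intervalIntegral.integral_congr this, intervalIntegral.integral_const, smul_eq_mul]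
    rw [show t - a - (-u + a) = b - a by linarith, mul_comm]
  have e3 : ∫ x in (t - a)..t, sessionOverlap t x u ^ 2 = a ^ 3 / 3 := by
    have : EqOn (fun x => sessionOverlap t x u ^ 2) (fun x => (t - x) ^ 2) (uIcc (t - a) t) := by
      intro x hx
      rw [uIcc_of_le (by linarith)] at hx
      simp only [hL]
      rw [min_eq_right (by linarith [hx.1] : t - x ≤ x + u), min_eq_right (by linarith [hx.1]),
        max_eq_left (by linarith [hx.2])]
    rw [intervalIntegral.integral_congr this,
      intervalIntegral.integral_comp_sub_left (fun x => x ^ 2), integral_pow]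
    norm_num
  rw [h0, ← intervalIntegral.integral_add_adjacent_intervals (hi _ (-u + a)) (hi _ _),
    ← intervalIntegral.integral_add_adjacent_intervals (hi (-u + a) (t - a)) (hi _ _), e1, e2, e3]
  ring

lemma memLp_two_sessionOverlap (t : ℝ≥0) {α : ℝ} (h1 : 1 < α) (h2 : α < 2) :
    MemLp (fun p : ℝ × ℝ => sessionOverlap t p.1 p.2) 2
      ((volume : Measure ℝ).prod (powerMeasure α)) := by
  have := memLp_sessionOverlap t h1 h2
  rwa [ENNReal.ofReal_ofNat] at this

/-- The trapezoid formula is integrated against the power law separately over u ≤ t and u > t. The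
first part converges because α < 2, the second because α > 1. -/
lemma integral_prod_sq_sessionOverlap (t : ℝ≥0) {α : ℝ} (h1 : 1 < α) (h2 : α < 2) :
    ∫ p, sessionOverlap t p.1 p.2 ^ 2 ∂((volume : Measure ℝ).prod (powerMeasure α)) =
      2 / ((α - 1) * (2 - α) * (3 - α)) * (t : ℝ) ^ (3 - α) := by
  rw [integral_prod_symm _ (memLp_two_sessionOverlap t h1 h2).integrable_sq,
    integral_powerMeasure (by linarith)]
  have e0 : ∫ u in Ioi (0 : ℝ), (α * u ^ (-(α + 1))) • ∫ x, sessionOverlap t x u ^ 2 =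
      ∫ u in Ioi (0 : ℝ), α * u ^ (-(α + 1)) * (min u t ^ 2 * max u t - min u t ^ 3 / 3) :=
    setIntegral_congr_fun measurableSet_Ioi fun u hu => by
      rw [integral_sq_sessionOverlap t.coe_nonneg (le_of_lt hu), smul_eq_mul]
  refine e0.trans ?_
  rcases eq_or_lt_of_le t.2 with ht | ht
  · have ht' : (t : ℝ) = 0 := ht.symm
    rw [ht', Real.zero_rpow (by linarith), mul_zero]
    refine (setIntegral_congr_fun measurableSet_Ioi fun u hu => ?_).trans (integral_zero _ _)
    simp [min_eq_right (le_of_lt (show (0 : ℝ) < u from hu))]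
  have ht' : (0 : ℝ) < t := ht
  have hlow : EqOn (fun u : ℝ => α * u ^ (-(α + 1)) * (min u t ^ 2 * max u t - min u t ^ 3 / 3))
      (fun u => α * t * u ^ (1 - α) - α / 3 * u ^ (2 - α)) (Ioc 0 t) := by
    intro u hu
    have hu0 : 0 < u := hu.1
    simp only
    rw [min_eq_left hu.2, max_eq_right hu.2, show 1 - α = -(α + 1) + (2 : ℕ) by push_cast; ring,
      show 2 - α = -(α + 1) + (3 : ℕ) by push_cast; ring, Real.rpow_add_natCast hu0.ne',
      Real.rpow_add_natCast hu0.ne']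
    ring
  have hhigh : EqOn (fun u : ℝ => α * u ^ (-(α + 1)) * (min u t ^ 2 * max u t - min u t ^ 3 / 3))
      (fun u => α * t ^ 2 * u ^ (-α) - α * t ^ 3 / 3 * u ^ (-(α + 1))) (Ioi t) := by
    intro u hu
    have htu : t < u := hu
    have hu0 : 0 < u := ht'.trans htu
    simp only
    rw [min_eq_right htu.le, max_eq_left htu.le, show -α = -(α + 1) + (1 : ℕ) by push_cast; ring,
      Real.rpow_add_natCast hu0.ne']
    ring
  have i1 : IntervalIntegrable (fun u : ℝ => α * t * u ^ (1 - α)) volume 0 t :=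
    (intervalIntegral.intervalIntegrable_rpow' (by linarith)).const_mul _
  have i2 : IntervalIntegrable (fun u : ℝ => α / 3 * u ^ (2 - α)) volume 0 t :=
    (intervalIntegral.intervalIntegrable_rpow' (by linarith)).const_mul _
  have i3 : IntegrableOn (fun u : ℝ => α * t ^ 2 * u ^ (-α)) (Ioi t) :=
    (integrableOn_Ioi_rpow_of_lt (by linarith) ht').const_mul _
  have i4 : IntegrableOn (fun u : ℝ => α * t ^ 3 / 3 * u ^ (-(α + 1))) (Ioi t) :=
    (integrableOn_Ioi_rpow_of_lt (by linarith) ht').const_mul _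
  have j1 := ((i1.sub i2).1.congr_fun hlow.symm measurableSet_Ioc)
  have j2 := (IntegrableOn.congr_fun (Integrable.sub i3 i4) hhigh.symm measurableSet_Ioi)
  rw [← Ioc_union_Ioi_eq_Ioi ht'.le, setIntegral_union
    (Ioc_disjoint_Ioi le_rfl) measurableSet_Ioi j1 j2,
    setIntegral_congr_fun measurableSet_Ioc hlow, setIntegral_congr_fun measurableSet_Ioi hhigh,
    ← intervalIntegral.integral_of_le ht'.le, intervalIntegral.integral_sub i1 i2,
    integral_sub i3 i4]
  simp only [intervalIntegral.integral_const_mul, integral_const_mul]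
  rw [integral_rpow (Or.inl (by linarith)), integral_rpow (Or.inl (by linarith)),
    integral_Ioi_rpow_of_lt (by linarith) ht', integral_Ioi_rpow_of_lt (by linarith) ht',
    Real.zero_rpow (by linarith), Real.zero_rpow (by linarith)]
  have p1 : (t : ℝ) ^ (1 - α + 1) = (t : ℝ) ^ (-α) * t ^ 2 := by
    rw [← Real.rpow_add_natCast ht'.ne']
    congr 1
    push_cast
    ring
  have p2 : (t : ℝ) ^ (2 - α + 1) = (t : ℝ) ^ (-α) * t ^ 3 := by
    rw [← Real.rpow_add_natCast ht'.ne']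
    congr 1
    push_cast
    ring
  have p3 : (t : ℝ) ^ (-α + 1) = (t : ℝ) ^ (-α) * t := by
    rw [Real.rpow_add_one ht'.ne']
  rw [p1, p2, p3, show 3 - α = 2 - α + 1 by ring, p2, show -(α + 1) + 1 = -α by ring]
  have a1 : α - 1 ≠ 0 := by linarith
  have a2 : 2 - α ≠ 0 := by linarith
  have a3 : 2 - α + 1 ≠ 0 := by linarith
  have a4 : -α + 1 ≠ 0 := by linarith
  have a5 : -α ≠ 0 := by linarith
  have a6 : 1 - α + 1 ≠ 0 := by linarith
  rw [show -α + 1 = -(α - 1) by ring, show 1 - α + 1 = 2 - α by ring]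
  have a0 : α ≠ 0 := by linarith
  field_simp
  ring

/-- An increment is the overlap with a window of length t - s, up to a shift of the start.
Invariance of Lebesgue measure then gives stationary increments. -/
lemma sessionOverlap_sub {s t x u : ℝ} (hs : 0 ≤ s) (hst : s ≤ t) (hu : 0 ≤ u) :
    sessionOverlap t x u - sessionOverlap s x u = sessionOverlap (t - s) (x - s) u := by
  simp only [sessionOverlap_eq, min_def, max_def]
  split_ifs <;> linarith

lemma integral_prod_sq_sessionOverlap_sub {s t : ℝ≥0} (hst : s ≤ t) {α : ℝ} (h1 : 1 < α)
    (h2 : α < 2) :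
    ∫ p, (sessionOverlap t p.1 p.2 - sessionOverlap s p.1 p.2) ^ 2
        ∂((volume : Measure ℝ).prod (powerMeasure α)) =
      2 / ((α - 1) * (2 - α) * (3 - α)) * ((t : ℝ) - s) ^ (3 - α) := by
  have hts : ((t - s : ℝ≥0) : ℝ) = t - s := NNReal.coe_sub hst
  have hi := ((memLp_two_sessionOverlap t h1 h2).sub (memLp_two_sessionOverlap s h1 h2)).integrable_sq
  simp only [Pi.sub_apply] at hi
  rw [← hts, ← integral_prod_sq_sessionOverlap (t - s) h1 h2, integral_prod_symm _ hi,
    integral_prod_symm _ (memLp_two_sessionOverlap (t - s) h1 h2).integrable_sq]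
  refine integral_congr_ae ?_
  filter_upwards [ae_powerMeasure_pos α] with u hu
  rw [← integral_sub_right_eq_self (fun x => sessionOverlap ((t - s : ℝ≥0) : ℝ) x u ^ 2) (s : ℝ), hts]
  congr 1
  ext x
  rw [← sessionOverlap_sub s.coe_nonneg (by exact_mod_cast hst) hu.le]

/-- The overlap functionals have the covariance of a fractional Brownian motion. -/
lemma integral_sessionOverlap_mul (s t : ℝ≥0) {α : ℝ} (h1 : 1 < α) (h2 : α < 2) :
    ∫ p, sessionOverlap s p.1 p.2 * sessionOverlap t p.1 p.2
        ∂((volume : Measure ℝ).prod (powerMeasure α)) =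
      2 / ((α - 1) * (2 - α) * (3 - α)) *
        (1 / 2 * ((s : ℝ) ^ (3 - α) + (t : ℝ) ^ (3 - α) - |(s : ℝ) - t| ^ (3 - α))) := by
  wlog hst : s ≤ t generalizing s t
  · have := this t s (le_of_not_ge hst)
    rw [abs_sub_comm, add_comm ((s : ℝ) ^ _), ← this]
    simp only [mul_comm]
  -- Polarisation: the variance of increments determines the covariance, which gives the fractional
  -- Brownian form.
  have e : ∀ p : ℝ × ℝ, sessionOverlap s p.1 p.2 * sessionOverlap t p.1 p.2 =
      1 / 2 * (sessionOverlap s p.1 p.2 ^ 2 + sessionOverlap t p.1 p.2 ^ 2 -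
        (sessionOverlap t p.1 p.2 - sessionOverlap s p.1 p.2) ^ 2) := fun p => by ring
  have is := (memLp_two_sessionOverlap s h1 h2).integrable_sq
  have it := (memLp_two_sessionOverlap t h1 h2).integrable_sq
  have id := ((memLp_two_sessionOverlap t h1 h2).sub (memLp_two_sessionOverlap s h1 h2)).integrable_sq
  simp only [Pi.sub_apply] at id
  simp_rw [e]
  have ia : Integrable (fun p : ℝ × ℝ => sessionOverlap s p.1 p.2 ^ 2 + sessionOverlap t p.1 p.2 ^ 2)
      ((volume : Measure ℝ).prod (powerMeasure α)) := is.add it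
  rw [integral_const_mul, integral_sub ia id, integral_add is it,
    integral_prod_sq_sessionOverlap s h1 h2, integral_prod_sq_sessionOverlap t h1 h2,
    integral_prod_sq_sessionOverlap_sub hst h1 h2, abs_sub_comm,
    abs_of_nonneg (sub_nonneg.2 (show (s : ℝ) ≤ t by exact_mod_cast hst))]
  ring

lemma integral_sq_overlapSum {m : ℕ} (t : Fin m → ℝ≥0) (z : Fin m → ℝ) {α : ℝ} (h1 : 1 < α)
    (h2 : α < 2) :
    ∫ p, overlapSum t z p.1 p.2 ^ 2 ∂((volume : Measure ℝ).prod (powerMeasure α)) =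
      2 / ((α - 1) * (2 - α) * (3 - α)) * ∑ i, ∑ j, z i * z j *
        (1 / 2 * ((t i : ℝ) ^ (3 - α) + (t j : ℝ) ^ (3 - α) - |(t i : ℝ) - t j| ^ (3 - α))) := by
  have e : ∀ p : ℝ × ℝ, overlapSum t z p.1 p.2 ^ 2 = ∑ i, ∑ j, z i * z j *
      (sessionOverlap (t i) p.1 p.2 * sessionOverlap (t j) p.1 p.2) := fun p => by
    rw [sq, overlapSum, Finset.sum_mul_sum]
    refine Finset.sum_congr rfl fun i _ => Finset.sum_congr rfl fun j _ => ?_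
    ring
  have hi : ∀ i j, Integrable (fun p : ℝ × ℝ => z i * z j *
      (sessionOverlap (t i) p.1 p.2 * sessionOverlap (t j) p.1 p.2))
      ((volume : Measure ℝ).prod (powerMeasure α)) := fun i j =>
    ((memLp_two_sessionOverlap (t i) h1 h2).integrable_mul
      (memLp_two_sessionOverlap (t j) h1 h2)).const_mul _
  simp_rw [e]
  rw [integral_finsetSum _ fun i _ => integrable_finsetSum _ fun j _ => hi i j, Finset.mul_sum]
  refine Finset.sum_congr rfl fun i _ => ?_
  rw [integral_finsetSum _ fun j _ => hi i j, Finset.mul_sum]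
  refine Finset.sum_congr rfl fun j _ => ?_
  rw [integral_const_mul, integral_sessionOverlap_mul _ _ h1 h2]
  ring

lemma integral_sq_mul_overlapSum_limitMean {m : ℕ} (t : Fin m → ℝ≥0) (z : Fin m → ℝ) {α : ℝ}
    (h1 : 1 < α) (h2 : α < 2) (FR : Measure ℝ) [SFinite FR] :
    ∫ y, (y.2.2 * overlapSum t z y.1 y.2.1) ^ 2 ∂(limitMean α FR) =
      (∫ r, r ^ 2 ∂FR) * (2 / ((α - 1) * (2 - α) * (3 - α)) * ∑ i, ∑ j, z i * z j *
        (1 / 2 * ((t i : ℝ) ^ (3 - α) + (t j : ℝ) ^ (3 - α) - |(t i : ℝ) - t j| ^ (3 - α)))) := by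
  rw [limitMean, ← Measure.prodAssoc_prod, integral_map_equiv, ← integral_sq_overlapSum t z h1 h2,
    mul_comm, ← integral_prod_mul]
  congr 1
  ext p
  simp only [MeasurableEquiv.prodAssoc, MeasurableEquiv.coe_mk, Equiv.prodAssoc_apply]
  ring

/-- The finite-dimensional characteristic functions of fractional Brownian motion. -/
theorem IsFractionalBrownianMotion.jointCF_eq {Ω : Type*} [MeasurableSpace Ω] {P : Measure Ω}
    {H : ℝ} {B : ℝ≥0 → Ω → ℝ} (hB : IsFractionalBrownianMotion P H B) {m : ℕ} (t : Fin m → ℝ≥0)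
    (z : Fin m → ℝ) :
    jointCF P (fun i => B (t i)) z = Complex.exp (-(((∑ i, ∑ j, z i * z j *
      (1 / 2 * ((t i : ℝ) ^ (2 * H) + (t j : ℝ) ^ (2 * H) - |(t i : ℝ) - t j| ^ (2 * H))) : ℝ) : ℂ)
        / 2)) := by
  have := hB.isGaussianProcess.isProbabilityMeasure
  have hG : HasGaussianLaw (fun ω => ∑ i, z i * B (t i) ω) P :=
    ((hB.isGaussianProcess.comp_right t).smul z).hasGaussianLaw_fun_sum (I := Finset.univ)
  have h2 : ∀ i, MemLp (fun ω => z i * B (t i) ω) 2 P := fun i =>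
    (hB.isGaussianProcess.hasGaussianLaw_eval (t i)).memLp_two.const_mul (z i)
  have hmean : ∫ ω, ∑ i, z i * B (t i) ω ∂P = 0 := by
    rw [integral_finsetSum _ fun i _ => (h2 i).integrable one_le_two]
    simp_rw [integral_const_mul, hB.mean_zero, mul_zero, Finset.sum_const_zero]
  have hvar : Var[fun ω => ∑ i, z i * B (t i) ω; P] = ∑ i, ∑ j, z i * z j *
      (1 / 2 * ((t i : ℝ) ^ (2 * H) + (t j : ℝ) ^ (2 * H) - |(t i : ℝ) - t j| ^ (2 * H))) := by
    rw [← covariance_self hG.aemeasurable, covariance_fun_sum_fun_sum h2 h2]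
    refine Finset.sum_congr rfl fun i _ => Finset.sum_congr rfl fun j _ => ?_
    rw [covariance_const_mul_left, covariance_const_mul_right, hB.covariance]
    ring
  have key := hG.charFun_map_eq 1
  rw [charFun_apply_real, integral_map hG.aemeasurable
    (Continuous.aestronglyMeasurable (by fun_prop))] at key
  simp only [RCLike.inner_apply, map_one, mul_one, hmean, hvar, Complex.ofReal_zero, zero_mul,
    zero_sub, Complex.ofReal_one, one_mul] at key
  rw [← key, jointCF]
  simp only [mul_comm]

/-! ### The limit processes -/

instance (α : ℝ) (h : Measure ℝ) [SigmaFinite h] : SigmaFinite (limitMean α h) := by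
  unfold limitMean
  infer_instance

lemma jointCF_const_mul {Ω : Type*} [MeasurableSpace Ω] (P : Measure Ω) {m : ℕ} (X : Fin m → Ω → ℝ)
    (k : ℝ) (z : Fin m → ℝ) :
    jointCF P (fun i ω => k * X i ω) z = jointCF P X (fun i => k * z i) := by
  simp only [jointCF, mul_assoc, mul_left_comm k]

lemma jointCF_skewedStableIntegral {Ω E : Type*} [MeasurableSpace Ω]
    [MeasurableSpace E] {P : Measure Ω} {γ : ℝ} (h1 : 1 < γ) (h2 : γ < 2)
    {m : Measure E} {I : (E → ℝ) → Ω → ℝ} (hI : IsSkewedStableIntegral P γ m I) {n : ℕ}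
    {f : Fin n → E → ℝ} (hf : ∀ i, MemLp (f i) (ENNReal.ofReal γ) m) (z : Fin n → ℝ) :
    jointCF P (fun i ω => stableConst γ ^ (1 / γ) * I (f i) ω) z =
      Complex.exp (-((stableConst γ : ℂ) * ∫ x, skewedStableExponent γ (∑ i, z i * f i x) ∂m)) := by
  have hC := stableConst_pos h1 h2
  rw [jointCF_const_mul P (fun i => I (f i)), jointCF, hI.2 n f hf]
  simp_rw [mul_assoc, ← Finset.mul_sum, skewedStableExponent_mul (Real.rpow_pos_of_pos hC _)]
  rw [integral_const_mul, ← Real.rpow_mul hC.le, one_div, inv_mul_cancel₀ (by linarith), Real.rpow_one]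

lemma jointCF_fractionalBrownianMotion {Ω : Type*} [MeasurableSpace Ω] {P : Measure Ω}
    {FR : Measure ℝ} [SFinite FR] {α : ℝ} (h1 : 1 < α)
    (h2 : α < 2) {B : ℝ≥0 → Ω → ℝ} (hB : IsFractionalBrownianMotion P ((3 - α) / 2) B) {m : ℕ}
    (t : Fin m → ℝ≥0) (z : Fin m → ℝ) :
    jointCF P (fun i ω => (∫ r, r ^ 2 ∂FR) ^ (1 / 2 : ℝ) *
      (2 / ((α - 1) * (2 - α) * (3 - α))) ^ (1 / 2 : ℝ) * B (t i) ω) z =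
      Complex.exp (∫ y, ((-((y.2.2 * overlapSum t z y.1 y.2.1) ^ 2 / 2) : ℝ) : ℂ)
        ∂(limitMean α FR)) := by
  have hσ : 0 ≤ 2 / ((α - 1) * (2 - α) * (3 - α)) :=
    div_nonneg zero_le_two (mul_nonneg (mul_nonneg (by linarith) (by linarith)) (by linarith))
  have hE : 0 ≤ ∫ r, r ^ 2 ∂FR := integral_nonneg fun r => sq_nonneg r
  rw [jointCF_const_mul P (fun i => B (t i)), hB.jointCF_eq, integral_complex_ofReal, integral_neg,
    integral_div, integral_sq_mul_overlapSum_limitMean t z h1 h2, ← Real.mul_rpow hE hσ]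
  set k := ((∫ r, r ^ 2 ∂FR) * (2 / ((α - 1) * (2 - α) * (3 - α)))) ^ (1 / 2 : ℝ) with hk
  have hk2 : k * k = (∫ r, r ^ 2 ∂FR) * (2 / ((α - 1) * (2 - α) * (3 - α))) := by
    rw [hk, ← Real.sqrt_eq_rpow, Real.mul_self_sqrt (mul_nonneg hE hσ)]
  rw [← mul_assoc, ← hk2, mul_div_cancel₀ (3 - α) two_ne_zero]
  push_cast
  congr 2
  simp only [Finset.mul_sum]
  refine congrArg (· / (2 : ℂ)) (Finset.sum_congr rfl fun i _ => Finset.sum_congr rfl fun j _ => ?_)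
  ring

section Limits

variable {Ω : Type*} [MeasurableSpace Ω] {P : Measure Ω} [IsProbabilityMeasure P]

lemma measurable_rate_mul_sessionOverlap (t : ℝ) :
    Measurable fun x : ℝ × ℝ × ℝ => x.2.2 * sessionOverlap t x.1 x.2.1 :=
  (by fun_prop : Measurable fun x : ℝ × ℝ × ℝ => x.2.2).mul (measurable_sessionOverlap t)

lemma abs_rate_mul_sessionOverlap_le (t : ℝ≥0) {s u : ℝ} (x : ℝ) (hu : 0 < u) :
    |x * sessionOverlap t s u| ≤ (1 + t) * |x| * min 1 (u / (1 + |s|)) := by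
  rw [abs_mul, abs_of_nonneg (sessionOverlap_nonneg _ _ _), mul_comm (1 + (t : ℝ)), mul_assoc]
  exact mul_le_mul_of_nonneg_left (sessionOverlap_le t.coe_nonneg hu.le s) (abs_nonneg _)

lemma integrable_min_rate_mul_sessionOverlap {FR : Measure ℝ} [SFinite FR] {α κ₂ : ℝ} (h1 : 1 < α)
    (hκ : α < κ₂) (hκ2 : κ₂ ≤ 2)
    (hmom : ∀ κ, 1 ≤ κ → κ ≤ κ₂ → Integrable (fun r : ℝ => |r| ^ κ) FR) (t : ℝ≥0) :
    Integrable (fun x : ℝ × ℝ × ℝ => min ((x.2.2 * sessionOverlap t x.1 x.2.1) ^ 2)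
      |x.2.2 * sessionOverlap t x.1 x.2.1|) (limitMean α FR) := by
  have ht : (0 : ℝ) ≤ 1 + t := by positivity
  exact integrable_min_limitMean h1 hκ hκ2 hmom ht (measurable_rate_mul_sessionOverlap t)
    fun s u x hu => (abs_rate_mul_sessionOverlap_le t x hu).trans
      (mul_le_mul_of_nonneg_left (min_le_right _ _) (by positivity))

lemma integrable_min_rate_mul_sessionOverlap_powerMeasure {α αR : ℝ} (h1 : 1 < α) (hα : α < αR)
    (hR2 : αR < 2) (t : ℝ≥0) :
    Integrable (fun x : ℝ × ℝ × ℝ => min ((x.2.2 * sessionOverlap t x.1 x.2.1) ^ 2)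
      |x.2.2 * sessionOverlap t x.1 x.2.1|) (limitMean α (powerMeasure αR)) := by
  have ht : (1 : ℝ) ≤ 1 + t := by simp
  exact integrable_min_limitMean_powerMeasure h1 hα hR2 ht (measurable_rate_mul_sessionOverlap t)
    fun s u x hu => abs_rate_mul_sessionOverlap_le t x hu

lemma integrable_min_duration_mul_rate_mul_indicator {FR : Measure ℝ} [SFinite FR] {α κ₂ : ℝ}
    (h1 : 1 < α) (hκ : α < κ₂) (hκ2 : κ₂ ≤ 2)
    (hmom : ∀ κ, 1 ≤ κ → κ ≤ κ₂ → Integrable (fun r : ℝ => |r| ^ κ) FR) (t : ℝ≥0) :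
    Measurable (fun x : ℝ × ℝ × ℝ => x.2.1 * x.2.2 * (Ioo (0 : ℝ) t).indicator 1 x.1) ∧
    Integrable (fun x : ℝ × ℝ × ℝ => min ((x.2.1 * x.2.2 * (Ioo (0 : ℝ) t).indicator 1 x.1) ^ 2)
      |x.2.1 * x.2.2 * (Ioo (0 : ℝ) t).indicator 1 x.1|) (limitMean α FR) := by
  have ht : (0 : ℝ) ≤ 1 + t := by positivity
  have hm : Measurable fun x : ℝ × ℝ × ℝ =>
      x.2.1 * x.2.2 * (Ioo (0 : ℝ) t).indicator (1 : ℝ → ℝ) x.1 :=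
    (by fun_prop : Measurable fun x : ℝ × ℝ × ℝ => x.2.1 * x.2.2).mul
      ((measurable_one.indicator measurableSet_Ioo).comp measurable_fst)
  refine ⟨hm, integrable_min_limitMean h1 hκ hκ2 hmom ht hm fun s u x hu => ?_⟩
  have h0 : 0 ≤ u * (Ioo (0 : ℝ) t).indicator 1 s :=
    mul_nonneg hu.le (indicator_nonneg (fun _ _ => zero_le_one) s)
  calc |u * x * (Ioo (0 : ℝ) t).indicator 1 s| = |x| * (u * (Ioo (0 : ℝ) t).indicator 1 s) := by
        rw [mul_right_comm, mul_comm, abs_mul, abs_of_nonneg h0]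
    _ ≤ |x| * ((1 + t) * (u / (1 + |s|))) :=
        mul_le_mul_of_nonneg_left (abs_indicator_Ioo_mul_le t s u hu.le) (abs_nonneg _)
    _ = _ := by ring

/-- A family of overlap integrals against a compensated Poisson random measure. -/
lemma jointCF_overlapIntegral {α : ℝ} {h : Measure ℝ} [SigmaFinite h] {ξ : Ω → Measure (ℝ × ℝ × ℝ)}
    (hξ : IsPoissonRandomMeasure P ξ (limitMean α h)) {Z : ℝ≥0 → Ω → ℝ}
    (hZ : ∀ t : ℝ≥0, IsCompensatedIntegral P ξ (limitMean α h)
      (fun x => x.2.2 * sessionOverlap t x.1 x.2.1) (Z t)) {m : ℕ} (t : Fin m → ℝ≥0)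
    (z : Fin m → ℝ) :
    jointCF P (fun i => Z (t i)) z =
      Complex.exp (∫ y, centeredExp (y.2.2 * overlapSum t z y.1 y.2.1) ∂(limitMean α h)) := by
  rw [hξ.jointCF_of_isCompensatedIntegral (fun i => measurable_rate_mul_sessionOverlap (t i))
    (fun i => hZ (t i)) z]
  simp only [overlapSum, Finset.mul_sum, mul_left_comm]

/-- Session works counted at their starting times. -/
lemma jointCF_workIntegral {α : ℝ} {h : Measure ℝ} [SigmaFinite h] {ξ : Ω → Measure (ℝ × ℝ × ℝ)}
    (hξ : IsPoissonRandomMeasure P ξ (limitMean α h)) {W : ℝ≥0 → Ω → ℝ}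
    (hm : ∀ t : ℝ≥0, Measurable
      (fun x : ℝ × ℝ × ℝ => x.2.1 * x.2.2 * (Ioo (0 : ℝ) t).indicator 1 x.1))
    (hW : ∀ t : ℝ≥0, IsCompensatedIntegral P ξ (limitMean α h)
      (fun x => x.2.1 * x.2.2 * (Ioo (0 : ℝ) t).indicator 1 x.1) (W t)) {m : ℕ} (t : Fin m → ℝ≥0)
    (z : Fin m → ℝ) :
    jointCF P (fun i => W (t i)) z =
      Complex.exp (∫ y, centeredExp (y.2.2 * (y.2.1 * stepSum t z y.1)) ∂(limitMean α h)) := by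
  rw [hξ.jointCF_of_isCompensatedIntegral (fun i => hm (t i)) (fun i => hW (t i)) z]
  congr 2
  ext y
  congr 1
  simp only [stepSum, Finset.mul_sum]
  refine Finset.sum_congr rfl fun i _ => ?_
  ring

lemma isStableProcess_overlapIntegral {α αR : ℝ} (h1 : 1 < α) (hα : α < αR) (hR2 : αR < 2)
    {ξ : Ω → Measure (ℝ × ℝ × ℝ)}
    (hξ : IsPoissonRandomMeasure P ξ (limitMean α (powerMeasure αR))) {Z : ℝ≥0 → Ω → ℝ}
    (hZ : ∀ t : ℝ≥0, IsCompensatedIntegral P ξ (limitMean α (powerMeasure αR))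
      (fun x => x.2.2 * sessionOverlap t x.1 x.2.1) (Z t)) : IsStableProcess P αR Z := fun _ t =>
  isStableLaw_of_jointCF (fun i => (hZ (t i)).aemeasurable)
    (fun z => jointCF_overlapIntegral hξ hZ t z) (by linarith)
    fun _ z hc => integral_centeredExp_overlapSum_smul t z h1 hα hR2 hc

/-- Multiplying the amplitudes by c multiplies the exponent by c^α_R, by stability of the rates; it
also equals c^(α-1) times the exponent at dilated times. Comparison gives α_R H = α_R + 1 - α. -/
lemma isSelfSimilar_overlapIntegral {α αR : ℝ} (h1 : 1 < α) (hα : α < αR) (hR2 : αR < 2)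
    {ξ : Ω → Measure (ℝ × ℝ × ℝ)}
    (hξ : IsPoissonRandomMeasure P ξ (limitMean α (powerMeasure αR))) {Z : ℝ≥0 → Ω → ℝ}
    (hZ : ∀ t : ℝ≥0, IsCompensatedIntegral P ξ (limitMean α (powerMeasure αR))
      (fun x => x.2.2 * sessionOverlap t x.1 x.2.1) (Z t)) :
    IsSelfSimilar P ((αR + 1 - α) / αR) Z := by
  intro c hc m t
  have hc' : (0 : ℝ) < c := hc
  refine map_eq_of_jointCF_eq (X := fun i => Z (c * t i))
    (Y := fun i ω => (c : ℝ) ^ ((αR + 1 - α) / αR) * Z (t i) ω)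
    (fun i => (hZ _).aemeasurable) (fun i => (hZ _).aemeasurable.const_mul _) fun z => ?_
  rw [jointCF_const_mul P (fun i => Z (t i)), jointCF_overlapIntegral hξ hZ,
    jointCF_overlapIntegral hξ hZ, integral_centeredExp_overlapSum_smul t z h1 hα hR2 (by positivity)]
  have e := integral_centeredExp_overlapSum_scale t z (by linarith : 0 < α) hc (powerMeasure αR)
  rw [integral_centeredExp_overlapSum_smul t z h1 hα hR2 hc'] at e
  have hp : ((((c : ℝ) ^ (α - 1) : ℝ)) : ℂ) ≠ 0 := by
    rw [Complex.ofReal_ne_zero]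
    positivity
  congr 1
  refine mul_left_cancel₀ hp ?_
  rw [← e, ← mul_assoc, ← Complex.ofReal_mul, ← Real.rpow_mul hc'.le, ← Real.rpow_add hc',
    div_mul_cancel₀ _ (by linarith)]
  congr 3
  ring

lemma stepSum_smul {m : ℕ} (t : Fin m → ℝ≥0) (z : Fin m → ℝ) (c s : ℝ) :
    stepSum t (fun i => c * z i) s = c * stepSum t z s := by
  simp only [stepSum, Finset.mul_sum, mul_assoc]

lemma integral_rpow_pos {FR : Measure ℝ} [IsProbabilityMeasure FR] (h0 : FR (Iic 0) = 0) {κ : ℝ}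
    (hi : Integrable (fun r : ℝ => r ^ κ) FR) : 0 < ∫ r, r ^ κ ∂FR := by
  have hpos := ae_pos_of_measure_Iic_eq_zero h0
  rw [integral_pos_iff_support_of_nonneg_ae
    (hpos.mono fun r hr => (Real.rpow_pos_of_pos hr κ).le) hi]
  have : FR (Function.support fun r : ℝ => r ^ κ) = 1 := by
    rw [← prob_compl_eq_zero_iff₀]
    · exact measure_mono_null (fun r hr => by
        by_contra h
        exact hr (Real.rpow_pos_of_pos (not_le.1 h) κ).ne') h0
    · exact (measurableSet_support (by fun_prop)).nullMeasurableSet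
  rw [this]
  exact one_pos

lemma jointCF_stableLevyMotion {FR : Measure ℝ} [IsProbabilityMeasure FR] (h0 : FR (Iic 0) = 0)
    {α : ℝ} (hα : 0 < α) (hi : Integrable (fun r : ℝ => r ^ α) FR) {Λ : ℝ≥0 → Ω → ℝ}
    (hΛ : IsSkewedStableLevyMotion P α Λ) {m : ℕ} (t : Fin m → ℝ≥0) (z : Fin m → ℝ) :
    jointCF P (fun i ω => (∫ r, r ^ α ∂FR) ^ (1 / α) * Λ (t i) ω) z =
      Complex.exp (-((stableConst α : ℂ) * (((∫ r, r ^ α ∂FR : ℝ) : ℂ) *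
        ∫ s, skewedStableExponent α (stepSum t z s)))) := by
  have hp := integral_rpow_pos h0 hi
  rw [jointCF_const_mul P (fun i => Λ (t i)), hΛ.jointCF_eq hα.ne']
  simp_rw [stepSum_smul, skewedStableExponent_mul (Real.rpow_pos_of_pos hp _)]
  rw [integral_const_mul, ← Real.rpow_mul hp.le, one_div, inv_mul_cancel₀ hα.ne', Real.rpow_one]

end Limits

/-! ### The mixture of the duration distributions -/

lemma mixture_Iic_zero {ι : Type*} [Fintype ι] {FD : ι → Measure ℝ} (h0 : ∀ j, FD j (Iic 0) = 0)
    (lam : ι → ℝ) : mixture lam FD (Iic 0) = 0 := by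
  simp [mixture, Measure.finsetSum_apply, h0]

section Mixture

variable {ι : Type*} [Fintype ι] [Nonempty ι] {FD : ι → Measure ℝ} [∀ j, IsProbabilityMeasure (FD j)]

lemma distTail_mixture {lam : ι → ℝ} (hlam : ∀ j, 0 < lam j) (x : ℝ) :
    distTail (mixture lam FD) x = ∑ j, lam j / totalRate lam * distTail (FD j) x := by
  have hL := totalRate_pos hlam
  rw [distTail, mixture, measureReal_def, Measure.finsetSum_apply, ENNReal.toReal_sum]
  · refine Finset.sum_congr rfl fun j _ => ?_
    rw [Measure.smul_apply, smul_eq_mul, ENNReal.toReal_mul,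
      ENNReal.toReal_ofReal (div_pos (hlam j) hL).le]
    rfl
  · intro j _
    rw [Measure.smul_apply, smul_eq_mul]
    exact ENNReal.mul_ne_top ENNReal.ofReal_ne_top (measure_ne_top _ _)

lemma totalRate_mul_distTail_mixture {lam : ι → ℝ} (hlam : ∀ j, 0 < lam j) (T x : ℝ) :
    totalRate lam * T * distTail (mixture lam FD) x = ∑ j, lam j * T * distTail (FD j) x := by
  have hL := totalRate_pos hlam
  rw [distTail_mixture hlam, Finset.mul_sum]
  refine Finset.sum_congr rfl fun j _ => ?_
  field_simp

lemma isRegularlyVarying_distTail_mixture {αs : ι → ℝ} {α : ℝ} (hα : 0 < α)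
    (hFD : ∀ j, IsRegularlyVarying (distTail (FD j)) (-αs j)) (hle : ∀ j, α ≤ αs j) {j₀ : ι}
    (hj₀ : αs j₀ = α) {lam : ι → ℝ} (hlam : ∀ j, 0 < lam j) :
    IsRegularlyVarying (distTail (mixture lam FD)) (-α) := by
  have e : distTail (mixture lam FD) = fun x => ∑ j, lam j / totalRate lam * distTail (FD j) x :=
    funext fun x => distTail_mixture hlam x
  rw [e]
  exact isRegularlyVarying_sum hFD (fun j => distTail_antitone (FD j)) hα hle hj₀
    fun j => div_pos (hlam j) (totalRate_pos hlam)

end Mixture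

/-- Both alternatives for the rates provide moments slightly beyond α, which is all that the
moderate and slow scenarios need. -/
lemma exists_abs_rpow_integrable {FR : Measure ℝ} [IsProbabilityMeasure FR] (h0 : FR (Iic 0) = 0)
    {α : ℝ} (h2 : α < 2)
    (h : FiniteSecondMoment FR ∨ ∃ αR, HeavyTailed FR αR ∧ α < αR) :
    ∃ κ₂, α < κ₂ ∧ κ₂ ≤ 2 ∧ ∀ κ : ℝ, 1 ≤ κ → κ ≤ κ₂ → Integrable (fun r : ℝ => |r| ^ κ) FR := by
  have habs : ∀ κ : ℝ, Integrable (fun r : ℝ => r ^ κ) FR → Integrable (fun r : ℝ => |r| ^ κ) FR :=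
    fun κ hi => hi.congr ((ae_pos_of_measure_Iic_eq_zero h0).mono fun r hr => by
      simp only [abs_of_pos hr])
  rcases h with h | ⟨αR, hR, hα⟩
  · exact ⟨2, h2, le_rfl, fun κ hκ hκ2 => habs κ (integrable_rpow_of_finiteSecondMoment h0 h hκ hκ2)⟩
  · obtain ⟨κ₂, hk1, hk2⟩ := exists_between hα
    exact ⟨κ₂, hk1, by linarith [hR.2.1], fun κ hκ hκ2 =>
      habs κ (integrable_rpow_of_heavyTailed h0 hR.2.2 hκ (by linarith))⟩

lemma integrable_of_integrable_abs_rpow_one {F : Measure ℝ}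
    (h : Integrable (fun r : ℝ => |r| ^ (1 : ℝ)) F) : Integrable (fun r : ℝ => r) F :=
  h.mono' (by fun_prop) (Eventually.of_forall fun r => by rw [Real.rpow_one, Real.norm_eq_abs])

/-! ### Assembly of the limit theorems -/

section Fidi

variable {ι : Type*} [Fintype ι] [Nonempty ι] {FD : ι → Measure ℝ} [∀ j, IsProbabilityMeasure (FD j)]
  {FR : Measure ℝ} [IsProbabilityMeasure FR] {lam : ℝ → ι → ℝ}
  {Ω : ℝ → Type*} [∀ T, MeasurableSpace (Ω T)] {P : ∀ T, Measure (Ω T)}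
  [∀ T, IsProbabilityMeasure (P T)] {Γ D R : ∀ T, ι → ℤ → Ω T → ℝ}
  {Ω' : Type*} [MeasurableSpace Ω'] {P' : Measure Ω'} [IsProbabilityMeasure P']

/-- Convergence of the scaled inputs from convergence of their characteristic exponents. -/
lemma fidiTendsto_scaledInput (hmodel : ∀ T, IsTrafficModel (P T) (lam T) FD FR (Γ T) (D T) (R T))
    (hlam : ∀ T j, 0 < lam T j) (h0 : ∀ j, FD j (Iic 0) = 0)
    (hFD : ∀ j, Integrable (fun u : ℝ => u) (FD j)) (hR : Integrable (fun r : ℝ => r) FR)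
    {F : Measure ℝ} (hF : ∀ᶠ T in atTop, mixture (lam T) FD = F) {a b : ℝ → ℝ} (hab : a =ᶠ[atTop] b)
    {Y : ℝ≥0 → Ω' → ℝ} (hY : ∀ t, AEMeasurable (Y t) P')
    {E : ∀ m : ℕ, (Fin m → ℝ≥0) → (Fin m → ℝ) → ℂ}
    (hE : ∀ (m : ℕ) (t : Fin m → ℝ≥0) (z : Fin m → ℝ),
      Tendsto (fun T => ((totalRate (lam T) * T : ℝ) : ℂ) *
        ∫ y, centeredExp (y.2.2 * (T / b T * overlapSum t z y.1 (y.2.1 / T)))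
          ∂((volume : Measure ℝ).prod (F.prod FR))) atTop (𝓝 (E m t z)))
    (hYE : ∀ (m : ℕ) (t : Fin m → ℝ≥0) (z : Fin m → ℝ),
      jointCF P' (fun i => Y (t i)) z = Complex.exp (E m t z)) :
    FidiTendsto P P' (fun T => scaledInput (lam T) FD FR (Γ T) (D T) (R T) T (a T)) Y := by
  refine fidiTendsto_of_jointCF (fun T t => aemeasurable_scaledInput (hmodel T) hFD hR T _ t) hY
    fun m t z => ?_
  rw [hYE]
  refine ((Complex.continuous_exp.tendsto _).comp (hE m t z)).congr' ?_
  filter_upwards [hF, hab, eventually_gt_atTop 0] with T hT hT' hT0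
  rw [jointCF_scaledInput (hmodel T) (hlam T) h0 hFD hR hT0, hT, hT']
  rfl

end Fidi

/-- Gaussian, Lévy and stable-integral limits are arbitrary processes with the defining law, whereas
the compensated integrals are constructed from a given Poisson random measure. -/
theorem mainTheorem2 {ι : Type*} [Fintype ι] [Nonempty ι]
    -- durations of the streams
    (FD : ι → Measure ℝ) [∀ j, IsProbabilityMeasure (FD j)] (hFDpos : ∀ j, FD j (Iic 0) = 0)
    (αs : ι → ℝ) (hFD : ∀ j, HeavyTailed (FD j) (αs j))
    (α : ℝ) (hα : α = ⨅ j, αs j)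
    -- rates
    (FR : Measure ℝ) [IsProbabilityMeasure FR] (hFRpos : FR (Iic 0) = 0)
    -- arrival intensities, with proportions that are constant for large `T`
    (lam : ℝ → ι → ℝ) (hlam : ∀ T j, 0 < lam T j)
    (hprop : ∃ w : ι → ℝ, ∀ᶠ T in atTop, ∀ j, lam T j / totalRate (lam T) = w j)
    -- the family of models
    {Ω : ℝ → Type*} [∀ T, MeasurableSpace (Ω T)] (P : ∀ T, Measure (Ω T))
    [∀ T, IsProbabilityMeasure (P T)] (Γ D R : ∀ T, ι → ℤ → Ω T → ℝ)
    (hmodel : ∀ T, IsTrafficModel (P T) (lam T) FD FR (Γ T) (D T) (R T))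
    -- the probability space of the limit processes
    {Ω' : Type*} [MeasurableSpace Ω'] (P' : Measure Ω') [IsProbabilityMeasure P'] :
    -- regular variation of the mixture
    (∀ᶠ T in atTop, IsRegularlyVarying (distTail (mixture (lam T) FD)) (-α)) ∧
    -- at least one stream in fast growth, rates with finite second moment
    ((∃ j, FastGrowth (fun T => lam T j) (FD j)) → FiniteSecondMoment FR →
      (3 - α) / 2 ∈ Ioo (1 / 2 : ℝ) 1 ∧
      ∀ B : ℝ≥0 → Ω' → ℝ, IsFractionalBrownianMotion P' ((3 - α) / 2) B →
        FidiTendsto P P'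
          (fun T => scaledInput (lam T) FD FR (Γ T) (D T) (R T) T
            ((totalRate (lam T) * T ^ 3 * distTail (mixture (lam T) FD) T) ^ (1 / 2 : ℝ)))
          (fun t ω => (∫ r, r ^ 2 ∂FR) ^ (1 / 2 : ℝ) *
            (2 / ((α - 1) * (2 - α) * (3 - α))) ^ (1 / 2 : ℝ) * B t ω)) ∧
    -- at least one stream in fast growth, heavy-tailed rates
    (∀ αR : ℝ, (∃ j, FastGrowth (fun T => lam T j) (FD j)) → HeavyTailed FR αR → α < αR →
      (∀ ξ : Ω' → Measure (ℝ × ℝ × ℝ),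
        IsPoissonRandomMeasure P' ξ (limitMean α (powerMeasure αR)) →
        ∃ Z : ℝ≥0 → Ω' → ℝ,
          (∀ t : ℝ≥0, IsCompensatedIntegral P' ξ (limitMean α (powerMeasure αR))
            (fun x => x.2.2 * sessionOverlap t x.1 x.2.1) (Z t)) ∧
          FidiTendsto P P'
            (fun T => scaledInput (lam T) FD FR (Γ T) (D T) (R T) T
              (T * quantileFn FR (totalRate (lam T) * T * distTail (mixture (lam T) FD) T))) Z ∧
          IsStableProcess P' αR Z ∧
          IsSelfSimilar P' ((αR + 1 - α) / αR) Z) ∧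
      (αR + 1 - α) / αR ∈ Ioo (1 / αR) 1 ∧
      (∀ I : (ℝ × ℝ → ℝ) → Ω' → ℝ,
        IsSkewedStableIntegral P' αR ((volume : Measure ℝ).prod (powerMeasure α)) I →
        FidiTendsto P P'
          (fun T => scaledInput (lam T) FD FR (Γ T) (D T) (R T) T
            (T * quantileFn FR (totalRate (lam T) * T * distTail (mixture (lam T) FD) T)))
          (fun t ω => stableConst αR ^ (1 / αR) *
            I (fun x => sessionOverlap t x.1 x.2) ω))) ∧
    ((FiniteSecondMoment FR ∨ ∃ αR, HeavyTailed FR αR ∧ α < αR) →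
      -- no stream in fast growth, the streams of the non-empty set `M` in moderate growth
      (∀ (M : Finset ι) (cs : ι → ℝ) (c : ℝ≥0), M.Nonempty →
        (∀ j ∈ M, ModerateGrowth (fun T => lam T j) (FD j) (αs j) (cs j)) →
        (∀ j ∉ M, SlowGrowth (fun T => lam T j) (FD j)) →
        (c : ℝ) = (∑ j ∈ M, cs j ^ (αs j - 1)) ^ (1 / (α - 1)) →
        ∀ ξ : Ω' → Measure (ℝ × ℝ × ℝ), IsPoissonRandomMeasure P' ξ (limitMean α FR) →
        ∃ Y : ℝ≥0 → Ω' → ℝ,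
          (∀ t : ℝ≥0, IsCompensatedIntegral P' ξ (limitMean α FR)
            (fun x => x.2.2 * sessionOverlap t x.1 x.2.1) (Y t)) ∧
          FidiTendsto P P'
            (fun T => scaledInput (lam T) FD FR (Γ T) (D T) (R T) T T)
            (fun t ω => (c : ℝ) * Y (t / c) ω)) ∧
      -- all streams in slow growth
      ((∀ j, SlowGrowth (fun T => lam T j) (FD j)) →
        Tendsto (fun T => totalRate (lam T) * T) atTop atTop →
        (∀ Λ : ℝ≥0 → Ω' → ℝ, IsSkewedStableLevyMotion P' α Λ →
          FidiTendsto P P'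
            (fun T => scaledInput (lam T) FD FR (Γ T) (D T) (R T) T
              (quantileFn (mixture (lam T) FD) (totalRate (lam T) * T)))
            (fun t ω => (∫ r, r ^ α ∂FR) ^ (1 / α) * Λ t ω)) ∧
        (∀ ξ : Ω' → Measure (ℝ × ℝ × ℝ), IsPoissonRandomMeasure P' ξ (limitMean α FR) →
          ∃ W : ℝ≥0 → Ω' → ℝ,
            (∀ t : ℝ≥0, IsCompensatedIntegral P' ξ (limitMean α FR)
              (fun x => x.2.1 * x.2.2 * (Ioo (0 : ℝ) t).indicator 1 x.1) (W t)) ∧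
            FidiTendsto P P'
              (fun T => scaledInput (lam T) FD FR (Γ T) (D T) (R T) T
                (quantileFn (mixture (lam T) FD) (totalRate (lam T) * T))) W) ∧
        (∀ I : (ℝ × ℝ → ℝ) → Ω' → ℝ,
          IsSkewedStableIntegral P' α ((volume : Measure ℝ).prod FR) I →
          FidiTendsto P P'
            (fun T => scaledInput (lam T) FD FR (Γ T) (D T) (R T) T
              (quantileFn (mixture (lam T) FD) (totalRate (lam T) * T)))
            (fun t ω => stableConst α ^ (1 / α) *
              I (fun x => x.2 * (Ioo (0 : ℝ) t).indicator 1 x.1) ω)))) := by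
  obtain ⟨j₀, hj₀⟩ : ∃ j, αs j = α := hα ▸ exists_eq_ciInf_of_finite
  have hle : ∀ j, α ≤ αs j := fun j => hα ▸ ciInf_le (Set.finite_range αs).bddBelow j
  have h1 : 1 < α := hj₀ ▸ (hFD j₀).1
  have h2 : α < 2 := hj₀ ▸ (hFD j₀).2.1
  have hreg : ∀ T, IsRegularlyVarying (distTail (mixture (lam T) FD)) (-α) := fun T =>
    isRegularlyVarying_distTail_mixture (by linarith) (fun j => (hFD j).2.2) hle hj₀ (hlam T)
  -- Constant proportions freeze the mixture: from some T on it is one law `F`, to which the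
  -- single-law limit theorems apply.
  obtain ⟨F, hFp, hF0, hFr, hFev⟩ : ∃ F : Measure ℝ, IsProbabilityMeasure F ∧ F (Iic 0) = 0 ∧
      IsRegularlyVarying (distTail F) (-α) ∧ ∀ᶠ T in atTop, mixture (lam T) FD = F := by
    obtain ⟨w, hw⟩ := hprop
    obtain ⟨T₀, hT₀⟩ := hw.exists
    exact ⟨mixture (lam T₀) FD, isProbabilityMeasure_mixture (hlam T₀), mixture_Iic_zero hFDpos _,
      hreg T₀, hw.mono fun T hT => by simp only [mixture, hT, hT₀]⟩
  have hFDi : ∀ j, Integrable (fun u : ℝ => u) (FD j) := fun j => by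
    simpa using integrable_rpow_of_heavyTailed (hFDpos j) (hFD j).2.2 le_rfl (hFD j).1
  -- This identity turns the conditions on the single streams into one condition on the total
  -- intensity and `F`.
  have hsum : (fun T => ∑ j, lam T j * T * distTail (FD j) T) =ᶠ[atTop]
      fun T => totalRate (lam T) * T * distTail F T := by
    filter_upwards [hFev] with T hT
    rw [← hT, totalRate_mul_distTail_mixture (hlam T)]
  have hfast : (∃ j, FastGrowth (fun T => lam T j) (FD j)) →
      Tendsto (fun T => totalRate (lam T) * T * distTail F T) atTop atTop := by
    rintro ⟨j, hj⟩
    refine (tendsto_atTop_mono' _ ?_ hj).congr' hsum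
    filter_upwards [eventually_ge_atTop 0] with T hT
    exact Finset.single_le_sum (f := fun j => lam T j * T * distTail (FD j) T)
      (fun i _ => mul_nonneg (mul_nonneg (hlam T i).le hT) (distTail_nonneg _ _))
      (Finset.mem_univ j)
  refine ⟨Eventually.of_forall hreg, fun hF hR2 => ?_, fun αR hF hR hαR => ?_, fun hR => ?_⟩
  · obtain ⟨κ₂, hk, hk2, hmom⟩ := exists_abs_rpow_integrable hFRpos h2 (Or.inl hR2)
    have hRi := integrable_of_integrable_abs_rpow_one (hmom 1 le_rfl (h1.trans hk).le)
    refine ⟨⟨by linarith, by linarith⟩, fun B hB => ?_⟩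
    exact fidiTendsto_scaledInput hmodel hlam hFDpos hFDi hRi hFev
      (b := fun T => (totalRate (lam T) * T ^ 3 * distTail F T) ^ (1 / 2 : ℝ))
      (hFev.mono fun T hT => by simp only [hT])
      (fun t => (hB.isGaussianProcess.aemeasurable t).const_mul _)
      (fun m t z => tendsto_exponent_fast_gaussian t z hF0 hFr h1 h2 hR2 (hfast hF))
      (fun m t z => jointCF_fractionalBrownianMotion h1 h2 hB t z)
  · obtain ⟨κ₂, hk, hk2, hmom⟩ := exists_abs_rpow_integrable hFRpos h2 (Or.inr ⟨αR, hR, hαR⟩)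
    have hRi := integrable_of_integrable_abs_rpow_one (hmom 1 le_rfl (h1.trans hk).le)
    have hlim : ∀ Y : ℝ≥0 → Ω' → ℝ, (∀ t, AEMeasurable (Y t) P') →
        (∀ (m : ℕ) (t : Fin m → ℝ≥0) (z : Fin m → ℝ), jointCF P' (fun i => Y (t i)) z =
          Complex.exp (∫ y, centeredExp (y.2.2 * overlapSum t z y.1 y.2.1)
            ∂(limitMean α (powerMeasure αR)))) →
        FidiTendsto P P' (fun T => scaledInput (lam T) FD FR (Γ T) (D T) (R T) T
          (T * quantileFn FR (totalRate (lam T) * T * distTail (mixture (lam T) FD) T))) Y :=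
      fun Y hY hYE => fidiTendsto_scaledInput hmodel hlam hFDpos hFDi hRi hFev
        (b := fun T => T * quantileFn FR (totalRate (lam T) * T * distTail F T))
        (hFev.mono fun T hT => by simp only [hT]) hY
        (fun m t z => tendsto_exponent_fast_stable t z hF0 hFr h1 hFRpos hR.2.2 hαR hR.2.1
          (hfast hF)) hYE
    refine ⟨fun ξ hξ => ?_, ?_, fun I hI => ?_⟩
    · choose Z hZ using fun t : ℝ≥0 =>
        hξ.exists_isCompensatedIntegral (measurable_rate_mul_sessionOverlap t)
          (integrable_min_rate_mul_sessionOverlap_powerMeasure h1 hαR hR.2.1 t)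
      exact ⟨Z, hZ, hlim Z (fun t => (hZ t).aemeasurable)
          fun m t z => jointCF_overlapIntegral hξ hZ t z,
        isStableProcess_overlapIntegral h1 hαR hR.2.1 hξ hZ,
        isSelfSimilar_overlapIntegral h1 hαR hR.2.1 hξ hZ⟩
    · have hp : 0 < αR := by linarith
      exact ⟨by gcongr; linarith, by rw [div_lt_one hp]; linarith⟩
    · have hL := fun t : ℝ≥0 => memLp_sessionOverlap t h1 hαR
      refine hlim _ (fun t => (hI.1 _ (hL t)).const_mul _) fun m t z => ?_
      rw [integral_centeredExp_limitMean_powerMeasure t z h1 hαR hR.2.1]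
      exact jointCF_skewedStableIntegral hR.1 hR.2.1 hI (fun i => hL (t i)) z
  · obtain ⟨κ₂, hk, hk2, hmom⟩ := exists_abs_rpow_integrable hFRpos h2 hR
    have hRi := integrable_of_integrable_abs_rpow_one (hmom 1 le_rfl (h1.trans hk).le)
    refine ⟨fun M cs c hM hMod hSlow hc ξ hξ => ?_, fun hSlow hT => ?_⟩
    · choose Y hY using fun t : ℝ≥0 =>
        hξ.exists_isCompensatedIntegral (measurable_rate_mul_sessionOverlap t)
          (integrable_min_rate_mul_sessionOverlap h1 hk hk2 hmom t)
      have hθ : 0 < ∑ j ∈ M, cs j ^ (αs j - 1) :=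
        Finset.sum_pos (fun j hj => Real.rpow_pos_of_pos (hMod j hj).1 _) hM
      have hc0 : 0 < c := NNReal.coe_pos.1 (hc ▸ Real.rpow_pos_of_pos hθ _)
      have hcθ : (c : ℝ) ^ (α - 1) = ∑ j ∈ M, cs j ^ (αs j - 1) := by
        rw [hc, ← Real.rpow_mul hθ.le, one_div, inv_mul_cancel₀ (by linarith), Real.rpow_one]
      have hl : Tendsto (fun T => totalRate (lam T) * T * distTail F T) atTop
          (𝓝 ((c : ℝ) ^ (α - 1))) := by
        classical
        have h := tendsto_finsetSum (Finset.univ : Finset ι)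
          (f := fun j T => lam T j * T * distTail (FD j) T)
          -- Streams outside `M` vanish in the limit, so the total is the sum over `M`, which is
          -- c^(α-1) by the choice of c.
          (a := fun j => if j ∈ M then cs j ^ (αs j - 1) else 0) (x := atTop) fun j _ => by
            by_cases hj : j ∈ M
            · simp only [hj, if_true]
              exact (hMod j hj).2
            · simp only [hj, if_false]
              exact hSlow j hj
        rw [Finset.sum_ite_mem, Finset.univ_inter, ← hcθ] at h
        exact h.congr' hsum
      refine ⟨Y, hY, ?_⟩
      refine fidiTendsto_scaledInput hmodel hlam hFDpos hFDi hRi hFev (b := fun T => T)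
        EventuallyEq.rfl (fun t => (hY _).aemeasurable.const_mul _)
        (fun m t z => tendsto_exponent_moderate t z hF0 hFr h1 hk hk2 hmom hl) fun m t z => ?_
      -- Amplitudes c z at times t/c carry the factor c^(α-1) relative to amplitudes z at times t,
      -- and this is exactly the limit of λT F̄(T).
      rw [jointCF_const_mul P' (fun i => Y (t i / c)), jointCF_overlapIntegral hξ hY,
        integral_centeredExp_overlapSum_scale _ z (by linarith) hc0]
      simp only [mul_div_cancel₀ _ hc0.ne']
    · have hl : Tendsto (fun T => totalRate (lam T) * T * distTail F T) atTop (𝓝 0) := by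
        have h := tendsto_finsetSum (Finset.univ : Finset ι) fun j _ => hSlow j
        rw [Finset.sum_const_zero] at h
        exact h.congr' hsum
      have hlim : ∀ Y : ℝ≥0 → Ω' → ℝ, (∀ t, AEMeasurable (Y t) P') →
          (∀ (m : ℕ) (t : Fin m → ℝ≥0) (z : Fin m → ℝ), jointCF P' (fun i => Y (t i)) z =
            Complex.exp (∫ y, centeredExp (y.2.2 * (y.2.1 * stepSum t z y.1)) ∂(limitMean α FR))) →
          FidiTendsto P P' (fun T => scaledInput (lam T) FD FR (Γ T) (D T) (R T) T
            (quantileFn (mixture (lam T) FD) (totalRate (lam T) * T))) Y :=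
        fun Y hY hYE => fidiTendsto_scaledInput hmodel hlam hFDpos hFDi hRi hFev
          (b := fun T => quantileFn F (totalRate (lam T) * T))
          (hFev.mono fun T hT => by simp only [hT]) hY
          (fun m t z => tendsto_exponent_slow t z hF0 hFr h1 hk hk2 hmom hl hT) hYE
      have hα0 : 0 < α := by linarith
      have hmα := hmom α h1.le hk.le
      refine ⟨fun Λ hΛ => ?_, fun ξ hξ => ?_, fun I hI => ?_⟩
      · refine hlim _ (fun t => (hΛ.aemeasurable t).const_mul _) fun m t z => ?_
        have hi : Integrable (fun r : ℝ => r ^ α) FR :=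
          hmα.congr ((ae_pos_of_measure_Iic_eq_zero hFRpos).mono fun r hr => by
            simp only [abs_of_pos hr])
        rw [integral_centeredExp_limitMean_stepSum t z h1 hk hk2 hmom,
          integral_skewedStableExponent_mul_stepSum t z hα0 hFRpos hmα]
        exact jointCF_stableLevyMotion hFRpos hα0 hi hΛ t z
      · have hW0 := fun t : ℝ≥0 =>
          integrable_min_duration_mul_rate_mul_indicator h1 hk hk2 hmom t
        choose W hW using fun t : ℝ≥0 =>
          hξ.exists_isCompensatedIntegral (hW0 t).1 (hW0 t).2
        exact ⟨W, hW, hlim W (fun t => (hW t).aemeasurable)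
          fun m t z => jointCF_workIntegral hξ (fun t => (hW0 t).1) hW t z⟩
      · have hL := fun t : ℝ≥0 => memLp_mul_indicator t hα0 hmα
        refine hlim _ (fun t => (hI.1 _ (hL t)).const_mul _) fun m t z => ?_
        rw [integral_centeredExp_limitMean_stepSum t z h1 hk hk2 hmom]
        have h := jointCF_skewedStableIntegral h1 h2 hI (fun i => hL (t i)) z
        simp only [stepSum, Finset.mul_sum, mul_left_comm] at h ⊢
        exact h
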